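/- **Conventions.** For subsets of a $C^*$-algebra, a product such as $DAD$ denotes the closed linear span of the products; ideals are closed and two-sided. $M(A)$ is the multiplier algebra; a homomorphism $\psi:D\to A$ is *extendible* if it extends to a strictly continuous homomorphism $\overline\psi:M(D)\to M(A)$. Let $X$ be a locally compact Hausdorff space. A *$C_0(X)$-algebra* is a $C^*$-algebra $A$ with a nondegenerate homomorphism $C_0(X)\to Z(M(A))$; its fibres are $A(x)=A/(C_0(X\setminus\{x\})\cdot A)$, $a(x)$ is the image of $a$ in $A(x)$, and for $P\in\mathrm{Prim}(A)$ we put $\sigma_A(P)=x$ if and only if $C_0(X\setminus\{x\})\cdot A\subseteq P$. The bundle $\bigsqcup_x A(x)$ carries the topology generated by the tubes $\{b\in A(y): y\in U,\ \|b-a(y)\|<\varepsilon\}$ ($a\in A$, $U\subseteq X$ open, $\varepsilon>0$). $A$ is *continuous* if the norm is continuous on this bundle. An *upper semicontinuous $C^*$-bundle* is a continuous open surjection $\mathcal B\to X$ whose fibres are $C^*$-algebras, such that the norm is upper semicontinuous, the fibrewise operations are continuous, and the sets $\{b: b\in B(y),\ y\in U,\ \|b\|<\varepsilon\}$ ($U\ni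 x$ open, $\varepsilon>0$) form a neighbourhood base of the zero of the fibre over $x$; it is *continuous* if the norm is continuous; $\Gamma_0(\mathcal B)$ is its $C^*$-algebra of continuous sections that vanish at infinity. A *morphism* $(\varphi,\{\alpha_x\}_{x\in\Delta})$ from a bundle over $Y$ with fibres $B(y)$ to a bundle over $X$ with fibres $A(x)$ consists of an open set $\Delta\subseteq X$, a continuous proper map $\varphi:\Delta\to Y$ and homomorphisms $\alpha_x:B(\varphi(x))\to A(x)$, $x\in\Delta$, which together form a continuous map on the pullback bundle. On bundles over the same space, it *induces* an endomorphism $\alpha$ of the section algebra if $\alpha(a)(x)=\alpha_x(a(\varphi(x)))$ for $x\in\Delta$ and $\alpha(a)(x)=0$ for $x\notin\Delta$. A *transfer operator* for an endomorphism $\beta$ of a $C^*$-algebra $B$ is a positive linear map $L:B\to B$ with $L(\beta(a)b)=aL(b)$; it is *regular* if $\beta\circ L$ is a conditional expectation onto $\beta(B)$. **Setting.** Let $A$ be a $C_0(X)$-algebra with $\sigma_A:\mathrm{Prim}(A)\to X$ surjective, let $\alpha:A\to A$ be an endomorphism induced by a morphism $(\varphi,\{\alpha_x\}_{x\in\Delta})$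 of the bundle of $A$ to itself, and let $J$ be an ideal of $A$ with $J\subseteq(\ker\alpha)^\perp$. Let $q:A\to A/J$ be the quotient map, $J(x)=\{a(x):a\in J\}$, $q_x:A(x)\to A(x)/J(x)$ the quotient map, and $Y=\overline{\sigma_A(\mathrm{Prim}(A/J))}$. *The reversible $J$-extension $(B,\beta)$.* Put $A_n=\alpha^n(A)A\alpha^n(A)$ and $B_n=q(A_0)\oplus\dots\oplus q(A_{n-1})\oplus A_n$. Let $B$ be the $C^*$-algebraic direct limit of the sequence $B_0\to B_1\to\cdots$ with bonding maps $a_0\oplus\dots\oplus a_n\mapsto a_0\oplus\dots\oplus a_{n-1}\oplus q(a_n)\oplus\alpha(a_n)$, with natural maps $\phi_n:B_n\to B$, and let $\beta$ be the endomorphism of $B$ with $\beta(\phi_{n+1}(a_0\oplus a_1\oplus\dots\oplus a_{n+1}))=\phi_n(a_1\oplus\dots\oplus a_{n+1})$. *The reversible $Y$-extension $(\widetilde X,\widetilde\varphi)$.* Put $\widetilde X=\bigcup_{N\ge0}X_N\cup X_\infty$, where $X_N$ is the set of sequences $(x_0,\dots,x_N,0,0,\dots)$ with $x_N\in Y$ and,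 for $1\le n\le N$, $x_n\in\Delta$ and $\varphi(x_n)=x_{n-1}$; and $X_\infty$ is the set of sequences $(x_0,x_1,\dots)$ with $x_n\in\Delta$ and $\varphi(x_n)=x_{n-1}$ for all $n\ge1$. The topology is inherited from the product $\prod_{n\in\mathbb N}(X\sqcup\{0\})$. Put $\widetilde\Delta=\{\tilde x\in\widetilde X:x_0\in\Delta\}$ and $\widetilde\varphi(x_0,x_1,\dots)=(\varphi(x_0),x_0,x_1,\dots)$ for $\tilde x\in\widetilde\Delta$. *The fibres.* Let $\Delta_n$ be the domain of $\varphi^n$. For $x\in\Delta_n$ put $\alpha_{(x,n)}=\alpha_x\circ\alpha_{\varphi(x)}\circ\dots\circ\alpha_{\varphi^{n-1}(x)}$ (so $\alpha_{(x,0)}=\mathrm{id}$) and $A_n(x)=\alpha_{(x,n)}(A(\varphi^n(x)))\,A(x)\,\alpha_{(x,n)}(A(\varphi^n(x)))$. For $\tilde x\in X_N$ let $B(\tilde x)=q_{x_N}(A_N(x_N))\subseteq A(x_N)/J(x_N)$; for $\tilde x\in X_\infty$ let $B(\tilde x)$ be the direct limit of $A_0(x_0)\xrightarrow{\alpha_{x_1}}A_1(x_1)\xrightarrow{\alpha_{x_2}}A_2(x_2)\to\cdots$,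 whose elements we write as classes $[a_0,a_1,a_2,\dots]$ of bounded sequences with $a_n\in A_n(x_n)$ modulo sequences that tend to $0$ in norm. Let $\mathcal B=\bigsqcup_{\tilde x\in\widetilde X}B(\tilde x)$. For $a=q(a_0)\oplus\dots\oplus q(a_{n-1})\oplus a_n\in B_n$ put $$\pi(\phi_n(a))(\tilde x)=\begin{cases}q_{x_N}(a_N(x_N)),&\tilde x\in X_N,\ N\le n,\\ q_{x_N}\big(\alpha_{(x_N,N-n)}(a_n(x_n))\big),&\tilde x\in X_N,\ N>n,\\ [0,\dots,0,a_n(x_n),\alpha_{x_{n+1}}(a_n(x_n)),\alpha_{(x_{n+2},2)}(a_n(x_n)),\dots]\ (n\text{ zeros}),&\tilde x\in X_\infty.\end{cases}$$ For $\tilde x\in\widetilde\Delta$ define $\beta_{\tilde x}:B(\widetilde\varphi(\tilde x))\to B(\tilde x)$ by $[a_0,a_1,a_2,\dots]\mapsto[a_1,a_2,\dots]$ if $\tilde x\in X_\infty$, and as the inclusion $q_{x_N}(A_{N+1}(x_N))\subseteq q_{x_N}(A_N(x_N))$ if $\tilde x\in X_N$. If $\alpha$ is extendible, then so are the homomorphisms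 $\alpha_{(x,n)}$; put $p_{(x,n)}=\overline{\alpha}_{(x,n)}(1)\in M(A(x))$. **Theorem.** The space $\widetilde X$ is locally compact and Hausdorff. The formula for $\pi$ extends to an isometric homomorphism $\pi$ from $B$ to the bounded sections of $\mathcal B$ with the supremum norm. There is a unique topology on $\mathcal B$ that makes it an upper semicontinuous $C^*$-bundle over $\widetilde X$ such that $\pi$ is an isomorphism of $B$ onto $\Gamma_0(\mathcal B)$. Identify $B$ with $\Gamma_0(\mathcal B)$ by means of $\pi$. 1. $(\widetilde\varphi,\{\beta_{\tilde x}\}_{\tilde x\in\widetilde\Delta})$ is a morphism from $\mathcal B$ to itself, and it induces $\beta$: for all $b\in B$, $\beta(b)(\tilde x)=\beta_{\tilde x}\big(b(\widetilde\varphi(\tilde x))\big)$ for $\tilde x\in\widetilde\Delta$, and $\beta(b)(\tilde x)=0$ for $\tilde x\notin\widetilde\Delta$. 2. If $\alpha$ is extendible, then $\beta$ is extendible, there is a unique regular transfer operator $\beta_*$ for $(B,\beta)$, there are positive linear maps $\beta_{*,\widetilde\varphi(\tilde x)}:B(\tilde x)\to B(\widetilde\varphi(\tilde x))$, $\tilde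 x\in\widetilde\Delta$, given by $$\beta_{*,\widetilde\varphi(\tilde x)}(q_{x_N}(a))=q_{x_N}\big(p_{(x_N,N+1)}\,a\,p_{(x_N,N+1)}\big)\quad(a\in A_N(x_N))\quad\text{if }\tilde x\in X_N,$$ $$\beta_{*,\widetilde\varphi(\tilde x)}[a_0,a_1,\dots]=[0,\,p_{(x_0,1)}a_0p_{(x_0,1)},\,p_{(x_1,2)}a_1p_{(x_1,2)},\dots]\quad\text{if }\tilde x\in X_\infty,$$ and for all $b\in B$ we have $\beta_*(b)(\widetilde\varphi(\tilde x))=\beta_{*,\widetilde\varphi(\tilde x)}(b(\tilde x))$ for $\tilde x\in\widetilde\Delta$, and $\beta_*(b)(\tilde y)=0$ for $\tilde y\notin\widetilde\varphi(\widetilde\Delta)$. 3. If $A$ is a continuous $C_0(X)$-algebra and either (i) $J$ is a complemented ideal (that is, $A=J\oplus K$ for some ideal $K$), for every $x\in X$ the ideal $J(x)$ is $\{0\}$ or $A(x)$, and $\alpha_x$ is injective for every $x\in\Delta$; or (ii) $\sigma_A$ is injective and $\alpha_x\ne0$ for every $x\in\Delta$ (as then the fibres are simple, every $\alpha_x$ is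 injective), then $\mathcal B$ is a continuous $C^*$-bundle. -/

import Mathlib

open Filter Topology
open scoped MultiplierAlgebra ENNReal ZeroAtInfty

namespace ReversibleExtension

universe u v w

noncomputable section

section ApproximateUnits

variable {A : Type u} [NonUnitalCStarAlgebra A]

theorem exists_approximate_unit (T : NonUnitalStarSubalgebra ℂ A) (hT : IsClosed (T : Set A))
    {j : A} (hj : j ∈ T) {ε : ℝ} (hε : 0 < ε) :
    ∃ e ∈ T, star e = e ∧ ‖j - j * e‖ < ε ∧ (∀ b : A, ‖b - b * e‖ ≤ ‖b‖) ∧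
      ∀ b : A, ‖b - e * b‖ ≤ ‖b‖ := by
  have : IsClosed (T : Set A) := hT
  let _ : PartialOrder T := CStarAlgebra.spectralOrder T
  have _ : StarOrderedRing T := CStarAlgebra.spectralOrderedRing T
  let _ : PartialOrder A := CStarAlgebra.spectralOrder A
  have _ : StarOrderedRing A := CStarAlgebra.spectralOrderedRing A
  have h := CStarAlgebra.increasingApproximateUnit T
  have := h.neBot
  have h1 := (h.tendsto_mul_left ⟨j, hj⟩).eventually (Metric.ball_mem_nhds _ hε)
  obtain ⟨e, h1, h2, h3⟩ := (h1.and (h.eventually_nonneg.and h.eventually_norm)).exists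
  obtain ⟨d, hd⟩ := CStarAlgebra.nonneg_iff_eq_star_mul_self.1 h2
  have he : (0 : A) ≤ (e : A) := by
    rw [hd]
    exact star_mul_self_nonneg (d : A)
  have hs : star (e : A) = e := (IsSelfAdjoint.of_nonneg he).star_eq
  have hl : ∀ b : A, ‖b - e * b‖ ≤ ‖b‖ := fun b ↦
    CStarAlgebra.norm_sub_mul_self_le_of_inr (x := 0) b le_rfl he h3 (norm_nonneg b) (by
      rw [Unitization.inr_zero, sub_zero, mul_one, CStarRing.norm_star_mul_self,
        Unitization.norm_inr, sq])
  refine ⟨e, e.2, hs, ?_, fun b ↦ ?_, hl⟩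
  · rw [norm_sub_rev]
    simpa [dist_eq_norm] using h1
  · have := hl (star b)
    rwa [← norm_star, star_sub, star_mul, star_star, hs, norm_star] at this

theorem continuous_hom {A' : Type v} [NonUnitalCStarAlgebra A'] (ψ : A →⋆ₙₐ[ℂ] A') :
    Continuous ψ :=
  AddMonoidHomClass.continuous_of_bound ψ 1 fun a ↦ by
    simpa only [one_mul] using NonUnitalStarAlgHom.norm_apply_le ψ a

end ApproximateUnits

/-- A closed two-sided ideal of a C*-algebra. -/
structure ClosedIdeal (A : Type u) [NonUnitalCStarAlgebra A] extends Submodule ℂ A where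
  mul_mem_left' : ∀ (a : A) {b : A}, b ∈ carrier → a * b ∈ carrier
  mul_mem_right' : ∀ (a : A) {b : A}, b ∈ carrier → b * a ∈ carrier
  isClosed' : IsClosed carrier

namespace ClosedIdeal

variable {A : Type u} [NonUnitalCStarAlgebra A] {A' : Type v} [NonUnitalCStarAlgebra A']

instance : SetLike (ClosedIdeal A) A where
  coe I := I.carrier
  coe_injective I I' h := by
    cases I; cases I'; congr; exact SetLike.coe_injective h

variable (I : ClosedIdeal A)

theorem mem_toSubmodule {a : A} : a ∈ I.toSubmodule ↔ a ∈ I := Iff.rfl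

theorem mul_mem_left (a : A) {b : A} (hb : b ∈ I) : a * b ∈ I := I.mul_mem_left' a hb

theorem mul_mem_right (a : A) {b : A} (hb : b ∈ I) : b * a ∈ I := I.mul_mem_right' a hb

instance : IsClosed (I.toSubmodule : Set A) := I.isClosed'

theorem star_mem {a : A} (ha : a ∈ I) : star a ∈ I := by
  let T : NonUnitalStarSubalgebra ℂ A :=
    { carrier := {b | b ∈ I ∧ star b ∈ I}
      add_mem' := fun {x y} hx hy ↦
        ⟨I.add_mem hx.1 hy.1, by rw [star_add]; exact I.add_mem hx.2 hy.2⟩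
      zero_mem' := ⟨I.zero_mem, by rw [star_zero]; exact I.zero_mem⟩
      mul_mem' := fun {x y} hx hy ↦
        ⟨I.mul_mem_left _ hy.1, by rw [star_mul]; exact I.mul_mem_left _ hx.2⟩
      smul_mem' := fun c x hx ↦
        ⟨I.smul_mem c hx.1, by rw [star_smul]; exact I.smul_mem _ hx.2⟩
      star_mem' := fun {x} hx ↦ ⟨hx.2, by rw [star_star]; exact hx.1⟩ }
  have hT : IsClosed (T : Set A) := I.isClosed'.inter (I.isClosed'.preimage continuous_star)
  have hj : a * star a ∈ T :=
    ⟨I.mul_mem_right _ ha, by rw [star_mul, star_star]; exact I.mul_mem_right _ ha⟩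
  have hcl : star a ∈ closure (I.carrier : Set A) := by
    rw [Metric.mem_closure_iff]
    intro ε hε
    obtain ⟨e, heT, hes, hje, -, hl⟩ := exists_approximate_unit T hT hj (pow_pos hε 2)
    refine ⟨star a * e, I.mul_mem_left _ heT.1, ?_⟩
    rw [dist_eq_norm]
    refine lt_of_pow_lt_pow_left₀ 2 hε.le (lt_of_le_of_lt ?_ hje)
    calc ‖star a - star a * e‖ ^ 2
        = ‖star (star a - star a * e) * (star a - star a * e)‖ := by
          rw [CStarRing.norm_star_mul_self, sq]
      _ = ‖(a * star a - a * star a * e) - e * (a * star a - a * star a * e)‖ := by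
          congr 1
          simp only [star_sub, star_mul, star_star, hes]
          noncomm_ring
      _ ≤ _ := hl _
  rwa [I.isClosed'.closure_eq] at hcl

/-- A closed ideal as a C*-subalgebra. -/
def toStarSubalgebra : NonUnitalStarSubalgebra ℂ A where
  carrier := I.carrier
  add_mem' := I.add_mem'
  zero_mem' := I.zero_mem'
  mul_mem' := fun {a _} _ hb ↦ I.mul_mem_left' a hb
  smul_mem' := I.smul_mem'
  star_mem' := fun h ↦ I.star_mem h

instance : IsClosed (I.toStarSubalgebra : Set A) := I.isClosed'

/-- The quotient C*-algebra `A/I`, with the quotient norm. -/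
def Quot : Type u := A ⧸ I.toSubmodule

namespace Quot

instance : NormedAddCommGroup I.Quot := inferInstanceAs (NormedAddCommGroup (A ⧸ I.toSubmodule))
instance : NormedSpace ℂ I.Quot := inferInstanceAs (NormedSpace ℂ (A ⧸ I.toSubmodule))
instance : CompleteSpace I.Quot := inferInstanceAs (CompleteSpace (A ⧸ I.toSubmodule))

/-- The quotient map as a linear map. -/
def mkₗ : A →ₗ[ℂ] I.Quot := I.toSubmodule.mkQ

theorem mkₗ_surjective : Function.Surjective (mkₗ I) := I.toSubmodule.mkQ_surjective

theorem mkₗ_eq_iff {a b : A} : mkₗ I a = mkₗ I b ↔ a - b ∈ I :=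
  Submodule.Quotient.eq I.toSubmodule

theorem norm_mkₗ_le (a : A) : ‖mkₗ I a‖ ≤ ‖a‖ := Submodule.Quotient.norm_mk_le (S := I.toSubmodule) a

theorem exists_lift (x : I.Quot) {ε : ℝ} (hε : 0 < ε) : ∃ a : A, mkₗ I a = x ∧ ‖a‖ < ‖x‖ + ε :=
  Submodule.Quotient.norm_mk_lt (S := I.toSubmodule) x hε

instance : Mul I.Quot where
  mul := Quotient.map₂ (· * ·) (by
    intro a a' h b b' h'
    rw [← Quotient.eq_iff_equiv] at h h' ⊢
    have h1 : a - a' ∈ I := (mkₗ_eq_iff I).1 h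
    have h2 : b - b' ∈ I := (mkₗ_eq_iff I).1 h'
    refine (mkₗ_eq_iff I).2 ?_
    have : a * b - a' * b' = a * (b - b') + (a - a') * b' := by noncomm_ring
    rw [this]
    exact I.add_mem (I.mul_mem_left _ h2) (I.mul_mem_right _ h1))

instance : Star I.Quot where
  star := Quotient.map star (by
    intro a a' h
    rw [← Quotient.eq_iff_equiv] at h ⊢
    refine (mkₗ_eq_iff I).2 ?_
    rw [← star_sub]
    exact I.star_mem ((mkₗ_eq_iff I).1 h))

theorem mkₗ_mul (a b : A) : mkₗ I (a * b) = mkₗ I a * mkₗ I b := rfl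

theorem mkₗ_star (a : A) : mkₗ I (star a) = star (mkₗ I a) := rfl

instance : NonUnitalRing I.Quot where
  left_distrib x y z := by
    obtain ⟨a, rfl⟩ := mkₗ_surjective I x
    obtain ⟨b, rfl⟩ := mkₗ_surjective I y
    obtain ⟨c, rfl⟩ := mkₗ_surjective I z
    simp only [← map_add, ← mkₗ_mul, mul_add]
  right_distrib x y z := by
    obtain ⟨a, rfl⟩ := mkₗ_surjective I x
    obtain ⟨b, rfl⟩ := mkₗ_surjective I y
    obtain ⟨c, rfl⟩ := mkₗ_surjective I z
    simp only [← map_add, ← mkₗ_mul, add_mul]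
  zero_mul x := by
    obtain ⟨a, rfl⟩ := mkₗ_surjective I x
    rw [← map_zero (mkₗ I), ← mkₗ_mul, zero_mul]
  mul_zero x := by
    obtain ⟨a, rfl⟩ := mkₗ_surjective I x
    rw [← map_zero (mkₗ I), ← mkₗ_mul, mul_zero]
  mul_assoc x y z := by
    obtain ⟨a, rfl⟩ := mkₗ_surjective I x
    obtain ⟨b, rfl⟩ := mkₗ_surjective I y
    obtain ⟨c, rfl⟩ := mkₗ_surjective I z
    simp only [← mkₗ_mul, mul_assoc]

theorem norm_mul_le' (x y : I.Quot) : ‖x * y‖ ≤ ‖x‖ * ‖y‖ := by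
  have key : ∀ ε > (0 : ℝ), ‖x * y‖ ≤ (‖x‖ + ε) * (‖y‖ + ε) := by
    intro ε hε
    obtain ⟨a, rfl, ha⟩ := exists_lift I x hε
    obtain ⟨b, rfl, hb⟩ := exists_lift I y hε
    rw [← mkₗ_mul]
    calc ‖mkₗ I (a * b)‖ ≤ ‖a * b‖ := norm_mkₗ_le I _
      _ ≤ ‖a‖ * ‖b‖ := norm_mul_le _ _
      _ ≤ _ := by gcongr
  have h : Tendsto (fun ε : ℝ ↦ (‖x‖ + ε) * (‖y‖ + ε)) (𝓝[>] 0) (𝓝 ((‖x‖ + 0) * (‖y‖ + 0))) :=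
    Tendsto.mono_left (Continuous.tendsto (by fun_prop) 0) nhdsWithin_le_nhds
  rw [add_zero, add_zero] at h
  exact ge_of_tendsto h (eventually_nhdsWithin_of_forall fun ε hε ↦ key ε hε)

instance : NonUnitalNormedRing I.Quot where
  dist_eq := dist_eq_norm_neg_add
  norm_mul_le := norm_mul_le' I

instance : StarRing I.Quot where
  star_involutive x := by
    obtain ⟨a, rfl⟩ := mkₗ_surjective I x
    rw [← mkₗ_star, ← mkₗ_star, star_star]
  star_mul x y := by
    obtain ⟨a, rfl⟩ := mkₗ_surjective I x
    obtain ⟨b, rfl⟩ := mkₗ_surjective I y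
    simp only [← mkₗ_mul, ← mkₗ_star, star_mul]
  star_add x y := by
    obtain ⟨a, rfl⟩ := mkₗ_surjective I x
    obtain ⟨b, rfl⟩ := mkₗ_surjective I y
    simp only [← map_add, ← mkₗ_star, star_add]

instance : IsScalarTower ℂ I.Quot I.Quot where
  smul_assoc c x y := by
    obtain ⟨a, rfl⟩ := mkₗ_surjective I x
    obtain ⟨b, rfl⟩ := mkₗ_surjective I y
    simp only [smul_eq_mul, ← map_smul, ← mkₗ_mul, smul_mul_assoc]

instance : SMulCommClass ℂ I.Quot I.Quot where
  smul_comm c x y := by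
    obtain ⟨a, rfl⟩ := mkₗ_surjective I x
    obtain ⟨b, rfl⟩ := mkₗ_surjective I y
    simp only [smul_eq_mul, ← map_smul, ← mkₗ_mul, mul_smul_comm]

instance : StarModule ℂ I.Quot where
  star_smul c x := by
    obtain ⟨a, rfl⟩ := mkₗ_surjective I x
    simp only [← map_smul, ← mkₗ_star, star_smul]

instance : CStarRing I.Quot where
  norm_mul_self_le x := by
    obtain ⟨a, rfl⟩ := mkₗ_surjective I x
    refine le_of_forall_pos_le_add fun ε hε ↦ ?_
    rw [← mkₗ_star, ← mkₗ_mul]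
    obtain ⟨b, hb, hbn⟩ := exists_lift I (mkₗ I (star a * a)) (half_pos hε)
    have hj : star a * a - b ∈ I := (mkₗ_eq_iff I).1 hb.symm
    obtain ⟨e, heI, hes, hje, hr, hl⟩ :=
      exists_approximate_unit I.toStarSubalgebra I.isClosed' hj (half_pos hε)
    have h1 : ‖mkₗ I a‖ ≤ ‖a - a * e‖ := by
      have : mkₗ I a = mkₗ I (a - a * e) := (mkₗ_eq_iff I).2 (by
        rw [sub_sub_cancel]; exact I.mul_mem_left _ heI)
      rw [this]
      exact norm_mkₗ_le I _
    calc ‖mkₗ I a‖ * ‖mkₗ I a‖ ≤ ‖a - a * e‖ * ‖a - a * e‖ := by gcongr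
      _ = ‖star (a - a * e) * (a - a * e)‖ := by rw [CStarRing.norm_star_mul_self]
      _ = ‖(star a * a - star a * a * e) - e * (star a * a - star a * a * e)‖ := by
          congr 1
          simp only [star_sub, star_mul, hes]
          noncomm_ring
      _ ≤ ‖star a * a - star a * a * e‖ := hl _
      _ = ‖(b - b * e) + ((star a * a - b) - (star a * a - b) * e)‖ := by
          congr 1
          noncomm_ring
      _ ≤ ‖b - b * e‖ + ‖(star a * a - b) - (star a * a - b) * e‖ := norm_add_le _ _
      _ ≤ ‖b‖ + ε / 2 := add_le_add (hr b) hje.le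
      _ ≤ _ := by linarith

instance : NonUnitalCStarAlgebra I.Quot where

end Quot

/-- The quotient map `A → A/I`. -/
def proj : A →⋆ₙₐ[ℂ] I.Quot where
  toFun := Quot.mkₗ I
  map_smul' := map_smul _
  map_zero' := map_zero _
  map_add' := map_add _
  map_mul' := Quot.mkₗ_mul I
  map_star' := Quot.mkₗ_star I

theorem proj_surjective : Function.Surjective I.proj := Quot.mkₗ_surjective I

theorem proj_eq_iff {a b : A} : I.proj a = I.proj b ↔ a - b ∈ I := Quot.mkₗ_eq_iff I

theorem proj_eq_zero {a : A} : I.proj a = 0 ↔ a ∈ I := by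
  rw [← map_zero I.proj, proj_eq_iff, sub_zero]

/-- The homomorphism `A/I → A'` induced by a homomorphism `A → A'` that vanishes on `I`. -/
def lift (ψ : A →⋆ₙₐ[ℂ] A') (h : ∀ a ∈ I, ψ a = 0) : I.Quot →⋆ₙₐ[ℂ] A' :=
  let f : I.Quot → A' := Quotient.lift ψ (by
    intro a b hab
    rw [← Quotient.eq_iff_equiv] at hab
    have := h _ ((Quot.mkₗ_eq_iff I).1 hab)
    rwa [map_sub, sub_eq_zero] at this)
  have hf : ∀ a, f (I.proj a) = ψ a := fun _ ↦ rfl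
  { toFun := f
    map_smul' := fun c x ↦ by
      obtain ⟨a, rfl⟩ := I.proj_surjective x
      simp only [← map_smul, hf, MonoidHom.id_apply]
    map_zero' := by rw [← map_zero I.proj, hf, map_zero]
    map_add' := fun x y ↦ by
      obtain ⟨a, rfl⟩ := I.proj_surjective x
      obtain ⟨b, rfl⟩ := I.proj_surjective y
      simp only [← map_add, hf]
    map_mul' := fun x y ↦ by
      obtain ⟨a, rfl⟩ := I.proj_surjective x
      obtain ⟨b, rfl⟩ := I.proj_surjective y
      simp only [← map_mul, hf]
    map_star' := fun x ↦ by
      obtain ⟨a, rfl⟩ := I.proj_surjective x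
      simp only [← map_star, hf] }

theorem lift_proj (ψ : A →⋆ₙₐ[ℂ] A') (h : ∀ a ∈ I, ψ a = 0) (a : A) : I.lift ψ h (I.proj a) = ψ a :=
  rfl

/-- The kernel of a homomorphism of C*-algebras. -/
def ker (ψ : A →⋆ₙₐ[ℂ] A') : ClosedIdeal A where
  carrier := {a | ψ a = 0}
  add_mem' := fun {a b} ha hb ↦ by
    simp only [Set.mem_ofPred_eq] at ha hb ⊢
    rw [map_add, ha, hb, add_zero]
  zero_mem' := map_zero ψ
  smul_mem' := fun c a ha ↦ by
    simp only [Set.mem_ofPred_eq] at ha ⊢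
    rw [map_smul, ha, smul_zero]
  mul_mem_left' := fun a b hb ↦ by
    simp only [Set.mem_ofPred_eq] at hb ⊢
    rw [map_mul, hb, mul_zero]
  mul_mem_right' := fun a b hb ↦ by
    simp only [Set.mem_ofPred_eq] at hb ⊢
    rw [map_mul, hb, zero_mul]
  isClosed' := isClosed_eq (continuous_hom ψ) continuous_const

/-- The range of a homomorphism of C*-algebras is closed. -/
theorem isClosed_range (ψ : A →⋆ₙₐ[ℂ] A') : IsClosed (Set.range ψ) := by
  let χ := (ker ψ).lift ψ (fun _ h ↦ h)
  have hχ : Function.Injective χ := by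
    intro x y hxy
    obtain ⟨a, rfl⟩ := (ker ψ).proj_surjective x
    obtain ⟨b, rfl⟩ := (ker ψ).proj_surjective y
    refine (ker ψ).proj_eq_iff.2 ?_
    change ψ (a - b) = 0
    rw [map_sub, sub_eq_zero]
    exact hxy
  have hr : Set.range ψ = Set.range χ := by
    ext z
    constructor
    · rintro ⟨a, rfl⟩
      exact ⟨(ker ψ).proj a, rfl⟩
    · rintro ⟨x, rfl⟩
      obtain ⟨a, rfl⟩ := (ker ψ).proj_surjective x
      exact ⟨a, rfl⟩
  rw [hr]
  exact (NonUnitalStarAlgHom.isometry χ hχ).isClosedEmbedding.isClosed_range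

end ClosedIdeal

section Subalgebras

variable {A : Type u} [NonUnitalCStarAlgebra A] {A' : Type v} [NonUnitalCStarAlgebra A']
  {D : Type w} [NonUnitalCStarAlgebra D]

instance isClosed_map (S : NonUnitalStarSubalgebra ℂ A) [hS : IsClosed (S : Set A)]
    (ψ : A →⋆ₙₐ[ℂ] A') : IsClosed ((S.map ψ : NonUnitalStarSubalgebra ℂ A') : Set A') := by
  have h := ClosedIdeal.isClosed_range (ψ.comp (NonUnitalStarSubalgebraClass.subtype S))
  have h2 : Set.range (ψ.comp (NonUnitalStarSubalgebraClass.subtype S)) =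
      ((S.map ψ : NonUnitalStarSubalgebra ℂ A') : Set A') := by
    ext z
    simp
  rwa [h2] at h

/-- The image of a closed ideal under a surjective homomorphism. -/
def ClosedIdeal.image (I : ClosedIdeal A) (ψ : A →⋆ₙₐ[ℂ] A') (hψ : Function.Surjective ψ) :
    ClosedIdeal A' where
  carrier := ψ '' I
  add_mem' := by
    rintro _ _ ⟨a, ha, rfl⟩ ⟨b, hb, rfl⟩
    exact ⟨a + b, I.add_mem ha hb, map_add _ _ _⟩
  zero_mem' := ⟨0, I.zero_mem, map_zero _⟩
  smul_mem' := by
    rintro c _ ⟨a, ha, rfl⟩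
    exact ⟨c • a, I.smul_mem c ha, map_smul _ _ _⟩
  mul_mem_left' := by
    rintro y _ ⟨a, ha, rfl⟩
    obtain ⟨b, rfl⟩ := hψ y
    exact ⟨b * a, I.mul_mem_left b ha, map_mul _ _ _⟩
  mul_mem_right' := by
    rintro y _ ⟨a, ha, rfl⟩
    obtain ⟨b, rfl⟩ := hψ y
    exact ⟨a * b, I.mul_mem_right b ha, map_mul _ _ _⟩
  isClosed' := isClosed_map I.toStarSubalgebra ψ

/-- A closed star subalgebra as a C*-algebra. -/
def SubAlg (S : NonUnitalStarSubalgebra ℂ A) [IsClosed (S : Set A)] : Type u := S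

instance (S : NonUnitalStarSubalgebra ℂ A) [IsClosed (S : Set A)] :
    NonUnitalCStarAlgebra (SubAlg S) := inferInstanceAs (NonUnitalCStarAlgebra S)

/-- The restriction of a homomorphism to subalgebras. -/
def restrictHom (ψ : A →⋆ₙₐ[ℂ] A') (S : NonUnitalStarSubalgebra ℂ A) [IsClosed (S : Set A)]
    (S' : NonUnitalStarSubalgebra ℂ A') [IsClosed (S' : Set A')] (h : ∀ a ∈ S, ψ a ∈ S') :
    SubAlg S →⋆ₙₐ[ℂ] SubAlg S' where
  toFun a := ⟨ψ a.1, h a.1 a.2⟩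
  map_smul' c a := Subtype.ext (map_smul ψ c a.1)
  map_zero' := Subtype.ext (map_zero ψ)
  map_add' a b := Subtype.ext (map_add ψ a.1 b.1)
  map_mul' a b := Subtype.ext (map_mul ψ a.1 b.1)
  map_star' a := Subtype.ext (map_star ψ a.1)

theorem restrictHom_val (ψ : A →⋆ₙₐ[ℂ] A') (S : NonUnitalStarSubalgebra ℂ A)
    [IsClosed (S : Set A)] (S' : NonUnitalStarSubalgebra ℂ A') [IsClosed (S' : Set A')]
    (h : ∀ a ∈ S, ψ a ∈ S') (a : SubAlg S) : (restrictHom ψ S S' h a).1 = ψ a.1 := rfl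

/-- The inclusion of subalgebras. -/
def inclHom {S S' : NonUnitalStarSubalgebra ℂ A} [IsClosed (S : Set A)] [IsClosed (S' : Set A)]
    (h : S ≤ S') : SubAlg S →⋆ₙₐ[ℂ] SubAlg S' :=
  restrictHom (NonUnitalStarAlgHom.id ℂ A) S S' h

theorem inclHom_val {S S' : NonUnitalStarSubalgebra ℂ A} [IsClosed (S : Set A)]
    [IsClosed (S' : Set A)] (h : S ≤ S') (a : SubAlg S) : (inclHom h a).1 = a.1 := rfl

/-- The products `f(d) a f(d')`. -/
def cornerSet (f : D →⋆ₙₐ[ℂ] A) : Set A := {b | ∃ d a d', b = f d * a * f d'}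

/-- The hereditary C*-subalgebra `f(D) A f(D)`, the closed linear span of the products
`f(d) a f(d')`. -/
def hereditary (f : D →⋆ₙₐ[ℂ] A) : NonUnitalStarSubalgebra ℂ A where
  __ := (Submodule.span ℂ (cornerSet f)).topologicalClosure
  mul_mem' := by
    intro x y hx hy
    refine map_mem_closure₂ continuous_mul hx hy fun a ha b hb ↦ ?_
    refine Submodule.span_induction (p := fun a _ ↦ a * b ∈ Submodule.span ℂ (cornerSet f))
      ?_ (by simp) (fun _ _ _ _ h h' ↦ by rw [add_mul]; exact add_mem h h')
      (fun c _ _ h ↦ by rw [smul_mul_assoc]; exact Submodule.smul_mem _ c h) ha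
    rintro _ ⟨d, a, d', rfl⟩
    refine Submodule.span_induction
      (p := fun b _ ↦ f d * a * f d' * b ∈ Submodule.span ℂ (cornerSet f))
      ?_ (by simp) (fun _ _ _ _ h h' ↦ by rw [mul_add]; exact add_mem h h')
      (fun c _ _ h ↦ by rw [mul_smul_comm]; exact Submodule.smul_mem _ c h) hb
    rintro _ ⟨e, b, e', rfl⟩
    exact Submodule.subset_span ⟨d, a * f d' * f e * b, e', by simp only [mul_assoc]⟩
  star_mem' := by
    intro x hx
    refine map_mem_closure continuous_star hx fun a ha ↦ ?_
    refine Submodule.span_induction (p := fun a _ ↦ star a ∈ Submodule.span ℂ (cornerSet f))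
      ?_ (by simp) (fun _ _ _ _ h h' ↦ by rw [star_add]; exact add_mem h h')
      (fun c _ _ h ↦ by rw [star_smul]; exact Submodule.smul_mem _ _ h) ha
    rintro _ ⟨d, a, d', rfl⟩
    exact Submodule.subset_span ⟨star d', star a, star d, by
      simp only [star_mul, map_star, mul_assoc]⟩

theorem mem_hereditary (f : D →⋆ₙₐ[ℂ] A) {a : A} :
    a ∈ hereditary f ↔ a ∈ closure (Submodule.span ℂ (cornerSet f) : Set A) := Iff.rfl

instance (f : D →⋆ₙₐ[ℂ] A) : IsClosed (hereditary f : Set A) :=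
  (Submodule.span ℂ (cornerSet f)).isClosed_topologicalClosure

theorem map_mem_hereditary {D' : Type*} [NonUnitalCStarAlgebra D'] (f : D →⋆ₙₐ[ℂ] A)
    (f' : D' →⋆ₙₐ[ℂ] A') (ψ : A →⋆ₙₐ[ℂ] A') (h : ∀ d, ∃ d', f' d' = ψ (f d))
    {a : A} (ha : a ∈ hereditary f) : ψ a ∈ hereditary f' := by
  refine map_mem_closure (continuous_hom ψ) ha fun a ha ↦ ?_
  refine Submodule.span_induction (p := fun a _ ↦ ψ a ∈ Submodule.span ℂ (cornerSet f'))
    ?_ (by simp) (fun _ _ _ _ h h' ↦ by rw [map_add]; exact add_mem h h')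
    (fun c _ _ h ↦ by rw [map_smul]; exact Submodule.smul_mem _ _ h) ha
  rintro _ ⟨d, a, d', rfl⟩
  obtain ⟨e, he⟩ := h d
  obtain ⟨e', he'⟩ := h d'
  exact Submodule.subset_span ⟨e, ψ a, e', by rw [map_mul, map_mul, he, he']⟩

attribute [irreducible] hereditary

end Subalgebras

section DirectLimit

variable (E : ℕ → Type u) [∀ n, NonUnitalCStarAlgebra (E n)]

/-- The ideal of null sequences in the C*-algebra `ℓ^∞(E)` of bounded sequences. -/
def nullIdeal : ClosedIdeal (lp E ∞) where
  carrier := {a | Tendsto (fun n ↦ ‖a n‖) atTop (𝓝 0)}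
  add_mem' := fun {a b} ha hb ↦ by
    refine squeeze_zero (fun n ↦ norm_nonneg _) (fun n ↦ norm_add_le (a n) (b n)) ?_
    simpa using Tendsto.add ha hb
  zero_mem' := by
    refine Tendsto.congr (f₁ := fun _ ↦ (0 : ℝ)) (fun n ↦ ?_) tendsto_const_nhds
    simp
  smul_mem' := fun c a ha ↦ by
    refine Tendsto.congr (f₁ := fun n ↦ ‖c‖ * ‖a n‖) (fun n ↦ ?_) (by
      simpa using Tendsto.const_mul ‖c‖ ha)
    simp [norm_smul]
  mul_mem_left' := fun a b hb ↦ by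
    refine squeeze_zero (fun n ↦ norm_nonneg _) (fun n ↦ ?_) (by
      simpa using Tendsto.const_mul ‖a‖ hb)
    rw [lp.infty_coeFn_mul]
    exact (norm_mul_le _ _).trans (by
      gcongr
      exact lp.norm_apply_le_norm ENNReal.top_ne_zero a n)
  mul_mem_right' := fun a b hb ↦ by
    refine squeeze_zero (fun n ↦ norm_nonneg _) (fun n ↦ ?_) (by
      simpa using Tendsto.mul_const ‖a‖ hb)
    rw [lp.infty_coeFn_mul]
    exact (norm_mul_le _ _).trans (by
      gcongr
      exact lp.norm_apply_le_norm ENNReal.top_ne_zero a n)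
  isClosed' := by
    refine isClosed_of_closure_subset fun a ha ↦ ?_
    rw [Metric.mem_closure_iff] at ha
    simp only [Set.mem_ofPred_eq]
    rw [Metric.tendsto_atTop]
    intro ε hε
    obtain ⟨b, hb, hab⟩ := ha (ε / 2) (half_pos hε)
    obtain ⟨N, hN⟩ := Metric.tendsto_atTop.1 hb (ε / 2) (half_pos hε)
    refine ⟨N, fun n hn ↦ ?_⟩
    have h1 := hN n hn
    rw [dist_zero_right, norm_norm] at h1 ⊢
    have h2 : ‖a n - b n‖ ≤ ‖a - b‖ := lp.norm_apply_le_norm ENNReal.top_ne_zero (a - b) n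
    rw [dist_eq_norm] at hab
    calc ‖a n‖ = ‖(a n - b n) + b n‖ := by rw [sub_add_cancel]
      _ ≤ ‖a n - b n‖ + ‖b n‖ := norm_add_le _ _
      _ < ε := by linarith

/-- The C*-algebra `ℓ^∞(E)/c₀(E)` of bounded sequences modulo null sequences. -/
abbrev SeqAlg : Type u := (nullIdeal E).Quot

/-- The class `[a₀, a₁, a₂, ...]` of a bounded sequence modulo null sequences. -/
def seqClass : lp E ∞ →⋆ₙₐ[ℂ] SeqAlg E := (nullIdeal E).proj

variable {E}

/-- The identity `E n → E m` for `n = m`. -/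
def castHom {n m : ℕ} (h : n = m) : E n →⋆ₙₐ[ℂ] E m := h ▸ NonUnitalStarAlgHom.id ℂ (E n)

variable (f : ∀ n, E n →⋆ₙₐ[ℂ] E (n + 1))

/-- The map `E n → E m` which is zero for `m < n` and the composition
`f (m - 1) ∘ ⋯ ∘ f n` for `n ≤ m`. -/
def thread (n : ℕ) : ∀ m, E n →⋆ₙₐ[ℂ] E m
  | 0 => if h : n = 0 then castHom h else 0
  | m + 1 => if h : n = m + 1 then castHom h else (f m).comp (thread n m)

theorem thread_self (n : ℕ) : thread f n n = NonUnitalStarAlgHom.id ℂ (E n) := by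
  cases n <;> simp [thread, castHom]

theorem thread_of_lt (n : ℕ) : ∀ m, m < n → thread f n m = 0
  | 0, h => by simp [thread, h.ne']
  | m + 1, h => by
    ext b
    simp [thread, h.ne', thread_of_lt n m (by omega)]

theorem thread_succ {n m : ℕ} (h : n ≤ m) :
    thread f n (m + 1) = (f m).comp (thread f n m) := by
  simp [thread, show n ≠ m + 1 by omega]

theorem thread_succ_left {n m : ℕ} (h : n < m) (b : E n) :
    thread f (n + 1) m (f n b) = thread f n m b := by
  induction m, h using Nat.le_induction with
  | base => rw [thread_self, thread_succ f le_rfl, thread_self]; rfl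
  | succ m h ih =>
    rw [thread_succ f h, thread_succ f (by omega : n ≤ m)]
    simp [ih]

/-- The sequence `0, ..., 0, b, f n b, f (n + 1) (f n b), ...`. -/
def threadSeq (n : ℕ) : E n →⋆ₙₐ[ℂ] lp E ∞ where
  toFun b := ⟨fun m ↦ thread f n m b, memℓp_infty ⟨‖b‖, by
    rintro _ ⟨m, rfl⟩
    exact NonUnitalStarAlgHom.norm_apply_le (thread f n m) b⟩⟩
  map_smul' c b := by ext m; simp
  map_zero' := by ext m; simp
  map_add' b c := Subtype.ext (funext fun _ ↦ map_add _ _ _)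
  map_mul' b c := by ext m; simp [lp.infty_coeFn_mul]
  map_star' b := Subtype.ext (funext fun _ ↦ map_star _ _)

/-- The homomorphism `E n → ℓ^∞(E)/c₀(E)`, `b ↦ [0, ..., 0, b, f n b, f (n + 1) (f n b), ...]`. -/
def threadClass (n : ℕ) : E n →⋆ₙₐ[ℂ] SeqAlg E := (seqClass E).comp (threadSeq f n)

/-- The C*-algebraic direct limit of `E 0 → E 1 → E 2 → ⋯`: the closure of the union of the
increasing sequence of the images of the algebras `E n` in `ℓ^∞(E)/c₀(E)`. -/
def limAlg : NonUnitalStarSubalgebra ℂ (SeqAlg E) :=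
  (⨆ n, NonUnitalStarAlgHom.range (threadClass f n)).topologicalClosure

instance : IsClosed (limAlg f : Set (SeqAlg E)) :=
  NonUnitalStarSubalgebra.isClosed_topologicalClosure _

theorem threadClass_mem (n : ℕ) (b : E n) : threadClass f n b ∈ limAlg f :=
  NonUnitalStarSubalgebra.le_topologicalClosure _
    (le_iSup (fun n ↦ NonUnitalStarAlgHom.range (threadClass f n)) n ⟨b, rfl⟩)

/-- The direct limit as a C*-algebra. -/
abbrev LimAlg : Type u := SubAlg (limAlg f)

/-- The natural homomorphism from `E n` to the direct limit. -/
def limOf (n : ℕ) : E n →⋆ₙₐ[ℂ] LimAlg f where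
  toFun b := ⟨threadClass f n b, threadClass_mem f n b⟩
  map_smul' c a := Subtype.ext (map_smul (threadClass f n) c a)
  map_zero' := Subtype.ext (map_zero (threadClass f n))
  map_add' a b := Subtype.ext (map_add (threadClass f n) a b)
  map_mul' a b := Subtype.ext (map_mul (threadClass f n) a b)
  map_star' a := Subtype.ext (map_star (threadClass f n) a)

theorem threadClass_succ (n : ℕ) (b : E n) :
    threadClass f (n + 1) (f n b) = threadClass f n b := by
  refine (nullIdeal E).proj_eq_iff.2 ?_
  refine tendsto_atTop_of_eventually_const (i₀ := n + 1) fun m hm ↦ ?_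
  have h : thread f (n + 1) m (f n b) = thread f n m b := thread_succ_left f (by omega) b
  change ‖thread f (n + 1) m (f n b) - thread f n m b‖ = 0
  rw [h, sub_self, norm_zero]

variable {E' : ℕ → Type u} [∀ n, NonUnitalCStarAlgebra (E' n)]
  (f' : ∀ n, E' n →⋆ₙₐ[ℂ] E' (n + 1))

/-- The map `(a₀, a₁, a₂, ...) ↦ (g 0 a₁, g 1 a₂, ...)` of bounded sequences. -/
def seqShift (g : ∀ n, E (n + 1) →⋆ₙₐ[ℂ] E' n) : lp E ∞ →⋆ₙₐ[ℂ] lp E' ∞ where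
  toFun a := ⟨fun n ↦ g n (a (n + 1)), memℓp_infty ⟨‖a‖, by
    rintro _ ⟨n, rfl⟩
    exact (NonUnitalStarAlgHom.norm_apply_le (g n) _).trans
      (lp.norm_apply_le_norm ENNReal.top_ne_zero a (n + 1))⟩⟩
  map_smul' c b := by ext m; simp
  map_zero' := by ext m; simp
  map_add' b c := Subtype.ext (funext fun _ ↦ map_add _ _ _)
  map_mul' b c := by ext m; simp [lp.infty_coeFn_mul]
  map_star' b := Subtype.ext (funext fun _ ↦ map_star _ _)

/-- The map `[a₀, a₁, a₂, ...] ↦ [g 0 a₁, g 1 a₂, ...]`. -/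
def classShift (g : ∀ n, E (n + 1) →⋆ₙₐ[ℂ] E' n) : SeqAlg E →⋆ₙₐ[ℂ] SeqAlg E' :=
  (nullIdeal E).lift ((seqClass E').comp (seqShift g)) fun a ha ↦
    (nullIdeal E').proj_eq_zero.2 <|
      squeeze_zero (fun _ ↦ norm_nonneg _)
        (fun n ↦ NonUnitalStarAlgHom.norm_apply_le (g n) (a (n + 1)))
        (Tendsto.comp (g := fun n ↦ ‖a n‖) ha (tendsto_add_atTop_nat 1))

theorem classShift_threadClass (g : ∀ n, E (n + 1) →⋆ₙₐ[ℂ] E' n)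
    (hg : ∀ n b, g (n + 1) (f (n + 1) b) = f' n (g n b)) (n : ℕ) (b : E (n + 1)) :
    classShift g (threadClass f (n + 1) b) = threadClass f' n (g n b) := by
  refine congrArg (seqClass E') (Subtype.ext (funext fun m ↦ ?_))
  change g m (thread f (n + 1) (m + 1) b) = thread f' n m (g n b)
  rcases lt_or_ge m n with h | h
  · rw [thread_of_lt f _ _ (by omega), thread_of_lt f' _ _ h]
    simp
  · induction m, h using Nat.le_induction with
    | base => rw [thread_self, thread_self]; rfl
    | succ m h ih =>
      rw [thread_succ f (by omega), thread_succ f' h]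
      simp [hg, ih]

/-- The homomorphism `[a₀, a₁, a₂, ...] ↦ [g 0 a₁, g 1 a₂, ...]` of direct limits. -/
def limShift (g : ∀ n, E (n + 1) →⋆ₙₐ[ℂ] E' n)
    (hg : ∀ n b, g (n + 1) (f (n + 1) b) = f' n (g n b)) : LimAlg f →⋆ₙₐ[ℂ] LimAlg f' :=
  restrictHom (classShift g) (limAlg f) (limAlg f') fun a ha ↦ by
    have hle : (⨆ n, NonUnitalStarAlgHom.range (threadClass f n)) ≤
        (limAlg f').comap (classShift g) := by
      refine iSup_le fun n ↦ ?_
      rintro _ ⟨b, rfl⟩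
      change classShift g (threadClass f n b) ∈ limAlg f'
      rw [← threadClass_succ, classShift_threadClass f f' g hg]
      exact threadClass_mem f' _ _
    exact NonUnitalStarSubalgebra.topologicalClosure_minimal _ hle
      (IsClosed.preimage (continuous_hom (classShift g))
        (inferInstance : IsClosed (limAlg f' : Set (SeqAlg E')))) ha

theorem limShift_limOf (g : ∀ n, E (n + 1) →⋆ₙₐ[ℂ] E' n)
    (hg : ∀ n b, g (n + 1) (f (n + 1) b) = f' n (g n b)) (n : ℕ) (b : E (n + 1)) :
    limShift f f' g hg (limOf f (n + 1) b) = limOf f' n (g n b) :=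
  Subtype.ext (classShift_threadClass f f' g hg n b)

end DirectLimit

section Multipliers

variable {A : Type u} [NonUnitalCStarAlgebra A] {D : Type v} [NonUnitalCStarAlgebra D]

/-- The strict topology on the multiplier algebra `M(A)`: the topology of pointwise convergence of
`a ↦ m a` and `a ↦ a m`. -/
abbrev strictTopology (A : Type u) [NonUnitalCStarAlgebra A] : TopologicalSpace 𝓜(ℂ, A) :=
  TopologicalSpace.induced (fun m ↦ ((fun a ↦ m.fst a, fun a ↦ m.snd a) : (A → A) × (A → A)))
    inferInstance

/-- `Ψ : M(D) → M(A)` is a strictly continuous extension of `ψ : D → A`. -/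
def IsStrictExtension (ψ : D →⋆ₙₐ[ℂ] A) (Ψ : 𝓜(ℂ, D) →⋆ₙₐ[ℂ] 𝓜(ℂ, A)) : Prop :=
  (∀ d : D, Ψ (d : 𝓜(ℂ, D)) = (ψ d : 𝓜(ℂ, A))) ∧
    Continuous[strictTopology D, strictTopology A] Ψ

/-- A homomorphism is extendible if it has a strictly continuous extension to the multiplier
algebras. -/
def IsExtendible (ψ : D →⋆ₙₐ[ℂ] A) : Prop := ∃ Ψ, IsStrictExtension ψ Ψ

open Classical in
/-- The strictly continuous extension `M(D) → M(A)` of an extendible homomorphism `D → A` (it is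
unique; the junk value is `0`). -/
def strictExtension (ψ : D →⋆ₙₐ[ℂ] A) : 𝓜(ℂ, D) →⋆ₙₐ[ℂ] 𝓜(ℂ, A) :=
  if h : IsExtendible ψ then h.choose else 0

/-- The compression `m a m` of `a` by a multiplier `m`. -/
def compress (m : 𝓜(ℂ, A)) (a : A) : A := m.snd (m.fst a)

/-- Positivity of maps of C*-algebras: positive elements are those of the form `b* b`. -/
def IsPositiveMap (T : D → A) : Prop := ∀ b, ∃ c, T (star b * b) = star c * c

/-- `L` is a transfer operator for the endomorphism `α`. -/
structure IsTransferOperator (α : A →⋆ₙₐ[ℂ] A) (L : A →ₗ[ℂ] A) : Prop where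
  positive : IsPositiveMap L
  transfer : ∀ a b, L (α a * b) = a * L b

/-- `L` is a regular transfer operator for `α`: the composition `α ∘ L` is a conditional
expectation onto `α(A)`. -/
structure IsRegularTransferOperator (α : A →⋆ₙₐ[ℂ] A) (L : A →ₗ[ℂ] A) : Prop extends
    IsTransferOperator α L where
  apply_range : ∀ a, α (L (α a)) = α a
  norm_le : ∀ a, ‖α (L a)‖ ≤ ‖a‖
  bimodule : ∀ a b c, α (L (α a * b * α c)) = α a * α (L b) * α c

theorem fst_mul (m : 𝓜(ℂ, A)) (a b : A) : m.fst (a * b) = m.fst a * b := by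
  have h : star (m.fst (a * b) - m.fst a * b) * (m.fst (a * b) - m.fst a * b) = 0 := by
    rw [mul_sub, ← m.central, ← mul_assoc, ← mul_assoc, ← m.central, sub_self]
  exact sub_eq_zero.1 ((CStarRing.star_mul_self_eq_zero_iff _).1 h)

theorem mul_fst_of_central {m : 𝓜(ℂ, A)} (hm : ∀ n, m * n = n * m) (a b : A) :
    m.fst (a * b) = a * m.fst b := by
  have h := congrArg (fun n : 𝓜(ℂ, A) ↦ n.fst b) (hm (a : 𝓜(ℂ, A)))
  simpa using h

end Multipliers

section Primitive

variable {A : Type u} [NonUnitalCStarAlgebra A]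

/-- Primitive ideals: the kernels of the irreducible representations on Hilbert spaces, that is, of
the nonzero representations without nontrivial closed invariant subspaces. -/
def IsPrimitive (P : ClosedIdeal A) : Prop :=
  ∃ (H : Type u) (_ : NormedAddCommGroup H) (_ : InnerProductSpace ℂ H) (_ : CompleteSpace H)
    (π : A →⋆ₙₐ[ℂ] (H →L[ℂ] H)), (∃ a, π a ≠ 0) ∧
      (∀ K : Submodule ℂ H, IsClosed (K : Set H) → (∀ a, ∀ v ∈ K, π a v ∈ K) → K = ⊥ ∨ K = ⊤) ∧
      ∀ a, a ∈ P ↔ π a = 0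

/-- `J` is a complemented ideal: `A = J ⊕ K` for some ideal `K`. -/
def ClosedIdeal.IsComplemented (J : ClosedIdeal A) : Prop :=
  ∃ K : ClosedIdeal A, IsCompl J.toSubmodule K.toSubmodule

end Primitive

section Bundles

/-- The total space `⨆ F x` of a family of fibres. -/
structure Tot {X : Type*} (F : X → Type*) where
  /-- The projection to the base space. -/
  base : X
  /-- The point in the fibre. -/
  val : F base

/-- Pairs of points in the same fibre. -/
structure FibrePair {X : Type*} (F : X → Type*) where
  /-- The projection to the base space. -/
  base : X
  /-- The first point. -/
  fst : F base
  /-- The second point. -/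
  snd : F base

/-- Pairs of a point of `Δ` and a point in the fibre over its image under `φ`. -/
structure PullbackPt {X Y : Type*} {Δ : Set X} (φ : Δ → Y) (G : Y → Type*) where
  /-- The point of `Δ`. -/
  base : Δ
  /-- The point in the fibre over `φ base`. -/
  val : G (φ base)

instance {X : Type*} (F : X → Type*) [TopologicalSpace (Tot F)] :
    TopologicalSpace (FibrePair F) :=
  TopologicalSpace.induced
    (fun z ↦ ((⟨z.base, z.fst⟩, ⟨z.base, z.snd⟩) : Tot F × Tot F)) inferInstance

instance {X Y : Type*} [TopologicalSpace X] {Δ : Set X} (φ : Δ → Y) (G : Y → Type*)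
    [TopologicalSpace (Tot G)] : TopologicalSpace (PullbackPt φ G) :=
  TopologicalSpace.induced
    (fun z ↦ ((z.base, ⟨φ z.base, z.val⟩) : Δ × Tot G)) inferInstance

/-- The total space, with its topology, is an upper semicontinuous C*-bundle. -/
structure IsUSCBundle {X : Type*} [TopologicalSpace X] (F : X → Type*)
    [∀ x, NonUnitalCStarAlgebra (F x)] [TopologicalSpace (Tot F)] : Prop where
  continuous_base : Continuous fun a : Tot F ↦ a.base
  isOpenMap_base : IsOpenMap fun a : Tot F ↦ a.base
  norm_usc : UpperSemicontinuous fun a : Tot F ↦ ‖a.val‖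
  continuous_add : Continuous fun z : FibrePair F ↦ (⟨z.base, z.fst + z.snd⟩ : Tot F)
  continuous_mul : Continuous fun z : FibrePair F ↦ (⟨z.base, z.fst * z.snd⟩ : Tot F)
  continuous_smul : ∀ c : ℂ, Continuous fun a : Tot F ↦ (⟨a.base, c • a.val⟩ : Tot F)
  continuous_star : Continuous fun a : Tot F ↦ (⟨a.base, star a.val⟩ : Tot F)
  tendsto_zero : ∀ x : X,
    (𝓝 x).comap (fun a : Tot F ↦ a.base) ⊓ (𝓝 0).comap (fun a : Tot F ↦ ‖a.val‖) ≤
      𝓝 (⟨x, 0⟩ : Tot F)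

/-- The bundle is continuous: the norm is a continuous function on the total space. -/
def IsContinuousBundle {X : Type*} (F : X → Type*)
    [∀ x, NonUnitalCStarAlgebra (F x)] [TopologicalSpace (Tot F)] : Prop :=
  Continuous fun a : Tot F ↦ ‖a.val‖

/-- The continuous sections that vanish at infinity. -/
def sectionsC0 {X : Type*} [TopologicalSpace X] (F : X → Type*)
    [∀ x, NonUnitalCStarAlgebra (F x)] [TopologicalSpace (Tot F)] : Set (∀ x, F x) :=
  {s | (Continuous fun x ↦ (⟨x, s x⟩ : Tot F)) ∧ ∀ ε : ℝ, 0 < ε → IsCompact {x | ε ≤ ‖s x‖}}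

/-- `(φ, α)` is a morphism from the bundle `G` over `Y` to the bundle `F` over `X`, where `φ` is
defined on `Δ ⊆ X`. -/
structure IsBundleMorphism {X Y : Type*} [TopologicalSpace X] [TopologicalSpace Y]
    (F : X → Type*) [∀ x, NonUnitalCStarAlgebra (F x)] [TopologicalSpace (Tot F)]
    (G : Y → Type*) [∀ y, NonUnitalCStarAlgebra (G y)] [TopologicalSpace (Tot G)]
    (Δ : Set X) (φ : Δ → Y) (α : ∀ x : Δ, G (φ x) →⋆ₙₐ[ℂ] F x) : Prop where
  isOpen : IsOpen Δ
  isProperMap : IsProperMap φ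
  continuous : Continuous fun z : PullbackPt φ G ↦ (⟨z.base, α z.base z.val⟩ : Tot F)

end Bundles

section C0Algebras

/-- A `C₀(X)`-algebra structure on `A`: a nondegenerate homomorphism from `C₀(X)` to the center of
the multiplier algebra of `A`. -/
structure C0Algebra (X : Type v) [TopologicalSpace X] (A : Type u) [NonUnitalCStarAlgebra A] where
  /-- The structure map. -/
  toHom : C₀(X, ℂ) →⋆ₙₐ[ℂ] 𝓜(ℂ, A)
  central : ∀ f m, toHom f * m = m * toHom f
  nondegenerate : Dense (Submodule.span ℂ {b : A | ∃ f a, b = (toHom f).fst a} : Set A)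

namespace C0Algebra

variable {X : Type v} [TopologicalSpace X] {A : Type u} [NonUnitalCStarAlgebra A]
  (μ : C0Algebra X A)

/-- The products `f · a` with `f ∈ C₀(X \ {x})`. -/
def vanishingSet (x : X) : Set A := {b | ∃ (f : C₀(X, ℂ)) (a : A), f x = 0 ∧ b = (μ.toHom f).fst a}

/-- The ideal `C₀(X \ {x}) · A`. -/
def vanishingIdeal (x : X) : ClosedIdeal A where
  __ := (Submodule.span ℂ (μ.vanishingSet x)).topologicalClosure
  mul_mem_left' := fun a b hb ↦ by
    refine map_mem_closure (continuous_const_mul a) hb fun b hb ↦ ?_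
    refine Submodule.span_induction (p := fun b _ ↦ a * b ∈ Submodule.span ℂ (μ.vanishingSet x))
      ?_ (by simp) (fun _ _ _ _ h h' ↦ by rw [mul_add]; exact add_mem h h')
      (fun c _ _ h ↦ by rw [mul_smul_comm]; exact Submodule.smul_mem _ c h) hb
    rintro _ ⟨f, b, hf, rfl⟩
    exact Submodule.subset_span ⟨f, a * b, hf, (mul_fst_of_central (μ.central f) a b).symm⟩
  mul_mem_right' := fun a b hb ↦ by
    refine map_mem_closure (f := fun b ↦ b * a) (continuous_mul_const a) hb fun b hb ↦ ?_
    refine Submodule.span_induction (p := fun b _ ↦ b * a ∈ Submodule.span ℂ (μ.vanishingSet x))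
      ?_ (by simp) (fun _ _ _ _ h h' ↦ by rw [add_mul]; exact add_mem h h')
      (fun c _ _ h ↦ by rw [smul_mul_assoc]; exact Submodule.smul_mem _ c h) hb
    rintro _ ⟨f, b, hf, rfl⟩
    exact Submodule.subset_span ⟨f, b * a, hf, (fst_mul _ b a).symm⟩
  isClosed' := (Submodule.span ℂ (μ.vanishingSet x)).isClosed_topologicalClosure

/-- The fibre `A(x)`. -/
def Fibre (x : X) : Type u := (μ.vanishingIdeal x).Quot

instance (x : X) : NonUnitalCStarAlgebra (μ.Fibre x) :=
  inferInstanceAs (NonUnitalCStarAlgebra (μ.vanishingIdeal x).Quot)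

/-- The evaluation `a ↦ a(x)`. -/
def ev (x : X) : A →⋆ₙₐ[ℂ] μ.Fibre x := (μ.vanishingIdeal x).proj

theorem ev_surjective (x : X) : Function.Surjective (μ.ev x) :=
  (μ.vanishingIdeal x).proj_surjective

/-- The topology of the bundle of a `C₀(X)`-algebra, generated by the tubes
`{b | b.base ∈ U, ‖b - a(b.base)‖ < ε}`. -/
instance : TopologicalSpace (Tot μ.Fibre) :=
  TopologicalSpace.generateFrom {W | ∃ (a : A) (U : Set X) (ε : ℝ), IsOpen U ∧
    W = {b : Tot μ.Fibre | b.base ∈ U ∧ ‖b.val - μ.ev b.base a‖ < ε}}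

/-- The graph of the base map `σ_A : Prim A → X`: one has `σ_A(P) = x` if and only if
`C₀(X \ {x}) · A ⊆ P`. -/
def IsBasePoint (P : ClosedIdeal A) (x : X) : Prop := ∀ a ∈ μ.vanishingIdeal x, a ∈ P

/-- The base map `σ_A : Prim A → X` is surjective. -/
def BaseMapSurjective : Prop := ∀ x, ∃ P, IsPrimitive P ∧ μ.IsBasePoint P x

/-- The base map `σ_A : Prim A → X` is injective. -/
def BaseMapInjective : Prop := ∀ P Q x, IsPrimitive P → IsPrimitive Q →
  μ.IsBasePoint P x → μ.IsBasePoint Q x → P = Q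

/-- The closure of `σ_A(Prim(A/J))`, where `Prim(A/J)` consists of the primitive ideals that
contain `J`. -/
def hull (J : ClosedIdeal A) : Set X :=
  closure {x | ∃ P, IsPrimitive P ∧ (∀ a ∈ J, a ∈ P) ∧ μ.IsBasePoint P x}

/-- The ideal `J(x) = {a(x) : a ∈ J}` of `A(x)`. -/
def fibreIdeal (J : ClosedIdeal A) (x : X) : ClosedIdeal (μ.Fibre x) :=
  J.image (μ.ev x) (μ.ev_surjective x)

/-- The homomorphism `A/J → A(x)/J(x)`, `a + J ↦ a(x) + J(x)`. -/
def quotEval (J : ClosedIdeal A) (x : X) : J.Quot →⋆ₙₐ[ℂ] (μ.fibreIdeal J x).Quot :=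
  J.lift ((μ.fibreIdeal J x).proj.comp (μ.ev x)) fun a ha ↦
    (μ.fibreIdeal J x).proj_eq_zero.2 ⟨a, ha, rfl⟩

end C0Algebra

end C0Algebras

section PartialDynamics

variable {X : Type v} {Δ : Set X} (φ : Δ → X)

/-- The domain `Δ_n` of the `n`-th iterate of the partial map `φ`. -/
def dom : ℕ → Set X
  | 0 => Set.univ
  | n + 1 => {x | ∃ h : x ∈ Δ, φ ⟨x, h⟩ ∈ dom n}

/-- The `n`-th iterate of the partial map `φ`. -/
def iter : ∀ (n : ℕ) (x : X), x ∈ dom φ n → X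
  | 0, x, _ => x
  | n + 1, x, h => iter n (φ ⟨x, h.fst⟩) h.snd

theorem dom_succ : ∀ (n : ℕ) (x : X) (h : x ∈ dom φ n), iter φ n x h ∈ Δ → x ∈ dom φ (n + 1)
  | 0, _, _, h' => ⟨h', trivial⟩
  | n + 1, _, h, h' => ⟨h.fst, dom_succ n _ h.snd h'⟩

theorem dom_antitone : Antitone (dom φ) := by
  refine antitone_nat_of_succ_le fun n ↦ ?_
  induction n with
  | zero => exact fun _ _ ↦ trivial
  | succ n ih => exact fun x hx ↦ ⟨hx.fst, ih hx.snd⟩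

/-- The backward orbits `x₀, x₁, x₂, ...` of `φ`, where `x_{n+1} ∈ Δ` and `φ(x_{n+1}) = x_n`. -/
def IsBackwardOrbit (x : ℕ → X) : Prop := ∀ n, ∃ h : x (n + 1) ∈ Δ, φ ⟨x (n + 1), h⟩ = x n

variable {φ} in
theorem IsBackwardOrbit.mem_dom {x : ℕ → X} (hx : IsBackwardOrbit φ x) : ∀ n, x n ∈ dom φ n
  | 0 => trivial
  | n + 1 => by
    obtain ⟨h, h'⟩ := hx n
    exact ⟨h, by rw [h']; exact hx.mem_dom n⟩

variable {φ} in
theorem IsBackwardOrbit.tail {x : ℕ → X} (hx : IsBackwardOrbit φ x) :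
    IsBackwardOrbit φ fun n ↦ x (n + 1) := fun n ↦ hx (n + 1)

/-- The space of the natural reversible `Y`-extension of `(X, φ)`. The point `fin N x` stands for
the sequence `(x₀, ..., x_N, 0, 0, ...)` with `x_N = x ∈ Y` and `x_n = φ^{N-n}(x)` for `n ≤ N`; the
point `inf x` stands for the sequence `(x₀, x₁, x₂, ...)`. -/
inductive ExtSpace (Y : Set X) : Type v
  | fin (N : ℕ) (x : X) (hx : x ∈ dom φ N) (hY : x ∈ Y)
  | inf (x : ℕ → X) (hx : IsBackwardOrbit φ x)

namespace ExtSpace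

variable {φ} {Y : Set X}

/-- The sequence in `X ⊔ {0}` for which a point of the extension space stands. -/
def toSeq : ExtSpace φ Y → ℕ → X ⊕ Unit
  | fin N x hx _, n =>
    if n ≤ N then .inl (iter φ (N - n) x (dom_antitone φ (Nat.sub_le N n) hx)) else .inr ()
  | inf x _, n => .inl (x n)

/-- The product topology inherited from `∏ (X ⊔ {0})`, where `{0}` is a clopen singleton. -/
instance [TopologicalSpace X] : TopologicalSpace (ExtSpace φ Y) :=
  TopologicalSpace.induced toSeq inferInstance

/-- The coordinate `x₀`. -/
def head : ExtSpace φ Y → X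
  | fin N x hx _ => iter φ N x hx
  | inf x _ => x 0

/-- The sequence `(y, x₀, x₁, ...)`. -/
def consSeq (y : X) (x : ℕ → X) : ℕ → X
  | 0 => y
  | n + 1 => x n

/-- The set of points with `x₀ ∈ Δ`. -/
def extDom : Set (ExtSpace φ Y) := {p | p.head ∈ Δ}

theorem isBackwardOrbit_consSeq {x : ℕ → X} (hx : IsBackwardOrbit φ x) (h : x 0 ∈ Δ) :
    IsBackwardOrbit φ (consSeq (φ ⟨x 0, h⟩) x)
  | 0 => ⟨h, rfl⟩
  | n + 1 => hx n

/-- The map `(x₀, x₁, ...) ↦ (φ(x₀), x₀, x₁, ...)`. -/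
def shift : ∀ p : ExtSpace φ Y, p.head ∈ Δ → ExtSpace φ Y
  | fin N x hx hY, h => fin (N + 1) x (dom_succ φ N x hx h) hY
  | inf x hx, h => inf (consSeq (φ ⟨x 0, h⟩) x) (isBackwardOrbit_consSeq hx h)

/-- The partial homeomorphism of the extension space. -/
def extMap (p : (extDom : Set (ExtSpace φ Y))) : ExtSpace φ Y := shift p.1 p.2

end ExtSpace

end PartialDynamics

section Products

variable {ι : Type} [Fintype ι] (F : ι → Type u) [∀ i, NonUnitalCStarAlgebra (F i)]
  (G : Type u) [NonUnitalCStarAlgebra G] {D : Type u} [NonUnitalCStarAlgebra D]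

/-- The direct sum of the C*-algebras `F i`, finite in number, and of the C*-algebra `G`. -/
def SumAlg : Type u := (∀ i, F i) × G

instance : NonUnitalCStarAlgebra (SumAlg F G) :=
  inferInstanceAs (NonUnitalCStarAlgebra ((∀ i, F i) × G))

/-- The coordinate homomorphism with index `i`. -/
def coordHom (i : ι) : SumAlg F G →⋆ₙₐ[ℂ] F i where
  toFun a := a.1 i
  map_smul' _ _ := rfl
  map_zero' := rfl
  map_add' _ _ := rfl
  map_mul' _ _ := rfl
  map_star' _ := rfl

/-- The last coordinate homomorphism. -/
def lastHom : SumAlg F G →⋆ₙₐ[ℂ] G where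
  toFun a := a.2
  map_smul' _ _ := rfl
  map_zero' := rfl
  map_add' _ _ := rfl
  map_mul' _ _ := rfl
  map_star' _ := rfl

variable {F G}

/-- The homomorphism with given coordinates. -/
def pairHom (f : ∀ i, D →⋆ₙₐ[ℂ] F i) (g : D →⋆ₙₐ[ℂ] G) : D →⋆ₙₐ[ℂ] SumAlg F G where
  toFun d := (fun i ↦ f i d, g d)
  map_smul' c d := Prod.ext (funext fun i ↦ map_smul (f i) c d) (map_smul g c d)
  map_zero' := Prod.ext (funext fun i ↦ map_zero (f i)) (map_zero g)
  map_add' c d := Prod.ext (funext fun i ↦ map_add (f i) c d) (map_add g c d)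
  map_mul' c d := Prod.ext (funext fun i ↦ map_mul (f i) c d) (map_mul g c d)
  map_star' d := Prod.ext (funext fun i ↦ map_star (f i) d) (map_star g d)

theorem coordHom_pairHom (f : ∀ i, D →⋆ₙₐ[ℂ] F i) (g : D →⋆ₙₐ[ℂ] G) (i : ι) (d : D) :
    coordHom F G i (pairHom f g d) = f i d := rfl

theorem lastHom_pairHom (f : ∀ i, D →⋆ₙₐ[ℂ] F i) (g : D →⋆ₙₐ[ℂ] G) (d : D) :
    lastHom F G (pairHom f g d) = g d := rfl

theorem SumAlg.ext {a b : SumAlg F G} (h : ∀ i, coordHom F G i a = coordHom F G i b)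
    (h' : lastHom F G a = lastHom F G b) : a = b := Prod.ext (funext h) h'

end Products

section Systems

/-- A `C₀(X)`-dynamical system: an endomorphism `α` of a `C₀(X)`-algebra `A` together with a
morphism `(φ, {α_x}_{x ∈ Δ})` of the bundle of `A` that induces it. -/
structure C0System (X : Type v) [TopologicalSpace X] (A : Type u) [NonUnitalCStarAlgebra A] where
  /-- The `C₀(X)`-algebra structure. -/
  μ : C0Algebra X A
  /-- The endomorphism. -/
  α : A →⋆ₙₐ[ℂ] A
  /-- The domain of the partial map. -/
  Δ : Set X
  /-- The partial map. -/
  φ : Δ → X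
  /-- The homomorphisms between the fibres. -/
  fib : ∀ x : Δ, μ.Fibre (φ x) →⋆ₙₐ[ℂ] μ.Fibre x
  morphism : IsBundleMorphism μ.Fibre μ.Fibre Δ φ fib
  induced_of_mem : ∀ (a : A) (x : Δ), μ.ev x (α a) = fib x (μ.ev (φ x) a)
  induced_of_notMem : ∀ (a : A), ∀ x ∉ Δ, μ.ev x (α a) = 0

namespace C0System

variable {X : Type v} [TopologicalSpace X] {A : Type u} [NonUnitalCStarAlgebra A]
  (S : C0System X A) (J : ClosedIdeal A)

/-! ### The reversible extension `(B, β)` -/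

/-- The iterate `α^n`. -/
def iterEnd : ℕ → A →⋆ₙₐ[ℂ] A
  | 0 => NonUnitalStarAlgHom.id ℂ A
  | n + 1 => S.α.comp (iterEnd n)

theorem iterEnd_comm (n : ℕ) (a : A) : S.iterEnd n (S.α a) = S.α (S.iterEnd n a) := by
  induction n with
  | zero => rfl
  | succ n ih => exact congrArg S.α ih

/-- The algebra `A_n = α^n(A) A α^n(A)`. -/
def subA (n : ℕ) : NonUnitalStarSubalgebra ℂ A := hereditary (S.iterEnd n)

instance (n : ℕ) : IsClosed (S.subA n : Set A) :=
  inferInstanceAs (IsClosed (hereditary (S.iterEnd n) : Set A))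

theorem subA_succ_le (n : ℕ) : S.subA (n + 1) ≤ S.subA n := fun _ ha ↦
  map_mem_hereditary (S.iterEnd (n + 1)) (S.iterEnd n) (NonUnitalStarAlgHom.id ℂ A)
    (fun d ↦ ⟨S.α d, S.iterEnd_comm n d⟩) ha

theorem α_mem_subA (n : ℕ) {a : A} (ha : a ∈ S.subA n) : S.α a ∈ S.subA (n + 1) :=
  map_mem_hereditary (S.iterEnd n) (S.iterEnd (n + 1)) S.α (fun d ↦ ⟨d, rfl⟩) ha

theorem iterEnd_mem_subA {n : ℕ} {a : A} (ha : a ∈ S.subA n) :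
    ∀ k, S.iterEnd k a ∈ S.subA (n + k)
  | 0 => ha
  | k + 1 => S.α_mem_subA (n + k) (iterEnd_mem_subA ha k)

/-- The algebra `q(A_n) ⊆ A/J`. -/
def quotA (n : ℕ) : NonUnitalStarSubalgebra ℂ J.Quot := (S.subA n).map J.proj

instance (n : ℕ) : IsClosed (S.quotA J n : Set J.Quot) := isClosed_map (S.subA n) J.proj

theorem quotA_succ_le (n : ℕ) : S.quotA J (n + 1) ≤ S.quotA J n :=
  NonUnitalStarSubalgebra.map_mono (S.subA_succ_le n)

theorem proj_mem_quotA {n : ℕ} {a : A} (ha : a ∈ S.subA n) : J.proj a ∈ S.quotA J n :=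
  ⟨a, ha, rfl⟩

/-- The algebra `B_n = q(A_0) ⊕ ⋯ ⊕ q(A_{n-1}) ⊕ A_n`. -/
abbrev stageB (n : ℕ) : Type u := SumAlg (fun k : Fin n ↦ SubAlg (S.quotA J k)) (SubAlg (S.subA n))

/-- The coordinate `B_n → q(A_k)`, for `k < n`. -/
def coord (n : ℕ) (k : Fin n) : S.stageB J n →⋆ₙₐ[ℂ] SubAlg (S.quotA J k) :=
  coordHom (fun k : Fin n ↦ SubAlg (S.quotA J k)) (SubAlg (S.subA n)) k

/-- The last coordinate `B_n → A_n`. -/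
def last (n : ℕ) : S.stageB J n →⋆ₙₐ[ℂ] SubAlg (S.subA n) :=
  lastHom (fun k : Fin n ↦ SubAlg (S.quotA J k)) (SubAlg (S.subA n))

/-- The restriction `A_n → q(A_k)` of `q`, for `n = k`. -/
def subProj (n k : ℕ) (h : n = k) : SubAlg (S.subA n) →⋆ₙₐ[ℂ] SubAlg (S.quotA J k) :=
  restrictHom J.proj _ _ fun _ ha ↦ S.proj_mem_quotA J (h ▸ ha)

/-- The restriction `A_n → A_{n+1}` of `α`. -/
def subα (n : ℕ) : SubAlg (S.subA n) →⋆ₙₐ[ℂ] SubAlg (S.subA (n + 1)) :=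
  restrictHom S.α _ _ fun _ ha ↦ S.α_mem_subA n ha

/-- The coordinate with index `k ≤ n` of the bonding homomorphism below. -/
def bondCoord (n : ℕ) (k : Fin (n + 1)) : S.stageB J n →⋆ₙₐ[ℂ] SubAlg (S.quotA J k) :=
  if h : k.1 < n then S.coord J n ⟨k.1, h⟩
  else (S.subProj J n k.1 (by omega)).comp (S.last J n)

/-- The bonding homomorphism
`a_0 ⊕ ⋯ ⊕ a_{n-1} ⊕ a_n ↦ a_0 ⊕ ⋯ ⊕ a_{n-1} ⊕ q(a_n) ⊕ α(a_n)`. -/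
def bond (n : ℕ) : S.stageB J n →⋆ₙₐ[ℂ] S.stageB J (n + 1) :=
  pairHom (S.bondCoord J n) ((S.subα n).comp (S.last J n))

/-- The `C*`-algebra `B`, the direct limit of the algebras `B_n`. -/
abbrev limB : Type u := LimAlg (S.bond J)

/-- The natural homomorphism `φ_n : B_n → B`. -/
abbrev toLimB (n : ℕ) : S.stageB J n →⋆ₙₐ[ℂ] S.limB J := limOf (S.bond J) n

/-- The homomorphism `a_0 ⊕ a_1 ⊕ ⋯ ⊕ a_{n+1} ↦ a_1 ⊕ ⋯ ⊕ a_{n+1}` from `B_{n+1}` to `B_n`. -/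
def stageShift (n : ℕ) : S.stageB J (n + 1) →⋆ₙₐ[ℂ] S.stageB J n :=
  pairHom
    (fun k ↦ (inclHom (S.quotA_succ_le J k)).comp
      (S.coord J (n + 1) k.succ))
    ((inclHom (S.subA_succ_le n)).comp (S.last J (n + 1)))

theorem coord_bond (n : ℕ) (k : Fin (n + 1)) (b : S.stageB J n) :
    S.coord J (n + 1) k (S.bond J n b) = S.bondCoord J n k b :=
  coordHom_pairHom _ _ _ _

theorem last_bond (n : ℕ) (b : S.stageB J n) :
    S.last J (n + 1) (S.bond J n b) = S.subα n (S.last J n b) :=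
  lastHom_pairHom _ _ _

theorem coord_stageShift (n : ℕ) (k : Fin n) (b : S.stageB J (n + 1)) :
    S.coord J n k (S.stageShift J n b) =
      inclHom (S.quotA_succ_le J k) (S.coord J (n + 1) k.succ b) :=
  coordHom_pairHom _ _ _ _

theorem last_stageShift (n : ℕ) (b : S.stageB J (n + 1)) :
    S.last J n (S.stageShift J n b) = inclHom (S.subA_succ_le n) (S.last J (n + 1) b) :=
  lastHom_pairHom _ _ _

theorem subProj_incl (n k : ℕ) (h : n = k) (a : SubAlg (S.subA (n + 1))) :
    inclHom (S.quotA_succ_le J k) (S.subProj J (n + 1) (k + 1) (by omega) a) =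
      S.subProj J n k h (inclHom (S.subA_succ_le n) a) := by
  apply Subtype.ext
  unfold subProj
  rw [inclHom_val, restrictHom_val, restrictHom_val, inclHom_val]

theorem subα_incl (n : ℕ) (a : SubAlg (S.subA (n + 1))) :
    inclHom (S.subA_succ_le (n + 1)) (S.subα (n + 1) a) =
      S.subα n (inclHom (S.subA_succ_le n) a) := by
  apply Subtype.ext
  unfold subα
  rw [inclHom_val, restrictHom_val, restrictHom_val, inclHom_val]

theorem stageShift_bond (n : ℕ) (b : S.stageB J (n + 1)) :
    S.stageShift J (n + 1) (S.bond J (n + 1) b) = S.bond J n (S.stageShift J n b) := by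
  refine SumAlg.ext (fun k ↦ ?_) ?_
  · have e1 := S.coord_stageShift J (n + 1) k (S.bond J (n + 1) b)
    have e2 := S.coord_bond J n k (S.stageShift J n b)
    refine e1.trans (Eq.trans ?_ e2.symm)
    rw [coord_bond]
    by_cases h : k.1 < n
    · have h1 : S.bondCoord J (n + 1) k.succ = S.coord J (n + 1) ⟨k.1 + 1, by omega⟩ :=
        dif_pos (show k.succ.1 < n + 1 by simpa using h)
      have h2 : S.bondCoord J n k = S.coord J n ⟨k.1, h⟩ := dif_pos h
      rw [h1, h2]
      exact (S.coord_stageShift J n ⟨k.1, h⟩ b).symm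
    · have h1 : S.bondCoord J (n + 1) k.succ =
          (S.subProj J (n + 1) (k.1 + 1) (by omega)).comp (S.last J (n + 1)) :=
        dif_neg (show ¬k.succ.1 < n + 1 by simpa using h)
      have h2 : S.bondCoord J n k = (S.subProj J n k.1 (by omega)).comp (S.last J n) := dif_neg h
      rw [h1, h2, NonUnitalStarAlgHom.comp_apply, NonUnitalStarAlgHom.comp_apply,
        last_stageShift]
      exact S.subProj_incl J n k.1 (by omega) _
  · have e1 := S.last_stageShift J (n + 1) (S.bond J (n + 1) b)
    have e2 := S.last_bond J n (S.stageShift J n b)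
    refine e1.trans (Eq.trans ?_ e2.symm)
    rw [last_bond, last_stageShift]
    exact S.subα_incl n _

/-- The endomorphism `β` of `B`, determined by
`β(φ_{n+1}(a_0 ⊕ a_1 ⊕ ⋯ ⊕ a_{n+1})) = φ_n(a_1 ⊕ ⋯ ⊕ a_{n+1})`. -/
def β : S.limB J →⋆ₙₐ[ℂ] S.limB J :=
  limShift (S.bond J) (S.bond J) (S.stageShift J) (S.stageShift_bond J)

theorem β_toLimB (n : ℕ) (a : S.stageB J (n + 1)) :
    S.β J (S.toLimB J (n + 1) a) = S.toLimB J n (S.stageShift J n a) :=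
  limShift_limOf _ _ _ _ n a

/-- The endomorphism `β_n` of `B_n`,
`a_0 ⊕ ⋯ ⊕ a_n ↦ a_1 ⊕ ⋯ ⊕ a_{n-1} ⊕ q(a_n) ⊕ α(a_n)`. -/
def stageβ (n : ℕ) : S.stageB J n →⋆ₙₐ[ℂ] S.stageB J n := (S.stageShift J n).comp (S.bond J n)

theorem β_toLimB' (n : ℕ) (a : S.stageB J n) :
    S.β J (S.toLimB J n a) = S.toLimB J n (S.stageβ J n a) := by
  have h : S.toLimB J (n + 1) (S.bond J n a) = S.toLimB J n a :=
    Subtype.ext (threadClass_succ (S.bond J) n a)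
  rw [← h, β_toLimB]
  rfl

/-! ### The fibres -/

/-- The homomorphism `α_{(x,n)} = α_x ∘ α_{φ(x)} ∘ ⋯ ∘ α_{φ^{n-1}(x)}`. -/
def iterHom : ∀ (n : ℕ) (x : X) (h : x ∈ dom S.φ n),
    S.μ.Fibre (iter S.φ n x h) →⋆ₙₐ[ℂ] S.μ.Fibre x
  | 0, x, _ => NonUnitalStarAlgHom.id ℂ (S.μ.Fibre x)
  | n + 1, x, h => (S.fib ⟨x, h.fst⟩).comp (iterHom n (S.φ ⟨x, h.fst⟩) h.snd)

theorem ev_iterEnd : ∀ (n : ℕ) (x : X) (h : x ∈ dom S.φ n) (a : A),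
    S.iterHom n x h (S.μ.ev (iter S.φ n x h) a) = S.μ.ev x (S.iterEnd n a)
  | 0, _, _, _ => rfl
  | n + 1, x, h, a => by
    change S.fib ⟨x, h.fst⟩ (S.iterHom n (S.φ ⟨x, h.fst⟩) h.snd
      (S.μ.ev (iter S.φ n (S.φ ⟨x, h.fst⟩) h.snd) a)) = S.μ.ev x (S.α (S.iterEnd n a))
    rw [ev_iterEnd n _ h.snd a, S.induced_of_mem _ ⟨x, h.fst⟩]

/-- The algebra `A_n(x) = α_{(x,n)}(A(φ^n(x))) A(x) α_{(x,n)}(A(φ^n(x)))`. -/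
def fibA (n : ℕ) (x : X) (h : x ∈ dom S.φ n) : NonUnitalStarSubalgebra ℂ (S.μ.Fibre x) :=
  hereditary (S.iterHom n x h)

instance (n : ℕ) (x : X) (h : x ∈ dom S.φ n) : IsClosed (S.fibA n x h : Set (S.μ.Fibre x)) :=
  inferInstanceAs (IsClosed (hereditary (S.iterHom n x h) : Set (S.μ.Fibre x)))

theorem iterHom_succ_mem_range : ∀ (n : ℕ) (x : X) (h : x ∈ dom S.φ (n + 1))
    (d : S.μ.Fibre (iter S.φ (n + 1) x h)),
    ∃ d', S.iterHom n x (dom_antitone S.φ n.le_succ h) d' = S.iterHom (n + 1) x h d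
  | 0, x, h, d => ⟨S.fib ⟨x, h.fst⟩ d, rfl⟩
  | n + 1, x, h, d => by
    obtain ⟨d', hd'⟩ := iterHom_succ_mem_range n (S.φ ⟨x, h.fst⟩) h.snd d
    exact ⟨d', congrArg (S.fib ⟨x, h.fst⟩) hd'⟩

theorem fibA_succ_le (n : ℕ) (x : X) (h : x ∈ dom S.φ (n + 1)) :
    S.fibA (n + 1) x h ≤ S.fibA n x (dom_antitone S.φ n.le_succ h) := fun _ ha ↦
  map_mem_hereditary (S.iterHom (n + 1) x h) (S.iterHom n x _)
    (NonUnitalStarAlgHom.id ℂ (S.μ.Fibre x)) (S.iterHom_succ_mem_range n x h) ha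

theorem ev_mem_fibA {n : ℕ} {a : A} (ha : a ∈ S.subA n) (x : X) (h : x ∈ dom S.φ n) :
    S.μ.ev x a ∈ S.fibA n x h :=
  map_mem_hereditary (S.iterEnd n) (S.iterHom n x h) (S.μ.ev x)
    (fun d ↦ ⟨S.μ.ev _ d, S.ev_iterEnd n x h d⟩) ha

/-- The homomorphism `α_x : A(y) → A(x)`, where `φ(x) = y`. -/
def linkHom {x y : X} (h : ∃ hx : x ∈ S.Δ, S.φ ⟨x, hx⟩ = y) : S.μ.Fibre y →⋆ₙₐ[ℂ] S.μ.Fibre x :=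
  h.snd ▸ S.fib ⟨x, h.fst⟩

theorem linkHom_mem_fibA {x y : X} (h : ∃ hx : x ∈ S.Δ, S.φ ⟨x, hx⟩ = y) (n : ℕ)
    (hy : y ∈ dom S.φ n) (hx : x ∈ dom S.φ (n + 1)) {b : S.μ.Fibre y} (hb : b ∈ S.fibA n y hy) :
    S.linkHom h b ∈ S.fibA (n + 1) x hx := by
  obtain ⟨hx', rfl⟩ := h
  exact map_mem_hereditary (S.iterHom n _ hy) (S.iterHom (n + 1) x hx) (S.fib ⟨x, hx'⟩)
    (fun d ↦ ⟨d, rfl⟩) hb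

/-- The bonding homomorphism `α_{x_{n+1}} : A_n(x_n) → A_{n+1}(x_{n+1})` along a backward orbit. -/
def orbitBond {x : ℕ → X} (hx : IsBackwardOrbit S.φ x) (n : ℕ) :
    SubAlg (S.fibA n (x n) (hx.mem_dom n)) →⋆ₙₐ[ℂ]
      SubAlg (S.fibA (n + 1) (x (n + 1)) (hx.mem_dom (n + 1))) :=
  restrictHom (S.linkHom (hx n)) _ _ fun _ hb ↦ S.linkHom_mem_fibA (hx n) n _ _ hb

/-- The homomorphism `[a₀, a₁, a₂, ...] ↦ [a₁, a₂, ...]` from the direct limit of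
`A_0(x₀) → A_1(x₁) → A_2(x₂) → ⋯` to the direct limit of `A_0(x₁) → A_1(x₂) → A_2(x₃) → ⋯`. -/
def orbitShift {x : ℕ → X} (hx : IsBackwardOrbit S.φ x) :
    LimAlg (S.orbitBond hx) →⋆ₙₐ[ℂ] LimAlg (S.orbitBond hx.tail) :=
  limShift (S.orbitBond hx) (S.orbitBond hx.tail)
    (fun n ↦ inclHom (S.fibA_succ_le n (x (n + 1)) (hx.mem_dom (n + 1)))) fun n b ↦ by
      apply Subtype.ext
      unfold orbitBond
      rw [inclHom_val, restrictHom_val, restrictHom_val, inclHom_val]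

/-- The algebra `q_x(A_N(x)) ⊆ A(x)/J(x)`. -/
def quotFib (N : ℕ) (x : X) (h : x ∈ dom S.φ N) :
    NonUnitalStarSubalgebra ℂ (S.μ.fibreIdeal J x).Quot :=
  (S.fibA N x h).map (S.μ.fibreIdeal J x).proj

instance (N : ℕ) (x : X) (h : x ∈ dom S.φ N) :
    IsClosed (S.quotFib J N x h : Set (S.μ.fibreIdeal J x).Quot) :=
  isClosed_map (S.fibA N x h) (S.μ.fibreIdeal J x).proj

theorem proj_mem_quotFib {N : ℕ} {x : X} {h : x ∈ dom S.φ N} {a : S.μ.Fibre x}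
    (ha : a ∈ S.fibA N x h) : (S.μ.fibreIdeal J x).proj a ∈ S.quotFib J N x h :=
  ⟨a, ha, rfl⟩

theorem quotFib_succ_le (N : ℕ) (x : X) (h : x ∈ dom S.φ (N + 1)) :
    S.quotFib J (N + 1) x h ≤ S.quotFib J N x (dom_antitone S.φ N.le_succ h) :=
  NonUnitalStarSubalgebra.map_mono (S.fibA_succ_le N x h)

/-- The space of the reversible `Y`-extension of `(X, φ)`, where `Y` is the closure of
`σ_A(Prim(A/J))`. -/
abbrev Ext : Type v := ExtSpace S.φ (S.μ.hull J)

/-- The fibre `B(p)`: it is `q_x(A_N(x))` for `p = (x₀, ..., x_N, 0, ...)` with `x_N = x`, and the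
direct limit of `A_0(x₀) → A_1(x₁) → A_2(x₂) → ⋯` for `p = (x₀, x₁, x₂, ...)`. -/
def FibreB : S.Ext J → Type u
  | .fin N x h _ => SubAlg (S.quotFib J N x h)
  | .inf _ hx => LimAlg (S.orbitBond hx)

instance : ∀ p : S.Ext J, NonUnitalCStarAlgebra (S.FibreB J p)
  | .fin N x h _ => inferInstanceAs (NonUnitalCStarAlgebra (SubAlg (S.quotFib J N x h)))
  | .inf _ hx => inferInstanceAs (NonUnitalCStarAlgebra (LimAlg (S.orbitBond hx)))

/-- The section `π(φ_n(a))` for `a ∈ B_n`. -/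
def stageSection (n : ℕ) (a : S.stageB J n) : ∀ p : S.Ext J, S.FibreB J p
  | .fin N x hx _ =>
    if h : N < n then
      (⟨S.μ.quotEval J x (S.coord J n ⟨N, h⟩ a).1, by
        obtain ⟨b, hb, hb'⟩ := (S.coord J n ⟨N, h⟩ a).2
        rw [← hb']
        exact S.proj_mem_quotFib J (S.ev_mem_fibA hb x hx)⟩ : SubAlg (S.quotFib J N x hx))
    else
      (⟨(S.μ.fibreIdeal J x).proj
          (S.iterHom (N - n) x (dom_antitone S.φ (Nat.sub_le N n) hx) (S.μ.ev _ (S.last J n a).1)), by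
        rw [ev_iterEnd]
        have h' := S.iterEnd_mem_subA (S.last J n a).2 (N - n)
        rw [show n + (N - n) = N by omega] at h'
        exact S.proj_mem_quotFib J (S.ev_mem_fibA h' x hx)⟩ : SubAlg (S.quotFib J N x hx))
  | .inf x hx =>
    limOf (S.orbitBond hx) n ⟨S.μ.ev (x n) (S.last J n a).1,
      S.ev_mem_fibA (S.last J n a).2 (x n) (hx.mem_dom n)⟩

/-- The homomorphism `β_p : B(φ~(p)) → B(p)`: the inclusion `q_x(A_{N+1}(x)) ⊆ q_x(A_N(x))` for
`p = (x₀, ..., x_N, 0, ...)` with `x_N = x`, and `[a₀, a₁, a₂, ...] ↦ [a₁, a₂, ...]` for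
`p = (x₀, x₁, x₂, ...)`. -/
def fibreβ : ∀ (p : S.Ext J) (h : p.head ∈ S.Δ), S.FibreB J (p.shift h) →⋆ₙₐ[ℂ] S.FibreB J p
  | .fin N x hx _, h =>
    inclHom (S.quotFib_succ_le J N x (dom_succ S.φ N x hx h))
  | .inf _ hx, h => S.orbitShift (ExtSpace.isBackwardOrbit_consSeq hx h)

/-- The image `p_{(x,n)} = ᾱ_{(x,n)}(1)` of the unit in `M(A(x))`. -/
def unitImage (n : ℕ) (x : X) (h : x ∈ dom S.φ n) : 𝓜(ℂ, S.μ.Fibre x) :=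
  strictExtension (S.iterHom n x h) 1

/-- The linear map `T : B(p) → B(φ~(p))` is given by `q_x(a) ↦ q_x(p_{(x,N+1)} a p_{(x,N+1)})` for
`p = (x₀, ..., x_N, 0, ...)` with `x_N = x`, and by
`[a₀, a₁, ...] ↦ [0, p_{(x₀,1)} a₀ p_{(x₀,1)}, p_{(x₁,2)} a₁ p_{(x₁,2)}, ...]` for
`p = (x₀, x₁, x₂, ...)`. -/
def IsFibreTransfer : ∀ (p : S.Ext J) (h : p.head ∈ S.Δ),
    (S.FibreB J p →ₗ[ℂ] S.FibreB J (p.shift h)) → Prop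
  | .fin N x hx _, h, T =>
    ∀ (a : S.μ.Fibre x) (ha : a ∈ S.fibA N x hx),
      (show SubAlg (S.quotFib J (N + 1) x (dom_succ S.φ N x hx h)) from
          T (show SubAlg (S.quotFib J N x hx) from
            ⟨(S.μ.fibreIdeal J x).proj a, S.proj_mem_quotFib J ha⟩)).1 =
        (S.μ.fibreIdeal J x).proj (compress (S.unitImage (N + 1) x (dom_succ S.φ N x hx h)) a)
  | .inf x hx, h, T =>
    let y := ExtSpace.consSeq (S.φ ⟨x 0, h⟩) x
    let hy : IsBackwardOrbit S.φ y := ExtSpace.isBackwardOrbit_consSeq hx h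
    ∀ (a : lp (fun n ↦ SubAlg (S.fibA n (x n) (hx.mem_dom n))) ∞)
      (ha : seqClass (fun n ↦ SubAlg (S.fibA n (x n) (hx.mem_dom n))) a ∈ limAlg (S.orbitBond hx)),
      ∃ c : lp (fun n ↦ SubAlg (S.fibA n (y n) (hy.mem_dom n))) ∞,
        c 0 = 0 ∧
        (∀ n, (c (n + 1)).1 =
          compress (S.unitImage (n + 1) (x n) (hy.mem_dom (n + 1))) (a n).1) ∧
        (show LimAlg (S.orbitBond hy) from
            T (show LimAlg (S.orbitBond hx) from ⟨seqClass _ a, ha⟩)).1 =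
          seqClass (fun n ↦ SubAlg (S.fibA n (y n) (hy.mem_dom n))) c

end C0System

end Systems

end

end ReversibleExtension

open ReversibleExtension

open ReversibleExtension

namespace ReversibleExtension

universe u v w

/-! The theorem follows once the representation π of B by sections has the four properties collected
in `IsSectionAlgebra`: it is injective, its values exhaust every fibre, the sets on which a section
has norm at least ε > 0 are compact, and the sections form a module over the compactly supported
functions. Closedness of those sets is upper semicontinuity of the norms, so the tubes about the
sections generate the topology of an upper semicontinuous bundle. A partition of unity shows that
every continuous section vanishing at infinity is a uniform limit of sections from B, hence is one
of them. The topology is unique because in any such bundle the tubes about a continuous section give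
the neighbourhoods of its points.

Injectivity is where J ⊆ (ker α)^⊥ enters. It makes the bonding maps injective, so that it is enough
to treat a single B_n. An ideal is determined by its fibres, and a point x with A(x)/J(x) ≠ 0 lies
in Y because this quotient has a primitive ideal; therefore the coordinates in q(A_k) are detected
by the points of X_k. If the last coordinate l vanishes at all finite points, then every α^k(l) lies
in J, where α is isometric, so ‖α^k(l)‖ = ‖l‖. The sets {x : ‖α^k(l)(x)‖ ≥ ‖l‖/2} are compact,
nonempty when l ≠ 0, and φ maps each into the preceding one. Compactness yields a backward orbit
through them, that is, a point of X_∞ at which l does not vanish (`stageHom_injective`).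

Compactness of the level sets rests on the facts that the extension space is closed in the product
and that x̃ ↦ x₀ is proper. The module property follows from Stone–Weierstrass, since the functions
g(x₀)f(x_n) separate points and multiply B_m into itself for m ≥ n (`isSectionAlgebra`).

For the transfer operator, an approximate unit (e) of A is also one for B, and β(e) acts on the
coordinate with index k as α^{k+1}(e); hence extendibility passes from α to β. With p the image of
1, β maps the ideal of the sections that vanish outside the range of φ̃ injectively onto pBp. The
operator β_* is the compression by p followed by the inverse of this map. The formulas in the fibres
hold because all the multipliers p and p_{(x,n)} are strict limits of images of the same approximate
unit of A.

For continuity, both sets of hypotheses give J(x) = 0 for x ∈ Y and isometric α_x. Then the norm of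
π(φ_n(a)) is locally the norm of a single coordinate a_k(x_k), which is continuous. -/

noncomputable section

/-! ### Approximate units as filters, and limits of bounded families of additive maps -/

section ContractiveUnits

/-- A filter along which both multiplications tend to the identity and whose elements are
eventually contractions. -/
structure IsContractiveUnit {A : Type*} [NonUnitalCStarAlgebra A] (l : Filter A) : Prop where
  neBot : l.NeBot
  left : ∀ a, Tendsto (fun e ↦ e * a) l (𝓝 a)
  right : ∀ a, Tendsto (fun e ↦ a * e) l (𝓝 a)
  norm_le : ∀ᶠ e in l, ‖e‖ ≤ 1

variable {A : Type*} [NonUnitalCStarAlgebra A] {A' : Type*} [NonUnitalCStarAlgebra A']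

variable (A) in
theorem exists_isContractiveUnit : ∃ l : Filter A, IsContractiveUnit l := by
  let _ : PartialOrder A := CStarAlgebra.spectralOrder A
  have _ : StarOrderedRing A := CStarAlgebra.spectralOrderedRing A
  have h := CStarAlgebra.increasingApproximateUnit A
  exact ⟨_, h.neBot, fun a ↦ h.tendsto_mul_right a, fun a ↦ h.tendsto_mul_left a, h.eventually_norm⟩

theorem IsContractiveUnit.map_of_tendsto {l : Filter A} (hl : IsContractiveUnit l)
    (ψ : A →⋆ₙₐ[ℂ] A') (h1 : ∀ b, Tendsto (fun e ↦ ψ e * b) l (𝓝 b))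
    (h2 : ∀ b, Tendsto (fun e ↦ b * ψ e) l (𝓝 b)) : IsContractiveUnit (l.map ψ) where
  neBot := by have := hl.neBot; infer_instance
  left a := by rw [tendsto_map'_iff]; exact h1 a
  right a := by rw [tendsto_map'_iff]; exact h2 a
  norm_le := by
    rw [eventually_map]
    filter_upwards [hl.norm_le] with e he
    exact (NonUnitalStarAlgHom.norm_apply_le ψ e).trans he

theorem IsContractiveUnit.map {l : Filter A} (hl : IsContractiveUnit l)
    (ψ : A →⋆ₙₐ[ℂ] A') (hψ : Function.Surjective ψ) : IsContractiveUnit (l.map ψ) := by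
  refine hl.map_of_tendsto ψ (fun b ↦ ?_) fun b ↦ ?_ <;> obtain ⟨a, rfl⟩ := hψ b
  · simpa only [← map_mul, Function.comp_def] using ((continuous_hom ψ).tendsto a).comp (hl.left a)
  · simpa only [← map_mul, Function.comp_def] using ((continuous_hom ψ).tendsto a).comp (hl.right a)

/-- Convergence of a filter of uniformly bounded linear maps is a closed condition. -/
theorem isClosed_exists_tendsto {ι E F : Type*} [SeminormedAddCommGroup E]
    [NormedAddCommGroup F] [CompleteSpace F] {l : Filter ι} [l.NeBot] (T : ι → E →+ F) {C : ℝ}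
    (hT : ∀ᶠ i in l, ∀ a, ‖T i a‖ ≤ C * ‖a‖) :
    IsClosed {a | ∃ c, Tendsto (fun i ↦ T i a) l (𝓝 c)} := by
  have hC : 0 < |C| + 1 := by positivity
  replace hT : ∀ᶠ i in l, ∀ a, ‖T i a‖ ≤ (|C| + 1) * ‖a‖ := by
    filter_upwards [hT] with i hi a
    refine (hi a).trans ?_
    gcongr
    exact (le_abs_self C).trans (by linarith)
  refine isClosed_of_closure_subset fun a ha ↦ ?_
  -- Completeness replaces the unknown limit at `a` by the Cauchy property, which is inherited from
  -- the convergence at a nearby point `b`.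
  rw [Set.mem_ofPred_eq, ← cauchy_map_iff_exists_tendsto, Metric.cauchy_iff]
  refine ⟨inferInstance, fun ε hε ↦ ?_⟩
  obtain ⟨b, ⟨c, hc⟩, hb⟩ := Metric.mem_closure_iff.1 ha (ε / (4 * (|C| + 1))) (by positivity)
  have h1 := hc.eventually (Metric.ball_mem_nhds c (show 0 < ε / 4 by positivity))
  refine ⟨_, image_mem_map (h1.and hT), ?_⟩
  have key : ∀ i, T i b ∈ Metric.ball c (ε / 4) → (∀ a, ‖T i a‖ ≤ (|C| + 1) * ‖a‖) →
      dist (T i a) c < ε / 2 := by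
    intro i hi hTi
    have h3 : dist (T i a) (T i b) ≤ ε / 4 := by
      rw [dist_eq_norm, ← map_sub]
      refine (hTi _).trans ?_
      rw [← dist_eq_norm]
      calc (|C| + 1) * dist a b ≤ (|C| + 1) * (ε / (4 * (|C| + 1))) := by gcongr
        _ = ε / 4 := by field_simp
    have h4 := Metric.mem_ball.1 hi
    linarith [dist_triangle (T i a) (T i b) c]
  rintro _ ⟨i, ⟨hi, hTi⟩, rfl⟩ _ ⟨j, ⟨hj, hTj⟩, rfl⟩
  have := key i hi hTi
  have := key j hj hTj
  linarith [dist_triangle_right (T i a) (T j a) c]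

/-- Convergence of a filter of uniformly bounded additive maps to a given one is a closed
condition. -/
theorem isClosed_tendsto_addMonoidHom {ι E F : Type*} [SeminormedAddCommGroup E]
    [SeminormedAddCommGroup F] {l : Filter ι} (T : ι → E →+ F) (S : E →+ F) {C : ℝ}
    (hT : ∀ᶠ i in l, ∀ a, ‖T i a - S a‖ ≤ C * ‖a‖) :
    IsClosed {a | Tendsto (fun i ↦ T i a) l (𝓝 (S a))} := by
  refine isClosed_of_closure_subset fun a ha ↦ ?_
  change Tendsto (fun i ↦ T i a) l (𝓝 (S a))
  rw [Metric.tendsto_nhds]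
  intro ε hε
  have hC : C ≤ |C| + 1 := (le_abs_self C).trans (by linarith)
  obtain ⟨b, hb, hab⟩ := Metric.mem_closure_iff.1 ha (ε / (2 * (|C| + 1))) (by positivity)
  have h1 : ∀ᶠ i in l, dist (T i b) (S b) < ε / 2 := Metric.tendsto_nhds.1 hb _ (by positivity)
  filter_upwards [h1, hT] with i h1 h2
  have h4 : T i a - S a = (T i (a - b) - S (a - b)) + (T i b - S b) := by
    rw [map_sub, map_sub]; abel
  rw [dist_eq_norm] at *
  rw [h4]
  have h3 : ‖T i (a - b) - S (a - b)‖ ≤ ε / 2 := by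
    refine (h2 (a - b)).trans ?_
    calc C * ‖a - b‖ ≤ (|C| + 1) * (ε / (2 * (|C| + 1))) := by gcongr
      _ = ε / 2 := by field_simp
  refine (norm_add_le _ _).trans_lt ?_
  linarith

end ContractiveUnits

/-! ### Homomorphisms into products -/

section Families

/-- The coordinates of a homomorphism to a product. -/
def evalHom {ι : Type*} {F : ι → Type*} [∀ i, NonUnitalCStarAlgebra (F i)] {D : Type*}
    [NonUnitalCStarAlgebra D] (Φ : D →⋆ₙₐ[ℂ] ∀ i, F i) (i : ι) : D →⋆ₙₐ[ℂ] F i where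
  toFun d := Φ d i
  map_smul' c d := congrFun (map_smul Φ c d) i
  map_zero' := congrFun (map_zero Φ) i
  map_add' c d := congrFun (map_add Φ c d) i
  map_mul' c d := congrFun (map_mul Φ c d) i
  map_star' d := congrFun (map_star Φ d) i

/-- The homomorphism to a product with given coordinates. -/
def piHom {ι : Type*} {F : ι → Type*} [∀ i, NonUnitalCStarAlgebra (F i)] {D : Type*}
    [NonUnitalCStarAlgebra D] (φ : ∀ i, D →⋆ₙₐ[ℂ] F i) : D →⋆ₙₐ[ℂ] ∀ i, F i where
  toFun d i := φ i d
  map_smul' c d := funext fun i ↦ map_smul (φ i) c d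
  map_zero' := funext fun i ↦ map_zero (φ i)
  map_add' c d := funext fun i ↦ map_add (φ i) c d
  map_mul' c d := funext fun i ↦ map_mul (φ i) c d
  map_star' d := funext fun i ↦ map_star (φ i) d

theorem piHom_apply {ι : Type*} {F : ι → Type*} [∀ i, NonUnitalCStarAlgebra (F i)] {D : Type*}
    [NonUnitalCStarAlgebra D] (φ : ∀ i, D →⋆ₙₐ[ℂ] F i) (d : D) (i : ι) :
    piHom φ d i = φ i d := rfl

variable {ι : Type*} {F : ι → Type*} [∀ i, NonUnitalCStarAlgebra (F i)] {D : Type*}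
  [NonUnitalCStarAlgebra D] (Φ : D →⋆ₙₐ[ℂ] ∀ i, F i)

theorem norm_coord_le (d : D) (i : ι) : ‖Φ d i‖ ≤ ‖d‖ :=
  NonUnitalStarAlgHom.norm_apply_le (evalHom Φ i) d

/-- The coordinates of `d` are bounded by ‖d‖, so Φ factors through the C*-algebra ℓ^∞, and
injective homomorphisms of C*-algebras are isometric. -/
theorem norm_eq_iSup (hΦ : Function.Injective Φ) (d : D) : ‖d‖ = ⨆ i, ‖Φ d i‖ := by
  let Ψ : D →⋆ₙₐ[ℂ] lp F ∞ :=
    { toFun := fun d ↦ ⟨Φ d, memℓp_infty ⟨‖d‖, by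
        rintro _ ⟨i, rfl⟩
        exact norm_coord_le Φ d i⟩⟩
      map_smul' := fun c d ↦ Subtype.ext (map_smul Φ c d)
      map_zero' := Subtype.ext (map_zero Φ)
      map_add' := fun c d ↦ Subtype.ext (map_add Φ c d)
      map_mul' := fun c d ↦ Subtype.ext (map_mul Φ c d)
      map_star' := fun d ↦ Subtype.ext (map_star Φ d) }
  have hΨ : Function.Injective Ψ := fun a b h ↦ hΦ (congrArg Subtype.val h)
  rw [← NonUnitalStarAlgHom.norm_map Ψ hΨ d, lp.norm_eq_ciSup]
  rfl

theorem norm_le_of_forall_coord (hΦ : Function.Injective Φ) {d : D} {r : ℝ} (hr : 0 ≤ r)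
    (h : ∀ i, ‖Φ d i‖ ≤ r) : ‖d‖ ≤ r := by
  rw [norm_eq_iSup Φ hΦ]
  exact Real.iSup_le h hr

end Families

/-! ### Hereditary subalgebras generated by the range of a homomorphism -/

section Surjectivity

variable {A : Type*} [NonUnitalCStarAlgebra A] {A' : Type*} [NonUnitalCStarAlgebra A']
  {D : Type*} [NonUnitalCStarAlgebra D] {D' : Type*} [NonUnitalCStarAlgebra D']

theorem hereditary_le {f : D →⋆ₙₐ[ℂ] A} {K : Submodule ℂ A} (hK : IsClosed (K : Set A))
    (h : ∀ d a d', f d * a * f d' ∈ K) {a : A} (ha : a ∈ hereditary f) : a ∈ K := by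
  rw [mem_hereditary] at ha
  refine closure_minimal ?_ hK ha
  refine Submodule.span_le.2 ?_
  rintro _ ⟨d, a, d', rfl⟩
  exact h d a d'

theorem mul_mem_hereditary (f : D →⋆ₙₐ[ℂ] A) (d : D) (a : A) (d' : D) :
    f d * a * f d' ∈ hereditary f := by
  rw [mem_hereditary]
  exact subset_closure (Submodule.subset_span ⟨d, a, d', rfl⟩)

/-- The image of a C*-subalgebra under a homomorphism is closed, so it is enough to lift the
generating products. -/
theorem exists_mem_hereditary_of_surjective {f : D →⋆ₙₐ[ℂ] A} {f' : D' →⋆ₙₐ[ℂ] A'}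
    {ψ : A →⋆ₙₐ[ℂ] A'} (hψ : Function.Surjective ψ) (h : ∀ d', ∃ d, f' d' = ψ (f d))
    {b : A'} (hb : b ∈ hereditary f') : ∃ a ∈ hereditary f, ψ a = b := by
  have hc : IsClosed ((hereditary f).map ψ : Set A') := isClosed_map (hereditary f) ψ
  suffices b ∈ ((hereditary f).map ψ).toSubmodule from this
  refine hereditary_le (f := f') hc ?_ hb
  intro d a d'
  obtain ⟨e, he⟩ := h d
  obtain ⟨e', he'⟩ := h d'
  obtain ⟨c, rfl⟩ := hψ a
  exact ⟨f e * c * f e', mul_mem_hereditary f e c e', by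
    rw [he, he', ← map_mul, ← map_mul]; rfl⟩

/-- Left and right multiplication by approximate units of the range of `f`. -/
theorem tendsto_mul_of_mem_hereditary {l : Filter D} (hl : IsContractiveUnit l)
    (f : D →⋆ₙₐ[ℂ] A) {a : A} (ha : a ∈ hereditary f) :
    Tendsto (fun e ↦ f e * a) l (𝓝 a) := by
  have := hl.neBot
  let T : D → A →+ A := fun e ↦ AddMonoidHom.mulLeft (f e)
  have hT : ∀ᶠ e in l, ∀ a, ‖T e a - a‖ ≤ 2 * ‖a‖ := by
    filter_upwards [hl.norm_le] with e he a
    refine (norm_sub_le _ _).trans ?_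
    have : ‖f e * a‖ ≤ 1 * ‖a‖ := (norm_mul_le _ _).trans (by
      gcongr
      exact (NonUnitalStarAlgHom.norm_apply_le f e).trans he)
    change ‖f e * a‖ + ‖a‖ ≤ _
    linarith
  let K : Submodule ℂ A :=
    { carrier := {a | Tendsto (fun e ↦ f e * a) l (𝓝 a)}
      add_mem' := fun {a b} ha hb ↦ by
        simp only [Set.mem_ofPred_eq, mul_add] at *
        exact ha.add hb
      zero_mem' := by simp
      smul_mem' := fun c a ha ↦ by
        simp only [Set.mem_ofPred_eq, mul_smul_comm] at *
        exact ha.const_smul c }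
  have hK : IsClosed (K : Set A) := isClosed_tendsto_addMonoidHom T (AddMonoidHom.id A) hT
  refine hereditary_le (K := K) hK (fun d a d' ↦ ?_) ha
  change Tendsto (fun e ↦ f e * (f d * a * f d')) l (𝓝 (f d * a * f d'))
  have := ((continuous_hom f).tendsto d).comp (hl.left d)
  have h2 := (this.mul_const (a * f d'))
  simpa only [Function.comp_def, map_mul, mul_assoc] using h2

/-- The range of `f` is contained in the hereditary subalgebra that it generates. -/
theorem apply_mem_hereditary (f : D →⋆ₙₐ[ℂ] A) (d : D) : f d ∈ hereditary f := by
  obtain ⟨l, hl⟩ := exists_isContractiveUnit D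
  have := hl.neBot
  have hd : d ∈ hereditary (NonUnitalStarAlgHom.id ℂ D) := by
    have h : IsClosed (hereditary (NonUnitalStarAlgHom.id ℂ D) : Set D) := inferInstance
    refine h.mem_of_tendsto (hl.left d) (Eventually.of_forall fun e ↦ ?_)
    refine h.mem_of_tendsto (hl.right (e * d)) (Eventually.of_forall fun e' ↦ ?_)
    exact mul_mem_hereditary (NonUnitalStarAlgHom.id ℂ D) e d e'
  exact map_mem_hereditary (NonUnitalStarAlgHom.id ℂ D) f f (fun d ↦ ⟨d, rfl⟩) hd

end Surjectivity

/-! ### Norms and the universal property of direct limits -/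

section Limits

variable {E : ℕ → Type u} [∀ n, NonUnitalCStarAlgebra (E n)]
  (f : ∀ n, E n →⋆ₙₐ[ℂ] E (n + 1))

/-- The norm of ℓ^∞/c₀ is the limit superior of the norms of the entries; this and
`norm_seqClass_le` are the two inequalities. Here a lift of nearly minimal norm differs from `a` by
a null sequence. -/
theorem eventually_norm_lt_of_norm_seqClass_lt {a : lp E ∞} {ε : ℝ} (h : ‖seqClass E a‖ < ε) :
    ∀ᶠ n in atTop, ‖a n‖ < ε := by
  obtain ⟨δ, hδ, h'⟩ : ∃ δ > 0, ‖seqClass E a‖ + δ + δ < ε :=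
    ⟨(ε - ‖seqClass E a‖) / 3, by linarith, by linarith⟩
  obtain ⟨b, hb, hbn⟩ := ClosedIdeal.Quot.exists_lift (nullIdeal E) (seqClass E a) hδ
  have hab : a - b ∈ nullIdeal E := (ClosedIdeal.Quot.mkₗ_eq_iff _).1 hb.symm
  have hab' : Tendsto (fun n ↦ ‖(a - b) n‖) atTop (𝓝 0) := hab
  filter_upwards [hab'.eventually (gt_mem_nhds hδ)] with n hn
  have h1 : ‖b n‖ ≤ ‖b‖ := lp.norm_apply_le_norm ENNReal.top_ne_zero b n
  have h2 : a n = (a - b) n + b n := by simp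
  rw [h2]
  refine (norm_add_le _ _).trans_lt ?_
  linarith

theorem norm_seqClass_le {a : lp E ∞} {r : ℝ} (hr : 0 ≤ r) (h : ∀ᶠ n in atTop, ‖a n‖ ≤ r) :
    ‖seqClass E a‖ ≤ r := by
  obtain ⟨N, hN⟩ := eventually_atTop.1 h
  let b : lp E ∞ := ⟨fun n ↦ if N ≤ n then a n else 0, memℓp_infty ⟨r, by
    rintro _ ⟨n, rfl⟩
    dsimp only
    split_ifs with h
    · exact hN n h
    · simpa using hr⟩⟩
  have hb : seqClass E a = seqClass E b := by
    refine (nullIdeal E).proj_eq_iff.2 ?_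
    refine tendsto_atTop_of_eventually_const (i₀ := N) fun n hn ↦ ?_
    change ‖a n - (if N ≤ n then a n else 0)‖ = 0
    rw [if_pos hn, sub_self, norm_zero]
  rw [hb]
  refine (NonUnitalStarAlgHom.norm_apply_le (seqClass E) b).trans ?_
  refine lp.norm_le_of_forall_le hr fun n ↦ ?_
  change ‖(if N ≤ n then a n else 0)‖ ≤ r
  split_ifs with h
  · exact hN n h
  · simpa using hr

theorem limOf_succ (n : ℕ) (b : E n) : limOf f (n + 1) (f n b) = limOf f n b :=
  Subtype.ext (threadClass_succ f n b)

theorem range_limOf_mono :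
    Monotone fun n ↦ NonUnitalStarAlgHom.range (threadClass f n) := by
  refine monotone_nat_of_le_succ fun n ↦ ?_
  rintro _ ⟨b, rfl⟩
  exact ⟨f n b, threadClass_succ f n b⟩

theorem LimAlg.induction {P : LimAlg f → Prop} (hP : IsClosed {x | P x})
    (h : ∀ n b, P (limOf f n b)) (x : LimAlg f) : P x := by
  obtain ⟨x, hx⟩ := x
  have hdense : x ∈ closure (⋃ n, Set.range (threadClass f n)) := by
    have h1 := NonUnitalStarSubalgebra.coe_iSup_of_directed (range_limOf_mono f).directed_le
    change x ∈ closure ((⨆ n, NonUnitalStarAlgHom.range (threadClass f n) :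
      NonUnitalStarSubalgebra ℂ (SeqAlg E)) : Set (SeqAlg E)) at hx
    rw [h1] at hx
    simpa using hx
  have hP' : {x : LimAlg f | P x} = closure {x | P x} := hP.closure_eq.symm
  change (⟨x, hx⟩ : LimAlg f) ∈ {x | P x}
  rw [hP']
  refine Metric.mem_closure_iff.2 fun ε hε ↦ ?_
  obtain ⟨y, hy, hxy⟩ := Metric.mem_closure_iff.1 hdense ε hε
  obtain ⟨n, hn⟩ := Set.mem_iUnion.1 hy
  obtain ⟨b, rfl⟩ := hn
  exact ⟨limOf f n b, h n b, hxy⟩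

theorem thread_norm_of_injective (hf : ∀ n, Function.Injective (f n)) {n m : ℕ} (h : n ≤ m)
    (b : E n) : ‖thread f n m b‖ = ‖b‖ := by
  induction m, h using Nat.le_induction with
  | base => rw [thread_self]; rfl
  | succ m h ih =>
    rw [thread_succ f h, NonUnitalStarAlgHom.comp_apply, NonUnitalStarAlgHom.norm_map _ (hf m), ih]

/-- Injective bonding maps keep the norm constant along a thread, so that a nonzero thread is not a
null sequence. The map into the limit is thus injective and hence isometric. -/
theorem norm_limOf_of_injective (hf : ∀ n, Function.Injective (f n)) (n : ℕ) (b : E n) :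
    ‖limOf f n b‖ = ‖b‖ := by
  refine NonUnitalStarAlgHom.norm_map _ ?_ b
  rw [injective_iff_map_eq_zero]
  intro b hb
  by_contra hb'
  have h1 : ‖seqClass E (threadSeq f n b)‖ < ‖b‖ := by
    have : seqClass E (threadSeq f n b) = 0 := congrArg Subtype.val hb
    rw [this, norm_zero]
    exact norm_pos_iff.2 hb'
  obtain ⟨m, hm, hm'⟩ :=
    ((eventually_norm_lt_of_norm_seqClass_lt h1).and (eventually_ge_atTop n)).exists
  change ‖thread f n m b‖ < ‖b‖ at hm
  rw [thread_norm_of_injective f hf hm'] at hm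
  exact lt_irrefl _ hm

/-- Identifies the limit of a constant sequence with F, which turns `limShift`, a map between direct
limits, into a map to a given algebra. -/
theorem limOf_id_bijective (F : Type u) [NonUnitalCStarAlgebra F] :
    Function.Bijective (limOf (E := fun _ ↦ F) (fun _ ↦ NonUnitalStarAlgHom.id ℂ F) 0) := by
  constructor
  · rw [injective_iff_map_eq_zero]
    intro b hb
    have := norm_limOf_of_injective (E := fun _ ↦ F) (fun _ ↦ NonUnitalStarAlgHom.id ℂ F)
      (fun _ _ _ h ↦ h) 0 b
    rwa [hb, norm_zero, eq_comm, norm_eq_zero] at this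
  · refine LimAlg.induction _ (ClosedIdeal.isClosed_range _) fun n b ↦ ?_
    induction n with
    | zero => exact ⟨b, rfl⟩
    | succ n ih =>
      obtain ⟨c, hc⟩ := ih
      have h := limOf_succ (E := fun _ ↦ F) (fun _ ↦ NonUnitalStarAlgHom.id ℂ F) n b
      exact ⟨c, hc.trans h.symm⟩

variable {f} in
/-- The universal property of the direct limit. -/
def limLift {F : Type u} [NonUnitalCStarAlgebra F] (g : ∀ n, E n →⋆ₙₐ[ℂ] F)
    (hg : ∀ n b, g (n + 1) (f n b) = g n b) : LimAlg f →⋆ₙₐ[ℂ] F :=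
  ((StarAlgEquiv.ofBijective _ (limOf_id_bijective F)).symm : _ →⋆ₙₐ[ℂ] F).comp
    -- `limShift` lowers the index by one; this is harmless since `g (n + 1)` composed with `f n` is
    -- `g n`.
    (limShift f (E' := fun _ ↦ F) (fun _ ↦ NonUnitalStarAlgHom.id ℂ F) (fun n ↦ g (n + 1))
      fun n b ↦ hg (n + 1) b)

theorem limOf_id (F : Type u) [NonUnitalCStarAlgebra F] (n : ℕ) (b : F) :
    limOf (E := fun _ ↦ F) (fun _ ↦ NonUnitalStarAlgHom.id ℂ F) n b =
      limOf (E := fun _ ↦ F) (fun _ ↦ NonUnitalStarAlgHom.id ℂ F) 0 b := by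
  induction n with
  | zero => rfl
  | succ n ih => exact (limOf_succ (E := fun _ ↦ F) (fun _ ↦ NonUnitalStarAlgHom.id ℂ F) n b).trans ih

theorem limLift_limOf {F : Type u} [NonUnitalCStarAlgebra F] (g : ∀ n, E n →⋆ₙₐ[ℂ] F)
    (hg : ∀ n b, g (n + 1) (f n b) = g n b) (n : ℕ) (b : E n) :
    limLift g hg (limOf f n b) = g n b := by
  rw [← limOf_succ]
  have h := limShift_limOf f (E' := fun _ ↦ F) (fun _ ↦ NonUnitalStarAlgHom.id ℂ F)
    (fun n ↦ g (n + 1)) (fun n b ↦ hg (n + 1) b) n (f n b)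
  refine (congrArg (StarAlgEquiv.ofBijective _ (limOf_id_bijective F)).symm h).trans ?_
  rw [limOf_id, hg]
  exact (StarAlgEquiv.ofBijective _ (limOf_id_bijective F)).symm_apply_apply (g n b)

end Limits

/-! ### States, extreme states and irreducibility of the GNS representation -/

section States

open scoped ComplexOrder InnerProductSpace ComplexStarModule

variable (U : Type*) [CStarAlgebra U]

/-- The states of a unital C*-algebra, as functions. -/
def stateSet : Set (U → ℂ) :=
  {φ | (∀ a b, φ (a + b) = φ a + φ b) ∧ (∀ (c : ℂ) a, φ (c • a) = c * φ a) ∧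
    (∀ a, 0 ≤ φ (star a * a)) ∧ φ 1 = 1}

variable {U}

theorem convex_stateSet : Convex ℝ (stateSet U) := by
  rintro φ ⟨h1, h2, h3, h4⟩ ψ ⟨k1, k2, k3, k4⟩ s t hs ht hst
  refine ⟨fun a b ↦ ?_, fun c a ↦ ?_, fun a ↦ ?_, ?_⟩
  · simp only [Pi.add_apply, Pi.smul_apply, h1, k1, smul_add]
    ring
  · simp only [Pi.add_apply, Pi.smul_apply, h2, k2, Complex.real_smul]
    ring
  · exact add_nonneg (smul_nonneg hs (h3 a)) (smul_nonneg ht (k3 a))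
  · simp only [Pi.add_apply, Pi.smul_apply, h4, k4, Complex.real_smul, mul_one]
    exact_mod_cast hst

theorem isClosed_stateSet : IsClosed (stateSet U) := by
  have h : stateSet U = (⋂ a, ⋂ b, {φ | φ (a + b) = φ a + φ b}) ∩
      ((⋂ c : ℂ, ⋂ a, {φ | φ (c • a) = c * φ a}) ∩
        ((⋂ a, {φ | 0 ≤ φ (star a * a)}) ∩ {φ | φ 1 = 1})) := by
    ext φ
    simp [stateSet]
  rw [h]
  refine IsClosed.inter ?_ (IsClosed.inter ?_ (IsClosed.inter ?_ ?_))
  · exact isClosed_iInter fun a ↦ isClosed_iInter fun b ↦ isClosed_eq (by fun_prop) (by fun_prop)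
  · exact isClosed_iInter fun a ↦ isClosed_iInter fun b ↦ isClosed_eq (by fun_prop) (by fun_prop)
  · exact isClosed_iInter fun a ↦ isClosed_le (by fun_prop) (by fun_prop)
  · exact isClosed_eq (by fun_prop) (by fun_prop)

variable [PartialOrder U] [StarOrderedRing U]

/-- A state as a positive linear map. -/
def stateMap {φ : U → ℂ} (hφ : φ ∈ stateSet U) : U →ₚ[ℂ] ℂ :=
  PositiveLinearMap.mk₀ { toFun := φ, map_add' := hφ.1, map_smul' := hφ.2.1 } fun a ha ↦ by
    obtain ⟨b, rfl⟩ := CStarAlgebra.nonneg_iff_eq_star_mul_self.1 ha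
    exact hφ.2.2.1 b

theorem stateMap_apply {φ : U → ℂ} (hφ : φ ∈ stateSet U) (a : U) : stateMap hφ a = φ a := rfl

/-- Cauchy–Schwarz in the pre-GNS space, applied to the vectors of 1 and of `a`. The bound places
the states in a product of discs, so that Tychonoff's theorem gives their compactness. -/
theorem norm_state_le {φ : U → ℂ} (hφ : φ ∈ stateSet U) (a : U) : ‖φ a‖ ≤ ‖a‖ := by
  let f := stateMap hφ
  have h1 : ‖f.toPreGNS 1‖ ≤ 1 := by
    rw [PositiveLinearMap.preGNS_norm_def]
    simp [f, stateMap_apply, hφ.2.2.2]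
  have h2 : ‖f.toPreGNS a‖ ≤ ‖a‖ := by
    have := (f.leftMulMapPreGNS a).le_of_opNorm_le (LinearMap.mkContinuous_norm_le _ (norm_nonneg a) _) (f.toPreGNS 1)
    simp only [PositiveLinearMap.leftMulMapPreGNS_apply] at this
    simp at this
    refine this.trans ?_
    exact mul_le_of_le_one_right (norm_nonneg a) h1
  have h3 := norm_inner_le_norm (𝕜 := ℂ) (f.toPreGNS 1) (f.toPreGNS a)
  rw [PositiveLinearMap.preGNS_inner_def] at h3
  simp [f, stateMap_apply] at h3
  calc _ ≤ _ := h3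
    _ ≤ 1 * ‖a‖ := by gcongr
    _ = _ := one_mul _

theorem isCompact_stateSet : IsCompact (stateSet U) := by
  refine (isCompact_univ_pi fun a : U ↦ isCompact_closedBall (0 : ℂ) ‖a‖).of_isClosed_subset
    isClosed_stateSet fun φ hφ a _ ↦ ?_
  rw [mem_closedBall_zero_iff]
  exact norm_state_le hφ a

/-- Hahn–Banach separates -h from the closed cone of positive elements. The separating functional is
nonpositive on the cone and negative at h, hence negative at 1, and dividing by its value at 1 makes
it a state. -/
theorem exists_state_ne_zero {h : U} (h0 : 0 ≤ h) (hne : h ≠ 0) : ∃ φ ∈ stateSet U, φ h ≠ 0 := by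
  have hcl : IsClosed {a : U | 0 ≤ a} := CStarAlgebra.isClosed_nonneg
  have hconv : Convex ℝ {a : U | 0 ≤ a} := fun a ha b hb s t hs ht _ ↦
    add_nonneg (smul_nonneg hs ha) (smul_nonneg ht hb)
  have hh : -h ∉ {a : U | 0 ≤ a} := fun hh ↦ hne (le_antisymm (neg_nonneg.1 hh) h0)
  obtain ⟨g, r, hg, hr⟩ := geometric_hahn_banach_closed_point hconv hcl hh
  have hr0 : 0 < r := by simpa using hg 0 le_rfl
  have hneg : ∀ a : U, 0 ≤ a → g a ≤ 0 := by
    intro a ha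
    by_contra! hlt
    have := hg ((r / g a) • a) (smul_nonneg (by positivity) ha)
    rw [map_smul, smul_eq_mul, div_mul_cancel₀ _ hlt.ne'] at this
    exact lt_irrefl _ this
  have hgh : g h < 0 := by
    rw [map_neg] at hr
    linarith
  -- From h ≤ ‖h‖·1 one gets ‖h‖ g(1) ≤ g(h) < 0.
  have hg1 : g 1 < 0 := by
    have h1 : h ≤ algebraMap ℝ U ‖h‖ := (IsSelfAdjoint.of_nonneg h0).le_algebraMap_norm_self
    have h2 := hneg _ (sub_nonneg.2 h1)
    rw [map_sub, Algebra.algebraMap_eq_smul_one, map_smul, smul_eq_mul] at h2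
    have h3 := norm_nonneg h
    by_contra! h4
    nlinarith
  have hsa : ∀ a : U, IsSelfAdjoint a → ((ℜ a : U) = a ∧ (ℑ a : U) = 0) := fun a ha ↦
    ⟨ha.coe_realPart, by rw [ha.imaginaryPart]; rfl⟩
  -- The real functional g/g(1) on self-adjoint elements is extended complex linearly by means of
  -- real and imaginary parts.
  refine ⟨fun a ↦ ((g (ℜ a) / g 1 : ℝ) : ℂ) + Complex.I * ((g (ℑ a) / g 1 : ℝ) : ℂ),
    ⟨fun a b ↦ ?_, fun c a ↦ ?_, fun a ↦ ?_, ?_⟩, ?_⟩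
  · simp only [map_add, AddSubgroup.coe_add, add_div]
    push_cast
    ring
  · beta_reduce
    rw [realPart_smul, imaginaryPart_smul]
    simp only [AddSubgroup.coe_add, AddSubgroup.coe_sub, selfAdjoint.val_smul, map_add, map_sub,
      map_smul, smul_eq_mul]
    rw [← Complex.re_add_im c]
    apply Complex.ext <;> simp <;> ring
  · obtain ⟨h1, h2⟩ := hsa _ (IsSelfAdjoint.star_mul_self a)
    beta_reduce
    rw [h1, h2]
    simp only [map_zero, zero_div, Complex.ofReal_zero, mul_zero, add_zero]
    exact_mod_cast div_nonneg_of_nonpos (hneg _ (star_mul_self_nonneg a)) hg1.le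
  · obtain ⟨h1, h2⟩ := hsa 1 (IsSelfAdjoint.one U)
    beta_reduce
    rw [h1, h2, div_self hg1.ne]
    simp
  · obtain ⟨h1, h2⟩ := hsa h (IsSelfAdjoint.of_nonneg h0)
    beta_reduce
    rw [h1, h2]
    simp [hgh.ne, hg1.ne]

/-- By Krein–Milman, if all extreme states vanished at h, then so would every state. -/
theorem exists_extreme_state_ne_zero {h : U} (h0 : 0 ≤ h) (hne : h ≠ 0) :
    ∃ φ ∈ (stateSet U).extremePoints ℝ, φ h ≠ 0 := by
  by_contra! hall
  obtain ⟨φ, hφ, hφh⟩ := exists_state_ne_zero h0 hne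
  have hsub : closure (convexHull ℝ ((stateSet U).extremePoints ℝ)) ⊆ {φ | φ h = 0} := by
    refine closure_minimal (convexHull_min hall ?_) (isClosed_eq (continuous_apply h) continuous_const)
    intro φ hφ ψ hψ s t _ _ _
    simp only [Set.mem_ofPred_eq, Pi.add_apply, Pi.smul_apply] at *
    simp [hφ, hψ]
  rw [closure_convexHull_extremePoints isCompact_stateSet convex_stateSet] at hsub
  exact hφh (hsub hφ)

section Irreducible

variable {φ : U → ℂ} (hφ : φ ∈ stateSet U)

/-- The cyclic vector of the representation associated with a state. -/
def cyclicVector : (stateMap hφ).GNS := ((stateMap hφ).toPreGNS 1 : (stateMap hφ).PreGNS)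

theorem gns_cyclicVector (a : U) : (stateMap hφ).gnsStarAlgHom a (cyclicVector hφ) =
    ((stateMap hφ).toPreGNS a : (stateMap hφ).PreGNS) := by
  simp [cyclicVector]

theorem inner_cyclicVector (a : U) :
    ⟪cyclicVector hφ, (stateMap hφ).gnsStarAlgHom a (cyclicVector hφ)⟫_ℂ = φ a := by
  rw [gns_cyclicVector, cyclicVector, UniformSpace.Completion.inner_coe,
    PositiveLinearMap.preGNS_inner_def]
  simp [stateMap_apply]

theorem eq_top_of_cyclicVector_mem {K : Submodule ℂ (stateMap hφ).GNS}
    (hK : IsClosed (K : Set (stateMap hφ).GNS))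
    (h : ∀ a, (stateMap hφ).gnsStarAlgHom a (cyclicVector hφ) ∈ K) : K = ⊤ := by
  refine eq_top_iff.2 fun v _ ↦ ?_
  clear * - hK h
  induction v using UniformSpace.Completion.induction_on with
  | hp => exact hK
  | ih a =>
    have := h ((stateMap hφ).ofPreGNS a)
    rwa [gns_cyclicVector] at this

theorem inner_self_eq_ofReal {H : Type*} [NormedAddCommGroup H] [InnerProductSpace ℂ H] (v : H) :
    ⟪v, v⟫_ℂ = ((‖v‖ ^ 2 : ℝ) : ℂ) := by
  rw [inner_self_eq_norm_sq_to_K]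
  norm_cast

theorem vector_state_mem {H : Type*} [NormedAddCommGroup H] [InnerProductSpace ℂ H]
    [CompleteSpace H] (π : U →⋆ₐ[ℂ] (H →L[ℂ] H)) {v : H} (hv : v ≠ 0) :
    (fun a ↦ ((‖v‖ ^ 2 : ℝ) : ℂ)⁻¹ * ⟪v, π a v⟫_ℂ) ∈ stateSet U := by
  refine ⟨fun a b ↦ ?_, fun c a ↦ ?_, fun a ↦ ?_, ?_⟩
  · simp [mul_add]
  · simp
    ring
  · have : ⟪v, π (star a * a) v⟫_ℂ = ((‖π a v‖ ^ 2 : ℝ) : ℂ) := by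
      rw [map_mul, map_star, mul_apply_eq_comp, ContinuousLinearMap.star_eq_adjoint,
        ContinuousLinearMap.adjoint_inner_right, inner_self_eq_ofReal]
    beta_reduce
    rw [this, ← Complex.ofReal_inv, ← Complex.ofReal_mul]
    exact_mod_cast (by positivity)
  · beta_reduce
    rw [map_one, one_apply_eq_self, inner_self_eq_ofReal]
    have : 0 < ‖v‖ := norm_pos_iff.2 hv
    exact inv_mul_cancel₀ (by exact_mod_cast (by positivity))

/-- Split the cyclic vector as ξ = ξ₁ + ξ₂ along K and its orthogonal complement. If one part is
zero, cyclicity makes K trivial. Otherwise the state is a proper convex combination of the vector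
states of ξ₁ and ξ₂. Extremality then makes ξ₁ a multiple of ξ, and pairing with ξ₂ gives ‖ξ₁‖²‖ξ₂‖²
= 0. -/
theorem gns_irreducible (hext : φ ∈ (stateSet U).extremePoints ℝ)
    (K : Submodule ℂ (stateMap hφ).GNS) (hK : IsClosed (K : Set (stateMap hφ).GNS))
    (hinv : ∀ a, ∀ v ∈ K, (stateMap hφ).gnsStarAlgHom a v ∈ K) : K = ⊥ ∨ K = ⊤ := by
  have _ : CompleteSpace K := hK.completeSpace_coe
  let π := (stateMap hφ).gnsStarAlgHom
  let ξ := cyclicVector hφ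
  have hinner : ∀ a v w, ⟪v, π a w⟫_ℂ = ⟪π (star a) v, w⟫_ℂ := by
    intro a v w
    rw [map_star, ContinuousLinearMap.star_eq_adjoint, ContinuousLinearMap.adjoint_inner_left]
  have hinv' : ∀ a, ∀ v ∈ Kᗮ, π a v ∈ Kᗮ := by
    intro a v hv k hk
    rw [hinner]
    exact hv _ (hinv _ k hk)
  obtain ⟨ξ₁, h₁, ξ₂, h₂, hξ⟩ := K.exists_add_mem_mem_orthogonal ξ
  have h12 : ∀ a, ⟪ξ₁, π a ξ₂⟫_ℂ = 0 := fun a ↦ hinv' a _ h₂ _ h₁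
  have h21 : ∀ a, ⟪ξ₂, π a ξ₁⟫_ℂ = 0 := fun a ↦ by
    rw [hinner, inner_eq_zero_symm]
    exact hinv' _ _ h₂ _ h₁
  by_cases z1 : ξ₁ = 0
  · left
    have : Kᗮ = ⊤ := eq_top_of_cyclicVector_mem hφ K.isClosed_orthogonal fun a ↦ hinv' a _ (by
      change ξ ∈ Kᗮ
      rw [hξ, z1, zero_add]
      exact h₂)
    rwa [Submodule.orthogonal_eq_top_iff] at this
  by_cases z2 : ξ₂ = 0
  · right
    exact eq_top_of_cyclicVector_mem hφ hK fun a ↦ hinv a _ (by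
      change ξ ∈ K
      rw [hξ, z2, add_zero]
      exact h₁)
  exfalso
  have hsum : ∀ a, φ a = ⟪ξ₁, π a ξ₁⟫_ℂ + ⟪ξ₂, π a ξ₂⟫_ℂ := by
    intro a
    rw [← inner_cyclicVector hφ a]
    change ⟪ξ, π a ξ⟫_ℂ = _
    rw [hξ, map_add, inner_add_left, inner_add_right, inner_add_right, h12, h21, add_zero, zero_add]
  have n1 : 0 < ‖ξ₁‖ ^ 2 := by positivity
  have n2 : 0 < ‖ξ₂‖ ^ 2 := by positivity
  have hnorm : ‖ξ₁‖ ^ 2 + ‖ξ₂‖ ^ 2 = 1 := by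
    have := hsum 1
    rw [hφ.2.2.2, map_one, one_apply_eq_self, one_apply_eq_self,
      inner_self_eq_ofReal, inner_self_eq_ofReal] at this
    exact_mod_cast this.symm
  have hmem : φ ∈ openSegment ℝ (fun a ↦ ((‖ξ₁‖ ^ 2 : ℝ) : ℂ)⁻¹ * ⟪ξ₁, π a ξ₁⟫_ℂ)
      (fun a ↦ ((‖ξ₂‖ ^ 2 : ℝ) : ℂ)⁻¹ * ⟪ξ₂, π a ξ₂⟫_ℂ) := by
    refine ⟨‖ξ₁‖ ^ 2, ‖ξ₂‖ ^ 2, n1, n2, hnorm, ?_⟩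
    funext a
    have e1 : ((‖ξ₁‖ ^ 2 : ℝ) : ℂ) ≠ 0 := by exact_mod_cast n1.ne'
    have e2 : ((‖ξ₂‖ ^ 2 : ℝ) : ℂ) ≠ 0 := by exact_mod_cast n2.ne'
    simp only [Pi.add_apply, Pi.smul_apply, Complex.real_smul]
    rw [mul_inv_cancel_left₀ e1, mul_inv_cancel_left₀ e2, hsum]
  have heq := (mem_extremePoints_iff_left.1 hext).2 _ (vector_state_mem π z1) _
    (vector_state_mem π z2) hmem
  -- Extremality gives ⟨ξ₁, π(a)ξ₁⟩ = ‖ξ₁‖²⟨ξ, π(a)ξ⟩, and the left-hand side equals ⟨ξ, π(a)ξ₁⟩ by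
  -- orthogonality.
  have hzero : ∀ a, ⟪π a ξ, ξ₁ - ((‖ξ₁‖ ^ 2 : ℝ) : ℂ) • ξ⟫_ℂ = 0 := by
    intro a
    have e1 : ((‖ξ₁‖ ^ 2 : ℝ) : ℂ) ≠ 0 := by exact_mod_cast n1.ne'
    have h := congrFun heq (star a)
    beta_reduce at h
    have h3 : ⟪ξ, π (star a) ξ₁⟫_ℂ = ⟪ξ₁, π (star a) ξ₁⟫_ℂ := by
      rw [hξ, inner_add_left, h21, add_zero]
    have h4 : ⟪ξ, π (star a) ξ⟫_ℂ = φ (star a) := inner_cyclicVector hφ _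
    rw [← h4, ← h3, inv_mul_eq_iff_eq_mul₀ e1] at h
    rw [hinner, hinner, star_star] at h
    rw [inner_sub_right, inner_smul_right, h, sub_self]
  have hz : ξ₁ - ((‖ξ₁‖ ^ 2 : ℝ) : ℂ) • ξ = 0 := by
    have htop : (ℂ ∙ (ξ₁ - ((‖ξ₁‖ ^ 2 : ℝ) : ℂ) • ξ))ᗮ = ⊤ :=
      eq_top_of_cyclicVector_mem hφ (Submodule.isClosed_orthogonal _) fun a ↦ by
        rw [Submodule.mem_orthogonal_singleton_iff_inner_left]
        exact hzero a
    have : ξ₁ - ((‖ξ₁‖ ^ 2 : ℝ) : ℂ) • ξ ∈ (ℂ ∙ (ξ₁ - ((‖ξ₁‖ ^ 2 : ℝ) : ℂ) • ξ))ᗮ := by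
      rw [htop]; trivial
    rw [Submodule.mem_orthogonal_singleton_iff_inner_left] at this
    exact inner_self_eq_zero.1 this
  have h5 : ⟪ξ₂, ξ₁ - ((‖ξ₁‖ ^ 2 : ℝ) : ℂ) • ξ⟫_ℂ = 0 := by rw [hz, inner_zero_right]
  have h6 : ⟪ξ₂, ξ₁⟫_ℂ = 0 := by simpa using h21 1
  rw [hξ, inner_sub_right, inner_smul_right, inner_add_right, h6, zero_add,
    inner_self_eq_ofReal, zero_sub, neg_eq_zero] at h5
  have h7 : ‖ξ₁‖ ^ 2 * ‖ξ₂‖ ^ 2 = 0 := by exact_mod_cast h5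
  exact (mul_pos n1 n2).ne' h7

end Irreducible

end States

/-! ### Closed ideals as intersections of primitive ideals -/

section Primitive

open scoped ComplexOrder InnerProductSpace

variable {D : Type u} [NonUnitalCStarAlgebra D]

/-- P is the kernel, restricted to D, of the GNS representation of an extreme state of the
unitization that does not vanish at d*d. -/
theorem exists_isPrimitive_notMem {d : D} (hd : d ≠ 0) : ∃ P : ClosedIdeal D, IsPrimitive P ∧ d ∉ P := by
  let _ : PartialOrder (Unitization ℂ D) := CStarAlgebra.spectralOrder _
  have _ : StarOrderedRing (Unitization ℂ D) := CStarAlgebra.spectralOrderedRing _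
  let h : Unitization ℂ D := star (d : Unitization ℂ D) * (d : Unitization ℂ D)
  have hne : h ≠ 0 := by
    rw [Ne, CStarRing.star_mul_self_eq_zero_iff]
    exact fun h ↦ hd (Unitization.inr_injective (R := ℂ) (by simpa using h))
  obtain ⟨φ, hφ, hφh⟩ := exists_extreme_state_ne_zero (star_mul_self_nonneg _ : 0 ≤ h) hne
  let ρ : D →⋆ₙₐ[ℂ] ((stateMap hφ.1).GNS →L[ℂ] (stateMap hφ.1).GNS) :=
    ((stateMap hφ.1).gnsStarAlgHom : _ →⋆ₙₐ[ℂ] _).comp (Unitization.inrNonUnitalStarAlgHom ℂ D)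
  have hρ : ∀ a, ρ a = (stateMap hφ.1).gnsStarAlgHom (a : Unitization ℂ D) := fun _ ↦ rfl
  have hρd : ρ d ≠ 0 := by
    intro h0
    rw [hρ] at h0
    refine hφh ?_
    rw [← inner_cyclicVector hφ.1, map_mul, h0, mul_zero, _root_.zero_apply,
      inner_zero_right]
  refine ⟨⟨⟨⟨⟨{a | ρ a = 0}, ?_⟩, ?_⟩, ?_⟩, ?_, ?_, ?_⟩, ?_, hρd⟩
  · intro a b ha hb
    simp only [Set.mem_ofPred_eq] at *
    rw [map_add, ha, hb, add_zero]
  · exact map_zero ρ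
  · intro c a ha
    simp only [Set.mem_ofPred_eq] at *
    change ρ (c • a) = 0
    rw [map_smul, ha, smul_zero]
  · intro a b hb
    change ρ (a * b) = 0
    rw [map_mul, show ρ b = 0 from hb, mul_zero]
  · intro a b hb
    change ρ (b * a) = 0
    rw [map_mul, show ρ b = 0 from hb, zero_mul]
  · exact isClosed_eq (continuous_hom ρ) continuous_const
  · refine ⟨(stateMap hφ.1).GNS, inferInstance, inferInstance, inferInstance, ρ, ⟨d, hρd⟩,
      fun K hK hinv ↦ gns_irreducible hφ.1 hφ K hK fun a v hv ↦ ?_, fun a ↦ Iff.rfl⟩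
    -- The unitization acts by scalars plus the action of D, so a subspace that is invariant under D
    -- is invariant under the unitization, and irreducibility survives the restriction.
    rw [← Unitization.inl_fst_add_inr_snd_eq a, map_add, ← hρ]
    refine K.add_mem ?_ (hinv _ v hv)
    have : (Unitization.inl a.fst : Unitization ℂ D) = a.fst • 1 := by
      rw [← Unitization.inl_one, ← Unitization.inl_smul]
      simp
    rw [this, map_smul, map_one]
    exact K.smul_mem _ hv

/-- Writing the preimage of P as a kernel makes it a `ClosedIdeal` without further work. -/
theorem IsPrimitive.comap {D' : Type u} [NonUnitalCStarAlgebra D'] {P : ClosedIdeal D'}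
    (hP : IsPrimitive P) (ψ : D →⋆ₙₐ[ℂ] D') (hψ : Function.Surjective ψ) :
    IsPrimitive (ClosedIdeal.ker (P.proj.comp ψ)) := by
  obtain ⟨H, _, _, _, π, ⟨a, ha⟩, hirr, hP⟩ := hP
  obtain ⟨a, rfl⟩ := hψ a
  refine ⟨H, inferInstance, inferInstance, inferInstance, π.comp ψ, ⟨a, ha⟩, fun K hK hinv ↦ ?_,
    fun a ↦ ?_⟩
  · refine hirr K hK fun b v hv ↦ ?_
    obtain ⟨b, rfl⟩ := hψ b
    exact hinv b v hv
  · exact P.proj_eq_zero.trans (hP _)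

theorem mem_ker_proj_comp {D' : Type u} [NonUnitalCStarAlgebra D'] (P : ClosedIdeal D')
    (ψ : D →⋆ₙₐ[ℂ] D') {a : D} : a ∈ ClosedIdeal.ker (P.proj.comp ψ) ↔ ψ a ∈ P :=
  P.proj_eq_zero

/-- A closed ideal is the intersection of the primitive ideals that contain it. -/
theorem ClosedIdeal.exists_isPrimitive_notMem_of_notMem (I : ClosedIdeal D) {d : D} (hd : d ∉ I) :
    ∃ P : ClosedIdeal D, IsPrimitive P ∧ (∀ a ∈ I, a ∈ P) ∧ d ∉ P := by
  have h0 : I.proj d ≠ 0 := fun h ↦ hd (I.proj_eq_zero.1 h)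
  obtain ⟨P, hP, hdP⟩ := exists_isPrimitive_notMem h0
  refine ⟨_, hP.comap I.proj I.proj_surjective, fun a ha ↦ ?_, fun h ↦ ?_⟩
  · rw [mem_ker_proj_comp, I.proj_eq_zero.2 ha]
    exact P.zero_mem
  · exact hdP ((mem_ker_proj_comp P I.proj).1 h)

end Primitive

/-! ### Compactly supported functions and finite partitions of unity -/

section PartitionOfUnity

variable {X : Type*} [TopologicalSpace X]

/-- A compactly supported real function as a complex function that vanishes at infinity. -/
def compactToC0 (g : C(X, ℝ)) (hg : HasCompactSupport g) : C₀(X, ℂ) where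
  toFun x := (g x : ℂ)
  continuous_toFun := by fun_prop
  zero_at_infty' := by
    have := (Complex.continuous_ofReal.tendsto 0).comp hg.is_zero_at_infty
    simpa [Function.comp_def] using this

theorem compactToC0_apply (g : C(X, ℝ)) (hg : HasCompactSupport g) (x : X) :
    compactToC0 g hg x = (g x : ℂ) := rfl

theorem norm_le_of_forall_norm_apply_le {f : C₀(X, ℂ)} {r : ℝ} (hr : 0 ≤ r)
    (h : ∀ x, ‖f x‖ ≤ r) : ‖f‖ ≤ r := by
  rw [← ZeroAtInftyContinuousMap.norm_toBCF_eq_norm]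
  exact (BoundedContinuousFunction.norm_le hr).2 h

theorem isCompact_norm_apply_ge (f : C₀(X, ℂ)) {ε : ℝ} (hε : 0 < ε) :
    IsCompact {x | ε ≤ ‖f x‖} := by
  have h0 : Tendsto (fun x ↦ ‖f x‖) (cocompact X) (𝓝 0) := by simpa using f.zero_at_infty'.norm
  obtain ⟨K, hK, hKs⟩ := mem_cocompact.1 (h0.eventually (gt_mem_nhds hε))
  refine hK.of_isClosed_subset (isClosed_le continuous_const (by fun_prop)) fun x hx ↦ ?_
  by_contra hxK
  have h1 : ‖f x‖ < ε := hKs hxK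
  exact not_le.2 h1 hx

theorem exists_finite_partition [T2Space X] [LocallyCompactSpace X] {ι : Type*} [Fintype ι]
    {K : Set X} (hK : IsCompact K) (U : ι → Set X) (hU : ∀ i, IsOpen (U i)) (hKU : K ⊆ ⋃ i, U i) :
    ∃ g : ι → C(X, ℝ), (∀ i, HasCompactSupport (g i)) ∧ (∀ i, tsupport (g i) ⊆ U i) ∧
      (∀ i x, 0 ≤ g i x) ∧ (∀ x, ∑ i, g i x ≤ 1) ∧ ∀ x ∈ K, ∑ i, g i x = 1 := by
  obtain ⟨f, hf, hc⟩ := PartitionOfUnity.exists_isSubordinate_of_locallyFinite_t2space hK U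
    hU (locallyFinite_of_finite _) hKU
  refine ⟨fun i ↦ f i, hc, hf, fun i x ↦ f.nonneg i x, fun x ↦ ?_, fun x hx ↦ ?_⟩
  · rw [← finsum_eq_sum_of_fintype]
    exact f.sum_le_one x
  · rw [← finsum_eq_sum_of_fintype]
    exact f.sum_eq_one hx

end PartitionOfUnity

/-! ### Norms of central convex combinations -/

section ConvexCombinations

variable {M : Type*} [CStarAlgebra M]

/-- Convexity of c ↦ c*c. Put P = Σ hᵢ*hᵢ ≤ 1 and let T be the sum. Expanding 0 ≤ Σ (hᵢ(cᵢ -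
T))*(hᵢ(cᵢ - T)) and using T*PT ≤ T*T gives T*T ≤ Σ hᵢ*cᵢ*cᵢhᵢ ≤ r²P. The bound does not depend on
the number of summands, as is needed for gluing local approximations. -/
theorem norm_sum_central_le {ι : Type*} (s : Finset ι) (h c : ι → M)
    (hh : ∀ i m, h i * m = m * h i) (hP : ‖∑ i ∈ s, star (h i) * h i‖ ≤ 1) {r : ℝ} (hr : 0 ≤ r)
    (hc : ∀ i ∈ s, ‖c i‖ ≤ r) : ‖∑ i ∈ s, star (h i) * h i * c i‖ ≤ r := by
  let _ : PartialOrder M := CStarAlgebra.spectralOrder M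
  have _ : StarOrderedRing M := CStarAlgebra.spectralOrderedRing M
  have hh' : ∀ i m, star (h i) * m = m * star (h i) := fun i m ↦ by
    have := congrArg star (hh i (star m))
    simpa [star_mul] using this.symm
  set P := ∑ i ∈ s, star (h i) * h i with hPdef
  set T := ∑ i ∈ s, star (h i) * h i * c i with hT
  have hP0 : 0 ≤ P := Finset.sum_nonneg fun i _ ↦ star_mul_self_nonneg (h i)
  have hP1 : P ≤ 1 := (CStarAlgebra.norm_le_one_iff_of_nonneg P).1 hP
  have key : ∑ i ∈ s, star (h i * (c i - T)) * (h i * (c i - T)) =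
      (∑ i ∈ s, star (h i) * (star (c i) * c i) * h i) - star T * T - star T * T + star T * P * T := by
    have e1 : star T * T = ∑ i ∈ s, star T * (star (h i) * h i * c i) := by
      rw [← Finset.mul_sum]
    have e2 : star T * T = ∑ i ∈ s, star (star (h i) * h i * c i) * T := by
      rw [← Finset.sum_mul, ← star_sum]
    have e3 : star T * P * T = ∑ i ∈ s, star T * (star (h i) * h i) * T := by
      rw [← Finset.sum_mul, ← Finset.mul_sum]
    rw [e3]
    nth_rewrite 2 [e2]
    rw [e1, ← Finset.sum_sub_distrib, ← Finset.sum_sub_distrib, ← Finset.sum_add_distrib]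
    refine Finset.sum_congr rfl fun i _ ↦ ?_
    have hp : c i * (star (h i) * h i) = star (h i) * h i * c i := by
      rw [mul_assoc, hh i (c i), ← mul_assoc (star (h i)), hh' i (c i), mul_assoc]
    have f1 : star (h i) * (star (c i) * c i) * h i = star (c i) * (star (h i) * h i * c i) := by
      rw [hh' i, mul_assoc, mul_assoc, hp]
    rw [f1]
    simp only [star_mul, star_sub, star_star]
    noncomm_ring
  have h1 : 0 ≤ ∑ i ∈ s, star (h i * (c i - T)) * (h i * (c i - T)) :=
    Finset.sum_nonneg fun i _ ↦ star_mul_self_nonneg _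
  have h2 : star T * P * T ≤ star T * T := by
    simpa using star_left_conjugate_le_conjugate hP1 T
  have h3 : star T * T ≤ ∑ i ∈ s, star (h i) * (star (c i) * c i) * h i := by
    rw [key] at h1
    have h4 := add_le_add h1 (sub_nonneg.2 h2)
    rw [add_zero] at h4
    rw [← sub_nonneg]
    refine h4.trans (le_of_eq ?_)
    abel
  have h4 : ∑ i ∈ s, star (h i) * (star (c i) * c i) * h i ≤ (r ^ 2) • P := by
    rw [hPdef, Finset.smul_sum]
    refine Finset.sum_le_sum fun i hi ↦ ?_
    refine (CStarAlgebra.star_left_conjugate_le_norm_smul (IsSelfAdjoint.star_mul_self (c i))).trans ?_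
    refine smul_le_smul_of_nonneg_right ?_ (star_mul_self_nonneg (h i))
    rw [CStarRing.norm_star_mul_self, ← sq]
    exact pow_le_pow_left₀ (norm_nonneg _) (hc i hi) 2
  have h5 : ‖star T * T‖ ≤ ‖(r ^ 2) • P‖ :=
    CStarAlgebra.norm_le_norm_of_nonneg_of_le (star_mul_self_nonneg T) (h3.trans h4)
  rw [CStarRing.norm_star_mul_self, norm_smul, Real.norm_of_nonneg (by positivity), ← sq] at h5
  refine le_of_sq_le_sq ?_ hr
  calc ‖T‖ ^ 2 ≤ r ^ 2 * ‖P‖ := h5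
    _ ≤ r ^ 2 * 1 := by gcongr
    _ = r ^ 2 := mul_one _

end ConvexCombinations

/-! ### Fibres of C₀(X)-algebras: semicontinuity, detection of ideals, the hull -/

namespace C0Algebra

variable {X : Type v} [TopologicalSpace X] {A : Type u} [NonUnitalCStarAlgebra A]
  (μ : C0Algebra X A)

/-- The action of `C₀(X)` on `A`. -/
def act (f : C₀(X, ℂ)) : A →L[ℂ] A := (μ.toHom f).fst

theorem act_mul (f g : C₀(X, ℂ)) (a : A) : μ.act (f * g) a = μ.act f (μ.act g a) := by
  simp [act]

theorem act_add (f g : C₀(X, ℂ)) (a : A) : μ.act (f + g) a = μ.act f a + μ.act g a := by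
  simp [act]

theorem act_sub (f g : C₀(X, ℂ)) (a : A) : μ.act (f - g) a = μ.act f a - μ.act g a := by
  simp [act]

theorem act_smul (c : ℂ) (f : C₀(X, ℂ)) (a : A) : μ.act (c • f) a = c • μ.act f a := by
  simp [act]

theorem act_sum {ι : Type*} (s : Finset ι) (f : ι → C₀(X, ℂ)) (a : A) :
    μ.act (∑ i ∈ s, f i) a = ∑ i ∈ s, μ.act (f i) a := by
  classical
  induction s using Finset.induction_on with
  | empty => simp [act]
  | insert i s hi ih => rw [Finset.sum_insert hi, Finset.sum_insert hi, act_add, ih]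

theorem norm_act_le (f : C₀(X, ℂ)) (a : A) : ‖μ.act f a‖ ≤ ‖f‖ * ‖a‖ := by
  refine ((μ.toHom f).fst.le_opNorm a).trans ?_
  gcongr
  rw [DoubleCentralizer.norm_fst]
  exact NonUnitalStarAlgHom.norm_apply_le μ.toHom f

theorem act_mul_right (f : C₀(X, ℂ)) (a b : A) : μ.act f (a * b) = μ.act f a * b := fst_mul _ a b

theorem act_mul_left (f : C₀(X, ℂ)) (a b : A) : μ.act f (a * b) = a * μ.act f b :=
  mul_fst_of_central (μ.central f) a b

theorem nondegenerate_induction {K : Submodule ℂ A} (hK : IsClosed (K : Set A))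
    (h : ∀ f a, μ.act f a ∈ K) (a : A) : a ∈ K := by
  have h1 : closure (Submodule.span ℂ {b : A | ∃ f a, b = (μ.toHom f).fst a} : Set A) ⊆ K := by
    refine closure_minimal (Submodule.span_le.2 ?_) hK
    rintro _ ⟨f, a, rfl⟩
    exact h f a
  exact h1 (μ.nondegenerate a)

theorem vanishingIdeal_induction {x : X} {K : Submodule ℂ A} (hK : IsClosed (K : Set A))
    (h : ∀ f a, f x = 0 → μ.act f a ∈ K) {a : A} (ha : a ∈ μ.vanishingIdeal x) : a ∈ K := by
  have h1 : closure (Submodule.span ℂ (μ.vanishingSet x) : Set A) ⊆ K := by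
    refine closure_minimal (Submodule.span_le.2 ?_) hK
    rintro _ ⟨f, a, hf, rfl⟩
    exact h f a hf
  exact h1 ha

theorem act_mem_vanishingIdeal {x : X} {f : C₀(X, ℂ)} (hf : f x = 0) (a : A) :
    μ.act f a ∈ μ.vanishingIdeal x :=
  subset_closure (Submodule.subset_span ⟨f, a, hf, rfl⟩)

theorem ev_eq_zero {x : X} {a : A} : μ.ev x a = 0 ↔ a ∈ μ.vanishingIdeal x :=
  (μ.vanishingIdeal x).proj_eq_zero

theorem ev_act (f : C₀(X, ℂ)) (a : A) (x : X) : μ.ev x (μ.act f a) = f x • μ.ev x a := by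
  let K : Submodule ℂ A :=
    { carrier := {a | μ.ev x (μ.act f a) = f x • μ.ev x a}
      add_mem' := fun {a b} ha hb ↦ by
        simp only [Set.mem_ofPred_eq, map_add, smul_add] at *
        rw [ha, hb]
      zero_mem' := by simp
      smul_mem' := fun c a ha ↦ by
        simp only [Set.mem_ofPred_eq, map_smul] at *
        rw [ha, smul_comm] }
  refine μ.nondegenerate_induction (K := K) ?_ (fun g a ↦ ?_) a
  · exact isClosed_eq ((continuous_hom _).comp (μ.act f).continuous)
      ((continuous_const_smul (f x)).comp (continuous_hom (μ.ev x)))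
  · change μ.ev x (μ.act f (μ.act g a)) = f x • μ.ev x (μ.act g a)
    -- The difference of the two sides comes from the function fg - f(x)g, which vanishes at x.
    rw [← map_smul, ← sub_eq_zero, ← map_sub, ev_eq_zero, ← act_mul, ← act_smul, ← act_sub]
    exact μ.act_mem_vanishingIdeal (by simp) a

/-- The elements whose fibres tend to zero along a filter. -/
def nullAlong (l : Filter X) : Submodule ℂ A where
  carrier := {a | Tendsto (fun x ↦ ‖μ.ev x a‖) l (𝓝 0)}
  add_mem' := fun {a b} ha hb ↦ by
    refine squeeze_zero (fun x ↦ norm_nonneg _) (fun x ↦ ?_) (by simpa using Tendsto.add ha hb)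
    rw [map_add]
    exact norm_add_le _ _
  zero_mem' := by simpa using tendsto_const_nhds
  smul_mem' := fun c a ha ↦ by
    have := Tendsto.const_mul ‖c‖ ha
    simp only [Set.mem_ofPred_eq, map_smul, norm_smul] at *
    simpa using this

theorem norm_ev_le (x : X) (a : A) : ‖μ.ev x a‖ ≤ ‖a‖ :=
  NonUnitalStarAlgHom.norm_apply_le (μ.ev x) a

theorem isClosed_nullAlong (l : Filter X) : IsClosed (μ.nullAlong l : Set A) := by
  refine isClosed_of_closure_subset fun a ha ↦ ?_
  change Tendsto (fun x ↦ ‖μ.ev x a‖) l (𝓝 0)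
  rw [Metric.tendsto_nhds]
  intro ε hε
  obtain ⟨b, hb, hab⟩ := Metric.mem_closure_iff.1 ha (ε / 2) (by positivity)
  have hb' : Tendsto (fun x ↦ ‖μ.ev x b‖) l (𝓝 0) := hb
  filter_upwards [hb'.eventually (gt_mem_nhds (show 0 < ε / 2 by positivity))] with x hx
  rw [dist_zero_right, norm_norm]
  have h1 : μ.ev x a = μ.ev x (a - b) + μ.ev x b := by rw [map_sub]; abel
  rw [h1]
  refine (norm_add_le _ _).trans_lt ?_
  have := μ.norm_ev_le x (a - b)
  rw [dist_eq_norm] at hab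
  linarith

/-- The condition is closed and linear in `a`; for a product f·a it holds since the norm in the
fibre over x is at most |f(x)|‖a‖. The same argument, near a zero of f, proves
`tendsto_norm_ev_of_mem`. -/
theorem tendsto_norm_ev_cocompact (a : A) :
    Tendsto (fun x ↦ ‖μ.ev x a‖) (cocompact X) (𝓝 0) := by
  refine μ.nondegenerate_induction (μ.isClosed_nullAlong _) (fun f a ↦ ?_) a
  refine squeeze_zero (fun x ↦ norm_nonneg _) (g := fun x ↦ ‖f x‖ * ‖a‖) (fun x ↦ ?_) ?_
  · rw [ev_act, norm_smul]
    gcongr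
    exact μ.norm_ev_le x a
  · have := (f.zero_at_infty'.norm).mul_const ‖a‖
    simpa using this

theorem tendsto_norm_ev_of_mem {x : X} {a : A} (ha : a ∈ μ.vanishingIdeal x) :
    Tendsto (fun y ↦ ‖μ.ev y a‖) (𝓝 x) (𝓝 0) := by
  refine μ.vanishingIdeal_induction (μ.isClosed_nullAlong _) (fun f a hf ↦ ?_) ha
  refine squeeze_zero (fun x ↦ norm_nonneg _) (g := fun x ↦ ‖f x‖ * ‖a‖) (fun x ↦ ?_) ?_
  · rw [ev_act, norm_smul]
    gcongr
    exact μ.norm_ev_le x a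
  · have := ((f.continuous.tendsto x).norm).mul_const ‖a‖
    simpa [hf] using this

/-- The norms of the fibres of an element are upper semicontinuous. -/
theorem eventually_norm_ev_lt {x : X} {a : A} {ε : ℝ} (h : ‖μ.ev x a‖ < ε) :
    ∀ᶠ y in 𝓝 x, ‖μ.ev y a‖ < ε := by
  obtain ⟨δ, hδ, h'⟩ : ∃ δ > 0, ‖μ.ev x a‖ + δ + δ < ε :=
    ⟨(ε - ‖μ.ev x a‖) / 3, by linarith, by linarith⟩
  -- A lift of a(x) of nearly minimal norm bounds all neighbouring fibres, up to the fibres of a -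
  -- b, which tend to zero at x.
  obtain ⟨b, hb, hbn⟩ := ClosedIdeal.Quot.exists_lift (μ.vanishingIdeal x) (μ.ev x a) hδ
  have hab : a - b ∈ μ.vanishingIdeal x := (ClosedIdeal.Quot.mkₗ_eq_iff _).1 hb.symm
  filter_upwards [(μ.tendsto_norm_ev_of_mem hab).eventually (gt_mem_nhds hδ)] with y hy
  have h1 : μ.ev y a = μ.ev y (a - b) + μ.ev y b := by rw [map_sub]; abel
  rw [h1]
  refine (norm_add_le _ _).trans_lt ?_
  have := μ.norm_ev_le y b
  change ‖b‖ < ‖μ.ev x a‖ + δ at hbn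
  linarith

section Quotients

variable (J : ClosedIdeal A)

theorem quotEval_proj (x : X) (a : A) :
    μ.quotEval J x (J.proj a) = (μ.fibreIdeal J x).proj (μ.ev x a) := rfl

theorem ev_mem_fibreIdeal (x : X) {a : A} (ha : a ∈ J) : μ.ev x a ∈ μ.fibreIdeal J x := ⟨a, ha, rfl⟩

theorem exists_of_mem_fibreIdeal {x : X} {b : μ.Fibre x} (hb : b ∈ μ.fibreIdeal J x) :
    ∃ a ∈ J, μ.ev x a = b := hb

theorem norm_quotEval_proj_le (x : X) (a : A) : ‖μ.quotEval J x (J.proj a)‖ ≤ ‖μ.ev x a‖ :=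
  NonUnitalStarAlgHom.norm_apply_le (μ.fibreIdeal J x).proj (μ.ev x a)

/-- Changing the representative of c by an element of J makes its norm in A(x) smaller than ε, and
the norms in the fibres A(y) are upper semicontinuous. -/
theorem eventually_norm_quotEval_lt {x : X} {c : J.Quot} {ε : ℝ} (h : ‖μ.quotEval J x c‖ < ε) :
    ∀ᶠ y in 𝓝 x, ‖μ.quotEval J y c‖ < ε := by
  obtain ⟨a, rfl⟩ := J.proj_surjective c
  obtain ⟨b, hb, hbn⟩ := ClosedIdeal.Quot.exists_lift (μ.fibreIdeal J x)
    (μ.quotEval J x (J.proj a)) (sub_pos.2 h)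
  have hab : μ.ev x a - b ∈ μ.fibreIdeal J x := (ClosedIdeal.Quot.mkₗ_eq_iff _).1 hb.symm
  obtain ⟨j, hj, hj'⟩ := μ.exists_of_mem_fibreIdeal J hab
  have h1 : ‖μ.ev x (a - j)‖ < ε := by
    rw [map_sub, hj', sub_sub_cancel]
    linarith
  filter_upwards [μ.eventually_norm_ev_lt h1] with y hy
  have h2 : J.proj a = J.proj (a - j) := J.proj_eq_iff.2 (by rwa [sub_sub_cancel])
  rw [h2]
  exact (μ.norm_quotEval_proj_le J y _).trans_lt hy

theorem isCompact_norm_quotEval_ge (c : J.Quot) {ε : ℝ} (hε : 0 < ε) :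
    IsCompact {x | ε ≤ ‖μ.quotEval J x c‖} := by
  have hcl : IsClosed {x | ε ≤ ‖μ.quotEval J x c‖} := by
    rw [← isOpen_compl_iff, isOpen_iff_eventually]
    intro x hx
    simp only [Set.mem_compl_iff, Set.mem_ofPred_eq, not_le] at hx ⊢
    exact μ.eventually_norm_quotEval_lt J hx
  obtain ⟨a, rfl⟩ := J.proj_surjective c
  obtain ⟨K, hK, hKs⟩ := mem_cocompact.1
    ((μ.tendsto_norm_ev_cocompact a).eventually (gt_mem_nhds hε))
  refine hK.of_isClosed_subset hcl fun x hx ↦ ?_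
  by_contra hxK
  have h1 : ‖μ.ev x a‖ < ε := hKs hxK
  exact absurd (hx.trans (μ.norm_quotEval_proj_le J x a)) (not_le.2 h1)

theorem isCompact_norm_ev_ge (a : A) {ε : ℝ} (hε : 0 < ε) :
    IsCompact {x | ε ≤ ‖μ.ev x a‖} := by
  have hcl : IsClosed {x | ε ≤ ‖μ.ev x a‖} := by
    rw [← isOpen_compl_iff, isOpen_iff_eventually]
    intro x hx
    simp only [Set.mem_compl_iff, Set.mem_ofPred_eq, not_le] at hx ⊢
    exact μ.eventually_norm_ev_lt hx
  obtain ⟨K, hK, hKs⟩ := mem_cocompact.1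
    ((μ.tendsto_norm_ev_cocompact a).eventually (gt_mem_nhds hε))
  refine hK.of_isClosed_subset hcl fun x hx ↦ ?_
  by_contra hxK
  have h1 : ‖μ.ev x a‖ < ε := hKs hxK
  exact not_le.2 h1 hx

/-- For an approximate unit e one has f·(je) = j(f·e) ∈ J, and je tends to j. -/
theorem act_mem_ideal (f : C₀(X, ℂ)) {j : A} (hj : j ∈ J) : μ.act f j ∈ J := by
  obtain ⟨l, hl⟩ := exists_isContractiveUnit A
  have := hl.neBot
  have h := ((μ.act f).continuous.tendsto j).comp (hl.right j)
  refine J.isClosed'.mem_of_tendsto h (Eventually.of_forall fun e ↦ ?_)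
  change μ.act f (j * e) ∈ J
  rw [act_mul_left]
  exact J.mul_mem_right _ hj

end Quotients

section Local

theorem toHom_mul_coe (f : C₀(X, ℂ)) (a : A) :
    μ.toHom f * (a : 𝓜(ℂ, A)) = (μ.act f a : A) := by
  refine DoubleCentralizer.ext _ _ _ _ (Prod.ext ?_ ?_)
  · ext b
    exact μ.act_mul_right f a b
  · ext b
    exact (μ.toHom f).central b a

theorem norm_coe_multiplier (a : A) : ‖(a : 𝓜(ℂ, A))‖ = ‖a‖ := by
  refine NonUnitalStarAlgHom.norm_map (DoubleCentralizer.coeHom (𝕜 := ℂ) (A := A)) ?_ a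
  rw [injective_iff_map_eq_zero]
  intro a ha
  have h := congrArg (fun m : 𝓜(ℂ, A) ↦ m.fst (star a)) ha
  have h2 : a * star a = 0 := by simpa using h
  exact (CStarRing.mul_star_self_eq_zero_iff a).1 h2

theorem exists_act_near (a : A) {ε : ℝ} (hε : 0 < ε) :
    ∃ e : C₀(X, ℂ), ‖e‖ ≤ 1 ∧ ‖a - μ.act e a‖ < ε := by
  obtain ⟨l, hl⟩ := exists_isContractiveUnit C₀(X, ℂ)
  have := hl.neBot
  let T : C₀(X, ℂ) → A →+ A := fun e ↦ (μ.act e : A →+ A)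
  let K : Submodule ℂ A :=
    { carrier := {a | Tendsto (fun e ↦ μ.act e a) l (𝓝 a)}
      add_mem' := fun {a b} ha hb ↦ by
        simp only [Set.mem_ofPred_eq, map_add] at *
        exact ha.add hb
      zero_mem' := by simp
      smul_mem' := fun c a ha ↦ by
        simp only [Set.mem_ofPred_eq, map_smul] at *
        exact ha.const_smul c }
  have hK : IsClosed (K : Set A) :=
    isClosed_tendsto_addMonoidHom (C := 2) T (AddMonoidHom.id A) (by
      filter_upwards [hl.norm_le] with e he a
      refine (norm_sub_le _ _).trans ?_
      have h1 : ‖T e a‖ ≤ 1 * ‖a‖ := (μ.norm_act_le e a).trans (by gcongr)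
      change _ + ‖a‖ ≤ _
      linarith)
  have h : Tendsto (fun e ↦ μ.act e a) l (𝓝 a) := by
    refine μ.nondegenerate_induction hK (fun f a ↦ ?_) a
    change Tendsto (fun e ↦ μ.act e (μ.act f a)) l (𝓝 (μ.act f a))
    simp_rw [← act_mul]
    have hc : Continuous fun g : C₀(X, ℂ) ↦ μ.act g a := by
      have h1 : Continuous fun m : 𝓜(ℂ, A) ↦ m.fst a := by
        refine AddMonoidHomClass.continuous_of_bound
          (AddMonoidHom.mk' (fun m : 𝓜(ℂ, A) ↦ m.fst a) (by simp)) ‖a‖ fun m ↦ ?_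
        rw [mul_comm, ← DoubleCentralizer.norm_fst]
        exact m.fst.le_opNorm a
      exact h1.comp (continuous_hom μ.toHom)
    exact (hc.tendsto f).comp (hl.left f)
  obtain ⟨e, h1, h2⟩ := (hl.norm_le.and (h.eventually (Metric.ball_mem_nhds a hε))).exists
  exact ⟨e, h1, by rwa [dist_comm, dist_eq_norm] at h2⟩

/-- Makes the vanishing of a(x) quantitative in A itself, uniformly in the functions f that live
near x. It is evident for a = g·a' with g(x) = 0, and the condition is closed and linear. -/
theorem exists_nhds_norm_act_le {x : X} {a : A} (ha : a ∈ μ.vanishingIdeal x) {ε : ℝ}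
    (hε : 0 < ε) : ∃ U : Set X, IsOpen U ∧ x ∈ U ∧ ∀ f : C₀(X, ℂ), (∀ y, ‖f y‖ ≤ 1) →
      (∀ y ∉ U, f y = 0) → ‖μ.act f a‖ ≤ ε := by
  let K : Submodule ℂ A :=
    { carrier := {a | ∀ ε : ℝ, 0 < ε → ∃ U : Set X, IsOpen U ∧ x ∈ U ∧ ∀ f : C₀(X, ℂ),
        (∀ y, ‖f y‖ ≤ 1) → (∀ y ∉ U, f y = 0) → ‖μ.act f a‖ ≤ ε}
      add_mem' := by
        intro a b ha hb ε hε
        obtain ⟨U, hU, hxU, h⟩ := ha (ε / 2) (half_pos hε)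
        obtain ⟨V, hV, hxV, k⟩ := hb (ε / 2) (half_pos hε)
        refine ⟨U ∩ V, hU.inter hV, ⟨hxU, hxV⟩, fun f hf hf' ↦ ?_⟩
        rw [map_add]
        refine (norm_add_le _ _).trans ?_
        have := h f hf fun y hy ↦ hf' y fun h ↦ hy h.1
        have := k f hf fun y hy ↦ hf' y fun h ↦ hy h.2
        linarith
      zero_mem' := fun ε hε ↦ ⟨Set.univ, isOpen_univ, trivial, fun f _ _ ↦ by simpa using hε.le⟩
      smul_mem' := by
        intro c a ha ε hε
        obtain ⟨U, hU, hxU, h⟩ := ha (ε / (‖c‖ + 1)) (by positivity)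
        refine ⟨U, hU, hxU, fun f hf hf' ↦ ?_⟩
        rw [map_smul, norm_smul]
        calc ‖c‖ * ‖μ.act f a‖ ≤ (‖c‖ + 1) * (ε / (‖c‖ + 1)) := by
              gcongr
              · linarith
              · exact h f hf hf'
          _ = ε := by field_simp }
  have hK : IsClosed (K : Set A) := by
    refine isClosed_of_closure_subset fun a ha ε hε ↦ ?_
    obtain ⟨b, hb, hab⟩ := Metric.mem_closure_iff.1 ha (ε / 2) (half_pos hε)
    obtain ⟨U, hU, hxU, h⟩ := hb (ε / 2) (half_pos hε)
    refine ⟨U, hU, hxU, fun f hf hf' ↦ ?_⟩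
    have h1 : μ.act f a = μ.act f (a - b) + μ.act f b := by rw [map_sub]; abel
    rw [h1]
    refine (norm_add_le _ _).trans ?_
    have h2 : ‖μ.act f (a - b)‖ ≤ 1 * ‖a - b‖ := (μ.norm_act_le f _).trans (by
      gcongr
      exact norm_le_of_forall_norm_apply_le zero_le_one hf)
    have h3 := h f hf hf'
    rw [dist_eq_norm] at hab
    linarith
  refine (μ.vanishingIdeal_induction (K := K) hK (fun g a hg ε hε ↦ ?_) ha) ε hε
  refine ⟨{y | ‖g y‖ < ε / (‖a‖ + 1)}, isOpen_lt (by fun_prop) continuous_const, ?_,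
    fun f hf hf' ↦ ?_⟩
  · simp only [Set.mem_ofPred_eq, hg, norm_zero]
    positivity
  · rw [← act_mul]
    refine (μ.norm_act_le _ _).trans ?_
    have : ‖f * g‖ ≤ ε / (‖a‖ + 1) := by
      refine norm_le_of_forall_norm_apply_le (by positivity) fun y ↦ ?_
      rw [ZeroAtInftyContinuousMap.mul_apply, norm_mul]
      by_cases hy : ‖g y‖ < ε / (‖a‖ + 1)
      · calc ‖f y‖ * ‖g y‖ ≤ 1 * (ε / (‖a‖ + 1)) := by
              gcongr
              exact hf y
          _ = _ := one_mul _
      · rw [hf' y hy, norm_zero, zero_mul]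
        positivity
    calc ‖f * g‖ * ‖a‖ ≤ (ε / (‖a‖ + 1)) * (‖a‖ + 1) := by
          gcongr
          linarith
      _ = ε := by field_simp

variable [T2Space X] [LocallyCompactSpace X]

/-- An ideal is determined by its fibres. -/
theorem mem_of_forall_ev_mem (J : ClosedIdeal A) {a : A} (h : ∀ x, μ.ev x a ∈ μ.fibreIdeal J x) :
    a ∈ J := by
  have hcl : a ∈ closure (J.carrier : Set A) := by
    rw [Metric.mem_closure_iff]
    intro ε hε
    obtain ⟨e, he1, he⟩ := μ.exists_act_near a (show 0 < ε / 5 by positivity)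
    have hK : IsCompact {x | ε / (5 * (‖a‖ + 1)) ≤ ‖e x‖} :=
      isCompact_norm_apply_ge e (by positivity)
    have h1 : ∀ x, ∃ (j : A) (U : Set X), j ∈ J ∧ IsOpen U ∧ x ∈ U ∧ ∀ f : C₀(X, ℂ),
        (∀ y, ‖f y‖ ≤ 1) → (∀ y ∉ U, f y = 0) → ‖μ.act f (a - j)‖ ≤ ε / 5 := by
      intro x
      obtain ⟨j, hj, hj'⟩ := μ.exists_of_mem_fibreIdeal J (h x)
      have : a - j ∈ μ.vanishingIdeal x := by rw [← ev_eq_zero, map_sub, hj', sub_self]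
      obtain ⟨U, hU, hxU, h⟩ := μ.exists_nhds_norm_act_le this (show 0 < ε / 5 by positivity)
      exact ⟨j, U, hj, hU, hxU, h⟩
    choose j U hj hU hxU hact using h1
    obtain ⟨t, ht⟩ := hK.elim_finite_subcover U hU fun x _ ↦ Set.mem_iUnion.2 ⟨x, hxU x⟩
    obtain ⟨g, hgc, hgs, hg0, hg1, hgK⟩ := exists_finite_partition hK (fun i : t ↦ U i)
      (fun i ↦ hU i) (by simpa [Set.iUnion_subtype] using ht)
    -- Since kᵢ is 1 on the support of gᵢ, one may replace a - jᵢ by cᵢ = kᵢ·(a - jᵢ) under gᵢ. This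
    -- has norm at most ε/5 since kᵢ lives in Uᵢ. With weights √gᵢ, `norm_sum_central_le` bounds the
    -- sum.
    have hk : ∀ i : t, ∃ k : C(X, ℝ), Set.EqOn k 1 (tsupport (g i)) ∧ Set.EqOn k 0 (U i)ᶜ ∧
        HasCompactSupport k ∧ ∀ x, k x ∈ Set.Icc (0 : ℝ) 1 := fun i ↦
      exists_continuous_one_zero_of_isCompact (hgc i) (hU i).isClosed_compl
        (Set.disjoint_compl_right_iff_subset.2 (hgs i))
    choose k hk1 hk0 hkc hkI using hk
    let c : t → A := fun i ↦ μ.act (compactToC0 (k i) (hkc i)) (a - j i)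
    have hc : ∀ i, ‖c i‖ ≤ ε / 5 := fun i ↦ by
      refine hact i _ (fun y ↦ ?_) fun y hy ↦ ?_
      · rw [compactToC0_apply, Complex.norm_real, Real.norm_of_nonneg (hkI i y).1]
        exact (hkI i y).2
      · rw [compactToC0_apply, hk0 i hy]
        simp
    let G : t → C₀(X, ℂ) := fun i ↦ compactToC0 (g i) (hgc i)
    let r : t → C₀(X, ℂ) := fun i ↦ compactToC0 ⟨fun x ↦ √(g i x), by fun_prop⟩
      ((hgc i).comp_left (g := Real.sqrt) Real.sqrt_zero)
    have hG : ∀ i, star (r i) * r i = G i := fun i ↦ by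
      ext y
      change (starRingEnd ℂ) ((√(g i y) : ℝ) : ℂ) * ((√(g i y) : ℝ) : ℂ) = (g i y : ℂ)
      rw [Complex.conj_ofReal, ← Complex.ofReal_mul, Real.mul_self_sqrt (hg0 i y)]
    have hGk : ∀ i, G i * compactToC0 (k i) (hkc i) = G i := fun i ↦ by
      ext y
      change (g i y : ℂ) * (k i y : ℂ) = (g i y : ℂ)
      by_cases hy : g i y = 0
      · simp [hy]
      · rw [hk1 i (subset_tsupport _ hy)]
        simp
    have hGs : ∀ y, (∑ i, G i) y = ((∑ i, g i y : ℝ) : ℂ) := fun y ↦ by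
      rw [Complex.ofReal_sum]
      exact map_sum (AddMonoidHom.mk' (fun f : C₀(X, ℂ) ↦ f y) fun _ _ ↦ rfl) G _
    have hGn : ‖∑ i, G i‖ ≤ 1 := norm_le_of_forall_norm_apply_le zero_le_one fun y ↦ by
      rw [hGs, Complex.norm_real, Real.norm_of_nonneg (Finset.sum_nonneg fun i _ ↦ hg0 i y)]
      exact hg1 y
    have hT : ‖∑ i, μ.act (G i) (a - j i)‖ ≤ ε / 5 := by
      have e1 : ((∑ i, μ.act (G i) (a - j i) : A) : 𝓜(ℂ, A)) =
          ∑ i, star (μ.toHom (r i)) * μ.toHom (r i) * (c i : 𝓜(ℂ, A)) := by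
        refine (map_sum (DoubleCentralizer.coeHom (𝕜 := ℂ) (A := A)) _ _).trans ?_
        refine Finset.sum_congr rfl fun i _ ↦ ?_
        rw [← map_star, ← map_mul, hG, toHom_mul_coe]
        change ((μ.act (G i) (a - j i) : A) : 𝓜(ℂ, A)) = _
        rw [← act_mul, hGk]
      rw [← norm_coe_multiplier, e1]
      refine norm_sum_central_le _ _ _ (fun i m ↦ μ.central _ m) ?_ (by positivity) fun i _ ↦ ?_
      · simp_rw [← map_star, ← map_mul, hG]
        rw [← map_sum]
        exact (NonUnitalStarAlgHom.norm_apply_le μ.toHom _).trans hGn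
      · rw [norm_coe_multiplier]
        exact hc i
    have hb : ∑ i, μ.act (G i) (j i) ∈ J :=
      J.sum_mem fun i _ ↦ μ.act_mem_ideal J (G i) (hj i)
    refine ⟨_, hb, ?_⟩
    -- With G = Σ Gᵢ, the four errors are: e does not fix a exactly; G is 1 only where e is not
    -- small; again e does not fix a; and the local errors a - jᵢ. Each has norm at most ε/5.
    have e2 : a - ∑ i, μ.act (G i) (j i) = (a - μ.act e a) + μ.act (e - (∑ i, G i) * e) a +
        μ.act (∑ i, G i) (μ.act e a - a) + ∑ i, μ.act (G i) (a - j i) := by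
      simp only [map_sub, act_sub, act_mul, act_sum, Finset.sum_sub_distrib]
      abel
    have h2 : ‖μ.act (e - (∑ i, G i) * e) a‖ ≤ ε / 5 := by
      refine (μ.norm_act_le _ _).trans ?_
      have : ‖e - (∑ i, G i) * e‖ ≤ ε / (5 * (‖a‖ + 1)) := by
        refine norm_le_of_forall_norm_apply_le (by positivity) fun y ↦ ?_
        rw [ZeroAtInftyContinuousMap.sub_apply, ZeroAtInftyContinuousMap.mul_apply, hGs]
        by_cases hy : ε / (5 * (‖a‖ + 1)) ≤ ‖e y‖
        · rw [hgK y hy]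
          simp only [Complex.ofReal_one, one_mul, sub_self, norm_zero]
          positivity
        · rw [show e y - ((∑ i, g i y : ℝ) : ℂ) * e y = ((1 - ∑ i, g i y : ℝ) : ℂ) * e y by
            push_cast; ring, norm_mul, Complex.norm_real,
            Real.norm_of_nonneg (sub_nonneg.2 (hg1 y))]
          have h3 : 1 - ∑ i, g i y ≤ 1 := by
            have := Finset.sum_nonneg fun i (_ : i ∈ Finset.univ) ↦ hg0 i y
            linarith
          calc (1 - ∑ i, g i y) * ‖e y‖ ≤ 1 * ‖e y‖ := by gcongr
            _ ≤ _ := by rw [one_mul]; exact (not_le.1 hy).le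
      calc _ ≤ ε / (5 * (‖a‖ + 1)) * (‖a‖ + 1) := by
            gcongr
            linarith
        _ = ε / 5 := by field_simp
    have h3 : ‖μ.act (∑ i, G i) (μ.act e a - a)‖ ≤ ε / 5 := by
      refine (μ.norm_act_le _ _).trans ?_
      rw [norm_sub_rev]
      calc _ ≤ 1 * (ε / 5) := by gcongr
        _ = _ := one_mul _
    rw [dist_eq_norm, e2]
    refine norm_add₄_le.trans_lt ?_
    linarith
  rwa [J.isClosed'.closure_eq] at hcl

theorem eq_zero_of_forall_ev {a : A} (h : ∀ x, μ.ev x a = 0) : a = 0 := by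
  let I : ClosedIdeal A := ClosedIdeal.ker (NonUnitalStarAlgHom.id ℂ A)
  exact μ.mem_of_forall_ev_mem I fun x ↦ by
    rw [h x]
    exact (μ.fibreIdeal I x).zero_mem

theorem quotEval_injective (J : ClosedIdeal A) {c : J.Quot} (h : ∀ x, μ.quotEval J x c = 0) :
    c = 0 := by
  obtain ⟨a, rfl⟩ := J.proj_surjective c
  exact J.proj_eq_zero.2 (μ.mem_of_forall_ev_mem J fun x ↦
    (μ.fibreIdeal J x).proj_eq_zero.1 (h x))

end Local

/-- A primitive ideal of A(x) that contains J(x) pulls back to a primitive ideal of A that contains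
J and lies over x. Thus A(x)/J(x) = 0 outside the hull. -/
theorem mem_hull_of_notMem_fibreIdeal (J : ClosedIdeal A) {x : X} {b : μ.Fibre x}
    (h : b ∉ μ.fibreIdeal J x) : x ∈ μ.hull J := by
  obtain ⟨P, hP, hJP, -⟩ := (μ.fibreIdeal J x).exists_isPrimitive_notMem_of_notMem h
  refine subset_closure ⟨_, hP.comap (μ.ev x) (μ.ev_surjective x), fun a ha ↦ ?_, fun a ha ↦ ?_⟩
  · rw [mem_ker_proj_comp]
    exact hJP _ (μ.ev_mem_fibreIdeal J x ha)
  · rw [mem_ker_proj_comp, μ.ev_eq_zero.2 ha]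
    exact P.zero_mem

theorem mem_hull_of_quotEval_ne_zero (J : ClosedIdeal A) {x : X} {c : J.Quot}
    (h : μ.quotEval J x c ≠ 0) : x ∈ μ.hull J := by
  obtain ⟨a, rfl⟩ := J.proj_surjective c
  exact μ.mem_hull_of_notMem_fibreIdeal J fun h' ↦ h ((μ.fibreIdeal J x).proj_eq_zero.2 h')

/-- Conversely, if J(x) = A(x), then a primitive ideal over x containing J would be all of A,
although its representation is nonzero. -/
theorem exists_notMem_fibreIdeal (J : ClosedIdeal A) {x : X} {P : ClosedIdeal A}
    (hP : IsPrimitive P) (hJ : ∀ a ∈ J, a ∈ P) (hx : μ.IsBasePoint P x) :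
    ∃ b, b ∉ μ.fibreIdeal J x := by
  obtain ⟨H, _, _, _, π, ⟨a, ha⟩, -, hπ⟩ := hP
  refine ⟨μ.ev x a, fun h ↦ ha ((hπ a).1 ?_)⟩
  obtain ⟨j, hj, hja⟩ := μ.exists_of_mem_fibreIdeal J h
  have h1 : a - j ∈ P := hx _ (by rw [← ev_eq_zero, map_sub, hja, sub_self])
  have := P.add_mem h1 (hJ j hj)
  rwa [sub_add_cancel] at this

end C0Algebra

/-! ### Neighbourhoods in upper semicontinuous bundles -/

section USCBundles

variable {X : Type*} [TopologicalSpace X] {F : X → Type*} [∀ x, NonUnitalCStarAlgebra (F x)]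

namespace IsUSCBundle

variable [TopologicalSpace (Tot F)] (hF : IsUSCBundle F)
include hF

theorem tendsto_norm_of_tendsto_zero {ι : Type*} {l : Filter ι} {g : ι → Tot F} {x : X}
    (h : Tendsto g l (𝓝 ⟨x, 0⟩)) : Tendsto (fun i ↦ ‖(g i).val‖) l (𝓝 0) := by
  rw [Metric.tendsto_nhds]
  intro ε hε
  have h1 := hF.norm_usc ⟨x, 0⟩ ε (by simpa using hε)
  filter_upwards [h.eventually h1] with i hi
  simpa using hi

theorem continuous_section_neg {s : ∀ x, F x} (hs : Continuous fun x ↦ (⟨x, s x⟩ : Tot F)) :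
    Continuous fun x ↦ (⟨x, -s x⟩ : Tot F) := by
  have := (hF.continuous_smul (-1)).comp hs
  simpa [Function.comp_def] using this

theorem continuous_add_section {s : ∀ x, F x} (hs : Continuous fun x ↦ (⟨x, s x⟩ : Tot F)) :
    Continuous fun z : Tot F ↦ (⟨z.base, z.val + s z.base⟩ : Tot F) := by
  have h : Continuous fun z : Tot F ↦ (⟨z.base, z.val, s z.base⟩ : FibrePair F) :=
    continuous_induced_rng.2 (continuous_id.prodMk (hs.comp hF.continuous_base))
  exact hF.continuous_add.comp h

/-- A neighbourhood base of a point on a continuous section is given by tubes. -/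
theorem nhds_eq {s : ∀ x, F x} (hs : Continuous fun x ↦ (⟨x, s x⟩ : Tot F)) (x : X) :
    𝓝 (⟨x, s x⟩ : Tot F) = (𝓝 x).comap (fun z : Tot F ↦ z.base) ⊓
      (𝓝 0).comap fun z : Tot F ↦ ‖z.val - s z.base‖ := by
  refine le_antisymm (le_inf ?_ ?_) ?_
  · exact (hF.continuous_base.tendsto (⟨x, s x⟩ : Tot F)).le_comap
  · have h := (hF.continuous_add_section (hF.continuous_section_neg hs)).tendsto ⟨x, s x⟩
    simp only [add_neg_cancel] at h
    simpa only [sub_eq_add_neg] using (hF.tendsto_norm_of_tendsto_zero h).le_comap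
  · set l := (𝓝 x).comap (fun z : Tot F ↦ z.base) ⊓
      (𝓝 0).comap fun z : Tot F ↦ ‖z.val - s z.base‖
    -- Translation by the section reduces the claim to the zero section, where the neighbourhoods
    -- are prescribed by `tendsto_zero`.
    have h1 : Tendsto (fun z : Tot F ↦ (⟨z.base, z.val - s z.base⟩ : Tot F)) l (𝓝 ⟨x, 0⟩) := by
      refine Tendsto.mono_right ?_ (hF.tendsto_zero x)
      exact tendsto_inf.2 ⟨tendsto_comap_iff.2 (tendsto_comap.mono_left inf_le_left),
        tendsto_comap_iff.2 (tendsto_comap.mono_left inf_le_right)⟩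
    have h2 := ((hF.continuous_add_section hs).tendsto ⟨x, 0⟩).comp h1
    simp only [Function.comp_def, sub_add_cancel, zero_add] at h2
    exact h2

end IsUSCBundle

/-- The topology of a bundle with many sections is determined by the continuous sections. -/
theorem IsUSCBundle.topology_unique {t t' : TopologicalSpace (Tot F)}
    (h : @IsUSCBundle _ _ F _ t) (h' : @IsUSCBundle _ _ F _ t')
    (hs : ∀ z : Tot F, ∃ s : ∀ x, F x, s z.base = z.val ∧ Continuous[_, t] (fun x ↦ (⟨x, s x⟩ : Tot F)) ∧
      Continuous[_, t'] (fun x ↦ (⟨x, s x⟩ : Tot F))) : t' = t := by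
  refine TopologicalSpace.ext_nhds fun z ↦ ?_
  obtain ⟨x, v⟩ := z
  obtain ⟨s, hv, h1, h2⟩ := hs ⟨x, v⟩
  obtain rfl : s x = v := hv
  rw [@IsUSCBundle.nhds_eq _ _ F _ t h s h1, @IsUSCBundle.nhds_eq _ _ F _ t' h' s h2]

end USCBundles

/-! ### Bundles constructed from algebras of sections -/

section SectionAlgebras

/-- An injective Φ is isometric for the supremum norm, so uniform limits of sections from B come
from limits in B. -/
theorem exists_section_of_approx {X : Type*} {F : X → Type*} [∀ x, NonUnitalCStarAlgebra (F x)]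
    {B : Type*} [NonUnitalCStarAlgebra B] (Φ : B →⋆ₙₐ[ℂ] ∀ x, F x) (hΦ : Function.Injective Φ)
    {s : ∀ x, F x}
    (h : ∀ ε : ℝ, 0 < ε → ∃ b, ∀ x, ‖s x - Φ b x‖ ≤ ε) : ∃ b, Φ b = s := by
  choose b hb using fun n : ℕ ↦ h (1 / (n + 1)) Nat.one_div_pos_of_nat
  have hc : CauchySeq b := by
    refine Metric.cauchySeq_iff'.2 fun ε hε ↦ ?_
    obtain ⟨N, hN⟩ := exists_nat_one_div_lt (show 0 < ε / 3 by positivity)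
    refine ⟨N, fun n hn ↦ ?_⟩
    have h1 : (1 : ℝ) / (n + 1) ≤ 1 / (N + 1) := by gcongr
    rw [dist_eq_norm]
    refine (norm_le_of_forall_coord Φ hΦ (r := ε / 3 + ε / 3) (by positivity) fun x ↦ ?_).trans_lt
      (by linarith)
    have e : Φ (b n - b N) x = (s x - Φ (b N) x) - (s x - Φ (b n) x) := by
      rw [map_sub, Pi.sub_apply]
      abel
    rw [e]
    refine (norm_sub_le _ _).trans ?_
    have := hb n x
    have := hb N x
    linarith
  obtain ⟨c, hc⟩ := cauchySeq_tendsto_of_complete hc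
  refine ⟨c, funext fun x ↦ ?_⟩
  refine tendsto_nhds_unique (((continuous_hom (evalHom Φ x)).tendsto c).comp hc) ?_
  rw [tendsto_iff_norm_sub_tendsto_zero]
  refine squeeze_zero (fun n ↦ norm_nonneg _) (fun n ↦ ?_) tendsto_one_div_add_atTop_nhds_zero_nat
  rw [norm_sub_rev]
  exact hb n x

variable {X : Type*} [TopologicalSpace X] {F : X → Type*} [∀ x, NonUnitalCStarAlgebra (F x)]
  {B : Type*} [NonUnitalCStarAlgebra B] (Φ : B →⋆ₙₐ[ℂ] ∀ x, F x)

/-- A faithful representation of a C*-algebra by sections that vanish at infinity, which exhaust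
the fibres and form a module over the compactly supported functions. -/
structure IsSectionAlgebra : Prop where
  injective : Function.Injective Φ
  fibre_surjective : ∀ x v, ∃ b, Φ b x = v
  isCompact : ∀ b (ε : ℝ), 0 < ε → IsCompact {x | ε ≤ ‖Φ b x‖}
  exists_smul : ∀ f : C(X, ℝ), HasCompactSupport f → ∀ b, ∃ b', ∀ x, Φ b' x = (f x : ℂ) • Φ b x

/-- The topology generated by the tubes about the sections. -/
@[reducible]
def tubeTopology : TopologicalSpace (Tot F) :=
  TopologicalSpace.generateFrom {W | ∃ (b : B) (U : Set X) (ε : ℝ), IsOpen U ∧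
    W = {z : Tot F | z.base ∈ U ∧ ‖z.val - Φ b z.base‖ < ε}}

variable {Φ}

namespace IsSectionAlgebra

variable [T2Space X] (h : IsSectionAlgebra Φ)
include h

/-- Compact sets of a Hausdorff space are closed; hence the compactness of the sets where the norm
is at least ε already contains upper semicontinuity. -/
theorem eventually_norm_lt {b : B} {x : X} {ε : ℝ} (hb : ‖Φ b x‖ < ε) :
    ∀ᶠ y in 𝓝 x, ‖Φ b y‖ < ε := by
  have h1 := (h.isCompact b ε ((norm_nonneg _).trans_lt hb)).isClosed.isOpen_compl.mem_nhds
    (show x ∈ {x | ε ≤ ‖Φ b x‖}ᶜ from not_le.2 hb)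
  filter_upwards [h1] with y hy using not_le.1 hy

/-- Upper semicontinuity of ‖Φ(b - c)‖ lets a tube about any c through the point Φ(b)(x) be replaced
by a thinner one about b. This description yields continuity of all operations. -/
theorem nhds_tube (b : B) (x : X) :
    @nhds _ (tubeTopology Φ) ⟨x, Φ b x⟩ = (𝓝 x).comap (fun z : Tot F ↦ z.base) ⊓
      (𝓝 0).comap fun z : Tot F ↦ ‖z.val - Φ b z.base‖ := by
  let _ := tubeTopology Φ
  have hopen : ∀ (U : Set X) (ε : ℝ), IsOpen U →
      IsOpen {z : Tot F | z.base ∈ U ∧ ‖z.val - Φ b z.base‖ < ε} := fun U ε hU ↦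
    TopologicalSpace.isOpen_generateFrom_of_mem ⟨b, U, ε, hU, rfl⟩
  refine le_antisymm (le_inf ?_ ?_) ?_
  · rw [← tendsto_iff_comap]
    intro V hV
    obtain ⟨U, hUV, hU, hx⟩ := mem_nhds_iff.1 hV
    have h1 : (⟨x, Φ b x⟩ : Tot F) ∈ {z : Tot F | z.base ∈ U ∧ ‖z.val - Φ b z.base‖ < 1} :=
      ⟨hx, by simp⟩
    exact mem_map.2 (mem_of_superset ((hopen U 1 hU).mem_nhds h1) fun z hz ↦ hUV hz.1)
  · rw [← tendsto_iff_comap, Metric.tendsto_nhds]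
    intro ε hε
    have h1 : (⟨x, Φ b x⟩ : Tot F) ∈
        {z : Tot F | z.base ∈ Set.univ ∧ ‖z.val - Φ b z.base‖ < ε} := ⟨trivial, by simpa using hε⟩
    exact mem_of_superset ((hopen _ ε isOpen_univ).mem_nhds h1)
      fun z hz ↦ by simpa using hz.2
  · refine le_of_le_of_eq ?_ TopologicalSpace.nhds_generateFrom.symm
    refine le_iInf₂ fun W hW ↦ ?_
    obtain ⟨hW, c, U, ε, hU, rfl⟩ := hW
    obtain ⟨hx, hε⟩ := hW
    rw [le_principal_iff]
    change x ∈ U at hx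
    change ‖Φ b x - Φ c x‖ < ε at hε
    obtain ⟨δ, hδ, h'⟩ : ∃ δ > 0, ‖Φ (b - c) x‖ < ε - δ :=
      ⟨(ε - ‖Φ b x - Φ c x‖) / 2, by linarith, by rw [map_sub, Pi.sub_apply]; linarith⟩
    have h1 := ((hU.eventually_mem hx).and (h.eventually_norm_lt h')).comap
      (fun z : Tot F ↦ z.base)
    have h2 := (gt_mem_nhds hδ).comap (fun z : Tot F ↦ ‖z.val - Φ b z.base‖)
    filter_upwards [mem_inf_of_left h1, mem_inf_of_right h2] with z hz1 hz2
    refine ⟨hz1.1, ?_⟩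
    have e : z.val - Φ c z.base = (z.val - Φ b z.base) + Φ (b - c) z.base := by
      rw [map_sub, Pi.sub_apply]
      abel
    have := hz1.2
    rw [e]
    refine (norm_add_le _ _).trans_lt ?_
    linarith

theorem tendsto_tube_iff {ι : Type*} {l : Filter ι} {g : ι → Tot F} {x : X} {b : B} :
    Tendsto g l (@nhds _ (tubeTopology Φ) ⟨x, Φ b x⟩) ↔ Tendsto (fun i ↦ (g i).base) l (𝓝 x) ∧
      Tendsto (fun i ↦ ‖(g i).val - Φ b (g i).base‖) l (𝓝 0) := by
  rw [h.nhds_tube, tendsto_inf, tendsto_comap_iff, tendsto_comap_iff]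
  rfl

theorem continuous_section (b : B) :
    Continuous[_, tubeTopology Φ] fun x ↦ (⟨x, Φ b x⟩ : Tot F) := by
  let _ := tubeTopology Φ
  refine continuous_iff_continuousAt.2 fun x ↦ h.tendsto_tube_iff.2 ⟨tendsto_id, ?_⟩
  simp

theorem isUSCBundle : @IsUSCBundle _ _ F _ (tubeTopology Φ) := by
  let _ := tubeTopology Φ
  have hid : ∀ x b, Tendsto (fun z : Tot F ↦ z) (𝓝 ⟨x, Φ b x⟩) (𝓝 ⟨x, Φ b x⟩) := fun _ _ ↦ tendsto_id
  have hpair : ∀ (x : X) (b c : B),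
      Tendsto (fun z : FibrePair F ↦ z.base) (𝓝 ⟨x, Φ b x, Φ c x⟩) (𝓝 x) ∧
      Tendsto (fun z : FibrePair F ↦ ‖z.fst - Φ b z.base‖) (𝓝 ⟨x, Φ b x, Φ c x⟩) (𝓝 0) ∧
      Tendsto (fun z : FibrePair F ↦ ‖z.snd - Φ c z.base‖) (𝓝 ⟨x, Φ b x, Φ c x⟩) (𝓝 0) := by
    intro x b c
    have h0 : Continuous fun z : FibrePair F ↦
      ((⟨z.base, z.fst⟩ : Tot F), (⟨z.base, z.snd⟩ : Tot F)) := continuous_induced_dom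
    have h1 := h0.fst
    have h2 := h0.snd
    obtain ⟨h3, h4⟩ := h.tendsto_tube_iff.1 (h1.tendsto ⟨x, Φ b x, Φ c x⟩)
    obtain ⟨-, h5⟩ := h.tendsto_tube_iff.1 (h2.tendsto ⟨x, Φ b x, Φ c x⟩)
    exact ⟨h3, h4, h5⟩
  constructor
  · refine continuous_iff_continuousAt.2 fun ⟨x, v⟩ ↦ ?_
    obtain ⟨b, rfl⟩ := h.fibre_surjective x v
    exact (h.tendsto_tube_iff.1 (hid x b)).1
  · refine IsOpenMap.of_nhds_le fun ⟨x, v⟩ ↦ ?_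
    obtain ⟨b, rfl⟩ := h.fibre_surjective x v
    intro W hW
    exact mem_of_superset ((h.continuous_section b).tendsto x hW) fun y hy ↦ hy
  · rintro ⟨x, v⟩ r hr
    obtain ⟨b, rfl⟩ := h.fibre_surjective x v
    change ‖Φ b x‖ < r at hr
    obtain ⟨δ, hδ, h'⟩ : ∃ δ > 0, ‖Φ b x‖ < r - δ :=
      ⟨(r - ‖Φ b x‖) / 2, by linarith, by linarith⟩
    obtain ⟨h1, h2⟩ := h.tendsto_tube_iff.1 (hid x b)
    filter_upwards [h1.eventually (h.eventually_norm_lt h'), h2.eventually (gt_mem_nhds hδ)]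
      with z hz1 hz2
    calc ‖z.val‖ = ‖(z.val - Φ b z.base) + Φ b z.base‖ := by rw [sub_add_cancel]
      _ ≤ ‖z.val - Φ b z.base‖ + ‖Φ b z.base‖ := norm_add_le _ _
      _ < r := by linarith
  · refine continuous_iff_continuousAt.2 fun ⟨x, v, v'⟩ ↦ ?_
    obtain ⟨b, rfl⟩ := h.fibre_surjective x v
    obtain ⟨c, rfl⟩ := h.fibre_surjective x v'
    obtain ⟨h1, h2, h3⟩ := hpair x b c
    have e : Φ b x + Φ c x = Φ (b + c) x := by rw [map_add]; rfl
    unfold ContinuousAt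
    beta_reduce
    rw [e]
    refine h.tendsto_tube_iff.2 ⟨h1, ?_⟩
    refine squeeze_zero (fun _ ↦ norm_nonneg _) (fun z ↦ ?_) (by simpa using h2.add h3)
    rw [map_add, Pi.add_apply, add_sub_add_comm]
    exact norm_add_le _ _
  · refine continuous_iff_continuousAt.2 fun ⟨x, v, v'⟩ ↦ ?_
    obtain ⟨b, rfl⟩ := h.fibre_surjective x v
    obtain ⟨c, rfl⟩ := h.fibre_surjective x v'
    obtain ⟨h1, h2, h3⟩ := hpair x b c
    have e : Φ b x * Φ c x = Φ (b * c) x := by rw [map_mul]; rfl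
    unfold ContinuousAt
    beta_reduce
    rw [e]
    refine h.tendsto_tube_iff.2 ⟨h1, ?_⟩
    have h4 := (h2.mul (h3.add_const ‖c‖)).add (h3.const_mul ‖b‖)
    refine squeeze_zero (fun _ ↦ norm_nonneg _) (fun z ↦ ?_) (by simpa using h4)
    have e : z.fst * z.snd - Φ (b * c) z.base = (z.fst - Φ b z.base) * ((z.snd - Φ c z.base) +
        Φ c z.base) + Φ b z.base * (z.snd - Φ c z.base) := by
      rw [map_mul, Pi.mul_apply]
      noncomm_ring
    rw [e]
    refine (norm_add_le _ _).trans (add_le_add ((norm_mul_le _ _).trans ?_)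
      ((norm_mul_le _ _).trans ?_))
    · gcongr
      exact (norm_add_le _ _).trans (by gcongr; exact norm_coord_le Φ c _)
    · gcongr
      exact norm_coord_le Φ b _
  · refine fun k ↦ continuous_iff_continuousAt.2 fun ⟨x, v⟩ ↦ ?_
    obtain ⟨b, rfl⟩ := h.fibre_surjective x v
    obtain ⟨h1, h2⟩ := h.tendsto_tube_iff.1 (hid x b)
    have e : k • Φ b x = Φ (k • b) x := by rw [map_smul]; rfl
    unfold ContinuousAt
    beta_reduce
    rw [e]
    refine h.tendsto_tube_iff.2 ⟨h1, ?_⟩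
    refine Tendsto.congr (fun z ↦ ?_) (by simpa using h2.const_mul ‖k‖)
    rw [map_smul, Pi.smul_apply, ← smul_sub, norm_smul]
  · refine continuous_iff_continuousAt.2 fun ⟨x, v⟩ ↦ ?_
    obtain ⟨b, rfl⟩ := h.fibre_surjective x v
    obtain ⟨h1, h2⟩ := h.tendsto_tube_iff.1 (hid x b)
    have e : star (Φ b x) = Φ (star b) x := by rw [map_star]; rfl
    unfold ContinuousAt
    beta_reduce
    rw [e]
    refine h.tendsto_tube_iff.2 ⟨h1, ?_⟩
    refine Tendsto.congr (fun z ↦ ?_) h2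
    rw [map_star, Pi.star_apply, ← star_sub, norm_star]
  · intro x
    have := h.nhds_tube 0 x
    rw [map_zero] at this
    simpa using this.ge

theorem isContinuousBundle (hc : ∀ b, Continuous fun x ↦ ‖Φ b x‖) :
    @IsContinuousBundle _ F _ (tubeTopology Φ) := by
  let _ := tubeTopology Φ
  refine continuous_iff_continuousAt.2 fun ⟨x, v⟩ ↦ ?_
  obtain ⟨b, rfl⟩ := h.fibre_surjective x v
  obtain ⟨h1, h2⟩ := h.tendsto_tube_iff.1 (tendsto_id (x := 𝓝 (⟨x, Φ b x⟩ : Tot F)))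
  have h3 := ((hc b).tendsto x).comp h1
  refine (tendsto_iff_of_dist (squeeze_zero (fun _ ↦ dist_nonneg) (fun z ↦ ?_) h2)).1 h3
  rw [dist_comm, Real.dist_eq]
  exact abs_norm_sub_norm_le _ _

/-- A continuous section is locally close to sections from B; a partition of unity over the compact
set where its norm is at least ε glues these to a uniform approximation. -/
theorem range_eq [LocallyCompactSpace X] : Set.range Φ = @sectionsC0 _ _ F _ (tubeTopology Φ) := by
  let _ := tubeTopology Φ
  refine Set.Subset.antisymm ?_ fun s hs ↦ ?_
  · rintro _ ⟨b, rfl⟩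
    exact ⟨h.continuous_section b, h.isCompact b⟩
  obtain ⟨hs, hK⟩ := hs
  refine exists_section_of_approx Φ h.injective fun ε hε ↦ ?_
  choose b hb using fun x ↦ h.fibre_surjective x (s x)
  have h1 : ∀ x, ∃ U : Set X, IsOpen U ∧ x ∈ U ∧ ∀ y ∈ U, ‖s y - Φ (b x) y‖ < ε := fun x ↦ by
    have h2 := hs.tendsto x
    rw [← hb x] at h2
    obtain ⟨-, h3⟩ := h.tendsto_tube_iff.1 h2
    obtain ⟨U, hU, hUo, hx⟩ := mem_nhds_iff.1 (h3.eventually (gt_mem_nhds hε))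
    exact ⟨U, hUo, hx, hU⟩
  choose U hU hxU hUs using h1
  obtain ⟨t, ht⟩ := (hK ε hε).elim_finite_subcover U hU fun x _ ↦ Set.mem_iUnion.2 ⟨x, hxU x⟩
  obtain ⟨g, hgc, hgs, hg0, hg1, hgK⟩ := exists_finite_partition (hK ε hε) (fun i : t ↦ U i)
    (fun i ↦ hU i) (by simpa [Set.iUnion_subtype] using ht)
  choose c hc using fun i : t ↦ h.exists_smul (g i) (hgc i) (b i)
  refine ⟨∑ i, c i, fun x ↦ ?_⟩
  -- The error is a convex combination of errors of norm at most ε: the local ones where gᵢ ≠ 0, and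
  -- s itself, whose coefficient vanishes wherever ‖s‖ ≥ ε.
  have e : s x - Φ (∑ i, c i) x = ((1 - ∑ i, g i x : ℝ) : ℂ) • s x +
      ∑ i, (g i x : ℂ) • (s x - Φ (b i) x) := by
    rw [map_sum, Finset.sum_apply]
    simp_rw [hc, smul_sub, Finset.sum_sub_distrib, ← Finset.sum_smul]
    rw [Complex.ofReal_sub, Complex.ofReal_one, sub_smul, one_smul, Complex.ofReal_sum]
    abel
  rw [e]
  have h2 : ‖∑ i, (g i x : ℂ) • (s x - Φ (b i) x)‖ ≤ (∑ i, g i x) * ε := by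
    rw [Finset.sum_mul]
    refine norm_sum_le_of_le _ fun i _ ↦ ?_
    rw [norm_smul, Complex.norm_real, Real.norm_of_nonneg (hg0 i x)]
    by_cases hx : g i x = 0
    · simp [hx]
    · gcongr
      · exact hg0 i x
      · exact (hUs i x (hgs i (subset_tsupport _ hx))).le
  have h3 : ‖((1 - ∑ i, g i x : ℝ) : ℂ) • s x‖ ≤ (1 - ∑ i, g i x) * ε := by
    rw [norm_smul, Complex.norm_real, Real.norm_of_nonneg (sub_nonneg.2 (hg1 x))]
    by_cases hx : ε ≤ ‖s x‖
    · rw [hgK x hx]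
      simp
    · exact mul_le_mul_of_nonneg_left (not_le.1 hx).le (sub_nonneg.2 (hg1 x))
  refine (norm_add_le _ _).trans ((add_le_add h3 h2).trans_eq ?_)
  ring

theorem topology_unique [LocallyCompactSpace X] {t' : TopologicalSpace (Tot F)}
    (h' : @IsUSCBundle _ _ F _ t') (hr : Set.range Φ = @sectionsC0 _ _ F _ t') :
    t' = tubeTopology Φ := by
  refine IsUSCBundle.topology_unique h.isUSCBundle h' fun ⟨x, v⟩ ↦ ?_
  obtain ⟨b, rfl⟩ := h.fibre_surjective x v
  have hb : Φ b ∈ @sectionsC0 _ _ F _ t' := hr ▸ ⟨b, rfl⟩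
  exact ⟨Φ b, rfl, h.continuous_section b, hb.1⟩

end IsSectionAlgebra

/-- The functions that multiply sections to sections. -/
def multiplierAlgebra (Φ : B →⋆ₙₐ[ℂ] ∀ x, F x) : StarSubalgebra ℂ C(OnePoint X, ℂ) where
  carrier := {f | ∀ b, ∃ b', ∀ x : X, Φ b' x = f x • Φ b x}
  mul_mem' := fun {f g} hf hg b ↦ by
    obtain ⟨b', hb'⟩ := hg b
    obtain ⟨b'', hb''⟩ := hf b'
    exact ⟨b'', fun x ↦ by rw [hb'', hb', smul_smul]; rfl⟩
  add_mem' := fun {f g} hf hg b ↦ by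
    obtain ⟨b', hb'⟩ := hf b
    obtain ⟨b'', hb''⟩ := hg b
    exact ⟨b' + b'', fun x ↦ by
      rw [map_add, Pi.add_apply, hb'', hb', ← add_smul]; rfl⟩
  algebraMap_mem' := fun k b ↦ ⟨k • b, fun x ↦ by rw [map_smul]; rfl⟩
  star_mem' := fun {f} hf b ↦ by
    obtain ⟨b', hb'⟩ := hf (star b)
    exact ⟨star b', fun x ↦ by
      rw [map_star, Pi.star_apply, hb', map_star, star_smul, Pi.star_apply, star_star]; rfl⟩

theorem isClosed_multiplierAlgebra (hΦ : Function.Injective Φ) :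
    IsClosed (multiplierAlgebra Φ : Set C(OnePoint X, ℂ)) := by
  refine isClosed_of_closure_subset fun f hf b ↦ ?_
  obtain ⟨b', hb'⟩ := exists_section_of_approx Φ hΦ (s := fun x ↦ f x • Φ b x) fun ε hε ↦ by
    obtain ⟨g, hg, hfg⟩ := Metric.mem_closure_iff.1 hf (ε / (‖b‖ + 1)) (by positivity)
    obtain ⟨b', hb'⟩ := hg b
    refine ⟨b', fun x ↦ ?_⟩
    rw [hb', ← sub_smul, norm_smul]
    rw [dist_eq_norm] at hfg
    calc ‖f x - g x‖ * ‖Φ b x‖ ≤ (ε / (‖b‖ + 1)) * (‖b‖ + 1) := by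
          gcongr
          · exact ((f - g).norm_coe_le_norm x).trans hfg.le
          · exact (norm_coord_le Φ b x).trans (by linarith)
      _ = ε := by field_simp
  exact ⟨b', fun x ↦ congrFun hb' x⟩

/-- The extension by zero of a function that vanishes at infinity to the one-point
compactification. -/
def extendByZero [T2Space X] (f : C₀(X, ℂ)) : C(OnePoint X, ℂ) :=
  OnePoint.continuousMapMk f.toContinuousMap 0 (by
    rw [coclosedCompact_eq_cocompact]
    exact f.zero_at_infty')

/-- Stone–Weierstrass on the one-point compactification: `h0` separates points from infinity and
`h1` separates them from each other. The multipliers form a closed unital star subalgebra, hence are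
all continuous functions. -/
theorem exists_smul_of_separates [T2Space X] [LocallyCompactSpace X] (hΦ : Function.Injective Φ)
    (h0 : ∀ x, ∃ f : C₀(X, ℂ), (∀ b, ∃ b', ∀ y, Φ b' y = f y • Φ b y) ∧ f x ≠ 0)
    (h1 : ∀ x x', x ≠ x' → ∃ f : C₀(X, ℂ), (∀ b, ∃ b', ∀ y, Φ b' y = f y • Φ b y) ∧ f x ≠ f x')
    (f : C(X, ℝ)) (hf : HasCompactSupport f) (b : B) :
    ∃ b', ∀ x, Φ b' x = (f x : ℂ) • Φ b x := by
  have hsep : (multiplierAlgebra Φ).SeparatesPoints := by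
    intro x y hxy
    have key : ∀ f : C₀(X, ℂ), (∀ b, ∃ b', ∀ y, Φ b' y = f y • Φ b y) →
        extendByZero f ∈ multiplierAlgebra Φ := fun f hf ↦ hf
    induction x using OnePoint.rec with
    | infty =>
      induction y using OnePoint.rec with
      | infty => exact absurd rfl hxy
      | coe y =>
        obtain ⟨f, hf, hfy⟩ := h0 y
        exact ⟨_, ⟨_, key f hf, rfl⟩, hfy.symm⟩
    | coe x =>
      induction y using OnePoint.rec with
      | infty =>
        obtain ⟨f, hf, hfx⟩ := h0 x
        exact ⟨_, ⟨_, key f hf, rfl⟩, hfx⟩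
      | coe y =>
        obtain ⟨f, hf, hfx⟩ := h1 x y fun h ↦ hxy (congrArg _ h)
        exact ⟨_, ⟨_, key f hf, rfl⟩, hfx⟩
  have h2 := ContinuousMap.starSubalgebra_topologicalClosure_eq_top_of_separatesPoints _ hsep
  have h3 : extendByZero (compactToC0 f hf) ∈ (multiplierAlgebra Φ).topologicalClosure :=
    h2 ▸ StarSubalgebra.mem_top
  have h4 : extendByZero (compactToC0 f hf) ∈ multiplierAlgebra Φ := by
    have := (isClosed_multiplierAlgebra hΦ).closure_eq
    exact this.subset h3
  exact h4 b

end SectionAlgebras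

/-! ### Topology of the extension space -/

section PartialDynamics

variable {X : Type v} {Δ : Set X} {φ : Δ → X} {Y : Set X}

theorem iter_congr {n m : ℕ} (h : n = m) {x : X} (hn : x ∈ dom φ n) (hm : x ∈ dom φ m) :
    iter φ n x hn = iter φ m x hm := by
  subst h
  rfl

theorem iter_mem : ∀ (n : ℕ) (x : X) (h : x ∈ dom φ (n + 1)),
    iter φ n x (dom_antitone φ n.le_succ h) ∈ Δ
  | 0, _, h => h.fst
  | n + 1, _, h => iter_mem n _ h.snd

theorem iter_succ' : ∀ (n : ℕ) (x : X) (h : x ∈ dom φ (n + 1)),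
    iter φ (n + 1) x h = φ ⟨iter φ n x (dom_antitone φ n.le_succ h), iter_mem n x h⟩
  | 0, _, _ => rfl
  | n + 1, _, h => iter_succ' n _ h.snd

namespace ExtSpace

theorem toSeq_fin_of_le {N n : ℕ} {x : X} {hx : x ∈ dom φ N} {hY : x ∈ Y} (h : n ≤ N) :
    toSeq (fin N x hx hY : ExtSpace φ Y) n =
      .inl (iter φ (N - n) x (dom_antitone φ (Nat.sub_le N n) hx)) := if_pos h

theorem toSeq_fin_self {N : ℕ} {x : X} {hx : x ∈ dom φ N} {hY : x ∈ Y} :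
    toSeq (fin N x hx hY : ExtSpace φ Y) N = .inl x :=
  (toSeq_fin_of_le le_rfl).trans (congrArg _ (iter_congr (m := 0) (Nat.sub_self N) _ trivial))

theorem toSeq_fin_of_lt {N n : ℕ} {x : X} {hx : x ∈ dom φ N} {hY : x ∈ Y} (h : N < n) :
    toSeq (fin N x hx hY : ExtSpace φ Y) n = .inr () := if_neg (not_le.2 h)

theorem toSeq_zero : ∀ p : ExtSpace φ Y, toSeq p 0 = .inl p.head
  | fin N _ _ _ => toSeq_fin_of_le N.zero_le
  | inf _ _ => rfl

theorem exists_toSeq_of_succ : ∀ (p : ExtSpace φ Y) (n : ℕ) (x : X), toSeq p (n + 1) = .inl x →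
    ∃ hx : x ∈ Δ, toSeq p n = .inl (φ ⟨x, hx⟩)
  | fin N y hy hY, n, x, h => by
    by_cases hn : n + 1 ≤ N
    · rw [toSeq_fin_of_le hn] at h
      obtain rfl := Sum.inl_injective h
      have e : N - n = N - (n + 1) + 1 := by omega
      have hd : y ∈ dom φ (N - (n + 1) + 1) := e ▸ dom_antitone φ (Nat.sub_le N n) hy
      refine ⟨iter_mem _ y hd, ?_⟩
      rw [toSeq_fin_of_le (by omega), ← iter_succ' _ _ hd, iter_congr e]
    · rw [toSeq_fin_of_lt (by omega)] at h
      cases h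
  | inf y hy, n, x, h => by
    obtain rfl : y (n + 1) = x := Sum.inl_injective h
    obtain ⟨h1, h2⟩ := hy n
    exact ⟨h1, congrArg _ h2.symm⟩

theorem mem_of_toSeq_succ : ∀ (p : ExtSpace φ Y) (n : ℕ) (x : X), toSeq p n = .inl x →
    toSeq p (n + 1) = .inr () → ∃ (hx : x ∈ dom φ n) (hY : x ∈ Y), p = fin n x hx hY
  | fin N y hy hY, n, x, h, h' => by
    obtain hn | rfl | hn := lt_trichotomy n N
    · rw [toSeq_fin_of_le (by omega)] at h'
      cases h'
    · rw [toSeq_fin_self] at h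
      obtain rfl := Sum.inl_injective h
      exact ⟨hy, hY, rfl⟩
    · rw [toSeq_fin_of_lt hn] at h
      cases h
  | inf y hy, n, x, h, h' => by cases h'

theorem exists_iter {s : ℕ → X ⊕ Unit}
    (hs : ∀ n x, s (n + 1) = .inl x → ∃ hx : x ∈ Δ, s n = .inl (φ ⟨x, hx⟩)) (n : ℕ) :
    ∀ (k : ℕ) (x : X), s (n + k) = .inl x → ∃ h : x ∈ dom φ k, s n = .inl (iter φ k x h)
  | 0, _, h => ⟨trivial, h⟩
  | k + 1, x, h => by
    obtain ⟨hx, h1⟩ := hs (n + k) x h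
    obtain ⟨h2, h3⟩ := exists_iter hs n k _ h1
    exact ⟨⟨hx, h2⟩, h3⟩

theorem exists_iter_toSeq (p : ExtSpace φ Y) {n k : ℕ} {x : X} (h : toSeq p (n + k) = .inl x) :
    ∃ h : x ∈ dom φ k, toSeq p n = .inl (iter φ k x h) :=
  exists_iter p.exists_toSeq_of_succ n k x h

theorem mem_dom_of_toSeq (p : ExtSpace φ Y) {n : ℕ} {x : X} (h : toSeq p n = .inl x) :
    x ∈ dom φ n := by
  obtain ⟨h, -⟩ := p.exists_iter_toSeq (n := 0) (k := n) (by rwa [zero_add])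
  exact h

theorem head_eq_iter (p : ExtSpace φ Y) {n : ℕ} {x : X} (h : toSeq p n = .inl x) :
    p.head = iter φ n x (p.mem_dom_of_toSeq h) := by
  obtain ⟨h1, h2⟩ := p.exists_iter_toSeq (n := 0) (k := n) (by rwa [zero_add])
  rw [toSeq_zero] at h2
  exact Sum.inl_injective h2

/-- The sequences for which the points of the extension space stand. -/
theorem mem_range_toSeq {s : ℕ → X ⊕ Unit} : s ∈ Set.range (toSeq : ExtSpace φ Y → ℕ → X ⊕ Unit) ↔
    (∃ x, s 0 = .inl x) ∧ (∀ n x, s (n + 1) = .inl x → ∃ hx : x ∈ Δ, s n = .inl (φ ⟨x, hx⟩)) ∧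
      ∀ n x, s n = .inl x → s (n + 1) = .inr () → x ∈ Y := by
  classical
  constructor
  · rintro ⟨p, rfl⟩
    refine ⟨⟨_, p.toSeq_zero⟩, p.exists_toSeq_of_succ, fun n x h h' ↦ ?_⟩
    obtain ⟨-, hY, -⟩ := p.mem_of_toSeq_succ n x h h'
    exact hY
  · rintro ⟨h0, hs, hY⟩
    -- `Nat.find h` is the last index with a coordinate in X: by minimality there is one, and a
    -- later coordinate in X would, by `exists_iter`, force the next one to be in X as well.
    by_cases h : ∃ n, s (n + 1) = .inr ()
    · obtain ⟨x, hx⟩ : ∃ x, s (Nat.find h) = .inl x := by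
        rcases hN : Nat.find h with _ | N
        · exact h0
        · rcases hsN : s (N + 1) with x | ⟨⟩
          · exact ⟨x, rfl⟩
          · exact absurd hsN (Nat.find_min h (by omega))
      have hd := exists_iter hs 0 (Nat.find h) x (by rwa [zero_add])
      refine ⟨fin (Nat.find h) x hd.1 (hY _ x hx (Nat.find_spec h)), funext fun n ↦ ?_⟩
      by_cases hn : n ≤ Nat.find h
      · rw [toSeq_fin_of_le hn]
        obtain ⟨h1, h2⟩ := exists_iter hs n (Nat.find h - n) x (by rwa [Nat.add_sub_cancel' hn])
        exact h2.symm
      · rw [toSeq_fin_of_lt (by omega)]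
        rcases hsn : s n with y | ⟨⟩
        · obtain ⟨h1, h2⟩ := exists_iter hs (Nat.find h + 1) (n - (Nat.find h + 1)) y
            (by rwa [Nat.add_sub_cancel' (by omega)])
          rw [Nat.find_spec h] at h2
          cases h2
        · rfl
    · have h1 : ∀ n, ∃ x, s n = .inl x := fun n ↦ by
        rcases n with _ | n
        · exact h0
        · rcases hsN : s (n + 1) with x | ⟨⟩
          · exact ⟨x, rfl⟩
          · exact absurd ⟨n, hsN⟩ h
      choose x hx using h1
      refine ⟨inf x fun n ↦ ?_, funext fun n ↦ (hx n).symm⟩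
      obtain ⟨h2, h3⟩ := hs n (x (n + 1)) (hx (n + 1))
      rw [hx n] at h3
      exact ⟨h2, (Sum.inl_injective h3).symm⟩

theorem toSeq_injective : Function.Injective (toSeq : ExtSpace φ Y → ℕ → X ⊕ Unit)
  | fin N x hx hY, q, h => by
    have h1 : toSeq q N = .inl x := by rw [← h, toSeq_fin_self]
    have h2 : toSeq q (N + 1) = .inr () := by rw [← h, toSeq_fin_of_lt (by omega)]
    obtain ⟨_, _, h3⟩ := q.mem_of_toSeq_succ N x h1 h2
    exact h3.symm
  | inf x hx, fin M y hy hY, h => by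
    have h1 := congrFun h (M + 1)
    rw [toSeq_fin_of_lt (by omega)] at h1
    cases h1
  | inf x hx, inf y hy, h => by
    obtain rfl : x = y := funext fun n ↦ Sum.inl_injective (congrFun h n)
    rfl

theorem eq_inf_of_forall (p : ExtSpace φ Y) (h : ∀ n, ∃ x, toSeq p n = .inl x) :
    ∃ x hx, p = inf x hx := by
  cases p with
  | fin N x hx hY =>
    obtain ⟨y, hy⟩ := h (N + 1)
    rw [toSeq_fin_of_lt (by omega)] at hy
    cases hy
  | inf x hx => exact ⟨x, hx, rfl⟩

theorem toSeq_shift_zero : ∀ (p : ExtSpace φ Y) (h : p.head ∈ Δ),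
    toSeq (p.shift h) 0 = .inl (φ ⟨p.head, h⟩)
  | fin N x hx hY, h => by
    rw [toSeq_zero]
    exact congrArg _ (iter_succ' N x (dom_succ φ N x hx h))
  | inf x hx, h => rfl

theorem toSeq_shift_succ : ∀ (p : ExtSpace φ Y) (h : p.head ∈ Δ) (n : ℕ),
    toSeq (p.shift h) (n + 1) = toSeq p n
  | fin N x hx hY, h, n => by
    by_cases hn : n ≤ N
    · refine (toSeq_fin_of_le (Nat.succ_le_succ hn)).trans
        (Eq.trans ?_ (toSeq_fin_of_le hn).symm)
      exact congrArg _ (iter_congr (Nat.succ_sub_succ N n) _ _)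
    · exact (toSeq_fin_of_lt (by omega)).trans (toSeq_fin_of_lt (by omega)).symm
  | inf x hx, h, n => rfl

theorem mem_range_extMap {q : ExtSpace φ Y} :
    q ∈ Set.range (extMap (φ := φ) (Y := Y)) ↔ ∃ x, toSeq q 1 = .inl x := by
  constructor
  · rintro ⟨p, rfl⟩
    exact ⟨p.1.head, (toSeq_shift_succ p.1 p.2 0).trans p.1.toSeq_zero⟩
  · rintro ⟨x, hx⟩
    cases q with
    | fin N y hy hY =>
      rcases N with _ | N
      · rw [toSeq_fin_of_lt zero_lt_one] at hx
        cases hx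
      · exact ⟨⟨fin N y (dom_antitone φ N.le_succ hy) hY, iter_mem N y hy⟩, rfl⟩
    | inf y hy =>
      refine ⟨⟨inf _ hy.tail, (hy 0).fst⟩, toSeq_injective (funext fun n ↦ ?_)⟩
      rcases n with _ | n
      · exact congrArg _ (hy 0).snd
      · rfl

/-- Points whose coordinate with index `n` belongs to a given set. -/
def coordIn (φ : Δ → X) (Y : Set X) (n : ℕ) (K : Set X) : Set (ExtSpace φ Y) :=
  {p | ∃ x ∈ K, toSeq p n = .inl x}

theorem coordIn_eq (n : ℕ) (K : Set X) :
    coordIn φ Y n K = (fun p ↦ toSeq p n) ⁻¹' (Sum.inl '' K) := by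
  ext p
  simp [coordIn, eq_comm]

variable [TopologicalSpace X]

theorem isInducing_toSeq : IsInducing (toSeq : ExtSpace φ Y → ℕ → X ⊕ Unit) := ⟨rfl⟩

theorem isEmbedding_toSeq : IsEmbedding (toSeq : ExtSpace φ Y → ℕ → X ⊕ Unit) :=
  ⟨isInducing_toSeq, toSeq_injective⟩

theorem continuous_toSeq (n : ℕ) : Continuous fun p : ExtSpace φ Y ↦ toSeq p n :=
  (continuous_apply n).comp isInducing_toSeq.continuous

theorem continuous_head : Continuous (head : ExtSpace φ Y → X) := by
  refine (IsEmbedding.inl (Y := Unit)).continuous_iff.2 ?_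
  exact (continuous_toSeq 0).congr toSeq_zero

theorem t2Space [T2Space X] : T2Space (ExtSpace φ Y) := isEmbedding_toSeq.t2Space

theorem isOpen_coordIn (n : ℕ) {U : Set X} (hU : IsOpen U) : IsOpen (coordIn φ Y n U) := by
  rw [coordIn_eq]
  exact (IsOpenEmbedding.inl.isOpenMap U hU).preimage (continuous_toSeq n)

theorem isClosed_coordIn (n : ℕ) {K : Set X} (hK : IsClosed K) : IsClosed (coordIn φ Y n K) := by
  rw [coordIn_eq]
  exact (IsClosedEmbedding.inl.isClosedMap K hK).preimage (continuous_toSeq n)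

theorem continuous_iter (hφ : IsProperMap φ) : ∀ n : ℕ, Continuous fun x : dom φ n ↦ iter φ n x.1 x.2
  | 0 => continuous_subtype_val
  | n + 1 => by
    have h : Continuous fun x : dom φ (n + 1) ↦
        (⟨φ ⟨x.1, x.2.fst⟩, x.2.snd⟩ : dom φ n) :=
      (hφ.continuous.comp (continuous_subtype_val.subtype_mk _)).subtype_mk _
    exact (continuous_iter hφ n).comp h

/-- Deleting the first coordinate is a continuous left inverse, and the range consists of the
sequences whose coordinate with index 1 lies in X, a closed condition because {0} is open. -/
theorem isClosedEmbedding_extMap (hφ : IsProperMap φ) :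
    IsClosedEmbedding (extMap (φ := φ) (Y := Y)) := by
  have h1 : Continuous (extMap (φ := φ) (Y := Y)) := by
    refine continuous_induced_rng.2 (continuous_pi fun n ↦ ?_)
    rcases n with _ | n
    · have h : Continuous fun p : (extDom : Set (ExtSpace φ Y)) ↦
          (Sum.inl (φ ⟨p.1.head, p.2⟩) : X ⊕ Unit) :=
        continuous_inl.comp (hφ.continuous.comp
          ((continuous_head.comp continuous_subtype_val).subtype_mk _))
      exact h.congr fun p ↦ (toSeq_shift_zero p.1 p.2).symm
    · exact ((continuous_toSeq n).comp continuous_subtype_val).congr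
        fun p ↦ (toSeq_shift_succ p.1 p.2 n).symm
  have h2 : Continuous fun s : ℕ → X ⊕ Unit ↦ fun n ↦ s (n + 1) := by fun_prop
  have h3 : IsEmbedding ((fun (s : ℕ → X ⊕ Unit) n ↦ s (n + 1)) ∘
      (toSeq ∘ extMap (φ := φ) (Y := Y))) := by
    have e : (fun (s : ℕ → X ⊕ Unit) n ↦ s (n + 1)) ∘ (toSeq ∘ extMap (φ := φ) (Y := Y)) =
        toSeq ∘ Subtype.val := funext fun p ↦ funext fun n ↦ toSeq_shift_succ p.1 p.2 n
    rw [e]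
    exact isEmbedding_toSeq.comp IsEmbedding.subtypeVal
  refine ⟨IsEmbedding.of_comp h1 (h2.comp isInducing_toSeq.continuous) h3, ?_⟩
  have e : Set.range (extMap (φ := φ) (Y := Y)) = coordIn φ Y 1 Set.univ := by
    ext q
    rw [mem_range_extMap]
    simp [coordIn]
  rw [e]
  exact isClosed_coordIn 1 isClosed_univ

variable [T2Space X]

/-- Every condition of `mem_range_toSeq` is closed. For the link between consecutive coordinates
this uses properness of φ: the map x ↦ (φ(x), x) is then proper, so its range is closed in X × X
although Δ is a subset that need not be closed. -/
theorem isClosed_range_toSeq (hφ : IsProperMap φ) (hY : IsClosed Y)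
    : IsClosed (Set.range (toSeq : ExtSpace φ Y → ℕ → X ⊕ Unit)) := by
  have hg : IsProperMap fun x : Δ ↦ (φ x, x.1) :=
    isProperMap_of_comp_of_t2 (hφ.continuous.prodMk continuous_subtype_val) continuous_fst hφ
  have hinl : IsProperMap (Sum.inl : X → X ⊕ Unit) := IsClosedEmbedding.inl.isProperMap
  have hG := ((hinl.prodMap hinl).comp hg).isClosed_range
  have e : Set.range (toSeq : ExtSpace φ Y → ℕ → X ⊕ Unit) =
      {s | s 0 ∈ Set.range Sum.inl} ∩
        ((⋂ n, {s | s (n + 1) ∈ Set.range Sum.inr ∨ (s n, s (n + 1)) ∈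
          Set.range (Prod.map Sum.inl Sum.inl ∘ fun x : Δ ↦ (φ x, x.1))}) ∩
        ⋂ n, {s | s (n + 1) ∈ Set.range Sum.inl ∨ (s n ∈ Set.range Sum.inr ∨ s n ∈ Sum.inl '' Y)}) := by
    ext s
    rw [mem_range_toSeq]
    simp only [Set.mem_inter_iff, Set.mem_iInter, Set.mem_ofPred_eq]
    refine and_congr (by simp [eq_comm]) (and_congr (forall_congr' fun n ↦ ?_)
      (forall_congr' fun n ↦ ?_))
    · rcases h : s (n + 1) with x | ⟨⟩
      · simp only [Sum.inl.injEq, Set.mem_range, reduceCtorEq, exists_false, false_or,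
          Function.comp_apply, Prod.map_apply, Prod.mk.injEq, Subtype.exists]
        constructor
        · intro h'
          obtain ⟨hx, h'⟩ := h' x rfl
          exact ⟨x, hx, h'.symm, rfl⟩
        · rintro ⟨y, hy, h1, rfl⟩ x rfl
          exact ⟨hy, h1.symm⟩
      · simp
    · rcases h : s (n + 1) with x | ⟨⟩
      · simp
      · rcases h' : s n with x | ⟨⟩ <;> simp
  rw [e]
  refine (isClosed_range_inl.preimage (continuous_apply 0)).inter
    ((isClosed_iInter fun n ↦ ?_).inter (isClosed_iInter fun n ↦ ?_))
  · exact (isClosed_range_inr.preimage (continuous_apply (n + 1))).union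
      (hG.preimage (f := fun s : ℕ → X ⊕ Unit ↦ (s n, s (n + 1))) (by fun_prop))
  · exact (isClosed_range_inl.preimage (continuous_apply (n + 1))).union
      ((isClosed_range_inr.preimage (continuous_apply n)).union
        ((IsClosedEmbedding.inl.isClosedMap Y hY).preimage
          (f := fun s : ℕ → X ⊕ Unit ↦ s n) (continuous_apply n)))

/-- The coordinates with index n of the points over K lie in the n-th preimage of K under φ or are
0. These preimages are compact by properness, and Tychonoff's theorem applies. -/
theorem isCompact_preimage_head (hφ : IsProperMap φ) (hY : IsClosed Y)
    {K : Set X} (hK : IsCompact K) :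
    IsCompact (head ⁻¹' K : Set (ExtSpace φ Y)) := by
  let L : ℕ → Set X := fun n ↦ Nat.rec K (fun _ L ↦ Subtype.val '' (φ ⁻¹' L)) n
  have hL : ∀ n, IsCompact (L n) := fun n ↦ by
    induction n with
    | zero => exact hK
    | succ n ih => exact (hφ.isCompact_preimage ih).image continuous_subtype_val
  let C : ℕ → Set (X ⊕ Unit) := fun n ↦ Sum.inl '' L n ∪ {.inr ()}
  have hC : IsCompact (Set.univ.pi C) := isCompact_univ_pi fun n ↦
    ((hL n).image continuous_inl).union isCompact_singleton
  rw [isInducing_toSeq.isCompact_iff]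
  refine hC.of_isClosed_subset ?_ ?_
  · have e : toSeq '' (head ⁻¹' K : Set (ExtSpace φ Y)) =
        Set.range (toSeq : ExtSpace φ Y → ℕ → X ⊕ Unit) ∩ (fun s ↦ s 0) ⁻¹' (Sum.inl '' K) := by
      ext s
      constructor
      · rintro ⟨p, hp, rfl⟩
        exact ⟨⟨p, rfl⟩, p.head, hp, p.toSeq_zero.symm⟩
      · rintro ⟨⟨p, rfl⟩, x, hx, h⟩
        refine ⟨p, ?_, rfl⟩
        have h1 : Sum.inl x = toSeq p 0 := h
        rw [toSeq_zero] at h1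
        rwa [Set.mem_preimage, ← Sum.inl_injective h1]
    rw [e]
    exact (isClosed_range_toSeq hφ hY).inter
      ((IsClosedEmbedding.inl.isClosedMap K hK.isClosed).preimage (continuous_apply 0))
  · rintro _ ⟨p, hp, rfl⟩ n -
    induction n with
    | zero => exact .inl ⟨p.head, hp, p.toSeq_zero.symm⟩
    | succ n ih =>
      rcases h : toSeq p (n + 1) with x | ⟨⟩
      · obtain ⟨hx, h1⟩ := p.exists_toSeq_of_succ n x h
        rw [h1] at ih
        rcases ih with ⟨y, hy, hyx⟩ | h2
        · exact .inl ⟨x, ⟨⟨x, hx⟩, by rwa [Set.mem_preimage, ← Sum.inl_injective hyx], rfl⟩, rfl⟩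
        · cases h2
      · exact .inr rfl

theorem locallyCompactSpace (hφ : IsProperMap φ) (hY : IsClosed Y)
    [LocallyCompactSpace X] : LocallyCompactSpace (ExtSpace φ Y) := by
  have := t2Space (φ := φ) (Y := Y)
  have : WeaklyLocallyCompactSpace (ExtSpace φ Y) := ⟨fun p ↦ by
    obtain ⟨K, hK, hp⟩ := exists_compact_mem_nhds p.head
    exact ⟨_, isCompact_preimage_head hφ hY hK, continuous_head.continuousAt hp⟩⟩
  infer_instance

/-- The coordinate x₀ is φ^n of the coordinate with index n, so it ranges over a compact set. -/
theorem isCompact_coordIn (hφ : IsProperMap φ) (hY : IsClosed Y)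
    {n : ℕ} {K : Set X} (hK : IsCompact K) (h : K ⊆ dom φ n) :
    IsCompact (coordIn φ Y n K) := by
  have hK' : IsCompact ((fun x : dom φ n ↦ iter φ n x.1 x.2) '' (Subtype.val ⁻¹' K)) := by
    refine IsCompact.image ?_ (continuous_iter hφ n)
    rw [IsEmbedding.subtypeVal.isCompact_iff, Subtype.image_preimage_coe,
      Set.inter_eq_right.2 h]
    exact hK
  refine (isCompact_preimage_head hφ hY hK').of_isClosed_subset (isClosed_coordIn n hK.isClosed) ?_
  rintro p ⟨x, hx, hp⟩
  exact ⟨⟨x, h hx⟩, hx, (p.head_eq_iter hp).symm⟩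

/-- A decreasing sequence of nonempty compact sets contains a backward orbit. -/
theorem exists_backwardOrbit (hφ : IsProperMap φ) {n : ℕ} (K : ℕ → Set X) (hK : ∀ k, IsCompact (K k))
    (hne : ∀ k, (K k).Nonempty) (hd : ∀ k, K k ⊆ dom φ (n + k))
    (hs : ∀ k, ∀ x ∈ K (k + 1), ∃ hx : x ∈ Δ, φ ⟨x, hx⟩ ∈ K k) :
    ∃ x, IsBackwardOrbit φ x ∧ ∀ k, x (n + k) ∈ K k := by
  -- In the extension space with Y = X every finite orbit is a point, so the sets of points whose
  -- coordinate with index n + k lies in K k are nonempty. They decrease and the first is compact.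
  obtain ⟨p, hp⟩ := IsCompact.nonempty_iInter_of_sequence_nonempty_isCompact_isClosed
    (fun k ↦ coordIn φ Set.univ (n + k) (K k))
    (by
      rintro k p ⟨x, hx, hp⟩
      obtain ⟨h1, h2⟩ := hs k x hx
      obtain ⟨h3, h4⟩ := p.exists_toSeq_of_succ _ x hp
      exact ⟨_, h2, h4⟩)
    (fun k ↦ by
      obtain ⟨x, hx⟩ := hne k
      exact ⟨fin (n + k) x (hd k hx) trivial, x, hx, toSeq_fin_self⟩)
    (isCompact_coordIn hφ isClosed_univ (hK 0) (hd 0))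
    (fun k ↦ isClosed_coordIn _ (hK k).isClosed)
  rw [Set.mem_iInter] at hp
  obtain ⟨x, hx, rfl⟩ := p.eq_inf_of_forall fun k ↦ by
    obtain ⟨y, -, hy⟩ := hp k
    rw [Nat.add_comm] at hy
    obtain ⟨h, h'⟩ := p.exists_iter_toSeq hy
    exact ⟨_, h'⟩
  refine ⟨x, hx, fun k ↦ ?_⟩
  obtain ⟨y, hy, h⟩ := hp k
  obtain rfl : x (n + k) = y := Sum.inl_injective h
  exact hy

end ExtSpace

end PartialDynamics

theorem LimAlg.exists_near {E : ℕ → Type u} [∀ n, NonUnitalCStarAlgebra (E n)]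
    (f : ∀ n, E n →⋆ₙₐ[ℂ] E (n + 1)) (x : LimAlg f) {ε : ℝ} (hε : 0 < ε) :
    ∃ n b, ‖x - limOf f n b‖ < ε := by
  have h : x ∈ closure (⋃ n, Set.range (limOf f n)) :=
    LimAlg.induction f (P := fun x ↦ x ∈ closure (⋃ n, Set.range (limOf f n))) isClosed_closure
      (fun n b ↦ subset_closure (Set.mem_iUnion.2 ⟨n, b, rfl⟩)) x
  obtain ⟨y, hy, hxy⟩ := Metric.mem_closure_iff.1 h ε hε
  obtain ⟨n, b, rfl⟩ := Set.mem_iUnion.1 hy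
  exact ⟨n, b, by rwa [dist_eq_norm] at hxy⟩

section SubAlg

variable {A : Type u} [NonUnitalCStarAlgebra A] (T : NonUnitalStarSubalgebra ℂ A)
  [IsClosed (T : Set A)]

/-- The inclusion of a closed subalgebra. -/
def valHom : SubAlg T →⋆ₙₐ[ℂ] A := NonUnitalStarSubalgebraClass.subtype T

theorem valHom_injective : Function.Injective (valHom T) := Subtype.val_injective

theorem valHom_mem (a : SubAlg T) : valHom T a ∈ T := Subtype.property (p := (· ∈ T)) a

end SubAlg

/-! ### The representation of B by sections -/

namespace C0System

variable {X : Type v} [TopologicalSpace X] {A : Type u} [NonUnitalCStarAlgebra A]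
  (S : C0System X A) (J : ClosedIdeal A)

theorem linkHom_ev {x y : X} (h : ∃ hx : x ∈ S.Δ, S.φ ⟨x, hx⟩ = y) (a : A) :
    S.linkHom h (S.μ.ev y a) = S.μ.ev x (S.α a) := by
  obtain ⟨hx, rfl⟩ := h
  exact (S.induced_of_mem a ⟨x, hx⟩).symm

theorem subA_antitone : Antitone S.subA := antitone_nat_of_succ_le S.subA_succ_le

theorem ev_iterEnd_of_notMem_dom : ∀ {n : ℕ} {x : X}, x ∉ dom S.φ n → ∀ a,
    S.μ.ev x (S.iterEnd n a) = 0
  | 0, _, h, _ => absurd trivial h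
  | n + 1, x, h, a => by
    change S.μ.ev x (S.α (S.iterEnd n a)) = 0
    by_cases hx : x ∈ S.Δ
    · rw [S.induced_of_mem _ ⟨x, hx⟩, ev_iterEnd_of_notMem_dom (fun h' ↦ h ⟨hx, h'⟩), map_zero]
    · exact S.induced_of_notMem _ x hx

theorem ev_of_notMem_dom {n : ℕ} {x : X} (hx : x ∉ dom S.φ n) {a : A} (ha : a ∈ S.subA n) :
    S.μ.ev x a = 0 := by
  let K : Submodule ℂ A := (ClosedIdeal.ker (S.μ.ev x)).toSubmodule
  refine hereditary_le (K := K) (ClosedIdeal.ker (S.μ.ev x)).isClosed' (fun d a d' ↦ ?_) ha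
  change S.μ.ev x _ = 0
  rw [map_mul, map_mul, S.ev_iterEnd_of_notMem_dom hx, zero_mul, zero_mul]

theorem act_mem_subA (f : C₀(X, ℂ)) {n : ℕ} {a : A} (ha : a ∈ S.subA n) :
    S.μ.act f a ∈ S.subA n := by
  have hcl : IsClosed (S.subA n : Set A) := inferInstance
  let K : Submodule ℂ A := (S.subA n).toSubmodule.comap (S.μ.act f : A →ₗ[ℂ] A)
  refine hereditary_le (K := K) (hcl.preimage (S.μ.act f).continuous) (fun d a d' ↦ ?_) ha
  change S.μ.act f (S.iterEnd n d * a * S.iterEnd n d') ∈ S.subA n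
  rw [S.μ.act_mul_right, S.μ.act_mul_left]
  exact mul_mem_hereditary _ _ _ _

/-- Elements of the fibre algebra A_n(x) lift to A_n, since the range of α_{(x,n)} is the image of
α^n(A) under the evaluation at x. -/
theorem exists_mem_subA {n : ℕ} {x : X} {h : x ∈ dom S.φ n} {w : S.μ.Fibre x}
    (hw : w ∈ S.fibA n x h) : ∃ a ∈ S.subA n, S.μ.ev x a = w := by
  refine exists_mem_hereditary_of_surjective (S.μ.ev_surjective x) (fun d' ↦ ?_) hw
  obtain ⟨d, rfl⟩ := S.μ.ev_surjective _ d'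
  exact ⟨d, S.ev_iterEnd n x h d⟩

/-- The last coordinate, as an element of `A`. -/
def lastVal (n : ℕ) : S.stageB J n →⋆ₙₐ[ℂ] A := (valHom (S.subA n)).comp (S.last J n)

/-- The coordinate with index `k < n`, as an element of `A/J`. -/
def coordVal (n k : ℕ) (h : k < n) : S.stageB J n →⋆ₙₐ[ℂ] J.Quot :=
  (valHom (S.quotA J k)).comp (S.coord J n ⟨k, h⟩)

theorem lastVal_mem (n : ℕ) (a : S.stageB J n) : S.lastVal J n a ∈ S.subA n :=
  valHom_mem (S.subA n) _

theorem coordVal_mem (n k : ℕ) (h : k < n) (a : S.stageB J n) :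
    S.coordVal J n k h a ∈ S.quotA J k := valHom_mem (S.quotA J k) _

theorem stage_ext {n : ℕ} {a b : S.stageB J n}
    (h : ∀ k hk, S.coordVal J n k hk a = S.coordVal J n k hk b)
    (h' : S.lastVal J n a = S.lastVal J n b) : a = b :=
  SumAlg.ext (fun k ↦ valHom_injective _ (h k k.2)) (valHom_injective _ h')

theorem exists_stage (n : ℕ) (c : ∀ k, k < n → A) (hc : ∀ k hk, c k hk ∈ S.subA k) {l : A}
    (hl : l ∈ S.subA n) : ∃ a : S.stageB J n,
      (∀ k hk, S.coordVal J n k hk a = J.proj (c k hk)) ∧ S.lastVal J n a = l :=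
  ⟨((fun k ↦ ⟨J.proj (c k k.2), S.proj_mem_quotA J (hc k k.2)⟩ :
      ∀ k : Fin n, SubAlg (S.quotA J k)), (⟨l, hl⟩ : SubAlg (S.subA n))),
    fun _ _ ↦ rfl, rfl⟩

theorem exists_coord (n : ℕ) (a : S.stageB J n) : ∃ c : ∀ k, k < n → A,
    (∀ k hk, c k hk ∈ S.subA k) ∧ ∀ k hk, S.coordVal J n k hk a = J.proj (c k hk) := by
  choose c hc hc' using fun k hk ↦ S.coordVal_mem J n k hk a
  exact ⟨c, hc, fun k hk ↦ (hc' k hk).symm⟩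

theorem lastVal_bond (n : ℕ) (a : S.stageB J n) :
    S.lastVal J (n + 1) (S.bond J n a) = S.α (S.lastVal J n a) :=
  congrArg (valHom _) (S.last_bond J n a)

theorem coordVal_bond_of_lt {n k : ℕ} (h : k < n) (a : S.stageB J n) :
    S.coordVal J (n + 1) k (h.trans n.lt_succ_self) (S.bond J n a) = S.coordVal J n k h a := by
  refine congrArg (valHom _) ((S.coord_bond J n ⟨k, h.trans n.lt_succ_self⟩ a).trans ?_)
  have h1 : S.bondCoord J n ⟨k, h.trans n.lt_succ_self⟩ = S.coord J n ⟨k, h⟩ := dif_pos h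
  rw [h1]
  rfl

theorem coordVal_bond_self (n : ℕ) (a : S.stageB J n) :
    S.coordVal J (n + 1) n n.lt_succ_self (S.bond J n a) = J.proj (S.lastVal J n a) := by
  refine (congrArg (valHom _) (S.coord_bond J n ⟨n, n.lt_succ_self⟩ a)).trans ?_
  have h1 : S.bondCoord J n ⟨n, n.lt_succ_self⟩ = (S.subProj J n n rfl).comp (S.last J n) :=
    dif_neg (lt_irrefl n)
  rw [h1]
  rfl

theorem coordVal_stageShift {n k : ℕ} (h : k < n) (a : S.stageB J (n + 1)) :
    S.coordVal J n k h (S.stageShift J n a) = S.coordVal J (n + 1) (k + 1) (Nat.succ_lt_succ h) a :=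
  congrArg (valHom _) (S.coord_stageShift J n ⟨k, h⟩ a)

theorem lastVal_stageShift (n : ℕ) (a : S.stageB J (n + 1)) :
    S.lastVal J n (S.stageShift J n a) = S.lastVal J (n + 1) a :=
  congrArg (valHom _) (S.last_stageShift J n a)

theorem quotEval_mem_quotFib {N : ℕ} {x : X} {h : x ∈ dom S.φ N} {c : J.Quot}
    (hc : c ∈ S.quotA J N) : S.μ.quotEval J x c ∈ S.quotFib J N x h := by
  obtain ⟨b, hb, rfl⟩ := hc
  exact S.proj_mem_quotFib J (S.ev_mem_fibA hb x h)

/-- The inclusion of the fibre `q_x(A_N(x))` in `A(x)/J(x)`. -/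
def finVal (N : ℕ) (x : X) (hx : x ∈ dom S.φ N) (hY : x ∈ S.μ.hull J) :
    S.FibreB J (.fin N x hx hY) →⋆ₙₐ[ℂ] (S.μ.fibreIdeal J x).Quot :=
  valHom (S.quotFib J N x hx)

theorem finVal_injective {N : ℕ} {x : X} {hx : x ∈ dom S.φ N} {hY : x ∈ S.μ.hull J} :
    Function.Injective (S.finVal J N x hx hY) := valHom_injective _

theorem norm_finVal {N : ℕ} {x : X} {hx : x ∈ dom S.φ N} {hY : x ∈ S.μ.hull J}
    (b : S.FibreB J (.fin N x hx hY)) : ‖S.finVal J N x hx hY b‖ = ‖b‖ := rfl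

theorem finVal_mem {N : ℕ} {x : X} {hx : x ∈ dom S.φ N} {hY : x ∈ S.μ.hull J}
    (b : S.FibreB J (.fin N x hx hY)) : S.finVal J N x hx hY b ∈ S.quotFib J N x hx :=
  valHom_mem _ b

/-- The fibre over `(x₀, x₁, x₂, ...)` as a direct limit. -/
def infVal {x : ℕ → X} (hx : IsBackwardOrbit S.φ x) :
    S.FibreB J (.inf x hx) →⋆ₙₐ[ℂ] LimAlg (S.orbitBond hx) :=
  NonUnitalStarAlgHom.id ℂ (LimAlg (S.orbitBond hx))

theorem infVal_injective {x : ℕ → X} {hx : IsBackwardOrbit S.φ x} :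
    Function.Injective (S.infVal J hx) := fun _ _ h ↦ h

theorem norm_infVal {x : ℕ → X} {hx : IsBackwardOrbit S.φ x} (b : S.FibreB J (.inf x hx)) :
    ‖S.infVal J hx b‖ = ‖b‖ := rfl

/-- The homomorphism `a ↦ a(x)` from `A_n` to `A_n(x)`. -/
def evSub (n : ℕ) (x : X) (hx : x ∈ dom S.φ n) : SubAlg (S.subA n) →⋆ₙₐ[ℂ] SubAlg (S.fibA n x hx) :=
  restrictHom (S.μ.ev x) (S.subA n) (S.fibA n x hx) fun _ ha ↦ S.ev_mem_fibA ha x hx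

/-- The homomorphism `a ↦ [0, ..., 0, a(x_n), α(a)(x_{n+1}), ...]`. -/
def threadAt {x : ℕ → X} (hx : IsBackwardOrbit S.φ x) (n : ℕ) :
    SubAlg (S.subA n) →⋆ₙₐ[ℂ] LimAlg (S.orbitBond hx) :=
  (limOf (S.orbitBond hx) n).comp (S.evSub n (x n) (hx.mem_dom n))

theorem orbitBond_evSub {x : ℕ → X} (hx : IsBackwardOrbit S.φ x) (n : ℕ) (a : SubAlg (S.subA n)) :
    S.orbitBond hx n (S.evSub n (x n) (hx.mem_dom n) a) =
      S.evSub (n + 1) (x (n + 1)) (hx.mem_dom (n + 1)) (S.subα n a) :=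
  Subtype.ext (S.linkHom_ev (hx n) _)

theorem threadAt_succ {x : ℕ → X} (hx : IsBackwardOrbit S.φ x) (n : ℕ) (a : SubAlg (S.subA n)) :
    S.threadAt hx (n + 1) (S.subα n a) = S.threadAt hx n a := by
  refine Eq.trans ?_ (limOf_succ (S.orbitBond hx) n (S.evSub n (x n) (hx.mem_dom n) a))
  rw [orbitBond_evSub]
  rfl

theorem norm_threadAt_le {x : ℕ → X} (hx : IsBackwardOrbit S.φ x) (n : ℕ) (a : SubAlg (S.subA n)) :
    ‖S.threadAt hx n a‖ ≤ ‖S.μ.ev (x n) (valHom _ a)‖ :=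
  NonUnitalStarAlgHom.norm_apply_le (limOf (S.orbitBond hx) n) _

/-- The homomorphism `a ↦ π(φ_n(a))(p)` for `p = (x₀, ..., x_N, 0, ...)`. -/
def stageHomFin (n N : ℕ) (x : X) (hx : x ∈ dom S.φ N) :
    S.stageB J n →⋆ₙₐ[ℂ] SubAlg (S.quotFib J N x hx) :=
  if h : N < n then
    (restrictHom (S.μ.quotEval J x) (S.quotA J N) (S.quotFib J N x hx)
      fun _ hc ↦ S.quotEval_mem_quotFib J hc).comp (S.coord J n ⟨N, h⟩)
  else
    (restrictHom ((S.μ.fibreIdeal J x).proj.comp ((S.μ.ev x).comp (S.iterEnd (N - n))))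
      (S.subA n) (S.quotFib J N x hx) fun a ha ↦ by
        have h' := S.iterEnd_mem_subA ha (N - n)
        rw [show n + (N - n) = N by omega] at h'
        exact S.proj_mem_quotFib J (S.ev_mem_fibA h' x hx)).comp (S.last J n)

/-- The homomorphism `a ↦ π(φ_n(a))(p)`. -/
def stageHom (n : ℕ) : ∀ p : S.Ext J, S.stageB J n →⋆ₙₐ[ℂ] S.FibreB J p
  | .fin N x hx _ => S.stageHomFin J n N x hx
  | .inf _ hx => (S.threadAt hx n).comp (S.last J n)

theorem finVal_stageHom_of_lt {n N : ℕ} {x : X} {hx : x ∈ dom S.φ N} {hY : x ∈ S.μ.hull J}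
    (h : N < n) (a : S.stageB J n) :
    S.finVal J N x hx hY (S.stageHom J n (.fin N x hx hY) a) =
      S.μ.quotEval J x (S.coordVal J n N h a) := by
  have h1 : S.stageHomFin J n N x hx = _ := dif_pos h
  change valHom (S.quotFib J N x hx) (S.stageHomFin J n N x hx a) = _
  rw [h1]
  rfl

theorem finVal_stageHom_of_le {n N : ℕ} {x : X} {hx : x ∈ dom S.φ N} {hY : x ∈ S.μ.hull J}
    (h : n ≤ N) (a : S.stageB J n) :
    S.finVal J N x hx hY (S.stageHom J n (.fin N x hx hY) a) =
      (S.μ.fibreIdeal J x).proj (S.μ.ev x (S.iterEnd (N - n) (S.lastVal J n a))) := by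
  have h1 : S.stageHomFin J n N x hx = _ := dif_neg (not_lt.2 h)
  change valHom (S.quotFib J N x hx) (S.stageHomFin J n N x hx a) = _
  rw [h1]
  rfl

theorem stageHom_inf {n : ℕ} {x : ℕ → X} {hx : IsBackwardOrbit S.φ x} (a : S.stageB J n) :
    S.infVal J hx (S.stageHom J n (.inf x hx) a) = S.threadAt hx n (S.last J n a) := rfl

theorem stageHom_apply (n : ℕ) (a : S.stageB J n) : ∀ p : S.Ext J,
    S.stageHom J n p a = S.stageSection J n a p
  | .fin N x hx hY => by
    apply S.finVal_injective J
    by_cases h : N < n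
    · refine (S.finVal_stageHom_of_lt J h a).trans (Eq.symm ?_)
      exact congrArg (valHom (S.quotFib J N x hx)) (dif_pos h)
    · refine (S.finVal_stageHom_of_le J (not_lt.1 h) a).trans (Eq.symm ?_)
      refine (congrArg (valHom (S.quotFib J N x hx)) (dif_neg h)).trans ?_
      exact congrArg (S.μ.fibreIdeal J x).proj (S.ev_iterEnd _ _ _ _)
  | .inf x hx => rfl

/-- The compatibility that lets the stages pass to the limit. At a point of X_N nothing changes for
N < n; for N = n the value moves from the last coordinate to q of it; for N > n one factor α moves
from the point to the coordinate. -/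
theorem stageHom_bond (n : ℕ) (a : S.stageB J n) : ∀ p : S.Ext J,
    S.stageHom J (n + 1) p (S.bond J n a) = S.stageHom J n p a
  | .fin N x hx hY => by
    apply S.finVal_injective J
    obtain h | rfl | h := lt_trichotomy N n
    · rw [finVal_stageHom_of_lt S J (h.trans n.lt_succ_self), finVal_stageHom_of_lt S J h,
        coordVal_bond_of_lt]
    · rw [finVal_stageHom_of_lt S J N.lt_succ_self, finVal_stageHom_of_le S J le_rfl,
        coordVal_bond_self, Nat.sub_self]
      rfl
    · rw [finVal_stageHom_of_le S J h, finVal_stageHom_of_le S J h.le, lastVal_bond,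
        show N - n = N - (n + 1) + 1 by omega, iterEnd_comm]
      rfl
  | .inf x hx => by
    apply S.infVal_injective J
    rw [stageHom_inf, stageHom_inf, last_bond, threadAt_succ]

/-- The representation `π` of `B` by sections. -/
def sectionHom : S.limB J →⋆ₙₐ[ℂ] ∀ p, S.FibreB J p :=
  piHom fun p ↦ limLift (f := S.bond J) (fun n ↦ S.stageHom J n p) fun n a ↦ S.stageHom_bond J n a p

theorem sectionHom_toLimB (n : ℕ) (a : S.stageB J n) (p : S.Ext J) :
    S.sectionHom J (S.toLimB J n a) p = S.stageHom J n p a :=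
  limLift_limOf (S.bond J) (fun n ↦ S.stageHom J n p) (fun n a ↦ S.stageHom_bond J n a p) n a

theorem exists_raise (n : ℕ) (a : S.stageB J n) : ∀ k : ℕ, ∃ a' : S.stageB J (n + k),
    S.toLimB J (n + k) a' = S.toLimB J n a ∧
      S.lastVal J (n + k) a' = S.iterEnd k (S.lastVal J n a)
  | 0 => ⟨a, rfl, rfl⟩
  | k + 1 => by
    obtain ⟨a', h, h'⟩ := exists_raise n a k
    exact ⟨S.bond J (n + k) a', (limOf_succ _ _ _).trans h,
      (S.lastVal_bond J (n + k) a').trans (congrArg S.α h')⟩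

theorem exists_raise_of_le {n m : ℕ} (h : n ≤ m) (a : S.stageB J n) :
    ∃ a' : S.stageB J m, S.toLimB J m a' = S.toLimB J n a := by
  obtain ⟨k, rfl⟩ := Nat.exists_eq_add_of_le h
  obtain ⟨a', h, -⟩ := S.exists_raise J n a k
  exact ⟨a', h⟩

theorem thread_orbitBond {x : ℕ → X} (hx : IsBackwardOrbit S.φ x) {n : ℕ}
    (a : SubAlg (S.subA n)) (k : ℕ) :
    valHom _ (thread (S.orbitBond hx) n (n + k) (S.evSub n (x n) (hx.mem_dom n) a)) =
      S.μ.ev (x (n + k)) (S.iterEnd k (valHom _ a)) := by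
  induction k with
  | zero =>
    rw [Nat.add_zero, thread_self]
    rfl
  | succ k ih =>
    have h1 := thread_succ (S.orbitBond hx) (Nat.le_add_right n k)
    refine (congrArg (fun ψ ↦ valHom _ (ψ (S.evSub n (x n) (hx.mem_dom n) a))) h1).trans ?_
    refine (congrArg (S.linkHom (hx (n + k))) ih).trans ?_
    exact S.linkHom_ev (hx (n + k)) _

/-- The norm at an infinite point is the limit superior of the norms along the orbit, so a bound at
the point is a bound at some finite time. -/
theorem exists_norm_ev_lt {x : ℕ → X} (hx : IsBackwardOrbit S.φ x) {n : ℕ}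
    (a : SubAlg (S.subA n)) {ε : ℝ} (h : ‖S.threadAt hx n a‖ < ε) :
    ∃ k, ‖S.μ.ev (x (n + k)) (S.iterEnd k (valHom _ a))‖ < ε := by
  have h1 : ‖seqClass _ (threadSeq (S.orbitBond hx) n (S.evSub n (x n) (hx.mem_dom n) a))‖ < ε := h
  obtain ⟨m, hm⟩ := eventually_atTop.1 (eventually_norm_lt_of_norm_seqClass_lt h1)
  refine ⟨m, ?_⟩
  rw [← S.thread_orbitBond hx a m]
  exact hm (n + m) (Nat.le_add_left m n)

theorem norm_stageHom_le {n : ℕ} (a : S.stageB J n) : ∀ (p : S.Ext J) {x : X},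
    p.toSeq n = .inl x → ‖S.stageHom J n p a‖ ≤ ‖S.μ.ev x (S.lastVal J n a)‖
  | .fin N y hy hY, x, h => by
    by_cases hn : n ≤ N
    · rw [ExtSpace.toSeq_fin_of_le hn] at h
      obtain rfl := Sum.inl_injective h
      rw [← norm_finVal, finVal_stageHom_of_le S J hn,
        ← S.ev_iterEnd (N - n) y (dom_antitone S.φ (Nat.sub_le N n) hy)]
      exact (NonUnitalStarAlgHom.norm_apply_le _ _).trans (NonUnitalStarAlgHom.norm_apply_le _ _)
    · rw [ExtSpace.toSeq_fin_of_lt (by omega)] at h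
      cases h
  | .inf y hy, x, h => by
    obtain rfl : y n = x := Sum.inl_injective h
    exact S.norm_threadAt_le hy n _

/-! ### Injectivity of the representation -/

section Injectivity

variable (hJ : ∀ j ∈ J, ∀ a, S.α a = 0 → j * a = 0)
include hJ

/-- If α(j) = 0, then j* lies in the kernel too, so jj* = 0 by orthogonality. -/
theorem eq_zero_of_mem_of_α_eq_zero {j : A} (hj : j ∈ J) (h : S.α j = 0) : j = 0 := by
  have := hJ j hj (star j) (by rw [map_star, h, star_zero])
  exact (CStarRing.mul_star_self_eq_zero_iff j).1 this

theorem bond_injective (n : ℕ) : Function.Injective (S.bond J n) := by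
  rw [injective_iff_map_eq_zero]
  intro a ha
  refine S.stage_ext J (fun k hk ↦ ?_) ?_
  · rw [← coordVal_bond_of_lt, ha, map_zero, map_zero]
  · rw [map_zero]
    refine S.eq_zero_of_mem_of_α_eq_zero J hJ ?_ ?_
    · rw [← J.proj_eq_zero, ← coordVal_bond_self, ha, map_zero]
    · rw [← lastVal_bond, ha, map_zero]

theorem norm_toLimB (n : ℕ) (a : S.stageB J n) : ‖S.toLimB J n a‖ = ‖a‖ :=
  norm_limOf_of_injective _ (S.bond_injective J hJ) n a

theorem norm_α_of_mem {j : A} (hj : j ∈ J) : ‖S.α j‖ = ‖j‖ := by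
  let ψ : J.toStarSubalgebra →⋆ₙₐ[ℂ] A :=
    S.α.comp (NonUnitalStarSubalgebraClass.subtype J.toStarSubalgebra)
  have hψ : Function.Injective ψ := by
    rw [injective_iff_map_eq_zero]
    rintro ⟨i, hi⟩ h
    exact Subtype.ext (S.eq_zero_of_mem_of_α_eq_zero J hJ hi h)
  exact NonUnitalStarAlgHom.norm_map ψ hψ ⟨j, hj⟩

variable [T2Space X] [LocallyCompactSpace X]

/-- The first coordinates are seen at the finite points. If the last coordinate l were nonzero, its
iterates would stay in J with constant norm, and a backward orbit through points where they are
large would be an infinite point at which the section is nonzero. -/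
theorem stageHom_injective {n : ℕ} {a : S.stageB J n} (h : ∀ p, S.stageHom J n p a = 0) :
    a = 0 := by
  -- Only the points of X_N need testing: elements of A_N vanish outside the domain of φ^N, and
  -- A(x)/J(x) = 0 for x outside the hull.
  have hq : ∀ (N : ℕ) (b : A), b ∈ S.subA N →
      (∀ (x : X) (_ : x ∈ dom S.φ N) (_ : x ∈ S.μ.hull J), S.μ.quotEval J x (J.proj b) = 0) →
      J.proj b = 0 := by
    intro N b hb h'
    refine S.μ.quotEval_injective J fun x ↦ ?_
    by_contra hne
    by_cases hx : x ∈ dom S.φ N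
    · exact hne (h' x hx (S.μ.mem_hull_of_quotEval_ne_zero J hne))
    · rw [S.μ.quotEval_proj, S.ev_of_notMem_dom hx hb, map_zero] at hne
      exact hne rfl
  refine S.stage_ext J (fun k hk ↦ ?_) ?_
  · obtain ⟨c, hc, hc'⟩ := S.exists_coord J n a
    rw [map_zero, hc']
    refine hq k _ (hc k hk) fun x hx hY ↦ ?_
    rw [← hc', ← S.finVal_stageHom_of_lt J (hx := hx) (hY := hY) hk, h, map_zero]
  · rw [map_zero]
    set l := S.lastVal J n a with hl
    have hlA : l ∈ S.subA n := S.lastVal_mem J n a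
    -- The value at a point of X_{n+k} is the class of α^k(l) modulo J(x).
    have hlJ : ∀ k, S.iterEnd k l ∈ J := fun k ↦ by
      refine J.proj_eq_zero.1 (hq (n + k) _ (S.iterEnd_mem_subA hlA k) fun x hx hY ↦ ?_)
      have h2 := S.finVal_stageHom_of_le J (hx := hx) (hY := hY) (Nat.le_add_right n k) a
      rw [Nat.add_sub_cancel_left, h, map_zero] at h2
      exact h2.symm
    have hnorm : ∀ k, ‖S.iterEnd k l‖ = ‖l‖ := fun k ↦ by
      induction k with
      | zero => rfl
      | succ k ih => exact (S.norm_α_of_mem J hJ (hlJ k)).trans ih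
    by_contra hne
    have hpos : 0 < ‖l‖ / 2 := by
      have := norm_pos_iff.2 hne
      positivity
    -- These sets are nonempty because ‖α^k(l)‖ = ‖l‖ is the supremum over the fibres, and φ maps
    -- each into the preceding one because the α_x are contractive.
    obtain ⟨x, hx, hxK⟩ := ExtSpace.exists_backwardOrbit S.morphism.isProperMap (n := n)
      (fun k ↦ {x | ‖l‖ / 2 ≤ ‖S.μ.ev x (S.iterEnd k l)‖})
      (fun k ↦ S.μ.isCompact_norm_ev_ge _ hpos)
      (fun k ↦ by
        by_contra hempty
        have h1 : ∀ x, ‖piHom S.μ.ev (S.iterEnd k l) x‖ ≤ ‖l‖ / 2 := fun x ↦ by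
          by_contra hx
          exact hempty ⟨x, (not_le.1 hx).le⟩
        have h2 := norm_le_of_forall_coord (piHom S.μ.ev)
          ((injective_iff_map_eq_zero _).2 fun b hb ↦
            S.μ.eq_zero_of_forall_ev fun x ↦ congrFun hb x) hpos.le h1
        rw [hnorm] at h2
        linarith)
      (fun k x hx ↦ by
        by_contra hd
        change ‖l‖ / 2 ≤ ‖S.μ.ev x (S.iterEnd k l)‖ at hx
        rw [S.ev_of_notMem_dom hd (S.iterEnd_mem_subA hlA k), norm_zero] at hx
        linarith)
      (fun k x hx ↦ by
        change ‖l‖ / 2 ≤ ‖S.μ.ev x (S.α (S.iterEnd k l))‖ at hx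
        by_cases hxΔ : x ∈ S.Δ
        · refine ⟨hxΔ, hx.trans ?_⟩
          rw [S.induced_of_mem _ ⟨x, hxΔ⟩]
          exact NonUnitalStarAlgHom.norm_apply_le _ _
        · rw [S.induced_of_notMem _ x hxΔ, norm_zero] at hx
          linarith)
    have h1 : ‖S.threadAt hx n (S.last J n a)‖ < ‖l‖ / 2 := by
      rw [← S.stageHom_inf J, h, map_zero, norm_zero]
      exact hpos
    obtain ⟨k, hk⟩ := S.exists_norm_ev_lt hx _ h1
    exact not_le.2 hk (hxK k)

/-- Injectivity on each B_n is isometry there; since B_n embeds isometrically in B, an element near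
a stage with all values zero has arbitrarily small norm. -/
theorem sectionHom_injective : Function.Injective (S.sectionHom J) := by
  rw [injective_iff_map_eq_zero]
  intro b hb
  refine norm_eq_zero.1 (le_antisymm (le_of_forall_pos_le_add fun ε hε ↦ ?_) (norm_nonneg b))
  obtain ⟨n, a, ha⟩ := LimAlg.exists_near (S.bond J) b (half_pos hε)
  have h1 : ‖a‖ ≤ ε / 2 := by
    refine norm_le_of_forall_coord (piHom (S.stageHom J n))
      ((injective_iff_map_eq_zero _).2 fun b hb ↦
        S.stageHom_injective J hJ fun x ↦ congrFun hb x) (half_pos hε).le fun p ↦ ?_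
    rw [piHom_apply, ← sectionHom_toLimB]
    have h2 := norm_coord_le (S.sectionHom J) (b - S.toLimB J n a) p
    rw [map_sub, hb, Pi.sub_apply, Pi.zero_apply, zero_sub, norm_neg] at h2
    exact h2.trans ha.le
  have h3 : b = (b - S.toLimB J n a) + S.toLimB J n a := by rw [sub_add_cancel]
  rw [h3]
  refine (norm_add_le _ _).trans ?_
  have h4 := S.norm_toLimB J hJ n a
  have h5 : ‖b - S.toLimB J n a‖ < ε / 2 := ha
  linarith

end Injectivity

end C0System

theorem norm_C0_apply_le {X : Type*} [TopologicalSpace X] (f : C₀(X, ℂ)) (x : X) : ‖f x‖ ≤ ‖f‖ := by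
  rw [← ZeroAtInftyContinuousMap.norm_toBCF_eq_norm]
  exact f.toBCF.norm_coe_le_norm x

theorem exists_C0_one_zero {X : Type*} [TopologicalSpace X] [T2Space X] [LocallyCompactSpace X]
    (x : X) {s : Set X} (hs : IsClosed s) (hx : x ∉ s) :
    ∃ f : C₀(X, ℂ), f x = 1 ∧ ∀ y ∈ s, f y = 0 := by
  obtain ⟨f, h1, h0, hc, -⟩ := exists_continuous_one_zero_of_isCompact
    (isCompact_singleton (x := x)) hs (Set.disjoint_singleton_left.2 hx)
  refine ⟨compactToC0 f hc, ?_, fun y hy ↦ ?_⟩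
  · rw [compactToC0_apply, h1 rfl]
    simp
  · rw [compactToC0_apply, h0 hy]
    simp

/-- The composition with a proper map that is defined on an open set, extended by zero. -/
def pullC0 {X : Type*} [TopologicalSpace X] [T2Space X] {Δ : Set X} (hΔ : IsOpen Δ) {φ : Δ → X}
    (hφ : IsProperMap φ) (f : C₀(X, ℂ)) : C₀(X, ℂ) :=
  have hval : ∀ x : Δ, (Function.extend Subtype.val (f ∘ φ) 0 : X → ℂ) x = f (φ x) :=
    Subtype.val_injective.extend_apply _ _
  have h0 : ∀ x ∉ Δ, (Function.extend Subtype.val (f ∘ φ) 0 : X → ℂ) x = 0 := fun x hx ↦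
    Function.extend_apply' _ _ _ (by rintro ⟨y, rfl⟩; exact hx y.2)
  have hK : ∀ ε : ℝ, 0 < ε →
      IsCompact {x | ε ≤ ‖(Function.extend Subtype.val (f ∘ φ) 0 : X → ℂ) x‖} := fun ε hε ↦ by
    convert (hφ.isCompact_preimage (isCompact_norm_apply_ge f hε)).image continuous_subtype_val
      using 1
    ext x
    by_cases hx : x ∈ Δ
    · simp [hval ⟨x, hx⟩, hx]
    · simp [hx, hε]
  { toFun := Function.extend Subtype.val (f ∘ φ) 0
    continuous_toFun := by
      refine continuous_iff_continuousAt.2 fun x ↦ ?_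
      by_cases hx : x ∈ Δ
      · have h1 : ContinuousAt ((Function.extend Subtype.val (f ∘ φ) 0 : X → ℂ) ∘ Subtype.val)
            (⟨x, hx⟩ : Δ) :=
          ((f.continuous.comp hφ.continuous).congr fun y ↦ (hval y).symm).continuousAt
        exact (hΔ.isOpenEmbedding_subtypeVal.continuousAt_iff).1 h1
      · rw [ContinuousAt, h0 x hx, tendsto_zero_iff_norm_tendsto_zero, Metric.tendsto_nhds]
        intro ε hε
        filter_upwards [(hK ε hε).isClosed.isOpen_compl.mem_nhds (by simp [h0 x hx, hε])] with y hy
        simpa using hy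
    zero_at_infty' := by
      rw [tendsto_zero_iff_norm_tendsto_zero, Metric.tendsto_nhds]
      intro ε hε
      filter_upwards [(hK ε hε).compl_mem_cocompact] with y hy
      simpa using hy }

theorem pullC0_apply {X : Type*} [TopologicalSpace X] [T2Space X] {Δ : Set X} (hΔ : IsOpen Δ)
    {φ : Δ → X} (hφ : IsProperMap φ) (f : C₀(X, ℂ)) (x : Δ) :
    pullC0 hΔ hφ f x = f (φ x) := Subtype.val_injective.extend_apply _ _ _

/-! ### B as the section algebra of a bundle -/

namespace C0System

variable {X : Type v} [TopologicalSpace X] {A : Type u} [NonUnitalCStarAlgebra A]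
  (S : C0System X A) (J : ClosedIdeal A)

theorem sectionHom_fibre_surjective : ∀ (p : S.Ext J) (v : S.FibreB J p),
    ∃ b, S.sectionHom J b p = v
  | .fin N x hx hY, v => by
    obtain ⟨w, hw, hwv⟩ := S.finVal_mem J v
    obtain ⟨b, hb, rfl⟩ := S.exists_mem_subA hw
    -- Only the coordinate with index N is seen at this point; the other entries are irrelevant.
    obtain ⟨a, ha, -⟩ := S.exists_stage J (N + 1) (fun _ _ ↦ b)
      (fun k hk ↦ S.subA_antitone (Nat.le_of_lt_succ hk) hb) (zero_mem (S.subA (N + 1)))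
    refine ⟨S.toLimB J (N + 1) a, S.finVal_injective J ?_⟩
    rw [sectionHom_toLimB, S.finVal_stageHom_of_lt J N.lt_succ_self, ha]
    exact hwv
  | .inf x hx, v => by
    suffices h : ∃ b, S.infVal J hx (S.sectionHom J b (.inf x hx)) = S.infVal J hx v by
      obtain ⟨b, hb⟩ := h
      exact ⟨b, S.infVal_injective J hb⟩
    refine LimAlg.induction (S.orbitBond hx)
      (P := fun v ↦ ∃ b, S.infVal J hx (S.sectionHom J b (.inf x hx)) = v)
      (ClosedIdeal.isClosed_range ((S.infVal J hx).comp (evalHom (S.sectionHom J) (.inf x hx))))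
      (fun n w ↦ ?_) (S.infVal J hx v)
    obtain ⟨b, hb, hbw⟩ := S.exists_mem_subA (valHom_mem (S.fibA n (x n) (hx.mem_dom n)) w)
    obtain ⟨a, -, ha⟩ := S.exists_stage J n (fun _ _ ↦ 0) (fun k _ ↦ zero_mem (S.subA k)) hb
    refine ⟨S.toLimB J n a, ?_⟩
    rw [sectionHom_toLimB, stageHom_inf]
    refine congrArg (limOf (S.orbitBond hx) n) (valHom_injective _ ?_)
    rw [← hbw, ← ha]
    rfl

theorem quotEval_proj_act (f : C₀(X, ℂ)) (a : A) (x : X) :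
    S.μ.quotEval J x (J.proj (S.μ.act f a)) = f x • S.μ.quotEval J x (J.proj a) := by
  rw [S.μ.quotEval_proj, S.μ.ev_act, map_smul, S.μ.quotEval_proj]

/-- Near a point of X_N all points lie in X_N, and after raising the stage beyond N the norm is that
of one coordinate in A(y)/J(y). At an infinite point, raise the stage until the last coordinate has
norm below ε at the corresponding point of the orbit. It then bounds the values at all points whose
coordinate with that index is close. -/
theorem eventually_norm_toLimB_lt (n : ℕ) (a : S.stageB J n) {ε : ℝ} : ∀ {p : S.Ext J},
    ‖S.sectionHom J (S.toLimB J n a) p‖ < ε →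
      ∀ᶠ q in 𝓝 p, ‖S.sectionHom J (S.toLimB J n a) q‖ < ε
  | .fin N x hx hY, h => by
    obtain ⟨a', ha'⟩ := S.exists_raise_of_le J (le_max_left n (N + 1)) a
    have hN : N < max n (N + 1) := lt_of_lt_of_le N.lt_succ_self (le_max_right _ _)
    rw [← ha'] at h ⊢
    set c := S.coordVal J _ N hN a' with hc
    have key : ∀ (y : X) (hy : y ∈ dom S.φ N) (hyY : y ∈ S.μ.hull J),
        ‖S.sectionHom J (S.toLimB J _ a') (.fin N y hy hyY)‖ = ‖S.μ.quotEval J y c‖ := by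
      intro y hy hyY
      rw [← norm_finVal, sectionHom_toLimB, S.finVal_stageHom_of_lt J hN]
    rw [key] at h
    have hU : IsOpen {y | ‖S.μ.quotEval J y c‖ < ε} :=
      isOpen_iff_eventually.2 fun y hy ↦ S.μ.eventually_norm_quotEval_lt J hy
    have h1 := (ExtSpace.isOpen_coordIn (φ := S.φ) (Y := S.μ.hull J) N hU).mem_nhds
      (x := .fin N x hx hY) ⟨x, h, ExtSpace.toSeq_fin_self⟩
    have h2 := (isOpen_range_inr.preimage (ExtSpace.continuous_toSeq (φ := S.φ)
      (Y := S.μ.hull J) (N + 1))).mem_nhds (x := .fin N x hx hY)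
        ⟨(), (ExtSpace.toSeq_fin_of_lt N.lt_succ_self).symm⟩
    filter_upwards [h1, h2] with q hq1 hq2
    obtain ⟨y, hy, hqy⟩ := hq1
    obtain ⟨⟨⟩, hq⟩ := hq2
    obtain ⟨hyd, hyY, rfl⟩ := q.mem_of_toSeq_succ N y hqy hq.symm
    rw [key]
    exact hy
  | .inf x hx, h => by
    rw [← norm_infVal, sectionHom_toLimB, stageHom_inf] at h
    obtain ⟨k, hk⟩ := S.exists_norm_ev_lt hx _ h
    obtain ⟨a', ha', ha''⟩ := S.exists_raise J n a k
    rw [← ha']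
    change ‖S.μ.ev (x (n + k)) (S.iterEnd k (S.lastVal J n a))‖ < ε at hk
    rw [← ha''] at hk
    have hU : IsOpen {y | ‖S.μ.ev y (S.lastVal J (n + k) a')‖ < ε} :=
      isOpen_iff_eventually.2 fun y hy ↦ S.μ.eventually_norm_ev_lt hy
    have h1 := (ExtSpace.isOpen_coordIn (φ := S.φ) (Y := S.μ.hull J) (n + k) hU).mem_nhds
      (x := .inf x hx) ⟨x (n + k), hk, rfl⟩
    filter_upwards [h1] with q hq1
    obtain ⟨y, hy, hqy⟩ := hq1
    rw [sectionHom_toLimB]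
    exact (S.norm_stageHom_le J a' q hqy).trans_lt hy

theorem eventually_norm_sectionHom_lt (b : S.limB J) {p : S.Ext J} {ε : ℝ}
    (h : ‖S.sectionHom J b p‖ < ε) : ∀ᶠ q in 𝓝 p, ‖S.sectionHom J b q‖ < ε := by
  obtain ⟨δ, hδ, h'⟩ : ∃ δ > 0, ‖S.sectionHom J b p‖ + δ + δ < ε :=
    ⟨(ε - ‖S.sectionHom J b p‖) / 3, by linarith, by linarith⟩
  obtain ⟨n, a, ha⟩ := LimAlg.exists_near (S.bond J) b hδ
  have key : ∀ q, ‖S.sectionHom J b q - S.sectionHom J (S.toLimB J n a) q‖ < δ := fun q ↦ by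
    rw [← Pi.sub_apply, ← map_sub]
    exact (norm_coord_le _ _ _).trans_lt ha
  have h1 : ‖S.sectionHom J (S.toLimB J n a) p‖ < ‖S.sectionHom J b p‖ + δ := by
    have := norm_sub_norm_le (S.sectionHom J (S.toLimB J n a) p) (S.sectionHom J b p)
    rw [norm_sub_rev] at this
    have := key p
    linarith
  filter_upwards [S.eventually_norm_toLimB_lt J n a h1] with q hq
  have := norm_sub_norm_le (S.sectionHom J b q) (S.sectionHom J (S.toLimB J n a) q)
  have := key q
  linarith

theorem isClosed_norm_sectionHom_ge (b : S.limB J) (ε : ℝ) :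
    IsClosed {p | ε ≤ ‖S.sectionHom J b p‖} := by
  rw [← isOpen_compl_iff, isOpen_iff_eventually]
  intro p hp
  simp only [Set.mem_compl_iff, Set.mem_ofPred_eq, not_le] at hp ⊢
  exact S.eventually_norm_sectionHom_lt J b hp

/-- `u` is given by functions of the last nonzero coordinate with index at most `n`. -/
def IsLevel (n : ℕ) (F : ℕ → C₀(X, ℂ)) (u : S.Ext J → ℂ) : Prop :=
  (∀ N x hx hY, N < n → u (.fin N x hx hY) = F N x) ∧ ∀ p x, p.toSeq n = .inl x → u p = F n x

variable {S J} in
-- A_k is a C₀(X)-submodule, so the function can act on each coordinate separately. On points beyond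
-- the stage it depends only on x_n, and α_{(x,N-n)} is linear.
theorem IsLevel.exists_stage_smul {n : ℕ} {F : ℕ → C₀(X, ℂ)} {u : S.Ext J → ℂ}
    (h : S.IsLevel J n F u) (a : S.stageB J n) :
    ∃ a', ∀ p, S.stageHom J n p a' = u p • S.stageHom J n p a := by
  obtain ⟨c, hc, hc'⟩ := S.exists_coord J n a
  obtain ⟨a', ha', ha''⟩ := S.exists_stage J n (fun k hk ↦ S.μ.act (F k) (c k hk))
    (fun k hk ↦ S.act_mem_subA _ (hc k hk)) (S.act_mem_subA (F n) (S.lastVal_mem J n a))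
  refine ⟨a', fun p ↦ ?_⟩
  cases p with
  | fin N x hx hY =>
    apply S.finVal_injective J
    rw [map_smul]
    by_cases hN : N < n
    · rw [S.finVal_stageHom_of_lt J hN, S.finVal_stageHom_of_lt J hN, ha', hc',
        quotEval_proj_act, h.1 N x hx hY hN]
    · have hN := not_lt.1 hN
      rw [S.finVal_stageHom_of_le J hN, S.finVal_stageHom_of_le J hN, ha'',
        ← S.ev_iterEnd (N - n) x (dom_antitone S.φ (Nat.sub_le N n) hx),
        ← S.ev_iterEnd (N - n) x (dom_antitone S.φ (Nat.sub_le N n) hx),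
        S.μ.ev_act, map_smul, map_smul, h.2 _ _ (ExtSpace.toSeq_fin_of_le hN)]
  | inf x hx =>
    apply S.infVal_injective J
    rw [map_smul, stageHom_inf, stageHom_inf, h.2 (.inf x hx) (x n) rfl]
    refine Eq.trans (congrArg (limOf (S.orbitBond hx) n) (valHom_injective _ ?_))
      (map_smul (limOf (S.orbitBond hx) n) (F n (x n))
        (S.evSub n (x n) (hx.mem_dom n) (S.last J n a)))
    exact ((congrArg (S.μ.ev (x n)) ha'').trans (S.μ.ev_act _ _ _)).trans
      (map_smul (valHom (S.fibA n (x n) (hx.mem_dom n))) (F n (x n))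
        (S.evSub n (x n) (hx.mem_dom n) (S.last J n a))).symm

variable [T2Space X]

/-- Up to ε/2, b comes from a stage. The section of a stage is large only where one of its finitely
many coordinates is large, which is a compact set of x_k inside the domain of φ^k. -/
theorem isCompact_norm_sectionHom_ge (b : S.limB J) {ε : ℝ} (hε : 0 < ε) :
    IsCompact {p | ε ≤ ‖S.sectionHom J b p‖} := by
  have hprop := S.morphism.isProperMap
  have hY : IsClosed (S.μ.hull J) := isClosed_closure
  obtain ⟨n, a, ha⟩ := LimAlg.exists_near (S.bond J) b (half_pos hε)
  have hε' := half_pos hε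
  have hK : IsCompact ((⋃ k : Fin n, ExtSpace.coordIn S.φ (S.μ.hull J) k
      {x | ε / 2 ≤ ‖S.μ.quotEval J x (S.coordVal J n k k.2 a)‖}) ∪
      ExtSpace.coordIn S.φ (S.μ.hull J) n {x | ε / 2 ≤ ‖S.μ.ev x (S.lastVal J n a)‖}) := by
    refine (isCompact_iUnion fun k ↦ ?_).union ?_
    · refine ExtSpace.isCompact_coordIn hprop hY (S.μ.isCompact_norm_quotEval_ge J _ hε') ?_
      intro x hx
      by_contra hd
      obtain ⟨c, hc, hc'⟩ := S.exists_coord J n a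
      change ε / 2 ≤ _ at hx
      rw [hc', S.μ.quotEval_proj, S.ev_of_notMem_dom hd (hc k k.2), map_zero, norm_zero] at hx
      linarith
    · refine ExtSpace.isCompact_coordIn hprop hY (S.μ.isCompact_norm_ev_ge _ hε') ?_
      intro x hx
      by_contra hd
      change ε / 2 ≤ _ at hx
      rw [S.ev_of_notMem_dom hd (S.lastVal_mem J n a), norm_zero] at hx
      linarith
  refine hK.of_isClosed_subset (S.isClosed_norm_sectionHom_ge J b ε) fun p hp ↦ ?_
  have h1 : ε / 2 ≤ ‖S.stageHom J n p a‖ := by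
    have h2 := norm_sub_norm_le (S.sectionHom J b p) (S.sectionHom J (S.toLimB J n a) p)
    rw [← Pi.sub_apply, ← map_sub] at h2
    have h3 := h2.trans ((norm_coord_le _ _ _).trans ha.le)
    change ε ≤ _ at hp
    rw [← sectionHom_toLimB]
    linarith
  rcases h : p.toSeq n with x | ⟨⟩
  · exact .inr ⟨x, h1.trans (S.norm_stageHom_le J a p h), h⟩
  · cases p with
    | fin N x hx hxY =>
      have hN : N < n := by
        by_contra hN
        rw [ExtSpace.toSeq_fin_of_le (not_lt.1 hN)] at h
        cases h
      refine .inl (Set.mem_iUnion.2 ⟨⟨N, hN⟩, x, ?_, ExtSpace.toSeq_fin_self⟩)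
      rw [← norm_finVal, S.finVal_stageHom_of_lt J hN] at h1
      exact h1
    | inf x hx => cases h

variable {S J} in
-- A function of x_n is a function of x_{n+1} through x_n = φ(x_{n+1}); properness of φ keeps it in
-- C₀(X).
theorem IsLevel.succ {n : ℕ} {F : ℕ → C₀(X, ℂ)} {u : S.Ext J → ℂ} (h : S.IsLevel J n F u) :
    S.IsLevel J (n + 1) (Function.update F (n + 1) (pullC0 S.morphism.isOpen
      S.morphism.isProperMap (F n))) u := by
  refine ⟨fun N x hx hY hN ↦ ?_, fun p x hp ↦ ?_⟩
  · rw [Function.update_of_ne hN.ne]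
    obtain rfl | hN' := eq_or_lt_of_le (Nat.le_of_lt_succ hN)
    · exact h.2 _ _ ExtSpace.toSeq_fin_self
    · exact h.1 N x hx hY hN'
  · obtain ⟨hx, h1⟩ := p.exists_toSeq_of_succ n x hp
    rw [Function.update_self, h.2 p _ h1]
    exact (pullC0_apply S.morphism.isOpen S.morphism.isProperMap (F n) ⟨x, hx⟩).symm

variable {S J} in
theorem IsLevel.exists_of_le {n m : ℕ} (hnm : n ≤ m) {F : ℕ → C₀(X, ℂ)} {u : S.Ext J → ℂ}
    (h : S.IsLevel J n F u) : ∃ F', S.IsLevel J m F' u := by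
  induction m, hnm using Nat.le_induction with
  | base => exact ⟨F, h⟩
  | succ m _ ih =>
    obtain ⟨F', hF'⟩ := ih
    exact ⟨_, hF'.succ⟩

variable [LocallyCompactSpace X] (hJ : ∀ j ∈ J, ∀ a, S.α a = 0 → j * a = 0)
include hJ

variable {S J} in
theorem IsLevel.exists_smul {n : ℕ} {F : ℕ → C₀(X, ℂ)} {u : S.Ext J → ℂ}
    (h : S.IsLevel J n F u) {C : ℝ} (hC : ∀ p, ‖u p‖ ≤ C) (b : S.limB J) :
    ∃ b', ∀ p, S.sectionHom J b' p = u p • S.sectionHom J b p := by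
  obtain ⟨b', hb'⟩ := exists_section_of_approx (S.sectionHom J) (S.sectionHom_injective J hJ)
    (s := fun p ↦ u p • S.sectionHom J b p) fun ε hε ↦ by
      obtain ⟨m, a, ha⟩ := LimAlg.exists_near (S.bond J) b
        (show 0 < ε / (|C| + 1) by positivity)
      obtain ⟨a', ha'⟩ := S.exists_raise_of_le J (le_max_right n m) a
      obtain ⟨F', hF'⟩ := h.exists_of_le (le_max_left n m)
      obtain ⟨a'', ha''⟩ := hF'.exists_stage_smul a'
      refine ⟨S.toLimB J _ a'', fun p ↦ ?_⟩
      rw [sectionHom_toLimB, ha'', ← sectionHom_toLimB, ha', ← smul_sub, norm_smul,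
        ← Pi.sub_apply, ← map_sub]
      calc ‖u p‖ * ‖S.sectionHom J (b - S.toLimB J m a) p‖ ≤ (|C| + 1) * (ε / (|C| + 1)) := by
            gcongr
            · exact (hC p).trans ((le_abs_self C).trans (by linarith))
            · exact (norm_coord_le _ _ _).trans ha.le
        _ = ε := by field_simp
  exact ⟨b', fun p ↦ congrFun hb' p⟩

/-- The sections form the section algebra of a bundle. -/
theorem isSectionAlgebra : IsSectionAlgebra (S.sectionHom J) where
  injective := S.sectionHom_injective J hJ
  fibre_surjective := S.sectionHom_fibre_surjective J
  isCompact b _ := S.isCompact_norm_sectionHom_ge J b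
  exists_smul := by
    have hprop := S.morphism.isProperMap
    have hY : IsClosed (S.μ.hull J) := isClosed_closure
    have := ExtSpace.t2Space (φ := S.φ) (Y := S.μ.hull J)
    have := ExtSpace.locallyCompactSpace hprop hY
    -- The function f(x_n) alone need not vanish at infinity. The factor g(x₀) achieves this because
    -- x₀ is a proper function of the point.
    have key : ∀ (n : ℕ) (g f : C₀(X, ℂ)), ∃ u : C₀(S.Ext J, ℂ),
        (∀ b, ∃ b', ∀ p, S.sectionHom J b' p = u p • S.sectionHom J b p) ∧
          ∀ p, u p = g p.head * Sum.elim f 0 (p.toSeq n) := by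
      intro n g f
      have hf : ∀ p : S.Ext J, ‖Sum.elim f 0 (p.toSeq n)‖ ≤ ‖f‖ := fun p ↦ by
        rcases p.toSeq n with x | ⟨⟩
        · exact norm_C0_apply_le f x
        · simp
      have hcont : Continuous fun p : S.Ext J ↦ (Sum.elim f 0 (p.toSeq n) : ℂ) :=
        (f.continuous.sumElim continuous_const).comp (ExtSpace.continuous_toSeq n)
      have hhead : Tendsto (ExtSpace.head : S.Ext J → X) (cocompact _) (cocompact X) :=
        (hasBasis_cocompact.tendsto_right_iff).2 fun K hK ↦
          (ExtSpace.isCompact_preimage_head hprop hY hK).compl_mem_cocompact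
      have h0 : Tendsto (fun p : S.Ext J ↦ g p.head * (Sum.elim f 0 (p.toSeq n) : ℂ))
          (cocompact _) (𝓝 0) := by
        rw [tendsto_zero_iff_norm_tendsto_zero]
        have h1 := (g.zero_at_infty'.comp hhead).norm.mul_const ‖f‖
        refine squeeze_zero (fun _ ↦ norm_nonneg _) (fun p ↦ ?_) (by simpa using h1)
        rw [norm_mul]
        exact mul_le_mul_of_nonneg_left (hf p) (norm_nonneg _)
      refine ⟨⟨⟨_, (g.continuous.comp ExtSpace.continuous_head).mul hcont⟩, h0⟩, fun b ↦ ?_,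
        fun _ ↦ rfl⟩
      have hlevel : S.IsLevel J n (fun N ↦ if N = n then f else 0)
          fun p ↦ Sum.elim f 0 (p.toSeq n) := by
        refine ⟨fun N x hx hY hN ↦ ?_, fun p x hp ↦ ?_⟩
        · beta_reduce
          rw [ExtSpace.toSeq_fin_of_lt hN, if_neg hN.ne]
          rfl
        · beta_reduce
          rw [hp, if_pos rfl]
          rfl
      have hlevel0 : S.IsLevel J 0 (fun _ ↦ g) fun p ↦ g p.head :=
        ⟨fun N _ _ _ h ↦ absurd h (Nat.not_lt_zero N), fun p x hp ↦ by
          rw [ExtSpace.toSeq_zero] at hp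
          beta_reduce
          rw [Sum.inl_injective hp]⟩
      obtain ⟨b', hb'⟩ := hlevel.exists_smul hJ hf b
      obtain ⟨b'', hb''⟩ := hlevel0.exists_smul hJ (fun p ↦ norm_C0_apply_le g p.head) b'
      exact ⟨b'', fun p ↦ by rw [hb'', hb', smul_smul]; rfl⟩
    -- Here g is 1 at the head of p, while f is 1 at x and vanishes at the coordinate of q with
    -- index n; the absent coordinate counts as zero.
    have hsep : ∀ (p q : S.Ext J) (n : ℕ) (x : X), p.toSeq n = .inl x → q.toSeq n ≠ .inl x →
        ∃ u : C₀(S.Ext J, ℂ),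
          (∀ b, ∃ b', ∀ p, S.sectionHom J b' p = u p • S.sectionHom J b p) ∧ u p ≠ u q := by
      intro p q n x hp hq
      obtain ⟨g, hg, -⟩ := exists_C0_one_zero p.head isClosed_empty (Set.notMem_empty _)
      obtain ⟨f, hfx, hf⟩ : ∃ f : C₀(X, ℂ), f x = 1 ∧ Sum.elim f 0 (q.toSeq n) = (0 : ℂ) := by
        rcases h : q.toSeq n with y | ⟨⟩
        · have hxy : x ≠ y := by
            rintro rfl
            exact hq h
          obtain ⟨f, h1, h2⟩ := exists_C0_one_zero x (isClosed_singleton (x := y)) hxy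
          exact ⟨f, h1, h2 y rfl⟩
        · obtain ⟨f, h1, -⟩ := exists_C0_one_zero x isClosed_empty (Set.notMem_empty _)
          exact ⟨f, h1, rfl⟩
      obtain ⟨u, hu, hu'⟩ := key n g f
      refine ⟨u, hu, ?_⟩
      rw [hu', hu', hf, hp, Sum.elim_inl, hfx, hg]
      simp
    refine exists_smul_of_separates (S.sectionHom_injective J hJ) (fun p ↦ ?_) fun p q hpq ↦ ?_
    · obtain ⟨g, hg, -⟩ := exists_C0_one_zero p.head isClosed_empty (Set.notMem_empty _)
      obtain ⟨u, hu, hu'⟩ := key 0 g g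
      refine ⟨u, hu, ?_⟩
      rw [hu', ExtSpace.toSeq_zero, Sum.elim_inl, hg]
      simp
    · obtain ⟨n, hn⟩ := Function.ne_iff.1 fun h ↦ hpq (ExtSpace.toSeq_injective h)
      rcases h : p.toSeq n with x | ⟨⟩
      · exact hsep p q n x h fun h' ↦ hn (h.trans h'.symm)
      · rcases h' : q.toSeq n with y | ⟨⟩
        · obtain ⟨u, hu, hu'⟩ := hsep q p n y h' (by rw [h]; simp)
          exact ⟨u, hu, hu'.symm⟩
        · exact absurd (h.trans h'.symm) hn

end C0System

theorem classShift_injective {E E' : ℕ → Type u} [∀ n, NonUnitalCStarAlgebra (E n)]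
    [∀ n, NonUnitalCStarAlgebra (E' n)] (g : ∀ n, E (n + 1) →⋆ₙₐ[ℂ] E' n)
    (hi : ∀ n, Function.Injective (g n)) : Function.Injective (classShift g) := by
  rw [injective_iff_map_eq_zero]
  intro c hc
  obtain ⟨a, rfl⟩ := (nullIdeal E).proj_surjective c
  have h1 : seqShift g a ∈ nullIdeal E' := (nullIdeal E').proj_eq_zero.1 hc
  refine (nullIdeal E).proj_eq_zero.2 ?_
  have h2 : Tendsto (fun n ↦ ‖g n (a (n + 1))‖) atTop (𝓝 0) := h1
  have h3 : Tendsto (fun n ↦ ‖a (n + 1)‖) atTop (𝓝 0) :=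
    h2.congr fun n ↦ NonUnitalStarAlgHom.norm_map (g n) (hi n) _
  exact (tendsto_add_atTop_iff_nat 1).1 h3

theorem limShift_injective {E E' : ℕ → Type u} [∀ n, NonUnitalCStarAlgebra (E n)]
    [∀ n, NonUnitalCStarAlgebra (E' n)] (f : ∀ n, E n →⋆ₙₐ[ℂ] E (n + 1))
    (f' : ∀ n, E' n →⋆ₙₐ[ℂ] E' (n + 1)) (g : ∀ n, E (n + 1) →⋆ₙₐ[ℂ] E' n)
    (hg : ∀ n b, g (n + 1) (f (n + 1) b) = f' n (g n b)) (hi : ∀ n, Function.Injective (g n)) :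
    Function.Injective (limShift f f' g hg) := fun _ _ h ↦
  Subtype.ext (classShift_injective g hi (congrArg Subtype.val h))

theorem valHom_inclHom {A : Type u} [NonUnitalCStarAlgebra A]
    {T T' : NonUnitalStarSubalgebra ℂ A} [IsClosed (T : Set A)] [IsClosed (T' : Set A)]
    (h : T ≤ T') (a : SubAlg T) : valHom T' (inclHom h a) = valHom T a := rfl

theorem valHom_restrictHom {A : Type u} [NonUnitalCStarAlgebra A] {A' : Type v}
    [NonUnitalCStarAlgebra A'] (ψ : A →⋆ₙₐ[ℂ] A') {T : NonUnitalStarSubalgebra ℂ A}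
    {T' : NonUnitalStarSubalgebra ℂ A'} [IsClosed (T : Set A)] [IsClosed (T' : Set A')]
    (h : ∀ a ∈ T, ψ a ∈ T') (a : SubAlg T) :
    valHom T' (restrictHom ψ T T' h a) = ψ (valHom T a) := rfl

theorem norm_map_sub_le {A : Type u} [NonUnitalCStarAlgebra A] {A' : Type v}
    [NonUnitalCStarAlgebra A'] (ψ : A →⋆ₙₐ[ℂ] A') (a b : A) : ‖ψ a - ψ b‖ ≤ ‖a - b‖ := by
  rw [← map_sub]
  exact NonUnitalStarAlgHom.norm_apply_le ψ _

/-! ### The endomorphism β in the fibres -/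

namespace C0System

variable {X : Type v} [TopologicalSpace X] {A : Type u} [NonUnitalCStarAlgebra A]
  (S : C0System X A) (J : ClosedIdeal A)

theorem finVal_fibreβ {N : ℕ} {x : X} {hx : x ∈ dom S.φ N} {hY : x ∈ S.μ.hull J}
    (h : (ExtSpace.fin N x hx hY : S.Ext J).head ∈ S.Δ)
    (v : S.FibreB J ((ExtSpace.fin N x hx hY : S.Ext J).shift h)) :
    S.finVal J N x hx hY (S.fibreβ J (.fin N x hx hY) h v) =
      S.finVal J (N + 1) x (dom_succ S.φ N x hx h) hY v :=
  valHom_inclHom (S.quotFib_succ_le J N x (dom_succ S.φ N x hx h)) v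

theorem orbitShift_injective {x : ℕ → X} (hx : IsBackwardOrbit S.φ x) :
    Function.Injective (S.orbitShift hx) := by
  unfold orbitShift
  apply limShift_injective
  intro n a b hab
  have h := congrArg (valHom _) hab
  rw [valHom_inclHom, valHom_inclHom] at h
  exact valHom_injective _ h

theorem fibreβ_injective : ∀ (p : S.Ext J) (h : p.head ∈ S.Δ),
    Function.Injective (S.fibreβ J p h)
  | .fin N x hx hY, h => fun v w hvw ↦ by
    have h1 := congrArg (S.finVal J N x hx hY) hvw
    rw [finVal_fibreβ, finVal_fibreβ] at h1
    exact S.finVal_injective J h1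
  | .inf x hx, h => S.orbitShift_injective (ExtSpace.isBackwardOrbit_consSeq hx h)

theorem orbitShift_limOf {x : ℕ → X} (hx : IsBackwardOrbit S.φ x) (n : ℕ)
    (v : SubAlg (S.fibA (n + 1) (x (n + 1)) (hx.mem_dom (n + 1)))) :
    S.orbitShift hx (limOf (S.orbitBond hx) (n + 1) v) =
      limOf (S.orbitBond hx.tail) n
        (inclHom (S.fibA_succ_le n (x (n + 1)) (hx.mem_dom (n + 1))) v) := by
  unfold orbitShift
  exact limShift_limOf (S.orbitBond hx) (S.orbitBond hx.tail)
    (fun n ↦ inclHom (S.fibA_succ_le n (x (n + 1)) (hx.mem_dom (n + 1)))) _ n v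

theorem inclHom_evSub {n : ℕ} {x : X} (hx : x ∈ dom S.φ (n + 1)) (a : SubAlg (S.subA (n + 1))) :
    inclHom (S.fibA_succ_le n x hx) (S.evSub (n + 1) x hx a) =
      S.evSub n x (dom_antitone S.φ n.le_succ hx) (inclHom (S.subA_succ_le n) a) := by
  apply valHom_injective
  unfold evSub
  rw [valHom_inclHom, valHom_restrictHom, valHom_restrictHom, valHom_inclHom]

theorem orbitShift_threadAt {x : ℕ → X} (hx : IsBackwardOrbit S.φ x) (n : ℕ)
    (a : SubAlg (S.subA (n + 1))) :
    S.orbitShift hx (S.threadAt hx (n + 1) a) =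
      S.threadAt hx.tail n (inclHom (S.subA_succ_le n) a) :=
  (S.orbitShift_limOf hx n (S.evSub (n + 1) (x (n + 1)) (hx.mem_dom (n + 1)) a)).trans
    (congrArg (limOf (S.orbitBond hx.tail) n) (S.inclHom_evSub (hx.mem_dom (n + 1)) a))

theorem stageHom_stageShift_fin {N n : ℕ} (hN : N < n) (a : S.stageB J (n + 1)) {x : X}
    {hx : x ∈ dom S.φ N} {hY : x ∈ S.μ.hull J}
    (h : (ExtSpace.fin N x hx hY : S.Ext J).head ∈ S.Δ) :
    S.stageHom J n (.fin N x hx hY) (S.stageShift J n a) =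
      S.fibreβ J (.fin N x hx hY) h
        (S.stageHom J (n + 1) ((ExtSpace.fin N x hx hY : S.Ext J).shift h) a) := by
  have h1 := S.finVal_stageHom_of_lt J (x := x) (hx := dom_succ S.φ N x hx h) (hY := hY)
    (Nat.succ_lt_succ hN) a
  have h2 := S.finVal_stageHom_of_lt J (x := x) (hx := hx) (hY := hY) hN (S.stageShift J n a)
  have h3 := S.finVal_fibreβ J h (S.stageHom J (n + 1) (.fin (N + 1) x (dom_succ S.φ N x hx h) hY) a)
  rw [coordVal_stageShift] at h2
  exact S.finVal_injective J (h2.trans (h1.symm.trans h3.symm))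

theorem stageHom_stageShift_inf (n : ℕ) (a : S.stageB J (n + 1)) {x : ℕ → X}
    {hx : IsBackwardOrbit S.φ x} (h : (ExtSpace.inf x hx : S.Ext J).head ∈ S.Δ) :
    S.stageHom J n (.inf x hx) (S.stageShift J n a) =
      S.fibreβ J (.inf x hx) h
        (S.stageHom J (n + 1) ((ExtSpace.inf x hx : S.Ext J).shift h) a) := by
  have h1 := S.stageHom_inf J (hx := ExtSpace.isBackwardOrbit_consSeq hx h) a
  have h2 := S.stageHom_inf J (hx := hx) (S.stageShift J n a)
  have h3 := S.orbitShift_threadAt (ExtSpace.isBackwardOrbit_consSeq hx h) n (S.last J (n + 1) a)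
  rw [last_stageShift] at h2
  rw [← h1] at h3
  exact h2.trans h3.symm

/-- At points with N < n both sides read off the coordinate with index N + 1 of a. Any element of a
stage can be raised so that this holds (`exists_raise_fin`). -/
theorem sectionHom_β_toLimB (n : ℕ) (a : S.stageB J (n + 1)) : ∀ (p : S.Ext J)
    (h : p.head ∈ S.Δ), (∀ N x hx hY, p = .fin N x hx hY → N < n) →
    S.stageHom J n p (S.stageShift J n a) = S.fibreβ J p h (S.stageHom J (n + 1) (p.shift h) a)
  | .fin N x hx hY, h, hn => S.stageHom_stageShift_fin J (hn N x hx hY rfl) a h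
  | .inf _ _, h, _ => S.stageHom_stageShift_inf J n a h

theorem exists_raise_fin (n : ℕ) (a : S.stageB J n) (p : S.Ext J) :
    ∃ (m : ℕ) (a' : S.stageB J (m + 1)), S.toLimB J (m + 1) a' = S.toLimB J n a ∧
      ∀ N x hx hY, p = .fin N x hx hY → N < m := by
  obtain ⟨M, hM⟩ : ∃ M, ∀ N x hx hY, p = .fin N x hx hY → N < M := by
    cases p with
    | fin N x hx hY =>
      refine ⟨N + 1, fun M y hy hyY h ↦ ?_⟩
      cases h
      exact N.lt_succ_self
    | inf x hx => exact ⟨0, fun _ _ _ _ h ↦ by cases h⟩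
  obtain ⟨a', ha'⟩ := S.exists_raise_of_le J (show n ≤ (n + M) + 1 by omega) a
  exact ⟨n + M, a', ha', fun N x hx hY h ↦ (hM N x hx hY h).trans_le (Nat.le_add_left M n)⟩

theorem sectionHom_β (b : S.limB J) (p : S.Ext J) (h : p.head ∈ S.Δ) :
    S.sectionHom J (S.β J b) p = S.fibreβ J p h (S.sectionHom J b (p.shift h)) := by
  refine LimAlg.induction (S.bond J)
    (P := fun b ↦ S.sectionHom J (S.β J b) p = S.fibreβ J p h (S.sectionHom J b (p.shift h)))
    (isClosed_eq (continuous_hom ((evalHom (S.sectionHom J) p).comp (S.β J)))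
      (continuous_hom ((S.fibreβ J p h).comp (evalHom (S.sectionHom J) (p.shift h)))))
    (fun n a ↦ ?_) b
  obtain ⟨m, a', ha', hm⟩ := S.exists_raise_fin J n a p
  change S.sectionHom J (S.β J (S.toLimB J n a)) p =
    S.fibreβ J p h (S.sectionHom J (S.toLimB J n a) (p.shift h))
  rw [← ha', β_toLimB, sectionHom_toLimB, sectionHom_toLimB]
  exact S.sectionHom_β_toLimB J m a' p h hm

/-- If x₀ = φ^n(x_n) is not in Δ, then x_n is outside the domain of φ^{n+1}, where A_{n+1} vanishes.
The shift puts elements of A_{n+1} in place n. -/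
theorem stageHom_stageShift_of_notMem (n : ℕ) (a : S.stageB J (n + 1)) : ∀ (p : S.Ext J),
    p.head ∉ S.Δ → (∀ N x hx hY, p = .fin N x hx hY → N < n) →
    S.stageHom J n p (S.stageShift J n a) = 0
  | .fin N x hx hY, h, hn => by
    have hN := hn N x hx hY rfl
    apply S.finVal_injective J
    obtain ⟨c, hc, hc'⟩ := S.exists_coord J (n + 1) a
    have hd : x ∉ dom S.φ (N + 1) := fun h' ↦ h (iter_mem N x h')
    rw [S.finVal_stageHom_of_lt J hN, coordVal_stageShift, hc', S.μ.quotEval_proj,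
      S.ev_of_notMem_dom hd (hc _ _), map_zero, map_zero]
  | .inf x hx, h, _ => by
    have hd : x n ∉ dom S.φ (n + 1) := fun h' ↦ h (by
      rw [(ExtSpace.inf x hx : S.Ext J).head_eq_iter (n := n) (x := x n) rfl]
      exact iter_mem n (x n) h')
    have h1 := S.norm_stageHom_le J (S.stageShift J n a) (.inf x hx) (x := x n) rfl
    rw [lastVal_stageShift, S.ev_of_notMem_dom hd (S.lastVal_mem J (n + 1) a), norm_zero] at h1
    exact norm_le_zero_iff.1 h1

theorem sectionHom_β_of_notMem (b : S.limB J) (p : S.Ext J) (h : p.head ∉ S.Δ) :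
    S.sectionHom J (S.β J b) p = 0 := by
  refine LimAlg.induction (S.bond J) (P := fun b ↦ S.sectionHom J (S.β J b) p = 0)
    (isClosed_eq (continuous_hom ((evalHom (S.sectionHom J) p).comp (S.β J))) continuous_const)
    (fun n a ↦ ?_) b
  obtain ⟨m, a', ha', hm⟩ := S.exists_raise_fin J n a p
  change S.sectionHom J (S.β J (S.toLimB J n a)) p = 0
  rw [← ha', β_toLimB, sectionHom_toLimB]
  exact S.stageHom_stageShift_of_notMem J m a' p h hm

/-- Tubes about b are mapped into tubes about β(b), as the β_p are contractive; φ̃ is proper since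
it is a closed embedding. -/
theorem isBundleMorphism [T2Space X] [LocallyCompactSpace X]
    (hJ : ∀ j ∈ J, ∀ a, S.α a = 0 → j * a = 0) :
    letI := tubeTopology (S.sectionHom J)
    IsBundleMorphism (S.FibreB J) (S.FibreB J) ExtSpace.extDom ExtSpace.extMap
      (fun p ↦ S.fibreβ J p.1 p.2) := by
  have := ExtSpace.t2Space (φ := S.φ) (Y := S.μ.hull J)
  have h := S.isSectionAlgebra J hJ
  let _ := tubeTopology (S.sectionHom J)
  refine ⟨S.morphism.isOpen.preimage ExtSpace.continuous_head,
    (ExtSpace.isClosedEmbedding_extMap S.morphism.isProperMap).isProperMap, ?_⟩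
  refine continuous_iff_continuousAt.2 fun ⟨p, v⟩ ↦ ?_
  obtain ⟨b, rfl⟩ := h.fibre_surjective _ v
  have h0 : Continuous fun z : PullbackPt (ExtSpace.extMap (φ := S.φ) (Y := S.μ.hull J))
      (S.FibreB J) ↦ (z.base, (⟨ExtSpace.extMap z.base, z.val⟩ : Tot (S.FibreB J))) :=
    continuous_induced_dom
  obtain ⟨h1, h2⟩ := h.tendsto_tube_iff.1
    (h0.snd.tendsto ⟨p, S.sectionHom J b (ExtSpace.extMap p)⟩)
  have h3 := h0.fst.tendsto ⟨p, S.sectionHom J b (ExtSpace.extMap p)⟩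
  have e : S.fibreβ J p.1 p.2 (S.sectionHom J b (ExtSpace.extMap p)) =
      S.sectionHom J (S.β J b) p.1 := (S.sectionHom_β J b p.1 p.2).symm
  suffices h4 : Tendsto (fun z : PullbackPt (ExtSpace.extMap (φ := S.φ) (Y := S.μ.hull J))
      (S.FibreB J) ↦ (⟨z.base.1, S.fibreβ J z.base.1 z.base.2 z.val⟩ : Tot (S.FibreB J)))
      (𝓝 ⟨p, S.sectionHom J b (ExtSpace.extMap p)⟩)
      (𝓝 ⟨p.1, S.sectionHom J (S.β J b) p.1⟩) by
    rw [← e] at h4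
    exact h4
  refine h.tendsto_tube_iff.2 ⟨(continuous_subtype_val.tendsto p).comp h3, ?_⟩
  refine squeeze_zero (fun _ ↦ norm_nonneg _) (fun z ↦ ?_) h2
  have e2 := S.sectionHom_β J b z.base.1 z.base.2
  have e3 := norm_map_sub_le (S.fibreβ J z.base.1 z.base.2) z.val
    (S.sectionHom J b (z.base.1.shift z.base.2))
  rw [← e2] at e3
  exact e3

end C0System

/-! ### Multipliers and the strict topology -/

section Multipliers

variable {A : Type*} [NonUnitalCStarAlgebra A] {D : Type*} [NonUnitalCStarAlgebra D]

theorem snd_mul (m : 𝓜(ℂ, A)) (a b : A) : m.snd (a * b) = a * m.snd b := by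
  have h : (m.snd (a * b) - a * m.snd b) * star (m.snd (a * b) - a * m.snd b) = 0 := by
    rw [sub_mul, m.central, mul_assoc a (m.snd b), m.central, mul_assoc, sub_self]
  exact sub_eq_zero.1 ((CStarRing.mul_star_self_eq_zero_iff _).1 h)

/-- The left action of a multiplier carries its whole norm, so it determines the multiplier;
identities between multipliers are checked on `fst` only. -/
theorem multiplier_ext {m n : 𝓜(ℂ, A)} (h : ∀ a, m.fst a = n.fst a) : m = n := by
  have h1 : (m - n).fst = 0 := by
    ext a
    exact sub_eq_zero.2 (h a)
  have h2 : ‖m - n‖ = 0 := by rw [← DoubleCentralizer.norm_fst, h1, norm_zero]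
  exact sub_eq_zero.1 (norm_eq_zero.1 h2)

theorem multiplier_mul_coe (m : 𝓜(ℂ, A)) (a : A) : m * (a : 𝓜(ℂ, A)) = (m.fst a : A) :=
  multiplier_ext fun b ↦ fst_mul m a b

theorem norm_fst_apply_le (m : 𝓜(ℂ, A)) (a : A) : ‖m.fst a‖ ≤ ‖m‖ * ‖a‖ := by
  rw [← DoubleCentralizer.norm_fst]
  exact m.fst.le_opNorm a

/-- Countably many elements of the unit ball are dominated by one element, simultaneously for all
multipliers. -/
theorem exists_dominating (e : ℕ → D) (he : ∀ k, ‖e k‖ ≤ 1) :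
    ∃ t : D, ∀ (m : 𝓜(ℂ, D)) k, ‖m.fst (e k)‖ ≤ 2 ^ k * ‖m.fst t‖ := by
  let _ : PartialOrder D := CStarAlgebra.spectralOrder D
  have _ : StarOrderedRing D := CStarAlgebra.spectralOrderedRing D
  let _ : PartialOrder 𝓜(ℂ, D) := CStarAlgebra.spectralOrder 𝓜(ℂ, D)
  have _ : StarOrderedRing 𝓜(ℂ, D) := CStarAlgebra.spectralOrderedRing 𝓜(ℂ, D)
  -- With t t* = Σ 4^{-k} e_k e_k* one has m e_k e_k* m* ≤ 4^k m t t* m* for every multiplier m; the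
  -- factor 2^k is the square root of 4^k. The sum is factored below as `star t * t`, so the adjoint
  -- of that t is the witness.
  let g : ℕ → D := fun k ↦ ((1 / 4 : ℝ) ^ k) • (e k * star (e k))
  have hg : ∀ k, 0 ≤ g k := fun k ↦
    smul_nonneg (by positivity) (mul_star_self_nonneg (e k))
  have hs : Summable g := by
    refine Summable.of_norm_bounded (g := fun k ↦ (1 / 4 : ℝ) ^ k)
      (summable_geometric_of_lt_one (by norm_num) (by norm_num)) fun k ↦ ?_
    change ‖((1 / 4 : ℝ) ^ k) • (e k * star (e k))‖ ≤ _
    rw [norm_smul, CStarRing.norm_self_mul_star, Real.norm_of_nonneg (by positivity)]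
    have := mul_le_one₀ (he k) (norm_nonneg _) (he k)
    exact mul_le_of_le_one_right (by positivity) this
  obtain ⟨t, ht⟩ := CStarAlgebra.nonneg_iff_eq_star_mul_self.1 (tsum_nonneg hg)
  refine ⟨star t, fun m k ↦ ?_⟩
  have h1 : g k ≤ star t * t := ht ▸ hs.le_tsum k fun i _ ↦ hg i
  have h2 : DoubleCentralizer.coeHom (𝕜 := ℂ) (g k) ≤
      DoubleCentralizer.coeHom (𝕜 := ℂ) (star t * t) := by
    rw [← sub_nonneg, ← map_sub]
    obtain ⟨y, hy⟩ := CStarAlgebra.nonneg_iff_eq_star_mul_self.1 (sub_nonneg.2 h1)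
    rw [hy, map_mul, map_star]
    exact star_mul_self_nonneg _
  have h3 := star_right_conjugate_le_conjugate h2 m
  have e1 : ∀ a : D, m * DoubleCentralizer.coeHom (𝕜 := ℂ) (a * star a) * star m =
      (m.fst a : 𝓜(ℂ, D)) * star (m.fst a : 𝓜(ℂ, D)) := fun a ↦ by
    rw [← multiplier_mul_coe, star_mul, map_mul, map_star]
    simp only [mul_assoc, DoubleCentralizer.coeHom_apply]
  have e2 : m * DoubleCentralizer.coeHom (𝕜 := ℂ) (g k) * star m =
      ((1 / 4 : ℝ) ^ k) • ((m.fst (e k) : 𝓜(ℂ, D)) * star (m.fst (e k) : 𝓜(ℂ, D))) := by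
    rw [← e1]
    change m * DoubleCentralizer.coeHom (𝕜 := ℂ) (((1 / 4 : ℝ) ^ k) • (e k * star (e k))) * _ = _
    rw [map_real_smul (DoubleCentralizer.coeHom (𝕜 := ℂ) (A := D)) (continuous_hom _)]
    rw [mul_smul_comm, smul_mul_assoc]
  have e3 := e1 (star t)
  rw [star_star] at e3
  rw [e2, e3] at h3
  have h4 := CStarAlgebra.norm_le_norm_of_nonneg_of_le
    (smul_nonneg (by positivity) (mul_star_self_nonneg _)) h3
  rw [norm_smul, CStarRing.norm_self_mul_star, CStarRing.norm_self_mul_star,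
    C0Algebra.norm_coe_multiplier, C0Algebra.norm_coe_multiplier,
    Real.norm_of_nonneg (by positivity)] at h4
  refine le_of_sq_le_sq ?_ (by positivity)
  have h5 : (0 : ℝ) < 4 ^ k := by positivity
  have h6 : ((1 / 4 : ℝ) ^ k) = (4 ^ k)⁻¹ := by rw [one_div, inv_pow]
  rw [h6, inv_mul_le_iff₀ h5] at h4
  calc ‖m.fst (e k)‖ ^ 2 ≤ 4 ^ k * (‖m.fst (star t)‖ * ‖m.fst (star t)‖) := by rw [sq]; exact h4
    _ = (2 ^ k * ‖m.fst (star t)‖) ^ 2 := by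
      rw [mul_pow, ← pow_mul, mul_comm k 2, pow_mul]; norm_num; ring

end Multipliers

section Strict

variable {D : Type*} [NonUnitalCStarAlgebra D]

theorem continuous_fst_strict (t : D) :
    Continuous[strictTopology D, inferInstance] fun m : 𝓜(ℂ, D) ↦ m.fst t := by
  let _ := strictTopology D
  have h : Continuous fun m : 𝓜(ℂ, D) ↦
      ((fun a ↦ m.fst a, fun a ↦ m.snd a) : (D → D) × (D → D)) := continuous_induced_dom
  exact (continuous_apply t).comp h.fst

theorem continuous_snd_strict (t : D) :
    Continuous[strictTopology D, inferInstance] fun m : 𝓜(ℂ, D) ↦ m.snd t := by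
  let _ := strictTopology D
  have h : Continuous fun m : 𝓜(ℂ, D) ↦
      ((fun a ↦ m.fst a, fun a ↦ m.snd a) : (D → D) × (D → D)) := continuous_induced_dom
  exact (continuous_apply t).comp h.snd

theorem continuous_star_strict :
    Continuous[strictTopology D, strictTopology D] (star : 𝓜(ℂ, D) → 𝓜(ℂ, D)) := by
  let _ := strictTopology D
  refine continuous_induced_rng.2 ((continuous_pi fun t ↦ ?_).prodMk (continuous_pi fun t ↦ ?_))
  · exact continuous_star.comp (continuous_snd_strict (star t))
  · exact continuous_star.comp (continuous_fst_strict (star t))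

end Strict

/-! ### Strictly continuous extensions from convergence of ψ(e)a -/

section Extension

variable {A : Type*} [NonUnitalCStarAlgebra A] {D : Type*} [NonUnitalCStarAlgebra D]
  {l : Filter D} (hl : IsContractiveUnit l) (ψ : D →⋆ₙₐ[ℂ] A)

include hl in
theorem IsContractiveUnit.star_left (d : D) : Tendsto (fun e ↦ star e * d) l (𝓝 d) := by
  have := (continuous_star.tendsto _).comp (hl.right (star d))
  simpa [Function.comp_def] using this

include hl in
theorem IsContractiveUnit.tendsto_map_mul (d : D) (a : A) :
    Tendsto (fun e ↦ ψ (d * e) * a) l (𝓝 (ψ d * a)) :=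
  (((continuous_hom ψ).tendsto d).comp (hl.right d)).mul_const a

include hl in
theorem IsContractiveUnit.eventually_norm_fst_le (m : 𝓜(ℂ, D)) :
    ∀ᶠ e in l, ∀ a, ‖AddMonoidHom.mulLeft (ψ (m.fst e)) a‖ ≤ ‖m‖ * ‖a‖ := by
  filter_upwards [hl.norm_le] with e he a
  refine (norm_mul_le _ _).trans ?_
  gcongr
  refine (NonUnitalStarAlgHom.norm_apply_le ψ _).trans ((norm_fst_apply_le m e).trans ?_)
  exact mul_le_of_le_one_right (norm_nonneg _) he

include hl in
-- Let c be the limit of ψ(e)a. Then ψ(me)a = ψ(me)c, and for the approximants ψ(f)a of c one has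
-- ψ(me)ψ(f)a → ψ(mf)a. Uniform boundedness carries the convergence over to c.
theorem exists_tendsto_fst (h : ∀ a, ∃ c, Tendsto (fun e ↦ ψ e * a) l (𝓝 c)) (m : 𝓜(ℂ, D))
    (a : A) : ∃ c, Tendsto (fun e ↦ ψ (m.fst e) * a) l (𝓝 c) := by
  have := hl.neBot
  obtain ⟨c, hc⟩ := h a
  have hcl := isClosed_exists_tendsto (l := l) (fun e ↦ AddMonoidHom.mulLeft (ψ (m.fst e)))
    (hl.eventually_norm_fst_le ψ m)
  have hc' : c ∈ {a | ∃ c, Tendsto (fun e ↦ AddMonoidHom.mulLeft (ψ (m.fst e)) a) l (𝓝 c)} := by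
    refine hcl.mem_of_tendsto hc (Eventually.of_forall fun f ↦ ⟨ψ (m.fst f) * a, ?_⟩)
    have h1 := ((continuous_hom ψ).comp m.fst.continuous).tendsto f |>.comp (hl.left f)
    refine (h1.mul_const a).congr fun e ↦ ?_
    change ψ (m.fst (e * f)) * a = ψ (m.fst e) * (ψ f * a)
    rw [fst_mul, map_mul, mul_assoc]
  obtain ⟨c', hc'⟩ := hc'
  refine ⟨c', hc'.congr fun e ↦ ?_⟩
  refine tendsto_nhds_unique (hc.const_mul (ψ (m.fst e))) ?_
  refine (hl.tendsto_map_mul ψ (m.fst e) a).congr fun f ↦ ?_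
  rw [map_mul, mul_assoc]

variable (h : ∀ a, ∃ c, Tendsto (fun e ↦ ψ e * a) l (𝓝 c))

/-- The left multiplication by the image of a multiplier. -/
def extFst (m : 𝓜(ℂ, D)) : A →L[ℂ] A :=
  have _ := hl.neBot
  have hs := fun a ↦ (exists_tendsto_fst hl ψ h m a).choose_spec
  LinearMap.mkContinuous
    { toFun := fun a ↦ (exists_tendsto_fst hl ψ h m a).choose
      map_add' := fun a b ↦ tendsto_nhds_unique (hs (a + b))
        (((hs a).add (hs b)).congr fun _ ↦ (mul_add _ _ _).symm)
      map_smul' := fun c a ↦ tendsto_nhds_unique (hs (c • a))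
        (((hs a).const_smul c).congr fun _ ↦ (mul_smul_comm c _ _).symm) }
    ‖m‖ fun a ↦ le_of_tendsto (hs a).norm
      ((hl.eventually_norm_fst_le ψ m).mono fun _ he ↦ he a)

theorem tendsto_extFst (m : 𝓜(ℂ, D)) (a : A) :
    Tendsto (fun e ↦ ψ (m.fst e) * a) l (𝓝 (extFst hl ψ h m a)) :=
  (exists_tendsto_fst hl ψ h m a).choose_spec

theorem extFst_eq {m : 𝓜(ℂ, D)} {a c : A} (hc : Tendsto (fun e ↦ ψ (m.fst e) * a) l (𝓝 c)) :
    extFst hl ψ h m a = c :=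
  have := hl.neBot
  tendsto_nhds_unique (tendsto_extFst hl ψ h m a) hc

theorem extFst_map_mul (m : 𝓜(ℂ, D)) (d : D) (a : A) :
    extFst hl ψ h m (ψ d * a) = ψ (m.fst d) * a := by
  refine extFst_eq hl ψ h ?_
  have h1 := ((continuous_hom ψ).comp m.fst.continuous).tendsto d |>.comp (hl.left d)
  refine (h1.mul_const a).congr fun e ↦ ?_
  change ψ (m.fst (e * d)) * a = ψ (m.fst e) * (ψ d * a)
  rw [fst_mul, map_mul, mul_assoc]

theorem map_mul_extFst (m : 𝓜(ℂ, D)) (d : D) (a : A) :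
    ψ d * extFst hl ψ h m a = ψ (m.snd d) * a := by
  have := hl.neBot
  refine tendsto_nhds_unique ((tendsto_extFst hl ψ h m a).const_mul (ψ d)) ?_
  refine (hl.tendsto_map_mul ψ (m.snd d) a).congr fun e ↦ ?_
  rw [m.central, map_mul, mul_assoc]

theorem isClosed_setOf_tendsto_map_mul {T : D → D} (hT : ∀ᶠ e in l, ‖T e‖ ≤ 1) :
    IsClosed {a : A | Tendsto (fun e ↦ ψ (T e) * a) l (𝓝 a)} := by
  refine isClosed_tendsto_addMonoidHom (C := 2) (fun e ↦ AddMonoidHom.mulLeft (ψ (T e)))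
    (AddMonoidHom.id A) ?_
  filter_upwards [hT] with e he a
  have h1 : ‖ψ (T e) * a‖ ≤ 1 * ‖a‖ := (norm_mul_le _ _).trans <| by
    gcongr
    exact (NonUnitalStarAlgHom.norm_apply_le ψ _).trans he
  refine (norm_sub_le _ _).trans ?_
  rw [two_mul]
  exact add_le_add (h1.trans_eq (one_mul _)) le_rfl

/-- Allows the adjoint of the unit to be inserted in front of the extended action, which turns the
compatibility of left and right actions into `map_mul_extFst`. -/
theorem tendsto_map_star_mul_extFst (m : 𝓜(ℂ, D)) (a : A) :
    Tendsto (fun e ↦ ψ (star e) * extFst hl ψ h m a) l (𝓝 (extFst hl ψ h m a)) := by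
  have := hl.neBot
  have hcl := isClosed_setOf_tendsto_map_mul (l := l) ψ (T := star)
    (hl.norm_le.mono fun e he ↦ by rwa [norm_star])
  refine hcl.mem_of_tendsto (tendsto_extFst hl ψ h m a) (Eventually.of_forall fun f ↦ ?_)
  have h1 := (((continuous_hom ψ).tendsto _).comp (hl.star_left (m.fst f))).mul_const a
  refine h1.congr fun e ↦ ?_
  change ψ (star e * m.fst f) * a = _
  rw [map_mul, mul_assoc]

/-- The right multiplication by the image of a multiplier. -/
def extSnd (m : 𝓜(ℂ, D)) : A →L[ℂ] A :=
  LinearMap.mkContinuous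
    { toFun := fun a ↦ star (extFst hl ψ h (star m) (star a))
      map_add' := fun a b ↦ by rw [star_add, map_add, star_add]
      map_smul' := fun c a ↦ by simp }
    ‖extFst hl ψ h (star m)‖ fun a ↦ by
      simpa using (extFst hl ψ h (star m)).le_opNorm (star a)

/-- The image of a multiplier. -/
def extMultiplier (m : 𝓜(ℂ, D)) : 𝓜(ℂ, A) where
  fst := extFst hl ψ h m
  snd := extSnd hl ψ h m
  central a b := by
    have := hl.neBot
    change star (extFst hl ψ h (star m) (star a)) * b = a * extFst hl ψ h m b
    have h1 := ((continuous_star.tendsto _).comp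
      (tendsto_extFst hl ψ h (star m) (star a))).mul_const b
    refine tendsto_nhds_unique h1
      (((tendsto_map_star_mul_extFst hl ψ h m b).const_mul a).congr fun e ↦ ?_)
    rw [map_mul_extFst]
    change _ = star (ψ (star (m.snd (star e))) * star a) * b
    rw [star_mul, star_star, ← map_star ψ, star_star, mul_assoc]

/-- The strictly continuous extension, constructed from the limits `lim ψ(e) a`. -/
def extHom : 𝓜(ℂ, D) →⋆ₙₐ[ℂ] 𝓜(ℂ, A) where
  toFun := extMultiplier hl ψ h
  map_smul' c m := multiplier_ext fun a ↦ extFst_eq hl ψ h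
    (((tendsto_extFst hl ψ h m a).const_smul c).congr fun e ↦ by
      change _ = ψ (c • m.fst e) * a
      rw [map_smul, smul_mul_assoc])
  map_zero' := multiplier_ext fun a ↦ extFst_eq hl ψ h (tendsto_const_nhds.congr fun e ↦ by
    change 0 = ψ 0 * a
    rw [map_zero, zero_mul])
  map_add' m n := multiplier_ext fun a ↦ extFst_eq hl ψ h
    (((tendsto_extFst hl ψ h m a).add (tendsto_extFst hl ψ h n a)).congr fun e ↦ by
      change _ = ψ (m.fst e + n.fst e) * a
      rw [map_add, add_mul])
  map_mul' m n := multiplier_ext fun a ↦ extFst_eq hl ψ h <| by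
    have h1 := ((extFst hl ψ h m).continuous.tendsto _).comp (tendsto_extFst hl ψ h n a)
    exact h1.congr fun e ↦ extFst_map_mul hl ψ h m (n.fst e) a
  map_star' m := multiplier_ext fun a ↦ by
    change extFst hl ψ h (star m) a = star (star (extFst hl ψ h (star m) (star (star a))))
    rw [star_star, star_star]

include hl in
-- A substitute for Cohen factorization: starting from r₀ = c, subtract ψ(e_k)r_k, where e_k fixes
-- r_k up to 4^{-(k+1)}. The remainders stay in the space on which the unit acts as an approximate
-- identity.
theorem exists_series {c : A} (hc : Tendsto (fun e ↦ ψ e * c) l (𝓝 c)) :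
    ∃ (e : ℕ → D) (r : ℕ → A) (C : ℝ), (∀ k, ‖e k‖ ≤ 1) ∧ (∀ k, ‖r k‖ ≤ C * (1 / 4) ^ k) ∧
      HasSum (fun k ↦ ψ (e k) * r k) c := by
  have := hl.neBot
  let R := {r : A // Tendsto (fun e ↦ ψ e * r) l (𝓝 r)}
  have step : ∀ (r : R) (k : ℕ), ∃ e : D, ‖e‖ ≤ 1 ∧ ‖r.1 - ψ e * r.1‖ ≤ (1 / 4) ^ (k + 1) := by
    intro r k
    have h1 := (tendsto_iff_norm_sub_tendsto_zero.1 r.2).eventually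
      (eventually_le_nhds (show (0 : ℝ) < (1 / 4) ^ (k + 1) by positivity))
    obtain ⟨e, he, he'⟩ := (h1.and hl.norm_le).exists
    exact ⟨e, he', by rwa [norm_sub_rev]⟩
  choose g hg1 hg2 using step
  have hR : ∀ (r : R) (e : D), Tendsto (fun f ↦ ψ f * (r.1 - ψ e * r.1)) l
      (𝓝 (r.1 - ψ e * r.1)) := by
    intro r e
    have h1 := (((continuous_hom ψ).tendsto e).comp (hl.left e)).mul_const r.1
    refine (r.2.sub h1).congr fun f ↦ ?_
    simp only [Function.comp_apply, map_mul, mul_sub, mul_assoc]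
  let q : ℕ → R := fun n ↦ Nat.rec ⟨c, hc⟩ (fun k r ↦ ⟨r.1 - ψ (g r k) * r.1, hR r _⟩) n
  have hq : ∀ k, (q (k + 1)).1 = (q k).1 - ψ (g (q k) k) * (q k).1 := fun _ ↦ rfl
  have hn : ∀ k, ‖(q k).1‖ ≤ (‖c‖ + 1) * (1 / 4) ^ k := by
    intro k
    cases k with
    | zero =>
      change ‖c‖ ≤ _
      rw [pow_zero, mul_one]
      exact (lt_add_one _).le
    | succ k =>
      rw [hq]
      exact (hg2 (q k) k).trans (le_mul_of_one_le_left (by positivity)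
        (le_add_of_nonneg_left (norm_nonneg c)))
  refine ⟨fun k ↦ g (q k) k, fun k ↦ (q k).1, ‖c‖ + 1, fun k ↦ hg1 _ _, hn, ?_⟩
  have hgeo : Summable fun k : ℕ ↦ (‖c‖ + 1) * (1 / 4 : ℝ) ^ k :=
    (summable_geometric_of_lt_one (by norm_num) (by norm_num)).mul_left _
  have hsum : Summable fun k ↦ ψ (g (q k) k) * (q k).1 := by
    refine Summable.of_norm_bounded hgeo fun k ↦ ?_
    refine (norm_mul_le _ _).trans ?_
    exact (mul_le_of_le_one_left (norm_nonneg _)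
      ((NonUnitalStarAlgHom.norm_apply_le ψ _).trans (hg1 _ _))).trans (hn k)
  rw [hsum.hasSum_iff_tendsto_nat]
  have hp : ∀ n, ∑ k ∈ Finset.range n, ψ (g (q k) k) * (q k).1 = c - (q n).1 := by
    intro n
    induction n with
    | zero => exact (sub_self c).symm
    | succ n ih =>
      rw [Finset.sum_range_succ, ih, hq]
      abel
  simp_rw [hp]
  have h0 : Tendsto (fun n ↦ (q n).1) atTop (𝓝 0) :=
    squeeze_zero_norm hn hgeo.tendsto_atTop_zero
  simpa using h0.const_sub c

/-- One strict seminorm controls the action on c: in the series for c the growth 2^k from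
`exists_dominating` is beaten by the decay 4^{-k} of the remainders. Since the estimate is uniform
in m, it gives strict continuity on all of M(D), not only on bounded sets. -/
theorem exists_norm_extFst_le {c : A} (hc : Tendsto (fun e ↦ ψ e * c) l (𝓝 c)) :
    ∃ (t : D) (C : ℝ), ∀ m, ‖extFst hl ψ h m c‖ ≤ C * ‖m.fst t‖ := by
  obtain ⟨e, r, C, he, hr, hs⟩ := exists_series hl ψ hc
  obtain ⟨t, ht⟩ := exists_dominating e he
  refine ⟨t, C * 2, fun m ↦ ?_⟩
  have h1 := (extFst hl ψ h m).hasSum hs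
  have h2 : HasSum (fun k ↦ C * ‖m.fst t‖ * (1 / 2 : ℝ) ^ k) (C * ‖m.fst t‖ * 2) :=
    hasSum_geometric_two.mul_left _
  have h3 : ‖∑' k, extFst hl ψ h m (ψ (e k) * r k)‖ ≤ C * ‖m.fst t‖ * 2 := by
    refine tsum_of_norm_bounded h2 fun k ↦ ?_
    rw [extFst_map_mul]
    refine (norm_mul_le _ _).trans ?_
    calc ‖ψ (m.fst (e k))‖ * ‖r k‖ ≤ (2 ^ k * ‖m.fst t‖) * (C * (1 / 4) ^ k) := by
          gcongr
          · exact (NonUnitalStarAlgHom.norm_apply_le ψ _).trans (ht m k)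
          · exact hr k
      _ = C * ‖m.fst t‖ * (1 / 2 : ℝ) ^ k := by
          rw [show (1 / 4 : ℝ) = 1 / 2 * (1 / 2) by norm_num, mul_pow]
          have : (2 : ℝ) ^ k * (1 / 2) ^ k = 1 := by rw [← mul_pow]; norm_num
          linear_combination C * ‖m.fst t‖ * (1 / 2 : ℝ) ^ k * this
  rw [← h1.tsum_eq]
  exact h3.trans_eq (by ring)

theorem continuous_extFst_strict (a : A) :
    Continuous[strictTopology D, inferInstance] fun m ↦ extFst hl ψ h m a := by
  let _ := strictTopology D
  have := hl.neBot
  obtain ⟨c, hc⟩ := h a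
  have hcc : Tendsto (fun e ↦ ψ e * c) l (𝓝 c) := by
    refine (isClosed_setOf_tendsto_map_mul (l := l) ψ (T := id) hl.norm_le).mem_of_tendsto hc
      (Eventually.of_forall fun f ↦ ?_)
    have h1 := (((continuous_hom ψ).tendsto _).comp (hl.left f)).mul_const a
    refine h1.congr fun e ↦ ?_
    change ψ (e * f) * a = _
    rw [map_mul, mul_assoc]
    rfl
  -- The series requires a vector fixed in the limit by the unit; the extended action cannot
  -- distinguish `a` from the limit `c` of ψ(e)a.
  have hac : ∀ m, extFst hl ψ h m a = extFst hl ψ h m c := by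
    intro m
    refine extFst_eq hl ψ h ?_
    refine (tendsto_extFst hl ψ h m c).congr fun e ↦ ?_
    refine tendsto_nhds_unique (hc.const_mul (ψ (m.fst e))) ?_
    refine (hl.tendsto_map_mul ψ (m.fst e) a).congr fun f ↦ ?_
    rw [map_mul, mul_assoc]
  obtain ⟨t, C, htC⟩ := exists_norm_extFst_le hl ψ h hcc
  have ht : Continuous fun m : 𝓜(ℂ, D) ↦ m.fst t := continuous_fst_strict t
  refine continuous_iff_continuousAt.2 fun m ↦ tendsto_iff_norm_sub_tendsto_zero.2 ?_
  have h0 : Tendsto (fun n : 𝓜(ℂ, D) ↦ C * ‖n.fst t - m.fst t‖) (𝓝 m) (𝓝 0) := by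
    simpa using (tendsto_iff_norm_sub_tendsto_zero.1 (ht.tendsto m)).const_mul C
  refine squeeze_zero (fun _ ↦ norm_nonneg _) (fun n ↦ ?_) h0
  have e1 : extFst hl ψ h n a - extFst hl ψ h m a = extFst hl ψ h (n - m) c := by
    rw [hac, hac]
    exact congrArg (fun z : 𝓜(ℂ, A) ↦ z.fst c) (map_sub (extHom hl ψ h) n m).symm
  beta_reduce
  rw [e1]
  exact htC (n - m)

theorem isStrictExtension_extHom : IsStrictExtension ψ (extHom hl ψ h) := by
  refine ⟨fun d ↦ multiplier_ext fun a ↦ extFst_eq hl ψ h (hl.tendsto_map_mul ψ d a), ?_⟩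
  let t1 := strictTopology D
  refine continuous_induced_rng.2 ((continuous_pi fun a ↦ ?_).prodMk (continuous_pi fun a ↦ ?_))
  · exact continuous_extFst_strict hl ψ h a
  · exact continuous_star.comp ((continuous_extFst_strict hl ψ h (star a)).comp
      continuous_star_strict)

end Extension

section Extendible

variable {A : Type*} [NonUnitalCStarAlgebra A] {D : Type*} [NonUnitalCStarAlgebra D]
  {l : Filter D} {ψ : D →⋆ₙₐ[ℂ] A}

theorem isExtendible_of_tendsto (hl : IsContractiveUnit l)
    (h : ∀ a, ∃ c, Tendsto (fun e ↦ ψ e * a) l (𝓝 c)) : IsExtendible ψ :=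
  ⟨_, isStrictExtension_extHom hl ψ h⟩

theorem isStrictExtension_strictExtension (hψ : IsExtendible ψ) :
    IsStrictExtension ψ (strictExtension ψ) := by
  unfold strictExtension
  rw [dif_pos hψ]
  exact hψ.choose_spec

theorem IsContractiveUnit.tendsto_strict (hl : IsContractiveUnit l) :
    Tendsto (fun e : D ↦ (e : 𝓜(ℂ, D))) l (@nhds _ (strictTopology D) 1) := by
  rw [nhds_induced, tendsto_comap_iff]
  refine Tendsto.prodMk_nhds (tendsto_pi_nhds.2 fun d ↦ ?_) (tendsto_pi_nhds.2 fun d ↦ ?_)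
  · exact hl.left d
  · exact hl.right d

/-- Approximate units converge strictly to 1. Therefore the value at 1 of the chosen extension is
the strict limit of ψ(e); all the properties of p below are read off from this. -/
theorem tendsto_strictExtension_one (hψ : IsExtendible ψ) (hl : IsContractiveUnit l) :
    Tendsto (fun e : D ↦ (ψ e : 𝓜(ℂ, A))) l (@nhds _ (strictTopology A) (strictExtension ψ 1)) := by
  have h := isStrictExtension_strictExtension hψ
  have h1 := (@Continuous.tendsto _ _ (strictTopology D) (strictTopology A) _ h.2 1).comp
    hl.tendsto_strict
  exact h1.congr fun e ↦ h.1 e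

theorem tendsto_fst_strictExtension (hψ : IsExtendible ψ) (hl : IsContractiveUnit l) (a : A) :
    Tendsto (fun e : D ↦ ψ e * a) l (𝓝 ((strictExtension ψ 1).fst a)) := by
  have h1 := tendsto_strictExtension_one hψ hl
  rw [nhds_induced, tendsto_comap_iff] at h1
  exact tendsto_pi_nhds.1 ((continuous_fst.tendsto _).comp h1) a

theorem tendsto_snd_strictExtension (hψ : IsExtendible ψ) (hl : IsContractiveUnit l) (a : A) :
    Tendsto (fun e : D ↦ a * ψ e) l (𝓝 ((strictExtension ψ 1).snd a)) := by
  have h1 := tendsto_strictExtension_one hψ hl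
  rw [nhds_induced, tendsto_comap_iff] at h1
  exact tendsto_pi_nhds.1 ((continuous_snd.tendsto _).comp h1) a

end Extendible

/-! ### Compression by the image of the unit -/

section UnitImage

variable {A : Type*} [NonUnitalCStarAlgebra A] {D : Type*} [NonUnitalCStarAlgebra D]
  {A' : Type*} [NonUnitalCStarAlgebra A'] {D' : Type*} [NonUnitalCStarAlgebra D']
  {Q : Type*} [NonUnitalCStarAlgebra Q] {l : Filter D} {ψ : D →⋆ₙₐ[ℂ] A} {ψ' : D' →⋆ₙₐ[ℂ] A'}

theorem fst_strictExtension_one_apply (hψ : IsExtendible ψ) (d : D) :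
    (strictExtension ψ 1).fst (ψ d) = ψ d := by
  obtain ⟨l, hl⟩ := exists_isContractiveUnit D
  have := hl.neBot
  refine tendsto_nhds_unique (tendsto_fst_strictExtension hψ hl (ψ d)) ?_
  exact (((continuous_hom ψ).tendsto d).comp (hl.left d)).congr fun e ↦ map_mul ψ e d

theorem star_strictExtension_one (ψ : D →⋆ₙₐ[ℂ] A) :
    star (strictExtension ψ 1) = strictExtension ψ 1 := by
  rw [← map_star, star_one]

theorem star_fst_strictExtension_one (ψ : D →⋆ₙₐ[ℂ] A) (a : A) :
    star ((strictExtension ψ 1).fst a) = (strictExtension ψ 1).snd (star a) := by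
  have h := congrArg (fun m : 𝓜(ℂ, A) ↦ m.snd (star a)) (star_strictExtension_one ψ)
  have h2 : (star (strictExtension ψ 1)).snd (star a) =
      star ((strictExtension ψ 1).fst (star (star a))) := rfl
  rw [star_star] at h2
  exact h2.symm.trans h

theorem star_snd_strictExtension_one (ψ : D →⋆ₙₐ[ℂ] A) (a : A) :
    star ((strictExtension ψ 1).snd a) = (strictExtension ψ 1).fst (star a) := by
  rw [← star_star ((strictExtension ψ 1).fst (star a)), star_fst_strictExtension_one, star_star]

theorem snd_strictExtension_one_apply (hψ : IsExtendible ψ) (d : D) :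
    (strictExtension ψ 1).snd (ψ d) = ψ d := by
  have h := star_fst_strictExtension_one ψ (ψ (star d))
  rw [fst_strictExtension_one_apply hψ, ← map_star ψ, star_star] at h
  exact h.symm

theorem norm_fst_strictExtension_one_le (hψ : IsExtendible ψ) (a : A) :
    ‖(strictExtension ψ 1).fst a‖ ≤ ‖a‖ := by
  obtain ⟨l, hl⟩ := exists_isContractiveUnit D
  have := hl.neBot
  refine le_of_tendsto (tendsto_fst_strictExtension hψ hl a).norm ?_
  filter_upwards [hl.norm_le] with e he
  exact (norm_mul_le _ _).trans (mul_le_of_le_one_left (norm_nonneg _)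
    ((NonUnitalStarAlgHom.norm_apply_le ψ _).trans he))

theorem norm_compress_le (hψ : IsExtendible ψ) (a : A) :
    ‖compress (strictExtension ψ 1) a‖ ≤ ‖a‖ := by
  have h : compress (strictExtension ψ 1) a =
      star ((strictExtension ψ 1).fst (star ((strictExtension ψ 1).fst a))) := by
    rw [star_fst_strictExtension_one, star_star]
    rfl
  rw [h, norm_star]
  refine (norm_fst_strictExtension_one_le hψ _).trans ?_
  rw [norm_star]
  exact norm_fst_strictExtension_one_le hψ a

theorem compress_sub (m : 𝓜(ℂ, A)) (a b : A) : compress m (a - b) = compress m a - compress m b := by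
  unfold compress
  rw [map_sub, map_sub]

theorem compress_add (m : 𝓜(ℂ, A)) (a b : A) : compress m (a + b) = compress m a + compress m b := by
  unfold compress
  rw [map_add, map_add]

theorem compress_smul (m : 𝓜(ℂ, A)) (c : ℂ) (a : A) : compress m (c • a) = c • compress m a := by
  unfold compress
  rw [map_smul, map_smul]

theorem compress_apply_mul (hψ : IsExtendible ψ) (d : D) (b : A) :
    compress (strictExtension ψ 1) (ψ d * b) = ψ d * compress (strictExtension ψ 1) b := by
  unfold compress
  rw [fst_mul, fst_strictExtension_one_apply hψ, ← snd_mul, ← (strictExtension ψ 1).central,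
    snd_strictExtension_one_apply hψ]

theorem compress_mul_apply (hψ : IsExtendible ψ) (b : A) (d : D) :
    compress (strictExtension ψ 1) (b * ψ d) = compress (strictExtension ψ 1) b * ψ d := by
  unfold compress
  rw [fst_mul, snd_mul, snd_strictExtension_one_apply hψ, (strictExtension ψ 1).central,
    fst_strictExtension_one_apply hψ]

theorem compress_apply_mul_apply (hψ : IsExtendible ψ) (d : D) (b : A) (d' : D) :
    compress (strictExtension ψ 1) (ψ d * b * ψ d') = ψ d * b * ψ d' := by
  unfold compress
  rw [mul_assoc, fst_mul, fst_strictExtension_one_apply hψ, ← mul_assoc, snd_mul,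
    snd_strictExtension_one_apply hψ]

theorem compress_apply (hψ : IsExtendible ψ) (d : D) :
    compress (strictExtension ψ 1) (ψ d) = ψ d := by
  unfold compress
  rw [fst_strictExtension_one_apply hψ, snd_strictExtension_one_apply hψ]

theorem compress_star_mul_self (ψ : D →⋆ₙₐ[ℂ] A) (b : A) :
    compress (strictExtension ψ 1) (star b * b) =
      star ((strictExtension ψ 1).snd b) * (strictExtension ψ 1).snd b := by
  rw [star_snd_strictExtension_one]
  unfold compress
  rw [fst_mul, snd_mul]

theorem compress_mem_of_isClosed (hψ : IsExtendible ψ) (hl : IsContractiveUnit l) {s : Set A}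
    (hs : IsClosed s) {a : A} (h : ∀ᶠ d in l, ∀ᶠ d' in l, ψ d * a * ψ d' ∈ s) :
    compress (strictExtension ψ 1) a ∈ s := by
  have := hl.neBot
  refine hs.mem_of_tendsto (((strictExtension ψ 1).snd.continuous.tendsto _).comp
    (tendsto_fst_strictExtension hψ hl a)) ?_
  filter_upwards [h] with e he
  exact hs.mem_of_tendsto (tendsto_snd_strictExtension hψ hl (ψ e * a)) he

/-- Compares the unit images of two homomorphisms through a common quotient: both sides are limits
of the same net, because the two approximate units have the same images there. It is used between A,
B and the fibres. -/
theorem map_fst_strictExtension_one (hψ : IsExtendible ψ) (hψ' : IsExtendible ψ')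
    {ι : Type*} {l : Filter ι} (θ : ι → D) (hθ : IsContractiveUnit (l.map θ)) (θ' : ι → D')
    (hθ' : IsContractiveUnit (l.map θ')) (χ : A →⋆ₙₐ[ℂ] Q) (χ' : A' →⋆ₙₐ[ℂ] Q)
    (h : ∀ i, χ (ψ (θ i)) = χ' (ψ' (θ' i))) {a : A} {a' : A'} (ha : χ a = χ' a') :
    χ ((strictExtension ψ 1).fst a) = χ' ((strictExtension ψ' 1).fst a') := by
  have : l.NeBot := (map_neBot_iff θ).1 hθ.neBot
  have h1 := ((continuous_hom χ).tendsto _).comp (tendsto_fst_strictExtension hψ hθ a)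
  have h2 := ((continuous_hom χ').tendsto _).comp (tendsto_fst_strictExtension hψ' hθ' a')
  rw [tendsto_map'_iff] at h1 h2
  refine tendsto_nhds_unique h1 (h2.congr fun e ↦ ?_)
  simp only [Function.comp_apply, map_mul, h, ha]

theorem map_snd_strictExtension_one (hψ : IsExtendible ψ) (hψ' : IsExtendible ψ')
    {ι : Type*} {l : Filter ι} (θ : ι → D) (hθ : IsContractiveUnit (l.map θ)) (θ' : ι → D')
    (hθ' : IsContractiveUnit (l.map θ')) (χ : A →⋆ₙₐ[ℂ] Q) (χ' : A' →⋆ₙₐ[ℂ] Q)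
    (h : ∀ i, χ (ψ (θ i)) = χ' (ψ' (θ' i))) {a : A} {a' : A'} (ha : χ a = χ' a') :
    χ ((strictExtension ψ 1).snd a) = χ' ((strictExtension ψ' 1).snd a') := by
  have : l.NeBot := (map_neBot_iff θ).1 hθ.neBot
  have h1 := ((continuous_hom χ).tendsto _).comp (tendsto_snd_strictExtension hψ hθ a)
  have h2 := ((continuous_hom χ').tendsto _).comp (tendsto_snd_strictExtension hψ' hθ' a')
  rw [tendsto_map'_iff] at h1 h2
  refine tendsto_nhds_unique h1 (h2.congr fun e ↦ ?_)
  simp only [Function.comp_apply, map_mul, h, ha]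

theorem map_compress (hψ : IsExtendible ψ) (hψ' : IsExtendible ψ')
    {ι : Type*} {l : Filter ι} (θ : ι → D) (hθ : IsContractiveUnit (l.map θ)) (θ' : ι → D')
    (hθ' : IsContractiveUnit (l.map θ')) (χ : A →⋆ₙₐ[ℂ] Q) (χ' : A' →⋆ₙₐ[ℂ] Q)
    (h : ∀ i, χ (ψ (θ i)) = χ' (ψ' (θ' i))) {a : A} {a' : A'} (ha : χ a = χ' a') :
    χ (compress (strictExtension ψ 1) a) = χ' (compress (strictExtension ψ' 1) a') :=
  map_snd_strictExtension_one hψ hψ' θ hθ θ' hθ' χ χ' h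
    (map_fst_strictExtension_one hψ hψ' θ hθ θ' hθ' χ χ' h ha)

/-- Convergence of ψ(e)a passes to quotients, hence extendibility does. -/
theorem IsExtendible.of_map (hψ : IsExtendible ψ) (hl : IsContractiveUnit l) (θ : D → D')
    (hθ : IsContractiveUnit (l.map θ)) (χ : A →⋆ₙₐ[ℂ] A') (hχ : Function.Surjective χ)
    (h : ∀ d, χ (ψ d) = ψ' (θ d)) : IsExtendible ψ' := by
  refine isExtendible_of_tendsto hθ fun a' ↦ ?_
  obtain ⟨a, rfl⟩ := hχ a'
  refine ⟨χ ((strictExtension ψ 1).fst a), ?_⟩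
  rw [tendsto_map'_iff]
  refine (((continuous_hom χ).tendsto _).comp (tendsto_fst_strictExtension hψ hl a)).congr
    fun e ↦ ?_
  simp only [Function.comp_apply, map_mul, h]

theorem IsExtendible.id : IsExtendible (NonUnitalStarAlgHom.id ℂ A) := by
  obtain ⟨l, hl⟩ := exists_isContractiveUnit A
  exact isExtendible_of_tendsto hl fun a ↦ ⟨a, hl.left a⟩

theorem IsExtendible.comp {χ : A →⋆ₙₐ[ℂ] A'} (hχ : IsExtendible χ) (hψ : IsExtendible ψ) :
    IsExtendible (χ.comp ψ) := by
  obtain ⟨Χ, h1, h2⟩ := hχ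
  obtain ⟨Ψ, h3, h4⟩ := hψ
  refine ⟨Χ.comp Ψ, fun d ↦ (congrArg Χ (h3 d)).trans (h1 _), ?_⟩
  exact @Continuous.comp _ _ _ (strictTopology D) (strictTopology A) (strictTopology A') _ _ h2 h4

theorem IsContractiveUnit.tendsto_mul_mul {l : Filter A} (hl : IsContractiveUnit l) (a : A) :
    Tendsto (fun e ↦ e * a * e) l (𝓝 a) := by
  rw [tendsto_iff_norm_sub_tendsto_zero]
  have h1 := (tendsto_iff_norm_sub_tendsto_zero.1 (hl.left a)).add
    (tendsto_iff_norm_sub_tendsto_zero.1 (hl.right a))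
  rw [add_zero] at h1
  refine squeeze_zero' (Eventually.of_forall fun _ ↦ norm_nonneg _) ?_ h1
  filter_upwards [hl.norm_le] with e he
  calc ‖e * a * e - a‖ = ‖(e * a - a) * e + (a * e - a)‖ := by congr 1; noncomm_ring
    _ ≤ ‖e * a - a‖ * ‖e‖ + ‖a * e - a‖ := (norm_add_le _ _).trans (by gcongr; exact norm_mul_le _ _)
    _ ≤ _ := by gcongr; exact mul_le_of_le_one_right (norm_nonneg _) he

end UnitImage

/-! ### Existence and uniqueness of regular transfer operators -/

section Transfer

/-- Injective homomorphisms reflect positivity: compressing c by its negative part gives a negative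
element whose image is positive, so it vanishes. -/
theorem exists_star_mul_self_of_map {D : Type*} [NonUnitalCStarAlgebra D] {A : Type*}
    [NonUnitalCStarAlgebra A] (ψ : D →⋆ₙₐ[ℂ] A) (hψ : Function.Injective ψ) {c : D} {y : A}
    (h : ψ c = star y * y) : ∃ d, c = star d * d := by
  let _ : PartialOrder D := CStarAlgebra.spectralOrder D
  have _ : StarOrderedRing D := CStarAlgebra.spectralOrderedRing D
  let _ : PartialOrder A := CStarAlgebra.spectralOrder A
  have _ : StarOrderedRing A := CStarAlgebra.spectralOrderedRing A
  have hc : IsSelfAdjoint c := hψ (by rw [map_star, h, star_mul, star_star])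
  have hn : 0 ≤ c⁻ := CFC.negPart_nonneg c
  have hns : star c⁻ = c⁻ := (IsSelfAdjoint.of_nonneg hn).star_eq
  obtain ⟨r, hr⟩ := CStarAlgebra.nonneg_iff_eq_star_mul_self.1 hn
  -- Both sides are minus the cube of the negative part of c.
  have e1 : c⁻ * c * c⁻ = -(star (r * c⁻) * (r * c⁻)) := by
    have e2 : c * c⁻ = -(c⁻ * c⁻) := by
      have e3 := CFC.posPart_sub_negPart c hc
      calc c * c⁻ = (c⁺ - c⁻) * c⁻ := by rw [e3]
        _ = _ := by rw [sub_mul, CFC.posPart_mul_negPart, zero_sub]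
    have e4 : star (r * c⁻) * (r * c⁻) = c⁻ * (star r * r) * c⁻ := by
      rw [star_mul, hns]
      simp only [mul_assoc]
    rw [e4, ← hr, mul_assoc, e2, mul_neg, mul_assoc]
  have e2 : ψ (star (r * c⁻) * (r * c⁻)) = 0 := by
    refine le_antisymm ?_ ?_
    · have e3 : -ψ (star (r * c⁻) * (r * c⁻)) = star (y * ψ c⁻) * (y * ψ c⁻) := by
        rw [← map_neg, ← e1, map_mul, map_mul, h, star_mul, ← map_star, hns]
        simp only [mul_assoc]
      have e4 := star_mul_self_nonneg (y * ψ c⁻)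
      rw [← e3] at e4
      exact neg_nonneg.1 e4
    · rw [map_mul, map_star]
      exact star_mul_self_nonneg _
  have e3 : r * c⁻ = 0 := by
    rw [← map_zero ψ] at e2
    exact (CStarRing.star_mul_self_eq_zero_iff _).1 (hψ e2)
  have e4 : c⁻ = 0 := by
    refine (CStarRing.star_mul_self_eq_zero_iff _).1 ?_
    rw [hns]
    calc c⁻ * c⁻ = star r * r * c⁻ := by rw [← hr]
      _ = 0 := by rw [mul_assoc, e3, mul_zero]
  have e5 := CFC.posPart_sub_negPart c hc
  rw [e4, sub_zero] at e5
  exact CStarAlgebra.nonneg_iff_eq_star_mul_self.1 (e5 ▸ CFC.posPart_nonneg c)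

variable {B : Type*} [NonUnitalCStarAlgebra B] {β : B →⋆ₙₐ[ℂ] B}

/-- With p the image of 1, β is injective on K and its image of K contains pBp. Hence L(b) can be
the unique element of K with image pbp, and all the identities follow by comparing images in pBp. -/
theorem exists_isRegularTransferOperator (hβ : IsExtendible β) (K : ClosedIdeal B)
    (hK : ∀ c ∈ K, β c = 0 → c = 0)
    (hE : ∀ b, ∃ c ∈ K, β c = compress (strictExtension β 1) b) :
    ∃ L : B →ₗ[ℂ] B, (∀ b, L b ∈ K) ∧ (∀ b, β (L b) = compress (strictExtension β 1) b) ∧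
      IsRegularTransferOperator β L := by
  choose L hLK hL using hE
  have huniq : ∀ b c, c ∈ K → β c = compress (strictExtension β 1) b → L b = c := by
    intro b c hc h
    refine sub_eq_zero.1 (hK _ (K.sub_mem (hLK b) hc) ?_)
    rw [map_sub, hL, h, sub_self]
  let L' : B →ₗ[ℂ] B :=
    { toFun := L
      map_add' := fun a b ↦ huniq _ _ (K.add_mem (hLK a) (hLK b)) (by
        rw [map_add, hL, hL, compress_add])
      map_smul' := fun c a ↦ huniq _ _ (K.smul_mem c (hLK a)) (by
        rw [map_smul, hL, compress_smul]; rfl) }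
  have hL' : ∀ b, β (L' b) = compress (strictExtension β 1) b := hL
  refine ⟨L', hLK, hL, ⟨fun b ↦ ?_, fun a b ↦ ?_⟩, fun a ↦ ?_, fun a ↦ ?_, fun a b c ↦ ?_⟩
  -- The compression pb*bp is positive, and the injective restriction of β to K reflects positivity.
  · let γ : SubAlg K.toStarSubalgebra →⋆ₙₐ[ℂ] B := β.comp (valHom K.toStarSubalgebra)
    have hγ : Function.Injective γ := by
      rw [injective_iff_map_eq_zero]
      intro c hc
      exact valHom_injective _ ((hK _ (valHom_mem _ c) hc).trans (map_zero _).symm)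
    obtain ⟨d, hd⟩ := exists_star_mul_self_of_map γ hγ
      (c := (⟨L (star b * b), hLK _⟩ : K.toStarSubalgebra))
      ((hL _).trans (compress_star_mul_self β b))
    refine ⟨valHom _ d, ?_⟩
    have := congrArg (valHom _) hd
    rw [map_mul, map_star] at this
    exact this
  · exact huniq _ _ (K.mul_mem_left _ (hLK b)) (by
      rw [map_mul, hL', compress_apply_mul hβ])
  · rw [hL', compress_apply hβ]
  · rw [hL']
    exact norm_compress_le hβ a
  · rw [hL', hL', compress_mul_apply hβ, compress_apply_mul hβ]

/-- Since pbp = β(L'(b)), each β(e)bβ(e) lies in the range of β, so the bimodule property fixes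
β(L(b)). The difference d = L(b) - L'(b) thus satisfies β(d) = 0, and the transfer identity gives
d*d = 0. -/
theorem IsRegularTransferOperator.eq (hβ : IsExtendible β) {L L' : B →ₗ[ℂ] B}
    (h : IsRegularTransferOperator β L) (h' : IsRegularTransferOperator β L')
    (hE : ∀ b, β (L' b) = compress (strictExtension β 1) b) : L = L' := by
  have key : ∀ b, β (L b) = β (L' b) := by
    intro b
    obtain ⟨l, hl⟩ := exists_isContractiveUnit B
    have := hl.neBot
    have h1 : ∀ x, Tendsto (fun e ↦ β e * β x * β e) l (𝓝 (β x)) := fun x ↦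
      (((continuous_hom β).tendsto x).comp (hl.tendsto_mul_mul x)).congr fun e ↦ by
        simp only [Function.comp_apply, map_mul]
    refine tendsto_nhds_unique (h1 (L b)) ((h1 (L' b)).congr fun e ↦ ?_)
    have h2 : β e * b * β e = β (e * L' b * e) := by
      rw [map_mul, map_mul, hE, ← compress_apply_mul hβ, ← compress_mul_apply hβ,
        compress_apply_mul_apply hβ]
    have h3 := h.bimodule e b e
    rw [h2, h.apply_range, map_mul, map_mul] at h3
    exact h3
  ext b
  refine sub_eq_zero.1 ((CStarRing.star_mul_self_eq_zero_iff _).1 ?_)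
  have h0 : β (star (L b - L' b)) = 0 := by
    rw [map_star, map_sub, key, sub_self, star_zero]
  rw [mul_sub, ← h.transfer, ← h'.transfer, h0, zero_mul, map_zero, map_zero, sub_zero]

end Transfer

theorem IsContractiveUnit.map_star {A : Type*} [NonUnitalCStarAlgebra A] {l : Filter A}
    (hl : IsContractiveUnit l) : IsContractiveUnit (l.map star) where
  neBot := by have := hl.neBot; infer_instance
  left a := by rw [tendsto_map'_iff]; exact hl.star_left a
  right a := by
    rw [tendsto_map'_iff]
    have := (continuous_star.tendsto _).comp (hl.left (star a))
    simpa [Function.comp_def] using this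
  norm_le := by
    rw [eventually_map]
    filter_upwards [hl.norm_le] with e he
    rwa [norm_star]

theorem tendsto_of_valHom {A : Type u} [NonUnitalCStarAlgebra A] {T : NonUnitalStarSubalgebra ℂ A}
    [IsClosed (T : Set A)] {ι : Type*} {l : Filter ι} {f : ι → SubAlg T} {b : SubAlg T}
    (h : Tendsto (fun i ↦ valHom T (f i)) l (𝓝 (valHom T b))) : Tendsto f l (𝓝 b) :=
  (NonUnitalStarAlgHom.isometry (valHom T) (valHom_injective T)).isEmbedding.tendsto_nhds_iff.2 h

/-! ### Extendibility of β and the ideal carried by the range of φ̃ -/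

namespace C0System

variable {X : Type v} [TopologicalSpace X] {A : Type u} [NonUnitalCStarAlgebra A]
  (S : C0System X A) (J : ClosedIdeal A)

theorem tendsto_stage {n : ℕ} {ι : Type*} {l : Filter ι} {f : ι → S.stageB J n} {b : S.stageB J n}
    (h : ∀ k hk, Tendsto (fun i ↦ S.coordVal J n k hk (f i)) l (𝓝 (S.coordVal J n k hk b)))
    (h' : Tendsto (fun i ↦ S.lastVal J n (f i)) l (𝓝 (S.lastVal J n b))) : Tendsto f l (𝓝 b) := by
  have h1 : Tendsto (fun i ↦ ((f i).1, (f i).2)) l (𝓝 (b.1, b.2)) :=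
    (tendsto_pi_nhds.2 fun k : Fin n ↦ tendsto_of_valHom (h k k.2)).prodMk_nhds (tendsto_of_valHom h')
  exact h1

/-- The homomorphism `a ↦ q(a) ⊕ q(α(a)) ⊕ ⋯ ⊕ q(α^{n-1}(a)) ⊕ α^n(a)` from `A` to `B_n`. -/
def stageEmb : ∀ n, A →⋆ₙₐ[ℂ] S.stageB J n
  | 0 => pairHom (fun _ ↦ 0) (NonUnitalStarAlgHom.codRestrict (NonUnitalStarAlgHom.id ℂ A) (S.subA 0)
      fun a ↦ apply_mem_hereditary (S.iterEnd 0) a)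
  | n + 1 => (S.bond J n).comp (stageEmb n)

theorem lastVal_stageEmb (a : A) : ∀ n, S.lastVal J n (S.stageEmb J n a) = S.iterEnd n a
  | 0 => rfl
  | n + 1 => (S.lastVal_bond J n _).trans (congrArg S.α (lastVal_stageEmb a n))

theorem coordVal_stageEmb (a : A) : ∀ n k (h : k < n),
    S.coordVal J n k h (S.stageEmb J n a) = J.proj (S.iterEnd k a)
  | n + 1, k, h => by
    rcases Nat.lt_succ_iff_lt_or_eq.1 h with h' | rfl
    · exact (S.coordVal_bond_of_lt J h' _).trans (coordVal_stageEmb a n k h')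
    · exact (S.coordVal_bond_self J k _).trans (congrArg J.proj (S.lastVal_stageEmb J a k))

theorem stageShift_stageEmb (n : ℕ) (a : A) :
    S.stageShift J n (S.stageEmb J (n + 1) a) = S.stageEmb J n (S.α a) := by
  refine S.stage_ext J (fun k hk ↦ ?_) ?_
  · rw [coordVal_stageShift, coordVal_stageEmb, coordVal_stageEmb, iterEnd_comm]
    rfl
  · rw [lastVal_stageShift, lastVal_stageEmb, lastVal_stageEmb, iterEnd_comm]
    rfl

/-- The natural homomorphism from `A` to `B`. -/
def emb : A →⋆ₙₐ[ℂ] S.limB J := (S.toLimB J 0).comp (S.stageEmb J 0)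

theorem toLimB_stageEmb (a : A) : ∀ n, S.toLimB J n (S.stageEmb J n a) = S.emb J a
  | 0 => rfl
  | n + 1 => (limOf_succ (S.bond J) n _).trans (toLimB_stageEmb a n)

theorem β_emb (a : A) : S.β J (S.emb J a) = S.emb J (S.α a) := by
  rw [← S.toLimB_stageEmb J a 1, β_toLimB, stageShift_stageEmb]
  rfl

/-- In the coordinate with index k, e acts as α^k(e), which is an approximate unit for A_k because
A_k is generated by products beginning and ending in α^k(A). The right-hand version follows by
taking adjoints. -/
theorem isContractiveUnit_map_emb {l : Filter A} (hl : IsContractiveUnit l) :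
    IsContractiveUnit (l.map (S.emb J)) := by
  have key : ∀ {l : Filter A}, IsContractiveUnit l → ∀ b,
      Tendsto (fun e ↦ S.emb J e * b) l (𝓝 b) := by
    intro l hl
    refine LimAlg.induction (S.bond J) (P := fun b ↦ Tendsto (fun e ↦ S.emb J e * b) l (𝓝 b))
      (isClosed_setOf_tendsto_map_mul (l := l) (S.emb J) (T := id) hl.norm_le) fun n a ↦ ?_
    obtain ⟨c, hc, hc'⟩ := S.exists_coord J n a
    have h1 : Tendsto (fun e ↦ S.stageEmb J n e * a) l (𝓝 a) := by
      refine S.tendsto_stage J (fun k hk ↦ ?_) ?_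
      · simp_rw [map_mul, coordVal_stageEmb, hc', ← map_mul]
        exact ((continuous_hom J.proj).tendsto _).comp
          (tendsto_mul_of_mem_hereditary hl (S.iterEnd k) (hc k hk))
      · simp_rw [map_mul, lastVal_stageEmb]
        exact tendsto_mul_of_mem_hereditary hl (S.iterEnd n) (S.lastVal_mem J n a)
    refine (((continuous_hom (S.toLimB J n)).tendsto a).comp h1).congr fun e ↦ ?_
    rw [← S.toLimB_stageEmb J e n, ← map_mul]
    rfl
  refine hl.map_of_tendsto (S.emb J) (key hl) fun b ↦ ?_
  have h1 := (continuous_star.tendsto _).comp (key hl.map_star (star b))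
  rw [star_star, tendsto_map'_iff] at h1
  refine h1.congr fun e ↦ ?_
  simp only [Function.comp_apply, map_star, star_mul, star_star]

theorem isExtendible_iterEnd (hα : IsExtendible S.α) : ∀ n, IsExtendible (S.iterEnd n)
  | 0 => IsExtendible.id
  | n + 1 => hα.comp (isExtendible_iterEnd hα n)

theorem isExtendible_iterHom (hα : IsExtendible S.α) {n : ℕ} {x : X} (hx : x ∈ dom S.φ n) :
    IsExtendible (S.iterHom n x hx) := by
  obtain ⟨l, hl⟩ := exists_isContractiveUnit A
  exact (S.isExtendible_iterEnd hα n).of_map hl (S.μ.ev (iter S.φ n x hx))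
    (hl.map _ (S.μ.ev_surjective _)) (S.μ.ev x) (S.μ.ev_surjective x)
    fun d ↦ (S.ev_iterEnd n x hx d).symm

theorem fst_strictExtension_mem_subA (hα : IsExtendible S.α) {n : ℕ} {a : A} (ha : a ∈ S.subA n) :
    (strictExtension (S.iterEnd (n + 1)) 1).fst a ∈ S.subA n := by
  obtain ⟨l, hl⟩ := exists_isContractiveUnit A
  have := hl.neBot
  have hcl : IsClosed (S.subA n : Set A) := inferInstance
  refine hcl.mem_of_tendsto (tendsto_fst_strictExtension (S.isExtendible_iterEnd hα (n + 1)) hl a)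
    (Eventually.of_forall fun e ↦ mul_mem ?_ ha)
  have h1 : S.iterEnd (n + 1) e = S.iterEnd n (S.α e) := (S.iterEnd_comm n e).symm
  rw [h1]
  exact apply_mem_hereditary (S.iterEnd n) (S.α e)

/-- In the coordinate with index k, β(e) acts as α^{k+1}(e), which converges strictly as α^{k+1} is
extendible. The limit keeps the coordinate in A_k. -/
theorem isExtendible_β (hα : IsExtendible S.α) : IsExtendible (S.β J) := by
  obtain ⟨l, hl⟩ := exists_isContractiveUnit A
  have := hl.neBot
  refine isExtendible_of_tendsto (S.isContractiveUnit_map_emb J hl) fun b ↦ ?_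
  simp_rw [tendsto_map'_iff]
  have hcl := isClosed_exists_tendsto (l := l)
    (fun e ↦ AddMonoidHom.mulLeft (S.β J (S.emb J e))) (C := 1) (by
      filter_upwards [hl.norm_le] with e he b
      refine (norm_mul_le _ _).trans ?_
      gcongr
      exact (NonUnitalStarAlgHom.norm_apply_le (S.β J) _).trans
        ((NonUnitalStarAlgHom.norm_apply_le (S.emb J) _).trans he))
  refine LimAlg.induction (S.bond J)
    (P := fun b ↦ ∃ c, Tendsto ((fun e ↦ S.β J e * b) ∘ S.emb J) l (𝓝 c)) hcl (fun n a ↦ ?_) b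
  obtain ⟨c, hc, hc'⟩ := S.exists_coord J n a
  obtain ⟨a', ha', ha''⟩ := S.exists_stage J n
    (fun k hk ↦ (strictExtension (S.iterEnd (k + 1)) 1).fst (c k hk))
    (fun k hk ↦ S.fst_strictExtension_mem_subA hα (hc k hk))
    (S.fst_strictExtension_mem_subA hα (S.lastVal_mem J n a))
  refine ⟨S.toLimB J n a', ?_⟩
  have h1 : Tendsto (fun e ↦ S.stageEmb J n (S.α e) * a) l (𝓝 a') := by
    refine S.tendsto_stage J (fun k hk ↦ ?_) ?_
    · simp_rw [map_mul, coordVal_stageEmb, hc', ha', ← map_mul, iterEnd_comm]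
      exact ((continuous_hom J.proj).tendsto _).comp
        (tendsto_fst_strictExtension (S.isExtendible_iterEnd hα (k + 1)) hl (c k hk))
    · simp_rw [map_mul, lastVal_stageEmb, ha'', iterEnd_comm]
      exact tendsto_fst_strictExtension (S.isExtendible_iterEnd hα (n + 1)) hl (S.lastVal J n a)
  refine (((continuous_hom (S.toLimB J n)).tendsto a').comp h1).congr fun e ↦ ?_
  simp only [Function.comp_apply]
  rw [map_mul, toLimB_stageEmb, β_emb]

/-- The ideal of the elements of `B` that vanish outside the range of `φ~`. -/
def rangeIdeal : ClosedIdeal (S.limB J) where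
  carrier := {b | ∀ p, p ∉ Set.range (ExtSpace.extMap (φ := S.φ) (Y := S.μ.hull J)) →
    S.sectionHom J b p = 0}
  add_mem' := fun {a b} ha hb p hp ↦ by
    rw [map_add, Pi.add_apply, ha p hp, hb p hp, add_zero]
  zero_mem' := fun p _ ↦ by rw [map_zero, Pi.zero_apply]
  smul_mem' := fun c a ha p hp ↦ by rw [map_smul, Pi.smul_apply, ha p hp, smul_zero]
  mul_mem_left' := fun a b hb p hp ↦ by rw [map_mul, Pi.mul_apply, hb p hp, mul_zero]
  mul_mem_right' := fun a b hb p hp ↦ by rw [map_mul, Pi.mul_apply, hb p hp, zero_mul]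
  isClosed' := by
    simp only [Set.ofPred_forall]
    exact isClosed_iInter fun p ↦ isClosed_iInter fun _ ↦
      isClosed_eq (continuous_hom (evalHom (S.sectionHom J) p)) continuous_const

theorem eq_zero_of_mem_rangeIdeal (hJ : ∀ j ∈ J, ∀ a, S.α a = 0 → j * a = 0) {b : S.limB J}
    (hb : b ∈ S.rangeIdeal J) (h : S.β J b = 0) [T2Space X] [LocallyCompactSpace X] : b = 0 := by
  refine S.sectionHom_injective J hJ ?_
  rw [map_zero]
  funext p
  by_cases hp : p ∈ Set.range (ExtSpace.extMap (φ := S.φ) (Y := S.μ.hull J))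
  · obtain ⟨⟨p, hp⟩, rfl⟩ := hp
    refine S.fibreβ_injective J p hp ?_
    refine (S.sectionHom_β J b p hp).symm.trans ?_
    rw [h, map_zero]
    exact (map_zero (S.fibreβ J p hp)).symm
  · exact hb p hp

theorem exists_rangeIdeal_β_eq_mul (d d' : A) (b : S.limB J) :
    S.β J (S.emb J d) * b * S.β J (S.emb J d') ∈
      ((S.rangeIdeal J).toStarSubalgebra.map (S.β J) : Set (S.limB J)) := by
  have hcl : IsClosed ((S.rangeIdeal J).toStarSubalgebra.map (S.β J) : Set (S.limB J)) :=
    isClosed_map (S.rangeIdeal J).toStarSubalgebra (S.β J)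
  refine LimAlg.induction (S.bond J) (P := fun b ↦ S.β J (S.emb J d) * b * S.β J (S.emb J d') ∈
      ((S.rangeIdeal J).toStarSubalgebra.map (S.β J) : Set (S.limB J)))
    (hcl.preimage (by fun_prop)) (fun n a ↦ ?_) b
  obtain ⟨c, hc, hc'⟩ := S.exists_coord J n a
  -- The coordinates are moved one place to the right and sandwiched between α^{k+1}(d) and
  -- α^{k+1}(d'), which puts them in A_{k+1}. The 0 in front makes the section vanish on X_0, the
  -- complement of the range of φ̃.
  obtain ⟨a', ha', ha''⟩ := S.exists_stage J (n + 1)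
    (fun k ↦ match k with
      | 0 => fun _ ↦ 0
      | k + 1 => fun hk ↦ S.iterEnd (k + 1) d * c k (Nat.lt_of_succ_lt_succ hk) *
          S.iterEnd (k + 1) d')
    (fun k ↦ match k with
      | 0 => fun _ ↦ zero_mem _
      | k + 1 => fun hk ↦ mul_mem_hereditary (S.iterEnd (k + 1)) _ _ _)
    (mul_mem_hereditary (S.iterEnd (n + 1)) d (S.lastVal J n a) d')
  refine ⟨S.toLimB J (n + 1) a', fun p hp ↦ ?_, ?_⟩
  · rw [ExtSpace.mem_range_extMap] at hp
    cases p with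
    | fin N x hx hY =>
      cases N with
      | zero =>
        rw [sectionHom_toLimB]
        apply S.finVal_injective J
        rw [S.finVal_stageHom_of_lt J n.succ_pos, ha', map_zero, map_zero]
        exact (map_zero (S.finVal J 0 x hx hY)).symm
      | succ N => exact absurd ⟨_, ExtSpace.toSeq_fin_of_le (by omega)⟩ hp
    | inf x hx => exact absurd ⟨x 1, rfl⟩ hp
  · change S.β J (S.toLimB J (n + 1) a') = _
    rw [β_toLimB, β_emb, β_emb, ← S.toLimB_stageEmb J (S.α d) n, ← S.toLimB_stageEmb J (S.α d') n]
    refine Eq.trans ?_ ((map_mul (S.toLimB J n) _ _).trans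
      (congrArg (· * _) (map_mul (S.toLimB J n) _ _)))
    congr 1
    refine S.stage_ext J (fun k hk ↦ ?_) ?_
    · have e1 : S.coordVal J n k hk (S.stageEmb J n (S.α d) * a * S.stageEmb J n (S.α d')) =
          J.proj (S.iterEnd k (S.α d) * c k hk * S.iterEnd k (S.α d')) := by
        rw [map_mul, map_mul, coordVal_stageEmb, coordVal_stageEmb, hc', map_mul, map_mul]
      rw [coordVal_stageShift, ha', e1, iterEnd_comm, iterEnd_comm]
      rfl
    · rw [lastVal_stageShift, ha'', map_mul, map_mul, lastVal_stageEmb, lastVal_stageEmb,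
        iterEnd_comm, iterEnd_comm]
      rfl

/-- The compression is an iterated limit of the products β(d)bβ(d'), and the image of the ideal
under β is closed. -/
theorem exists_rangeIdeal_β_eq_compress (hα : IsExtendible S.α) (b : S.limB J) :
    ∃ c ∈ S.rangeIdeal J, S.β J c = compress (strictExtension (S.β J) 1) b := by
  obtain ⟨l, hl⟩ := exists_isContractiveUnit A
  have hcl : IsClosed ((S.rangeIdeal J).toStarSubalgebra.map (S.β J) : Set (S.limB J)) :=
    isClosed_map (S.rangeIdeal J).toStarSubalgebra (S.β J)
  refine compress_mem_of_isClosed (S.isExtendible_β J hα) (S.isContractiveUnit_map_emb J hl) hcl ?_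
  rw [eventually_map]
  refine Eventually.of_forall fun d ↦ ?_
  rw [eventually_map]
  exact Eventually.of_forall fun d' ↦ S.exists_rangeIdeal_β_eq_mul J d d' b

end C0System

theorem norm_seqClass_le_of_le {E E' : ℕ → Type u} [∀ n, NonUnitalCStarAlgebra (E n)]
    [∀ n, NonUnitalCStarAlgebra (E' n)] {a : lp E ∞} {c : lp E' ∞} (h : ∀ n, ‖a n‖ ≤ ‖c n‖) :
    ‖seqClass E a‖ ≤ ‖seqClass E' c‖ := by
  refine le_of_forall_gt fun r hr ↦ ?_
  obtain ⟨s, hs, hsr⟩ := exists_between hr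
  refine lt_of_le_of_lt (norm_seqClass_le ((norm_nonneg _).trans hs.le) ?_) hsr
  filter_upwards [eventually_norm_lt_of_norm_seqClass_lt hs] with n hn
  exact (h n).trans hn.le

/-! ### The transfer operator in the fibres -/

namespace C0System

variable {X : Type v} [TopologicalSpace X] {A : Type u} [NonUnitalCStarAlgebra A]
  (S : C0System X A) (J : ClosedIdeal A)

/-- The evaluation `b ↦ b(p)` for `p = (x₀, ..., x_N, 0, ...)`. -/
def finEval (N : ℕ) (x : X) (hx : x ∈ dom S.φ N) (hY : x ∈ S.μ.hull J) :
    S.limB J →⋆ₙₐ[ℂ] (S.μ.fibreIdeal J x).Quot :=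
  (S.finVal J N x hx hY).comp (evalHom (S.sectionHom J) (.fin N x hx hY))

theorem finEval_apply {N : ℕ} {x : X} {hx : x ∈ dom S.φ N} {hY : x ∈ S.μ.hull J} (b : S.limB J) :
    S.finEval J N x hx hY b = S.finVal J N x hx hY (S.sectionHom J b (.fin N x hx hY)) := rfl

theorem finEval_emb (d : A) {N : ℕ} {x : X} {hx : x ∈ dom S.φ N} {hY : x ∈ S.μ.hull J} :
    S.finEval J N x hx hY (S.emb J d) = (S.μ.fibreIdeal J x).proj (S.μ.ev x (S.iterEnd N d)) := by
  rw [finEval_apply, ← S.toLimB_stageEmb J d (N + 1), sectionHom_toLimB,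
    S.finVal_stageHom_of_lt J N.lt_succ_self, coordVal_stageEmb, S.μ.quotEval_proj]

theorem finEval_β_emb (d : A) {N : ℕ} {x : X} {hx : x ∈ dom S.φ N} {hY : x ∈ S.μ.hull J}
    (h : x ∈ dom S.φ (N + 1)) :
    S.finEval J N x hx hY (S.β J (S.emb J d)) =
      (S.μ.fibreIdeal J x).proj (S.iterHom (N + 1) x h (S.μ.ev _ d)) := by
  rw [β_emb, finEval_emb, ev_iterEnd, iterEnd_comm]
  rfl

section Transfer

variable (hα : IsExtendible S.α) {L : S.limB J →ₗ[ℂ] S.limB J}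
  (hL : ∀ b, S.β J (L b) = compress (strictExtension (S.β J) 1) b)

include hα in
-- Compression is a limit of multiplications, so its value at p depends only on b(p). Together with
-- injectivity of β_p this makes the fibre maps of the transfer operator well defined.
theorem sectionHom_compress_congr {p : S.Ext J} {b b' : S.limB J}
    (h : S.sectionHom J b p = S.sectionHom J b' p) :
    S.sectionHom J (compress (strictExtension (S.β J) 1) b) p =
      S.sectionHom J (compress (strictExtension (S.β J) 1) b') p := by
  obtain ⟨l, hl⟩ := exists_isContractiveUnit (S.limB J)
  have hβ := S.isExtendible_β J hα
  have hl' : IsContractiveUnit (l.map id) := by rwa [map_id]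
  exact map_compress hβ hβ (l := l) id hl' id hl' (evalHom (S.sectionHom J) p)
    (evalHom (S.sectionHom J) p) (fun _ ↦ rfl) h

include hL in
theorem fibreβ_sectionHom_transfer (b : S.limB J) (p : S.Ext J) (h : p.head ∈ S.Δ) :
    S.fibreβ J p h (S.sectionHom J (L b) (p.shift h)) =
      S.sectionHom J (compress (strictExtension (S.β J) 1) b) p := by
  rw [← hL, S.sectionHom_β J (L b) p h]

include hα hL in
theorem sectionHom_transfer_congr {p : S.Ext J} (h : p.head ∈ S.Δ) {b b' : S.limB J}
    (hb : S.sectionHom J b p = S.sectionHom J b' p) :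
    S.sectionHom J (L b) (p.shift h) = S.sectionHom J (L b') (p.shift h) := by
  apply S.fibreβ_injective J p h
  rw [S.fibreβ_sectionHom_transfer J hL, S.fibreβ_sectionHom_transfer J hL]
  exact S.sectionHom_compress_congr J hα hb

include hα hL in
theorem exists_fibreTransfer (p : S.Ext J) (h : p.head ∈ S.Δ) :
    ∃ T : S.FibreB J p →ₗ[ℂ] S.FibreB J (p.shift h),
      ∀ b, T (S.sectionHom J b p) = S.sectionHom J (L b) (p.shift h) := by
  choose s hs using S.sectionHom_fibre_surjective J p
  refine ⟨
    { toFun := fun v ↦ S.sectionHom J (L (s v)) (p.shift h)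
      map_add' := fun v w ↦ ?_
      map_smul' := fun c v ↦ ?_ }, fun b ↦ S.sectionHom_transfer_congr J hα hL h (hs _)⟩
  · refine (S.sectionHom_transfer_congr J hα hL h (b' := s v + s w) ?_).trans ?_
    · rw [hs, map_add, Pi.add_apply, hs, hs]
    · rw [map_add, map_add, Pi.add_apply]
  · refine (S.sectionHom_transfer_congr J hα hL h (b' := c • s v) ?_).trans ?_
    · rw [hs, map_smul, Pi.smul_apply, hs]
    · rw [map_smul, map_smul, Pi.smul_apply]
      rfl

theorem isPositiveMap_fibreTransfer (hp : IsPositiveMap L) {p : S.Ext J} {h : p.head ∈ S.Δ}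
    {T : S.FibreB J p →ₗ[ℂ] S.FibreB J (p.shift h)}
    (hT : ∀ b, T (S.sectionHom J b p) = S.sectionHom J (L b) (p.shift h)) : IsPositiveMap T := by
  intro v
  obtain ⟨b, rfl⟩ := S.sectionHom_fibre_surjective J p v
  obtain ⟨c, hc⟩ := hp b
  refine ⟨S.sectionHom J c (p.shift h), ?_⟩
  have h1 := hT (star b * b)
  rw [hc] at h1
  simpa only [map_mul, map_star, Pi.mul_apply, Pi.star_apply] using h1

include hα in
theorem finEval_compress {N : ℕ} {x : X} {hx : x ∈ dom S.φ N} {hY : x ∈ S.μ.hull J}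
    (h : x ∈ dom S.φ (N + 1)) {b : S.limB J} {a : S.μ.Fibre x}
    (ha : S.finEval J N x hx hY b = (S.μ.fibreIdeal J x).proj a) :
    S.finEval J N x hx hY (compress (strictExtension (S.β J) 1) b) =
      (S.μ.fibreIdeal J x).proj (compress (S.unitImage (N + 1) x h) a) := by
  obtain ⟨l, hl⟩ := exists_isContractiveUnit A
  have h1 := S.isContractiveUnit_map_emb J hl
  have h2 := hl.map (S.μ.ev (iter S.φ (N + 1) x h)) (S.μ.ev_surjective _)
  unfold unitImage
  exact map_compress (S.isExtendible_β J hα) (S.isExtendible_iterHom hα h) (S.emb J) h1 _ h2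
    (S.finEval J N x hx hY) (S.μ.fibreIdeal J x).proj (fun d ↦ S.finEval_β_emb J d h) ha

include hα hL in
theorem finEval_transfer {N : ℕ} {x : X} {hx : x ∈ dom S.φ N} {hY : x ∈ S.μ.hull J}
    (h : (ExtSpace.fin N x hx hY : S.Ext J).head ∈ S.Δ) {b : S.limB J} {a : S.μ.Fibre x}
    (ha : S.finEval J N x hx hY b = (S.μ.fibreIdeal J x).proj a) :
    S.finEval J (N + 1) x (dom_succ S.φ N x hx h) hY (L b) = (S.μ.fibreIdeal J x).proj
      (compress (S.unitImage (N + 1) x (dom_succ S.φ N x hx h)) a) := by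
  have h1 := S.finEval_compress J hα (dom_succ S.φ N x hx h) ha
  rw [← hL, finEval_apply, S.sectionHom_β J (L b) _ h] at h1
  exact (S.finVal_fibreβ J h _).symm.trans h1

end Transfer

section Infinite

variable {x : ℕ → X} (hx : IsBackwardOrbit S.φ x)

/-- The value of an element of the fibre in the algebra of bounded sequences modulo null
sequences. -/
def seqVal : S.FibreB J (.inf x hx) →⋆ₙₐ[ℂ] SeqAlg fun n ↦ SubAlg (S.fibA n (x n) (hx.mem_dom n)) :=
  (valHom (limAlg (S.orbitBond hx))).comp (S.infVal J hx)

theorem norm_seqVal_sectionHom_sub_le (b b' : S.limB J) :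
    ‖S.seqVal J hx (S.sectionHom J b (.inf x hx)) -
      S.seqVal J hx (S.sectionHom J b' (.inf x hx))‖ ≤ ‖b - b'‖ :=
  norm_map_sub_le ((S.seqVal J hx).comp (evalHom (S.sectionHom J) (.inf x hx))) b b'

theorem iterEnd_mem_subA_self (n : ℕ) (d : A) : S.iterEnd n d ∈ S.subA n :=
  apply_mem_hereditary (S.iterEnd n) d

/-- The sequence `d(x₀), α(d)(x₁), α²(d)(x₂), ...`. -/
def orbitSeq (d : A) : lp (fun n ↦ SubAlg (S.fibA n (x n) (hx.mem_dom n))) ∞ :=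
  ⟨fun n ↦ S.evSub n (x n) (hx.mem_dom n) ⟨S.iterEnd n d, S.iterEnd_mem_subA_self n d⟩,
    memℓp_infty ⟨‖d‖, by
      rintro _ ⟨n, rfl⟩
      exact (NonUnitalStarAlgHom.norm_apply_le (S.μ.ev (x n)) _).trans
        (NonUnitalStarAlgHom.norm_apply_le (S.iterEnd n) d)⟩⟩

theorem valHom_thread_orbitBond (a : SubAlg (S.subA 0)) (n : ℕ) :
    valHom _ (thread (S.orbitBond hx) 0 n (S.evSub 0 (x 0) (hx.mem_dom 0) a)) =
      S.μ.ev (x n) (S.iterEnd n (valHom _ a)) := by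
  induction n with
  | zero =>
    rw [thread_self]
    rfl
  | succ k ih =>
    have h1 := thread_succ (S.orbitBond hx) (Nat.zero_le k)
    refine (congrArg (fun ψ ↦ valHom _ (ψ (S.evSub 0 (x 0) (hx.mem_dom 0) a))) h1).trans ?_
    refine (congrArg (S.linkHom (hx k)) ih).trans ?_
    exact S.linkHom_ev (hx k) _

theorem seqVal_emb (d : A) :
    S.seqVal J hx (S.sectionHom J (S.emb J d) (.inf x hx)) = seqClass _ (S.orbitSeq hx d) := by
  have h1 : S.sectionHom J (S.emb J d) (.inf x hx) =
      S.stageHom J 0 (.inf x hx) (S.stageEmb J 0 d) := S.sectionHom_toLimB J 0 _ _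
  rw [h1]
  refine (congrArg (valHom _) (S.stageHom_inf J (hx := hx) (S.stageEmb J 0 d))).trans ?_
  refine congrArg (seqClass _) (Subtype.ext (funext fun n ↦ valHom_injective _ ?_))
  exact S.valHom_thread_orbitBond hx (S.last J 0 (S.stageEmb J 0 d)) n

end Infinite

end C0System

theorem compress_mul_mul {A : Type*} [NonUnitalCStarAlgebra A] (m : 𝓜(ℂ, A)) (a b c : A) :
    compress m (a * b * c) = m.fst a * b * m.snd c := by
  unfold compress
  rw [fst_mul, fst_mul, snd_mul]

theorem norm_seqClass_sub_le_of_le {F F' : ℕ → Type u} [∀ n, NonUnitalCStarAlgebra (F n)]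
    [∀ n, NonUnitalCStarAlgebra (F' n)] {T : ∀ n, NonUnitalStarSubalgebra ℂ (F n)}
    [∀ n, IsClosed (T n : Set (F n))] {T' : ∀ n, NonUnitalStarSubalgebra ℂ (F' n)}
    [∀ n, IsClosed (T' n : Set (F' n))] {a a' : lp (fun n ↦ SubAlg (T n)) ∞}
    {c c' : lp (fun n ↦ SubAlg (T' n)) ∞}
    (h : ∀ n, ‖valHom (T n) (a n) - valHom (T n) (a' n)‖ ≤
      ‖valHom (T' n) (c n) - valHom (T' n) (c' n)‖) :
    ‖seqClass (fun n ↦ SubAlg (T n)) a - seqClass (fun n ↦ SubAlg (T n)) a'‖ ≤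
      ‖seqClass (fun n ↦ SubAlg (T' n)) c - seqClass (fun n ↦ SubAlg (T' n)) c'‖ := by
  rw [← map_sub (seqClass fun n ↦ SubAlg (T n)), ← map_sub (seqClass fun n ↦ SubAlg (T' n))]
  exact norm_seqClass_le_of_le h

namespace C0System

variable {X : Type v} [TopologicalSpace X] {A : Type u} [NonUnitalCStarAlgebra A]
  (S : C0System X A) (J : ClosedIdeal A) (hα : IsExtendible S.α)

include hα in
theorem compress_mem_fibA {n : ℕ} {x : X} (h : x ∈ dom S.φ n) (a : S.μ.Fibre x) :
    compress (S.unitImage n x h) a ∈ S.fibA n x h := by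
  obtain ⟨l, hl⟩ := exists_isContractiveUnit (S.μ.Fibre (iter S.φ n x h))
  have hcl : IsClosed (S.fibA n x h : Set (S.μ.Fibre x)) := inferInstance
  exact compress_mem_of_isClosed (S.isExtendible_iterHom hα h) hl hcl
    (Eventually.of_forall fun d ↦ Eventually.of_forall fun e ↦ mul_mem_hereditary _ d a e)

/-- The compression by the image of the unit, with values in `A_n(x)`. -/
def compressFib {n : ℕ} {x : X} (h : x ∈ dom S.φ n) (a : S.μ.Fibre x) : SubAlg (S.fibA n x h) :=
  ⟨compress (S.unitImage n x h) a, S.compress_mem_fibA hα h a⟩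

theorem valHom_compressFib {n : ℕ} {x : X} (h : x ∈ dom S.φ n) (a : S.μ.Fibre x) :
    valHom _ (S.compressFib hα h a) = compress (S.unitImage n x h) a := rfl

theorem norm_compressFib_le {n : ℕ} {x : X} (h : x ∈ dom S.φ n) (a : S.μ.Fibre x) :
    ‖S.compressFib hα h a‖ ≤ ‖a‖ := norm_compress_le (S.isExtendible_iterHom hα h) a

include hα in
-- The multiplier p_{(x,n+1)} acts on α^n(d)(x) as α^n(p d)(x), where p is the image of 1 under the
-- extension of α. The right-hand side involves one multiplier of A for all n, which is what makes
-- the action uniform along an orbit.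
theorem fst_unitImage_ev {n : ℕ} {x : X} (h : x ∈ dom S.φ (n + 1)) (d : A) :
    (S.unitImage (n + 1) x h).fst (S.μ.ev x (S.iterEnd n d)) =
      S.μ.ev x (S.iterEnd n ((strictExtension S.α 1).fst d)) := by
  obtain ⟨l, hl⟩ := exists_isContractiveUnit A
  have hl' : IsContractiveUnit (l.map id) := by rwa [map_id]
  refine (map_fst_strictExtension_one hα (S.isExtendible_iterHom hα h) (l := l) id hl'
    (S.μ.ev (iter S.φ (n + 1) x h)) (hl.map _ (S.μ.ev_surjective _))
    ((S.μ.ev x).comp (S.iterEnd n)) (NonUnitalStarAlgHom.id ℂ (S.μ.Fibre x)) (fun d ↦ ?_) rfl).symm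
  refine Eq.trans ?_ (S.ev_iterEnd (n + 1) x h d).symm
  exact congrArg (S.μ.ev x) (S.iterEnd_comm n d)

include hα in
theorem snd_unitImage_ev {n : ℕ} {x : X} (h : x ∈ dom S.φ (n + 1)) (d : A) :
    (S.unitImage (n + 1) x h).snd (S.μ.ev x (S.iterEnd n d)) =
      S.μ.ev x (S.iterEnd n ((strictExtension S.α 1).snd d)) := by
  obtain ⟨l, hl⟩ := exists_isContractiveUnit A
  have hl' : IsContractiveUnit (l.map id) := by rwa [map_id]
  refine (map_snd_strictExtension_one hα (S.isExtendible_iterHom hα h) (l := l) id hl'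
    (S.μ.ev (iter S.φ (n + 1) x h)) (hl.map _ (S.μ.ev_surjective _))
    ((S.μ.ev x).comp (S.iterEnd n)) (NonUnitalStarAlgHom.id ℂ (S.μ.Fibre x)) (fun d ↦ ?_) rfl).symm
  refine Eq.trans ?_ (S.ev_iterEnd (n + 1) x h d).symm
  exact congrArg (S.μ.ev x) (S.iterEnd_comm n d)

include hα in
theorem compress_emb_mul_emb (d : A) (b : S.limB J) :
    compress (strictExtension (S.β J) 1) (S.emb J d * b * S.emb J d) =
      S.emb J ((strictExtension S.α 1).fst d) * b * S.emb J ((strictExtension S.α 1).snd d) := by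
  obtain ⟨l, hl⟩ := exists_isContractiveUnit A
  have hl' : IsContractiveUnit (l.map id) := by rwa [map_id]
  have h1 : S.emb J ((strictExtension S.α 1).fst d) =
      (strictExtension (S.β J) 1).fst (S.emb J d) :=
    map_fst_strictExtension_one hα (S.isExtendible_β J hα) (l := l) id hl' (S.emb J)
      (S.isContractiveUnit_map_emb J hl) (S.emb J) (NonUnitalStarAlgHom.id ℂ (S.limB J))
      (fun d ↦ (S.β_emb J d).symm) rfl
  have h2 : S.emb J ((strictExtension S.α 1).snd d) =
      (strictExtension (S.β J) 1).snd (S.emb J d) :=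
    map_snd_strictExtension_one hα (S.isExtendible_β J hα) (l := l) id hl' (S.emb J)
      (S.isContractiveUnit_map_emb J hl) (S.emb J) (NonUnitalStarAlgHom.id ℂ (S.limB J))
      (fun d ↦ (S.β_emb J d).symm) rfl
  rw [compress_mul_mul, h1, h2]

theorem norm_inclHom_compressFib_le {n : ℕ} {x : X} (h : x ∈ dom S.φ (n + 1))
    (a : SubAlg (S.fibA n x (dom_antitone S.φ n.le_succ h))) :
    ‖inclHom (S.fibA_succ_le n x h) (S.compressFib hα h (valHom _ a))‖ ≤ ‖a‖ := by
  refine (NonUnitalStarAlgHom.norm_apply_le (inclHom (S.fibA_succ_le n x h)) _).trans ?_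
  refine (S.norm_compressFib_le hα h _).trans ?_
  exact NonUnitalStarAlgHom.norm_apply_le (valHom _) a

section Infinite

variable {x : ℕ → X} (hx : IsBackwardOrbit S.φ x) (h : ∀ n, x n ∈ dom S.φ (n + 1))

/-- The sequence of the compressions of the members of a sequence. -/
def compressSeq (a : lp (fun n ↦ SubAlg (S.fibA n (x n) (hx.mem_dom n))) ∞) :
    lp (fun n ↦ SubAlg (S.fibA n (x n) (hx.mem_dom n))) ∞ :=
  ⟨fun n ↦ inclHom (S.fibA_succ_le n (x n) (h n))
      (S.compressFib hα (h n) (valHom (S.fibA n (x n) (hx.mem_dom n)) (a n))),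
    memℓp_infty ⟨‖a‖, by
      rintro _ ⟨n, rfl⟩
      exact (S.norm_inclHom_compressFib_le hα (h n) (a n)).trans
        (lp.norm_apply_le_norm ENNReal.top_ne_zero a n)⟩⟩

theorem valHom_compressSeq (a : lp (fun n ↦ SubAlg (S.fibA n (x n) (hx.mem_dom n))) ∞) (n : ℕ) :
    valHom (S.fibA n (x n) (hx.mem_dom n)) (S.compressSeq hα hx h a n) =
      compress (S.unitImage (n + 1) (x n) (h n))
        (valHom (S.fibA n (x n) (hx.mem_dom n)) (a n)) := by
  change valHom _ (inclHom (S.fibA_succ_le n (x n) (h n))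
    (S.compressFib hα (h n) (valHom (S.fibA n (x n) (hx.mem_dom n)) (a n)))) = _
  rw [valHom_inclHom, valHom_compressFib]

theorem norm_seqClass_compressSeq_sub_le
    (a a' : lp (fun n ↦ SubAlg (S.fibA n (x n) (hx.mem_dom n))) ∞) :
    ‖seqClass (fun n ↦ SubAlg (S.fibA n (x n) (hx.mem_dom n))) (S.compressSeq hα hx h a) -
        seqClass (fun n ↦ SubAlg (S.fibA n (x n) (hx.mem_dom n))) (S.compressSeq hα hx h a')‖ ≤
      ‖seqClass (fun n ↦ SubAlg (S.fibA n (x n) (hx.mem_dom n))) a -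
        seqClass (fun n ↦ SubAlg (S.fibA n (x n) (hx.mem_dom n))) a'‖ := by
  refine norm_seqClass_sub_le_of_le fun n ↦ ?_
  rw [valHom_compressSeq, valHom_compressSeq, ← compress_sub]
  exact norm_compress_le (S.isExtendible_iterHom hα (h n)) _

theorem valHom_orbitSeq_mul_mul (d d' : A)
    (a : lp (fun n ↦ SubAlg (S.fibA n (x n) (hx.mem_dom n))) ∞) (n : ℕ) :
    valHom (S.fibA n (x n) (hx.mem_dom n)) ((S.orbitSeq hx d * a * S.orbitSeq hx d') n) =
      S.μ.ev (x n) (S.iterEnd n d) * valHom (S.fibA n (x n) (hx.mem_dom n)) (a n) *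
        S.μ.ev (x n) (S.iterEnd n d') := rfl

theorem compressSeq_orbitSeq_mul (d : A)
    (a : lp (fun n ↦ SubAlg (S.fibA n (x n) (hx.mem_dom n))) ∞) :
    S.compressSeq hα hx h (S.orbitSeq hx d * a * S.orbitSeq hx d) =
      S.orbitSeq hx ((strictExtension S.α 1).fst d) * a *
        S.orbitSeq hx ((strictExtension S.α 1).snd d) := by
  refine Subtype.ext (funext fun n ↦ valHom_injective _ ?_)
  refine (S.valHom_compressSeq hα hx h _ n).trans ?_
  refine Eq.trans ?_ (S.valHom_orbitSeq_mul_mul hx _ _ a n).symm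
  rw [valHom_orbitSeq_mul_mul, compress_mul_mul, S.fst_unitImage_ev hα, S.snd_unitImage_ev hα]

theorem seqVal_emb_mul_mul {b : S.limB J}
    {a : lp (fun n ↦ SubAlg (S.fibA n (x n) (hx.mem_dom n))) ∞}
    (ha : S.seqVal J hx (S.sectionHom J b (.inf x hx)) = seqClass _ a) (d d' : A) :
    S.seqVal J hx (S.sectionHom J (S.emb J d * b * S.emb J d') (.inf x hx)) =
      seqClass _ (S.orbitSeq hx d * a * S.orbitSeq hx d') := by
  have e : S.sectionHom J (S.emb J d * b * S.emb J d') (.inf x hx) =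
      S.sectionHom J (S.emb J d) (.inf x hx) * S.sectionHom J b (.inf x hx) *
        S.sectionHom J (S.emb J d') (.inf x hx) := by
    rw [map_mul, map_mul]
    rfl
  rw [e, map_mul, map_mul, ha, seqVal_emb, seqVal_emb, map_mul, map_mul]

/-- Termwise, the compressions are limits along an approximate unit, but these limits need not be
uniform in n. Therefore b is first replaced by dbd with d ∈ A, for which both sides can be computed
exactly from pd and dp. Both sides are contractive in b, so letting d run through an approximate
unit proves the formula. -/
theorem seqVal_compress {b : S.limB J}
    {a : lp (fun n ↦ SubAlg (S.fibA n (x n) (hx.mem_dom n))) ∞}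
    (ha : S.seqVal J hx (S.sectionHom J b (.inf x hx)) = seqClass _ a) :
    S.seqVal J hx (S.sectionHom J (compress (strictExtension (S.β J) 1) b) (.inf x hx)) =
      seqClass _ (S.compressSeq hα hx h a) := by
  obtain ⟨l, hl⟩ := exists_isContractiveUnit A
  have := hl.neBot
  have hβ := S.isExtendible_β J hα
  have key : ∀ d, ‖S.seqVal J hx (S.sectionHom J (compress (strictExtension (S.β J) 1) b)
      (.inf x hx)) - seqClass _ (S.compressSeq hα hx h a)‖ ≤
      ‖b - S.emb J d * b * S.emb J d‖ + ‖S.emb J d * b * S.emb J d - b‖ := by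
    intro d
    have h1 := S.norm_seqVal_sectionHom_sub_le J hx (compress (strictExtension (S.β J) 1) b)
      (compress (strictExtension (S.β J) 1) (S.emb J d * b * S.emb J d))
    rw [← compress_sub] at h1
    have h2 := h1.trans (norm_compress_le hβ _)
    have h3 := S.norm_seqClass_compressSeq_sub_le hα hx h (S.orbitSeq hx d * a * S.orbitSeq hx d) a
    have h4 := S.norm_seqVal_sectionHom_sub_le J hx (S.emb J d * b * S.emb J d) b
    rw [S.seqVal_emb_mul_mul J hx ha, ha] at h4
    have h5 : S.seqVal J hx (S.sectionHom J (compress (strictExtension (S.β J) 1)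
        (S.emb J d * b * S.emb J d)) (.inf x hx)) =
        seqClass _ (S.compressSeq hα hx h (S.orbitSeq hx d * a * S.orbitSeq hx d)) := by
      rw [S.compress_emb_mul_emb J hα, S.seqVal_emb_mul_mul J hx ha, compressSeq_orbitSeq_mul]
    rw [h5] at h2
    exact (norm_sub_le_norm_sub_add_norm_sub _ _ _).trans (add_le_add h2 (h3.trans h4))
  have ht := (S.isContractiveUnit_map_emb J hl).tendsto_mul_mul b
  have ht' : Tendsto (fun d ↦ S.emb J d * b * S.emb J d) l (𝓝 b) := ht
  have h6 : Tendsto (fun d ↦ ‖b - S.emb J d * b * S.emb J d‖ + ‖S.emb J d * b * S.emb J d - b‖) l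
      (𝓝 (‖b - b‖ + ‖b - b‖)) :=
    (tendsto_const_nhds.sub ht').norm.add (ht'.sub tendsto_const_nhds).norm
  have h7 := ge_of_tendsto' h6 key
  rw [sub_self, norm_zero, add_zero] at h7
  exact sub_eq_zero.1 (norm_le_zero_iff.1 h7)

end Infinite

end C0System

theorem valHom_limShift {E E' : ℕ → Type u} [∀ n, NonUnitalCStarAlgebra (E n)]
    [∀ n, NonUnitalCStarAlgebra (E' n)] (f : ∀ n, E n →⋆ₙₐ[ℂ] E (n + 1))
    (f' : ∀ n, E' n →⋆ₙₐ[ℂ] E' (n + 1)) (g : ∀ n, E (n + 1) →⋆ₙₐ[ℂ] E' n)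
    (hg : ∀ n b, g (n + 1) (f (n + 1) b) = f' n (g n b)) (v : LimAlg f) :
    valHom (limAlg f') (limShift f f' g hg v) = classShift g (valHom (limAlg f) v) := rfl

namespace C0System

variable {X : Type v} [TopologicalSpace X] {A : Type u} [NonUnitalCStarAlgebra A]
  (S : C0System X A) (J : ClosedIdeal A) (hα : IsExtendible S.α)

section ShiftedOrbit

variable {y : ℕ → X} (hy : IsBackwardOrbit S.φ y)

/-- The sequence `(0, c₀, c₁, ...)` of the compressions `cₙ` of the members of a sequence along the
tail of a backward orbit. -/
def compressCons (a : lp (fun n ↦ SubAlg (S.fibA n (y (n + 1)) (hy.tail.mem_dom n))) ∞) :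
    lp (fun n ↦ SubAlg (S.fibA n (y n) (hy.mem_dom n))) ∞ :=
  ⟨fun n ↦ n.casesOn 0 fun n ↦ S.compressFib hα (hy.mem_dom (n + 1))
      (valHom (S.fibA n (y (n + 1)) (hy.tail.mem_dom n)) (a n)),
    memℓp_infty ⟨‖a‖, by
      rintro _ ⟨n, rfl⟩
      rcases n with _ | n
      · exact norm_zero.trans_le (norm_nonneg a)
      · exact ((S.norm_compressFib_le hα (hy.mem_dom (n + 1)) _).trans
          (NonUnitalStarAlgHom.norm_apply_le (valHom _) (a n))).trans
          (lp.norm_apply_le_norm ENNReal.top_ne_zero a n)⟩⟩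

theorem compressCons_zero (a : lp (fun n ↦ SubAlg (S.fibA n (y (n + 1)) (hy.tail.mem_dom n))) ∞) :
    S.compressCons hα hy a 0 = 0 := rfl

theorem compressCons_succ (a : lp (fun n ↦ SubAlg (S.fibA n (y (n + 1)) (hy.tail.mem_dom n))) ∞)
    (n : ℕ) : S.compressCons hα hy a (n + 1) = S.compressFib hα (hy.mem_dom (n + 1))
      (valHom (S.fibA n (y (n + 1)) (hy.tail.mem_dom n)) (a n)) := rfl

theorem seqShift_compressCons
    (a : lp (fun n ↦ SubAlg (S.fibA n (y (n + 1)) (hy.tail.mem_dom n))) ∞) :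
    seqShift (E := fun n ↦ SubAlg (S.fibA n (y n) (hy.mem_dom n)))
      (E' := fun n ↦ SubAlg (S.fibA n (y (n + 1)) (hy.tail.mem_dom n)))
      (fun n ↦ inclHom (S.fibA_succ_le n (y (n + 1)) (hy.mem_dom (n + 1))))
        (S.compressCons hα hy a) =
      S.compressSeq hα hy.tail (fun n ↦ hy.mem_dom (n + 1)) a := rfl

/-- The shift along the orbit is injective on classes, so it is enough to compare after deleting the
entry with index 0, which is where the sequence receives its leading zero. -/
theorem eq_seqClass_compressCons {v : LimAlg (S.orbitBond hy)}
    {a : lp (fun n ↦ SubAlg (S.fibA n (y (n + 1)) (hy.tail.mem_dom n))) ∞}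
    (hv : valHom _ (S.orbitShift hy v) =
      seqClass _ (S.compressSeq hα hy.tail (fun n ↦ hy.mem_dom (n + 1)) a)) :
    valHom _ v = seqClass _ (S.compressCons hα hy a) := by
  refine classShift_injective (E := fun n ↦ SubAlg (S.fibA n (y n) (hy.mem_dom n)))
    (E' := fun n ↦ SubAlg (S.fibA n (y (n + 1)) (hy.tail.mem_dom n)))
    (fun n ↦ inclHom (S.fibA_succ_le n (y (n + 1)) (hy.mem_dom (n + 1)))) (fun n b b' h ↦ ?_) ?_
  · have h := congrArg (valHom _) h
    rw [valHom_inclHom, valHom_inclHom] at h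
    exact valHom_injective _ h
  · refine Eq.trans ?_ (hv.trans ?_)
    · exact (valHom_limShift _ _ _ _ v).symm
    · exact (congrArg (seqClass _) (S.seqShift_compressCons hα hy a)).symm

end ShiftedOrbit

variable {L : S.limB J →ₗ[ℂ] S.limB J}
  (hL : ∀ b, S.β J (L b) = compress (strictExtension (S.β J) 1) b)

include hα hL in
theorem isFibreTransfer : ∀ (p : S.Ext J) (h : p.head ∈ S.Δ)
    (T : S.FibreB J p →ₗ[ℂ] S.FibreB J (p.shift h)),
    (∀ b, T (S.sectionHom J b p) = S.sectionHom J (L b) (p.shift h)) → S.IsFibreTransfer J p h T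
  | .fin N x hx hY, h, T, hT => by
    intro a ha
    obtain ⟨b, hb⟩ := S.sectionHom_fibre_surjective J (.fin N x hx hY)
      (⟨(S.μ.fibreIdeal J x).proj a, S.proj_mem_quotFib J ha⟩ : SubAlg (S.quotFib J N x hx))
    have h1 : S.finEval J N x hx hY b = (S.μ.fibreIdeal J x).proj a :=
      congrArg (S.finVal J N x hx hY) hb
    have h2 := S.finEval_transfer J hα hL h h1
    rw [finEval_apply] at h2
    have h3 := hT b
    rw [hb] at h3
    exact (congrArg (S.finVal J (N + 1) x (dom_succ S.φ N x hx h) hY) h3).trans h2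
  | .inf x hx, h, T, hT => by
    intro a ha
    have hy := ExtSpace.isBackwardOrbit_consSeq hx h
    refine ⟨S.compressCons hα hy a, S.compressCons_zero hα hy a, fun n ↦ ?_, ?_⟩
    · exact congrArg (valHom _) (S.compressCons_succ hα hy a n)
    · obtain ⟨b, hb⟩ := S.sectionHom_fibre_surjective J (.inf x hx)
        (⟨seqClass _ a, ha⟩ : LimAlg (S.orbitBond hx))
      have h1 : S.seqVal J hx (S.sectionHom J b (.inf x hx)) = seqClass _ a :=
        congrArg (S.seqVal J hx) hb
      have h2 := S.seqVal_compress J hα hx (fun n ↦ hy.mem_dom (n + 1)) h1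
      rw [← S.fibreβ_sectionHom_transfer J hL b (.inf x hx) h, ← hT b, hb] at h2
      exact S.eq_seqClass_compressCons hα hy h2

theorem exists_transfer [T2Space X] [LocallyCompactSpace X]
    (hJ : ∀ j ∈ J, ∀ a, S.α a = 0 → j * a = 0) (hα : IsExtendible S.α) :
    ∃ βs : S.limB J →ₗ[ℂ] S.limB J, IsRegularTransferOperator (S.β J) βs ∧
      (∀ L, IsRegularTransferOperator (S.β J) L → L = βs) ∧
      ∃ T : ∀ (p : S.Ext J) (h : p.head ∈ S.Δ), S.FibreB J p →ₗ[ℂ] S.FibreB J (p.shift h),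
        (∀ p h, IsPositiveMap (T p h) ∧ S.IsFibreTransfer J p h (T p h)) ∧
        (∀ b p h, S.sectionHom J (βs b) (p.shift h) = T p h (S.sectionHom J b p)) ∧
        ∀ b p, p ∉ Set.range (ExtSpace.extMap (φ := S.φ) (Y := S.μ.hull J)) →
          S.sectionHom J (βs b) p = 0 := by
  have hβ := S.isExtendible_β J hα
  obtain ⟨L, hLr, hL, hreg⟩ := exists_isRegularTransferOperator hβ (S.rangeIdeal J)
    (fun c hc h ↦ S.eq_zero_of_mem_rangeIdeal J hJ hc h) (S.exists_rangeIdeal_β_eq_compress J hα)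
  choose T hT using S.exists_fibreTransfer J hα hL
  exact ⟨L, hreg, fun L' h ↦ h.eq hβ hreg hL, T,
    fun p h ↦ ⟨S.isPositiveMap_fibreTransfer J hreg.positive (hT p h),
      S.isFibreTransfer J hα hL p h _ (hT p h)⟩,
    fun b p h ↦ (hT p h b).symm, fun b p hp ↦ hLr b p hp⟩

end C0System

theorem ClosedIdeal.norm_proj_of_eq_bot {A : Type*} [NonUnitalCStarAlgebra A] {I : ClosedIdeal A}
    (h : ∀ b ∈ I, b = 0) (a : A) : ‖I.proj a‖ = ‖a‖ :=
  NonUnitalStarAlgHom.norm_map I.proj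
    ((injective_iff_map_eq_zero _).2 fun b hb ↦ h b (I.proj_eq_zero.1 hb)) a

theorem IsContinuousBundle.continuous_norm_section {X : Type*} [TopologicalSpace X] {F : X → Type*}
    [∀ x, NonUnitalCStarAlgebra (F x)] [TopologicalSpace (Tot F)] (hc : IsContinuousBundle F)
    {s : ∀ x, F x} (hs : Continuous fun x ↦ (⟨x, s x⟩ : Tot F)) : Continuous fun x ↦ ‖s x‖ :=
  Continuous.comp (g := fun b : Tot F ↦ ‖b.val‖) hc hs

/-! ### Continuity of the bundle -/

namespace C0Algebra

variable {X : Type v} [TopologicalSpace X]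
  {A : Type u} [NonUnitalCStarAlgebra A] (μ : C0Algebra X A)

theorem continuous_ev_section (a : A) : Continuous fun x ↦ (⟨x, μ.ev x a⟩ : Tot μ.Fibre) := by
  refine continuous_generateFrom_iff.2 ?_
  rintro _ ⟨c, U, ε, hU, rfl⟩
  refine isOpen_iff_mem_nhds.2 fun x hx ↦ ?_
  have h1 : ‖μ.ev x (a - c)‖ < ε := by
    rw [map_sub]
    exact hx.2
  filter_upwards [hU.mem_nhds hx.1, μ.eventually_norm_ev_lt h1] with y hy hy'
  rw [map_sub] at hy'
  exact ⟨hy, hy'⟩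

theorem continuous_norm_ev (hc : IsContinuousBundle μ.Fibre) (a : A) :
    Continuous fun x ↦ ‖μ.ev x a‖ :=
  hc.continuous_norm_section (s := fun x ↦ μ.ev x a) (μ.continuous_ev_section a)

/-- Over the base point of a primitive ideal containing J the fibre J(x) is not all of A(x), so it
is 0. Continuity of the norms makes the set where J(x) = 0 closed, hence it contains the closure. -/
theorem eq_zero_of_mem_hull (hc : IsContinuousBundle μ.Fibre) {J : ClosedIdeal A}
    (hJ : ∀ x, (∀ b ∈ μ.fibreIdeal J x, b = 0) ∨ ∀ b, b ∈ μ.fibreIdeal J x) {x : X}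
    (hx : x ∈ μ.hull J) : ∀ b ∈ μ.fibreIdeal J x, b = 0 := by
  have hcl : IsClosed {x | ∀ j ∈ J, μ.ev x j = 0} := by
    simp only [Set.ofPred_forall]
    refine isClosed_iInter fun j ↦ isClosed_iInter fun _ ↦ ?_
    have h := isClosed_eq (μ.continuous_norm_ev hc j) (continuous_const (y := (0 : ℝ)))
    simpa only [norm_eq_zero] using h
  have hsub : μ.hull J ⊆ {x | ∀ j ∈ J, μ.ev x j = 0} := by
    refine closure_minimal ?_ hcl
    rintro y ⟨P, hP, hJP, hy⟩ j hj
    obtain ⟨b, hb⟩ := μ.exists_notMem_fibreIdeal J hP hJP hy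
    exact (hJ y).resolve_right (fun h ↦ hb (h b)) _ (μ.ev_mem_fibreIdeal J y hj)
  intro b hb
  obtain ⟨j, hj, rfl⟩ := μ.exists_of_mem_fibreIdeal J hb
  exact hsub hx j hj

/-- A proper nonzero ideal I of A(x) would give two different primitive ideals over x: one
containing I and one missing an element of I. -/
theorem simple_fibre (hσ : μ.BaseMapInjective) (x : X) (I : ClosedIdeal (μ.Fibre x)) :
    (∀ b ∈ I, b = 0) ∨ ∀ b, b ∈ I := by
  by_contra! h
  obtain ⟨⟨b, hb, hb0⟩, c, hc⟩ := h
  obtain ⟨P, hP, hIP, -⟩ := I.exists_isPrimitive_notMem_of_notMem hc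
  obtain ⟨Q, hQ, hbQ⟩ := exists_isPrimitive_notMem hb0
  have hbase : ∀ R : ClosedIdeal (μ.Fibre x),
      μ.IsBasePoint (ClosedIdeal.ker (R.proj.comp (μ.ev x))) x := fun R a ha ↦ by
    rw [mem_ker_proj_comp, μ.ev_eq_zero.2 ha]
    exact R.zero_mem
  have h1 := hσ _ _ x (hP.comap (μ.ev x) (μ.ev_surjective x))
    (hQ.comap (μ.ev x) (μ.ev_surjective x)) (hbase P) (hbase Q)
  obtain ⟨a, rfl⟩ := μ.ev_surjective x b
  refine hbQ ((mem_ker_proj_comp Q (μ.ev x)).1 ?_)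
  rw [← h1]
  exact (mem_ker_proj_comp P (μ.ev x)).2 (hIP _ hb)

end C0Algebra

namespace C0System

variable {X : Type v} [TopologicalSpace X] {A : Type u} [NonUnitalCStarAlgebra A]
  (S : C0System X A) (J : ClosedIdeal A)

variable {J} in
theorem norm_stageHom_of_toSeq_succ (hY : ∀ x ∈ S.μ.hull J, ∀ b ∈ S.μ.fibreIdeal J x, b = 0)
    {n N : ℕ} (hN : N < n) {a : S.stageB J n} {c : A}
    (hc : S.coordVal J n N hN a = J.proj c) : ∀ (p : S.Ext J) {x : X},
    p.toSeq N = .inl x → p.toSeq (N + 1) = .inr () → ‖S.stageHom J n p a‖ = ‖S.μ.ev x c‖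
  | .fin M y hy hyY, x, h, h' => by
    have h1 : N ≤ M := by
      by_contra hlt
      rw [ExtSpace.toSeq_fin_of_lt (not_le.1 hlt)] at h
      cases h
    have h2 : M ≤ N := by
      by_contra hlt
      rw [ExtSpace.toSeq_fin_of_le (not_le.1 hlt)] at h'
      cases h'
    obtain rfl := le_antisymm h1 h2
    rw [ExtSpace.toSeq_fin_self] at h
    obtain rfl := Sum.inl_injective h
    rw [← norm_finVal, finVal_stageHom_of_lt S J hN, hc, S.μ.quotEval_proj,
      ClosedIdeal.norm_proj_of_eq_bot (hY y hyY)]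
  | .inf y hy, x, h, h' => by cases h'

section Injective

variable (hinj : ∀ x : S.Δ, Function.Injective (S.fib x))
include hinj

theorem iterHom_injective : ∀ (n : ℕ) (x : X) (h : x ∈ dom S.φ n),
    Function.Injective (S.iterHom n x h)
  | 0, _, _ => fun _ _ h ↦ h
  | n + 1, x, h => (hinj ⟨x, h.fst⟩).comp (iterHom_injective n (S.φ ⟨x, h.fst⟩) h.snd)

theorem linkHom_injective {x y : X} (h : ∃ hx : x ∈ S.Δ, S.φ ⟨x, hx⟩ = y) :
    Function.Injective (S.linkHom h) := by
  obtain ⟨hx, rfl⟩ := h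
  exact hinj ⟨x, hx⟩

theorem orbitBond_injective {x : ℕ → X} (hx : IsBackwardOrbit S.φ x) (n : ℕ) :
    Function.Injective (S.orbitBond hx n) := by
  intro a b hab
  have h := congrArg (valHom _) hab
  unfold orbitBond at h
  rw [valHom_restrictHom, valHom_restrictHom] at h
  exact valHom_injective _ (S.linkHom_injective hinj (hx n) h)

theorem norm_threadAt {x : ℕ → X} (hx : IsBackwardOrbit S.φ x) (n : ℕ) (a : SubAlg (S.subA n)) :
    ‖S.threadAt hx n a‖ = ‖S.μ.ev (x n) (valHom _ a)‖ :=
  norm_limOf_of_injective (S.orbitBond hx) (S.orbitBond_injective hinj hx) n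
    (S.evSub n (x n) (hx.mem_dom n) a)

variable {J} (hY : ∀ x ∈ S.μ.hull J, ∀ b ∈ S.μ.fibreIdeal J x, b = 0)
include hY

theorem norm_stageHom_of_toSeq {n : ℕ} (a : S.stageB J n) : ∀ (p : S.Ext J) {x : X},
    p.toSeq n = .inl x → ‖S.stageHom J n p a‖ = ‖S.μ.ev x (S.lastVal J n a)‖
  | .fin N y hy hyY, x, h => by
    by_cases hn : n ≤ N
    · rw [ExtSpace.toSeq_fin_of_le hn] at h
      obtain rfl := Sum.inl_injective h
      rw [← norm_finVal, finVal_stageHom_of_le S J hn, ClosedIdeal.norm_proj_of_eq_bot (hY y hyY),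
        ← S.ev_iterEnd (N - n) y (dom_antitone S.φ (Nat.sub_le N n) hy)]
      exact NonUnitalStarAlgHom.norm_map _ (S.iterHom_injective hinj _ _ _) _
    · rw [ExtSpace.toSeq_fin_of_lt (by omega)] at h
      cases h
  | .inf y hy, x, h => by
    obtain rfl : y n = x := Sum.inl_injective h
    exact S.norm_threadAt hinj hy n _

variable (hc : IsContinuousBundle S.μ.Fibre)
include hc

/-- The coordinate with index n is present on an open set, where the norm is that of the last
coordinate at x_n. Any other point lies in some X_N with N < n, and near it the norm is that of a
representative of the coordinate with index N at x_N. -/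
theorem continuous_norm_stageHom {n : ℕ} (a : S.stageB J n) :
    Continuous fun p ↦ ‖S.stageHom J n p a‖ := by
  have key : ∀ (k : ℕ) (c : A), Continuous fun p : S.Ext J ↦
      Sum.elim (fun x ↦ ‖S.μ.ev x c‖) (fun _ ↦ (0 : ℝ)) (p.toSeq k) := fun k c ↦
    ((S.μ.continuous_norm_ev hc c).sumElim continuous_const).comp (ExtSpace.continuous_toSeq k)
  have hl : ∀ (p : S.Ext J) k x, p.toSeq k = .inl x → ∀ᶠ q : S.Ext J in 𝓝 p,
      ∃ y, q.toSeq k = .inl y := fun p k x h ↦ by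
    have h1 : Set.range Sum.inl ∈ 𝓝 (p.toSeq k) := isOpen_range_inl.mem_nhds ⟨x, h.symm⟩
    filter_upwards [(ExtSpace.continuous_toSeq k).continuousAt h1] with q ⟨y, hy⟩
    exact ⟨y, hy.symm⟩
  refine continuous_iff_continuousAt.2 fun p ↦ ?_
  by_cases hp : ∃ x, p.toSeq n = .inl x
  · obtain ⟨x, hx⟩ := hp
    refine (key n (S.lastVal J n a)).continuousAt.congr ?_
    filter_upwards [hl p n x hx] with q ⟨y, hy⟩
    rw [hy, S.norm_stageHom_of_toSeq hinj hY a q hy]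
    rfl
  · obtain ⟨N, y, hy, hyY, rfl⟩ : ∃ N y hy hyY, p = .fin N y hy hyY := by
      cases p with
      | fin N y hy hyY => exact ⟨N, y, hy, hyY, rfl⟩
      | inf x hx => exact absurd ⟨x n, rfl⟩ hp
    have hN : N < n := by
      by_contra hlt
      exact hp ⟨_, ExtSpace.toSeq_fin_of_le (not_lt.1 hlt)⟩
    obtain ⟨c, -, hc'⟩ := S.exists_coord J n a
    refine (key N (c N hN)).continuousAt.congr ?_
    have h1 : Set.range Sum.inr ∈ 𝓝 ((ExtSpace.fin N y hy hyY : S.Ext J).toSeq (N + 1)) :=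
      isOpen_range_inr.mem_nhds ⟨(), (ExtSpace.toSeq_fin_of_lt N.lt_succ_self).symm⟩
    filter_upwards [hl _ N y ExtSpace.toSeq_fin_self,
      (ExtSpace.continuous_toSeq (N + 1)).continuousAt h1] with q ⟨z, hz⟩ ⟨⟨⟩, hq⟩
    rw [hz, S.norm_stageHom_of_toSeq_succ hY hN (hc' N hN) q hz hq.symm]
    rfl

theorem continuous_norm_sectionHom (b : S.limB J) : Continuous fun p ↦ ‖S.sectionHom J b p‖ := by
  refine continuous_of_uniform_approx_of_continuous fun u hu ↦ ?_
  obtain ⟨ε, hε, hu⟩ := Metric.mem_uniformity_dist.1 hu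
  obtain ⟨n, a, ha⟩ := LimAlg.exists_near (S.bond J) b hε
  refine ⟨fun p ↦ ‖S.stageHom J n p a‖, S.continuous_norm_stageHom hinj hY hc a, fun p ↦ hu ?_⟩
  rw [Real.dist_eq]
  refine (abs_norm_sub_norm_le _ _).trans_lt (lt_of_le_of_lt ?_ ha)
  have h2 := norm_coord_le (S.sectionHom J) (b - S.toLimB J n a) p
  rwa [map_sub, Pi.sub_apply, sectionHom_toLimB] at h2

end Injective

theorem fib_injective_of_ne_zero (hσ : S.μ.BaseMapInjective)
    (h : ∀ x : S.Δ, ∃ b, S.fib x b ≠ 0) (x : S.Δ) : Function.Injective (S.fib x) := by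
  obtain ⟨b, hb⟩ := h x
  exact (injective_iff_map_eq_zero _).2
    ((S.μ.simple_fibre hσ _ (ClosedIdeal.ker (S.fib x))).resolve_right fun h ↦ hb (h b))

end C0System

end

end ReversibleExtension

theorem mainTheorem6 {X : Type*} [TopologicalSpace X] [LocallyCompactSpace X] [T2Space X]
    {A : Type*} [NonUnitalCStarAlgebra A] (S : C0System X A) (hσ : S.μ.BaseMapSurjective)
    (J : ClosedIdeal A) (hJ : ∀ j ∈ J, ∀ a, S.α a = 0 → j * a = 0) :
    LocallyCompactSpace (S.Ext J) ∧ T2Space (S.Ext J) ∧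
    ∃ (Φ : S.limB J →⋆ₙₐ[ℂ] ∀ p, S.FibreB J p) (t : TopologicalSpace (Tot (S.FibreB J))),
      -- `Φ` is given on `B_n` by the explicit formula and is an isometric isomorphism onto the
      -- section algebra of an upper semicontinuous bundle, whose topology is unique
      (∀ n a p, Φ (S.toLimB J n a) p = S.stageSection J n a p) ∧
      Function.Injective Φ ∧
      (∀ b, ‖b‖ = ⨆ p, ‖Φ b p‖) ∧
      IsUSCBundle (S.FibreB J) ∧
      Set.range Φ = sectionsC0 (S.FibreB J) ∧
      (∀ t' : TopologicalSpace (Tot (S.FibreB J)), @IsUSCBundle _ _ (S.FibreB J) _ t' →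
        Set.range Φ = @sectionsC0 _ _ (S.FibreB J) _ t' → t' = t) ∧
      -- `β` is induced by the morphism `(φ~, {β_p})`
      IsBundleMorphism (S.FibreB J) (S.FibreB J) ExtSpace.extDom ExtSpace.extMap
        (fun p ↦ S.fibreβ J p.1 p.2) ∧
      (∀ b p (h : p.head ∈ S.Δ), Φ (S.β J b) p = S.fibreβ J p h (Φ b (p.shift h))) ∧
      (∀ b p, p.head ∉ S.Δ → Φ (S.β J b) p = 0) ∧
      -- the regular transfer operator
      (IsExtendible S.α → IsExtendible (S.β J) ∧
        ∃ βs : S.limB J →ₗ[ℂ] S.limB J, IsRegularTransferOperator (S.β J) βs ∧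
          (∀ L, IsRegularTransferOperator (S.β J) L → L = βs) ∧
          ∃ T : ∀ (p : S.Ext J) (h : p.head ∈ S.Δ), S.FibreB J p →ₗ[ℂ] S.FibreB J (p.shift h),
            (∀ p h, IsPositiveMap (T p h) ∧ S.IsFibreTransfer J p h (T p h)) ∧
            (∀ b p h, Φ (βs b) (p.shift h) = T p h (Φ b p)) ∧
            (∀ b p, p ∉ Set.range (ExtSpace.extMap (φ := S.φ) (Y := S.μ.hull J)) →
              Φ (βs b) p = 0)) ∧
      -- continuity of the bundle
      (IsContinuousBundle S.μ.Fibre →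
        ((J.IsComplemented ∧
            (∀ x, (∀ b ∈ S.μ.fibreIdeal J x, b = 0) ∨ ∀ b, b ∈ S.μ.fibreIdeal J x) ∧
            ∀ x : S.Δ, Function.Injective (S.fib x)) ∨
          (S.μ.BaseMapInjective ∧ ∀ x : S.Δ, ∃ b, S.fib x b ≠ 0)) →
        IsContinuousBundle (S.FibreB J)) := by
  have h := S.isSectionAlgebra J hJ
  have hT2 : T2Space (S.Ext J) := ExtSpace.t2Space
  have hLC : LocallyCompactSpace (S.Ext J) :=
    ExtSpace.locallyCompactSpace S.morphism.isProperMap isClosed_closure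
  refine ⟨hLC, hT2, S.sectionHom J, tubeTopology (S.sectionHom J),
    fun n a p ↦ (S.sectionHom_toLimB J n a p).trans (S.stageHom_apply J n a p),
    S.sectionHom_injective J hJ, norm_eq_iSup _ (S.sectionHom_injective J hJ), h.isUSCBundle,
    h.range_eq, fun t' h' hr ↦ h.topology_unique h' hr, S.isBundleMorphism J hJ,
    fun b p hp ↦ S.sectionHom_β J b p hp, fun b p hp ↦ S.sectionHom_β_of_notMem J b p hp,
    fun hα ↦ ⟨S.isExtendible_β J hα, S.exists_transfer J hJ hα⟩, fun hc hcases ↦ ?_⟩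
  -- Both cases provide the dichotomy for J(x) and the injectivity of all α_x; in the second case
  -- they come from simplicity of the fibres.
  obtain ⟨hfib, hinj⟩ : (∀ x, (∀ b ∈ S.μ.fibreIdeal J x, b = 0) ∨ ∀ b, b ∈ S.μ.fibreIdeal J x) ∧
      ∀ x : S.Δ, Function.Injective (S.fib x) := by
    obtain ⟨-, hfib, hinj⟩ | ⟨hσ', hne⟩ := hcases
    · exact ⟨hfib, hinj⟩
    · exact ⟨fun x ↦ S.μ.simple_fibre hσ' x _, S.fib_injective_of_ne_zero hσ' hne⟩
  exact h.isContinuousBundle (S.continuous_norm_sectionHom hinj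
    (fun x hx ↦ S.μ.eq_zero_of_mem_hull hc hfib hx) hc)
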